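/- Let $q\ge 0$ and let $D_q$ be a degree constraint matrix, i.e. a $q\times q$ matrix whose entries are finite or co-finite subsets of $\mathbb N$. A $D_q$-partition of a graph $G$ is a partition of $V(G)$ into classes $V_1,\dots,V_q$ (empty classes are allowed) such that $|N(v)\cap V_j|\in D_q[i,j]$ for all $i,j$ and all $v\in V_i$; the $\exists D_q$ problem asks whether $G$ has one. Put $d(\mathbb N)=d(\emptyset)=0$, $d(\mu)=1+\min(\max\mu,\max(\mathbb N\setminus\mu))$ for every other finite or co-finite $\mu\subseteq\mathbb N$ (the maximum of an infinite set being $\infty$), and $d=d(D_q)=\max_{i,j}d(D_q[i,j])$ (with $d=0$ if $q=0$). A decomposition tree of $G$ is a tree $T$ all of whose internal nodes have degree three, with a bijection $\delta$ between $V(G)$ and the leaves of $T$ (in a one-node tree the node is a leaf). Every edge $uv$ of $T$ induces a partition $\{X_u,X_v\}$ of $V(G)$ through the leaf sets of the two components of $T-uv$. For a symmetric function $f:2^{V(G)}\to\mathbb R$, the $f$-width of $(T,\delta)$ is $\max_{uv\in E(T)}f(X_u)$ ($0$ if $T$ has no edge); the $f$-width of $G$ is the minimum $f$-width of a decomposition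 tree of $G$, and a decomposition tree attaining it is called optimal. The rank-width $rw(G)$ and optimal rank decompositions are obtained for $f(A)=\log_2$ of the number of vectors spanned over $GF(2)$ by the rows of the $A\times(V(G)\setminus A)$ submatrix of the adjacency matrix of $G$; the boolean-width $\beta w(G)$ and optimal boolean decompositions are obtained for $f(A)=\log_2|\{N(Y)\setminus B: Y\subseteq B\}|$, where $B=V(G)\setminus A$ and $N(Y)=\bigcup_{y\in Y}N(y)$. Then there is an absolute constant $C$ such that for every $q$ and $D_q$ the following holds. There is a program for a uniform-cost random access machine (with addition and truncated subtraction of natural numbers as its arithmetic) that, given any $n$-vertex, $m$-edge graph $G$ as a list of edges together with an optimal rank decomposition of $G$, decides whether $G$ has a $D_q$-partition in at most $$C\cdot\bigl(1+n\,(m+q\,d\,k\,2^{3qdk^2+k})\bigr)$$ steps, where $k=rw(G)$. Likewise there is a program that does so, given an optimal boolean decomposition of $G$, within the same bound with $k=\beta w(G)$. -/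

import Mathlib

/-! ## Degree constraint matrices and the partitioning problem -/

/-- `μ` is a finite or co-finite set of natural numbers. -/
def FiniteOrCofinite (μ : Set ℕ) : Prop := μ.Finite ∨ μᶜ.Finite

/-- `d(μ) = 1 + min (max μ) (max (ℕ \ μ))` for finite or co-finite `μ`: the maximum of an infinite
set is `∞`, and the summand `1` is put inside the two maxima, so that the empty set contributes `0`;
in particular `d(ℕ) = 0` (and `d(∅) = 0`). -/
noncomputable def degreeBound (μ : Set ℕ) : ℕ :=
  (min (⨆ x ∈ μ, ((x : ℕ∞) + 1)) (⨆ x ∈ μᶜ, ((x : ℕ∞) + 1))).toNat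

/-- `d(D_q)`, the maximum of `d(D_q[i,j])` over all entries. -/
noncomputable def matrixDegreeBound {q : ℕ} (D : Fin q → Fin q → Set ℕ) : ℕ :=
  Finset.univ.sup fun i => Finset.univ.sup fun j => degreeBound (D i j)

/-- `G` has a `D_q`-partition `V_1, …, V_q` (classes may be empty): every `v ∈ V_i` has a number of
neighbours in `V_j` that lies in `D_q[i,j]`. -/
def HasDegreePartition {V : Type*} (G : SimpleGraph V) {q : ℕ} (D : Fin q → Fin q → Set ℕ) : Prop :=
  ∃ W : Fin q → Set V,
    (∀ i j, i ≠ j → Disjoint (W i) (W j)) ∧ (⋃ i, W i) = Set.univ ∧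
      ∀ i j, ∀ v ∈ W i, (G.neighborSet v ∩ W j).ncard ∈ D i j

/-! ## Decomposition trees and widths -/

/-- A leaf of a tree: a node of degree at most one (degree zero only in the one-node tree). -/
def IsLeafNode {N : ℕ} (T : SimpleGraph (Fin N)) (t : Fin N) : Prop :=
  (T.neighborSet t).ncard ≤ 1

/-- A decomposition tree with leaves in bijection with `V`: a tree all of whose internal nodes have
degree three, together with the bijection. -/
structure DecompositionTree (V : Type*) where
  /-- number of nodes -/
  N : ℕ
  /-- the tree -/
  tree : SimpleGraph (Fin N)
  isTree : tree.IsTree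
  subcubic : ∀ t, ¬ IsLeafNode tree t → (tree.neighborSet t).ncard = 3
  /-- the bijection between the elements of `V` and the leaves -/
  leaf : V ≃ {t : Fin N // IsLeafNode tree t}

namespace DecompositionTree

variable {V : Type*}

/-- For an oriented tree edge `(u, v)`, the set `X_u` of all elements of `V` that sit at the leaves
of the component of `u` after the removal of the edge `uv`. -/
def side (T : DecompositionTree V) (a : T.tree.Dart) : Set V :=
  {x | (T.tree.deleteEdges {a.edge}).Reachable a.fst (T.leaf x).1}

/-- The `f`-width of a decomposition tree, the maximum of `f(X_u)` over all edges
(`0` if there is no edge). -/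
noncomputable def width (T : DecompositionTree V) (f : Set V → ℝ) : ℝ :=
  ⨆ a : T.tree.Dart, f (T.side a)

/-- An optimal `f`-decomposition: one of minimum `f`-width. -/
def IsOptimal (T : DecompositionTree V) (f : Set V → ℝ) : Prop :=
  ∀ T' : DecompositionTree V, T.width f ≤ T'.width f

end DecompositionTree

/-- The minimum `f`-width over all decomposition trees. -/
noncomputable def minWidth {V : Type*} (f : Set V → ℝ) : ℝ :=
  ⨅ T : DecompositionTree V, T.width f

namespace SimpleGraph

variable {V : Type*}

/-- The boolean-cut function: the base `2` logarithm of the number of sets `N(Y) \ B` with `Y ⊆ B`,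
where `B` is the complement of `A`. -/
noncomputable def booleanCut (G : SimpleGraph V) (A : Set V) : ℝ :=
  Real.logb 2 ({X : Set V | X ⊆ A ∧ ∃ Y ⊆ Aᶜ, (⋃ y ∈ Y, G.neighborSet y) \ Aᶜ = X}.ncard)

open Classical in
/-- The cut-rank function: the base `2` logarithm of the number of vectors spanned over `GF(2)` by
the rows of the `A × (V \ A)` submatrix of the adjacency matrix. -/
noncomputable def cutRank (G : SimpleGraph V) (A : Set V) : ℝ :=
  Real.logb 2 (Nat.card (Submodule.span (ZMod 2)
    (Set.range fun a : A => fun b : (Aᶜ : Set V) => G.adjMatrix (ZMod 2) a.1 b.1)))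

/-- The boolean-width of a graph. -/
noncomputable def booleanWidth (G : SimpleGraph V) : ℝ := minWidth G.booleanCut

/-- The rank-width of a graph. -/
noncomputable def rankWidth (G : SimpleGraph V) : ℝ := minWidth G.cutRank

end SimpleGraph

/-! ## Random access machine, uniform cost

A program uses finitely many registers and a memory that is addressed by register contents.  The
arithmetic is addition and truncated subtraction of natural numbers.  Every elementary instruction
and every test costs one step. -/

/-- Structured programs of the random access machine. -/
inductive RamProg where
  /-- `r := c` -/
  | const (r c : ℕ)
  /-- `r := a + b` -/
  | add (r a b : ℕ)
  /-- `r := a - b`, truncated at `0` -/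
  | sub (r a b : ℕ)
  /-- `r := mem[a]` -/
  | load (r a : ℕ)
  /-- `mem[a] := r` -/
  | store (a r : ℕ)
  /-- first `P`, then `Q` -/
  | seq (P Q : RamProg)
  /-- `P` if register `r` is nonzero, else `Q` -/
  | ite (r : ℕ) (P Q : RamProg)
  /-- repeat `P` as long as register `r` is nonzero -/
  | loop (r : ℕ) (P : RamProg)

/-- A configuration: contents of the registers and of the memory. -/
structure RamState where
  reg : ℕ → ℕ
  mem : ℕ → ℕ

/-- `s` with register `r` set to `x`. -/
def RamState.setReg (s : RamState) (r x : ℕ) : RamState :=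
  { s with reg := Function.update s.reg r x }

/-- `s` with memory cell `a` set to `x`. -/
def RamState.setMem (s : RamState) (a x : ℕ) : RamState :=
  { s with mem := Function.update s.mem a x }

/-- The initial configuration: the input in the memory cells `0, 1, 2, …`, zero elsewhere. -/
def RamState.init (input : List ℕ) : RamState where
  reg := fun _ => 0
  mem := fun i => input.getD i 0

/-- `Exec P s t s'`: started in `s`, the program `P` halts in `s'` after exactly `t` steps. -/
inductive RamProg.Exec : RamProg → RamState → ℕ → RamState → Prop where
  | const (s : RamState) (r c : ℕ) : Exec (.const r c) s 1 (s.setReg r c)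
  | add (s : RamState) (r a b : ℕ) : Exec (.add r a b) s 1 (s.setReg r (s.reg a + s.reg b))
  | sub (s : RamState) (r a b : ℕ) : Exec (.sub r a b) s 1 (s.setReg r (s.reg a - s.reg b))
  | load (s : RamState) (r a : ℕ) : Exec (.load r a) s 1 (s.setReg r (s.mem (s.reg a)))
  | store (s : RamState) (a r : ℕ) : Exec (.store a r) s 1 (s.setMem (s.reg a) (s.reg r))
  | seq {P Q : RamProg} {s s₁ s₂ : RamState} {t₁ t₂ : ℕ} :
      Exec P s t₁ s₁ → Exec Q s₁ t₂ s₂ → Exec (.seq P Q) s (t₁ + t₂) s₂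
  | iteTrue {r : ℕ} {P Q : RamProg} {s s' : RamState} {t : ℕ} :
      s.reg r ≠ 0 → Exec P s t s' → Exec (.ite r P Q) s (t + 1) s'
  | iteFalse {r : ℕ} {P Q : RamProg} {s s' : RamState} {t : ℕ} :
      s.reg r = 0 → Exec Q s t s' → Exec (.ite r P Q) s (t + 1) s'
  | loopStep {r : ℕ} {P : RamProg} {s s₁ s₂ : RamState} {t₁ t₂ : ℕ} :
      s.reg r ≠ 0 → Exec P s t₁ s₁ → Exec (.loop r P) s₁ t₂ s₂ →
      Exec (.loop r P) s (t₁ + t₂ + 1) s₂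
  | loopExit {r : ℕ} {P : RamProg} {s : RamState} :
      s.reg r = 0 → Exec (.loop r P) s 1 s

/-- On `input`, the program halts after at most `B` steps, with register `0` equal to `1` if
`answer` holds and to `0` otherwise. -/
def RamProg.DecidesWithin (P : RamProg) (input : List ℕ) (answer : Prop) (B : ℝ) : Prop :=
  ∃ (t : ℕ) (s : RamState), P.Exec (RamState.init input) t s ∧ (t : ℝ) ≤ B ∧
    (answer → s.reg 0 = 1) ∧ (¬ answer → s.reg 0 = 0)

/-! ## Encoding of the input -/

/-- `L` lists every edge of `G` exactly once, in any order and with any order of its two ends. -/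
def IsEdgeList {n : ℕ} (G : SimpleGraph (Fin n)) (L : List (Fin n × Fin n)) : Prop :=
  (L.map fun p => s(p.1, p.2)).Nodup ∧ ∀ e, e ∈ L.map (fun p => s(p.1, p.2)) ↔ e ∈ G.edgeSet

/-- The numbers that encode a list of edges. -/
def encodeEdges {n : ℕ} (L : List (Fin n × Fin n)) : List ℕ :=
  L.flatMap fun p => [p.1.val, p.2.val]

/-- The input: the number of vertices, the number of edges and the number of tree nodes, the edges
of the graph, the edges of the tree, and for every vertex its leaf. -/
def encodeInput {n : ℕ} (T : DecompositionTree (Fin n)) (L : List (Fin n × Fin n))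
    (L' : List (Fin T.N × Fin T.N)) : List ℕ :=
  [n, L.length, T.N] ++ encodeEdges L ++ encodeEdges L' ++ List.ofFn fun v => (T.leaf v).1.val

/-- The running time `n (m + q d k 2 ^ (3 q d k² + k))`. -/
noncomputable def partitionTime (n m q d : ℕ) (k : ℝ) : ℝ :=
  n * (m + q * d * k * (2 : ℝ) ^ (3 * q * d * k ^ 2 + k))

/-! ## A language of bounded loops, compiled to the random access machine -/

set_option linter.constructorNameAsVariable false
set_option autoImplicit false

/-! A partition is a labelling of the vertices, and by `FiniteOrCofinite.mem_iff` only degrees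
truncated at d matter. The proof combines a dynamic program over the oriented edges of the
decomposition tree with a count of its states.

Every oriented tree edge has a side A, the vertices at the leaves behind it. Towards the outside, a
labelling of A acts only through its profile: for each y outside A and each label i, the truncated
number of neighbours of y in A with label i. Whether all vertices of A meet their constraints
depends on the labels in A and on the profile of the complement (`CutSystem.Sat.of_same`). For every
side the program therefore records which pairs (profile of A, profile of the complement) come from a
labelling that satisfies A. At an inner node of the tree a side a is the union of two sides b and c,
and b, c and the complement of a partition the vertex set. Hence any three profiles for these come
from one common labelling (`Imp.exists_merge`), truncated profiles add along unions, which yields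
the profiles of a and of the complements of b and c, and recorded solutions for b and c that fit can
be pasted (`CutSystem.Join.glue`). Two complementary sides decide the answer (`CutSystem.glue_opp`).
The work per side is the cube of the number of profiles times the length of a profile, and there are
fewer than 4n sides.

To count the profiles, let K be the integer part of 2^k. Both widths give `SimpleGraph.CutBound`:
the rows of a cut take at most K values, and any family of rows has the same union as some log₂ K of
its members. For rank-width these are a basis of the span; for boolean-width they are a minimal
subfamily with this union, whose subfamilies have pairwise different unions. Extracting such members
d times keeps all counts truncated at d (`CutSystem.RowBound.exists_sparse`), so a profile is
determined by d log₂ K rows per label, and there are at most K^(q d log₂ K) ≤ 2^(q d k²) profiles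
(`CutSystem.fewHandles`). A profile need only be stored at representatives of the at most K
different neighbourhoods across the cut. Together this is the factor 2^(3 q d k² + k).

The machine has no multiplication, but its registers are unbounded, and this makes tables cheap. A
finite set is coded as a sum of powers of 16 with digits 0 and 1; then a + 2b + 4c + 8e determines
the four codes a, b, c, e (`ix4_code_inj`). Neighbourhoods and whole profiles thus serve directly as
array indices, and nothing has to be searched or sorted. The program is written in a small language
of bounded loops whose compilation has an exactly known step count (`Imp.exec_cmd`). A queue finds
an order in which every side is composed of earlier ones.

The program depends on the constraints only; the width enters the analysis alone. If d = 0 or the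
graph has no edge, the answer does not depend on the graph. Otherwise k ≥ 1, which pays for the
factor k in the bound. -/

namespace Imp

/-- Variables. -/
inductive Var where
  | res | n | m | M | nt | t | l | J
  | e | we | p | wp | i | wi | j | wj | j1 | w1 | j2 | w2 | j3 | w3
  | u | o | ql | a | b | c | pa | pb | pc | po | pbo | pco
  | x | y | px | py | k | len | plen | ok
  | sa | sb | sc | r1 | r2 | h | pos | val | rep | st | sw | si | swi
  | q1 | q2 | q3 | g1 | g2 | g3
  deriving DecidableEq

/-- Arrays. -/
inductive Arr where
  | PW | OUT | DEG | OPP | QUE | CNT | D1 | D2 | LV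
  | KEY | INS | SEEN | REP | RC | VAL | EX | PL | PC | DT | TB
  deriving DecidableEq

/-- The number of a variable. -/
def Var.idx : Var → ℕ := Var.ctorIdx

/-- The number of an array. -/
def Arr.idx : Arr → ℕ := Arr.ctorIdx

theorem Var.idx_injective : Function.Injective Var.idx := by
  have h : ∀ v : Var, Var.ofNat v.idx = v := by intro v; cases v <;> rfl
  exact Function.LeftInverse.injective h

theorem Arr.idx_injective : Function.Injective Arr.idx := by
  have h : ∀ v : Arr, Arr.ofNat v.idx = v := by intro v; cases v <;> rfl
  exact Function.LeftInverse.injective h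

/-- The arrays are interleaved in memory with stride 32, so this bound keeps the cells of different
arrays apart. -/
theorem Arr.idx_lt (k : Arr) : k.idx < 32 := by
  cases k <;> decide

/-- Contents of the variables and arrays. -/
structure Store where
  var : Var → ℕ
  arr : Arr → ℕ → ℕ

namespace Store

/-- `σ` with variable `v` set to `x`. -/
def setVar (σ : Store) (v : Var) (x : ℕ) : Store :=
  { σ with var := fun w => if w = v then x else σ.var w }

/-- `σ` with entry `i` of array `k` set to `x`. -/
def setArr (σ : Store) (k : Arr) (i x : ℕ) : Store :=
  { σ with arr := fun k' => if k' = k then Function.update (σ.arr k) i x else σ.arr k' }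

@[simp] theorem var_setVar (σ : Store) (v w : Var) (x : ℕ) :
    (σ.setVar v x).var w = if w = v then x else σ.var w := rfl

@[simp] theorem arr_setVar (σ : Store) (v : Var) (x : ℕ) : (σ.setVar v x).arr = σ.arr := rfl

@[simp] theorem var_setArr (σ : Store) (k : Arr) (i x : ℕ) : (σ.setArr k i x).var = σ.var := rfl

@[simp] theorem arr_setArr (σ : Store) (k k' : Arr) (i x : ℕ) :
    (σ.setArr k i x).arr k' =
      if k' = k then Function.update (σ.arr k) i x else σ.arr k' := rfl

/-- All variables and arrays zero. -/
def zero : Store := ⟨fun _ => 0, fun _ _ => 0⟩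

end Store

/-- Expressions: constants, variables, sums, truncated differences, array entries, input cells. -/
inductive Expr where
  | lit (c : ℕ)
  | var (v : Var)
  | add (a b : Expr)
  | sub (a b : Expr)
  | arr (k : Arr) (i : Expr)
  | inp (i : Expr)

namespace Expr

instance : Add Expr := ⟨Expr.add⟩
instance : Sub Expr := ⟨Expr.sub⟩
instance : Coe Var Expr := ⟨Expr.var⟩

/-- The value of an expression; `I` is the input. -/
def eval (I : ℕ → ℕ) (σ : Store) : Expr → ℕ
  | lit c => c
  | var v => σ.var v
  | add a b => a.eval I σ + b.eval I σ
  | sub a b => a.eval I σ - b.eval I σ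
  | arr k i => σ.arr k (i.eval I σ)
  | inp i => I (i.eval I σ)

/-- The number of steps of the evaluation of an expression. -/
def cost : Expr → ℕ
  | lit _ => 1
  | var _ => 2
  | add a b => a.cost + b.cost + 1
  | sub a b => a.cost + b.cost + 1
  | arr _ i => i.cost + 9
  | inp i => i.cost + 3

@[simp] theorem eval_lit (I σ c) : (lit c).eval I σ = c := rfl
@[simp] theorem eval_var (I σ v) : (var v).eval I σ = σ.var v := rfl
@[simp] theorem eval_add (I σ) (a b : Expr) : (a + b).eval I σ = a.eval I σ + b.eval I σ := rfl
@[simp] theorem eval_sub (I σ) (a b : Expr) : (a - b).eval I σ = a.eval I σ - b.eval I σ := rfl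
@[simp] theorem eval_arr (I σ k) (i : Expr) : (arr k i).eval I σ = σ.arr k (i.eval I σ) := rfl
@[simp] theorem eval_inp (I σ) (i : Expr) : (inp i).eval I σ = I (i.eval I σ) := rfl

@[simp] theorem cost_lit (c) : (lit c).cost = 1 := rfl
@[simp] theorem cost_var (v) : (var v).cost = 2 := rfl
@[simp] theorem cost_add (a b : Expr) : (a + b).cost = a.cost + b.cost + 1 := rfl
@[simp] theorem cost_sub (a b : Expr) : (a - b).cost = a.cost + b.cost + 1 := rfl
@[simp] theorem cost_arr (k) (i : Expr) : (arr k i).cost = i.cost + 9 := rfl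
@[simp] theorem cost_inp (i : Expr) : (inp i).cost = i.cost + 3 := rfl

end Expr

/-- Commands. `loop v w e c` runs `c` for `v = 0, …, e - 1`, with `w = 16 ^ v`. -/
inductive Cmd where
  | skip
  | assign (v : Var) (e : Expr)
  | write (k : Arr) (i e : Expr)
  | seq (c d : Cmd)
  | ite (e : Expr) (c d : Cmd)
  | loop (v w : Var) (e : Expr) (c : Cmd)

infixr:60 " ;; " => Cmd.seq

namespace Cmd

/-- The store at the beginning of round `i` of a loop body. -/
def enter (v w : Var) (i : ℕ) (τ : Store) : Store := (τ.setVar v i).setVar w (16 ^ i)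

/-- The effect of a command. -/
def run (I : ℕ → ℕ) : Cmd → Store → Store
  | skip, σ => σ
  | assign v e, σ => σ.setVar v (e.eval I σ)
  | write k i e, σ => σ.setArr k (i.eval I σ) (e.eval I σ)
  | seq c d, σ => d.run I (c.run I σ)
  | ite e c d, σ => if e.eval I σ ≠ 0 then c.run I σ else d.run I σ
  | loop v w e c, σ =>
      Nat.rec σ (fun i τ => c.run I (enter v w i τ)) (e.eval I σ)

/-- The number of steps of a command. -/
def cost (I : ℕ → ℕ) : Cmd → Store → ℕ
  | skip, _ => 1
  | assign _ e, _ => e.cost + 2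
  | write _ i e, _ => i.cost + e.cost + 9
  | seq c d, σ => c.cost I σ + d.cost I (c.run I σ)
  | ite e c d, σ => e.cost + 1 + if e.eval I σ ≠ 0 then c.cost I σ else d.cost I σ
  | loop v w e c, σ =>
      e.cost + 3 + ∑ i ∈ Finset.range (e.eval I σ), (c.cost I (enter v w i
        (Nat.rec σ (fun i τ => c.run I (enter v w i τ)) i)) + 12)

section Unfold
variable (I : ℕ → ℕ) (σ : Store)
@[simp] theorem run_skip : skip.run I σ = σ := rfl
@[simp] theorem run_assign (v e) : (assign v e).run I σ = σ.setVar v (e.eval I σ) := rfl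
@[simp] theorem run_write (k i e) :
    (write k i e).run I σ = σ.setArr k (i.eval I σ) (e.eval I σ) := rfl
@[simp] theorem run_seq (c d : Cmd) : (c ;; d).run I σ = d.run I (c.run I σ) := rfl
theorem run_ite (e) (c d : Cmd) :
    (ite e c d).run I σ = if e.eval I σ ≠ 0 then c.run I σ else d.run I σ := rfl
@[simp] theorem cost_skip : skip.cost I σ = 1 := rfl
@[simp] theorem cost_assign (v e) : (assign v e).cost I σ = e.cost + 2 := rfl
@[simp] theorem cost_write (k i e) : (write k i e).cost I σ = i.cost + e.cost + 9 := rfl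
@[simp] theorem cost_seq (c d : Cmd) :
    (c ;; d).cost I σ = c.cost I σ + d.cost I (c.run I σ) := rfl
theorem cost_ite (e) (c d : Cmd) :
    (ite e c d).cost I σ = e.cost + 1 + if e.eval I σ ≠ 0 then c.cost I σ else d.cost I σ := rfl
end Unfold

/-! ### Frames and loop invariants -/

/-- The variables that a command may change. -/
def vars : Cmd → List Var
  | skip => []
  | assign v _ => [v]
  | write _ _ _ => []
  | seq c d => c.vars ++ d.vars
  | ite _ c d => c.vars ++ d.vars
  | loop v w _ c => v :: w :: c.vars

/-- The arrays that a command may change. -/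
def arrs : Cmd → List Arr
  | skip => []
  | assign _ _ => []
  | write k _ _ => [k]
  | seq c d => c.arrs ++ d.arrs
  | ite _ c d => c.arrs ++ d.arrs
  | loop _ _ _ c => c.arrs

/-- Frame rule: the syntactic list `vars` over-approximates the effect of a command. All later
specifications use it, with `arr_run`, to carry untouched data along. -/
theorem var_run (I : ℕ → ℕ) (c : Cmd) (σ : Store) (v : Var) (h : v ∉ c.vars) :
    (c.run I σ).var v = σ.var v := by
  induction c generalizing σ with
  | skip => rfl
  | assign w e => simp [vars] at h; simp [h]
  | write k i e => rfl
  | seq c d hc hd =>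
    simp [vars] at h
    rw [run_seq, hd _ h.2, hc _ h.1]
  | ite e c d hc hd =>
    simp [vars] at h
    rw [run_ite]
    split
    · exact hc _ h.1
    · exact hd _ h.2
  | loop u w e c hc =>
    simp [vars] at h
    have : ∀ k : ℕ, (Nat.rec σ (fun i τ => c.run I (enter u w i τ)) k : Store).var v = σ.var v := by
      intro k
      induction k with
      | zero => rfl
      | succ k ih => rw [← ih]; simp only []; rw [hc _ h.2.2]; simp [enter, h.1, h.2.1]
    exact this _

theorem arr_run (I : ℕ → ℕ) (c : Cmd) (σ : Store) (k : Arr) (h : k ∉ c.arrs) :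
    (c.run I σ).arr k = σ.arr k := by
  induction c generalizing σ with
  | skip => rfl
  | assign w e => rfl
  | write k i e => simp [arrs] at h; simp [h]
  | seq c d hc hd =>
    simp [arrs] at h
    rw [run_seq, hd _ h.2, hc _ h.1]
  | ite e c d hc hd =>
    simp [arrs] at h
    rw [run_ite]
    split
    · exact hc _ h.1
    · exact hd _ h.2
  | loop u w e c hc =>
    simp [arrs] at h
    have : ∀ j : ℕ, (Nat.rec σ (fun i τ => c.run I (enter u w i τ)) j : Store).arr k = σ.arr k := by
      intro j
      induction j with
      | zero => rfl
      | succ j ih => rw [← ih]; simp only []; rw [hc _ h]; simp [enter]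
    exact this _

/-- The rule for loops: an invariant, and a bound for the cost of every round. -/
theorem loop_rule (I : ℕ → ℕ) (v w : Var) (e : Expr) (c : Cmd) (σ : Store) (N B : ℕ)
    (hN : e.eval I σ = N) (Inv : ℕ → Store → Prop) (h0 : Inv 0 σ)
    (step : ∀ i < N, ∀ τ : Store, Inv i τ →
      (∀ x, x ∉ (loop v w e c).vars → τ.var x = σ.var x) →
      (∀ k, k ∉ c.arrs → τ.arr k = σ.arr k) →
      Inv (i + 1) (c.run I (enter v w i τ)) ∧ c.cost I (enter v w i τ) ≤ B) :
    Inv N ((loop v w e c).run I σ) ∧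
      (loop v w e c).cost I σ ≤ e.cost + 3 + N * (B + 12) := by
  subst hN
  -- The invariant and the frame are proved together, because `step` may use that everything outside
  -- the body is still as in `σ`.
  have key : ∀ k ≤ e.eval I σ,
      Inv k (Nat.rec σ (fun i τ => c.run I (enter v w i τ)) k) ∧
      (∀ x, x ∉ (loop v w e c).vars →
        (Nat.rec σ (fun i τ => c.run I (enter v w i τ)) k : Store).var x = σ.var x) ∧
      (∀ a, a ∉ c.arrs →
        (Nat.rec σ (fun i τ => c.run I (enter v w i τ)) k : Store).arr a = σ.arr a) := by
    intro k hk
    induction k with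
    | zero => exact ⟨h0, fun _ _ => rfl, fun _ _ => rfl⟩
    | succ k ih =>
      obtain ⟨i1, i2, i3⟩ := ih (by omega)
      refine ⟨(step k (by omega) _ i1 i2 i3).1, ?_, ?_⟩
      · intro x hx
        rw [← i2 x hx]
        simp [vars] at hx
        simp only []
        rw [var_run _ _ _ _ hx.2.2]
        simp [enter, hx.1, hx.2.1]
      · intro a ha
        rw [← i3 a ha]
        simp only []
        rw [arr_run _ _ _ _ ha]
        simp [enter]
  refine ⟨(key _ le_rfl).1, ?_⟩
  show e.cost + 3 + _ ≤ _
  gcongr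
  calc _ ≤ ∑ i ∈ Finset.range (e.eval I σ), (B + 12) := by
        apply Finset.sum_le_sum
        intro i hi
        have hi' := Finset.mem_range.1 hi
        obtain ⟨i1, i2, i3⟩ := key i hi'.le
        have := (step i hi' _ i1 i2 i3).2
        omega
    _ = _ := by simp

end Cmd

/-! ### Compilation -/

/-- Register of a variable. -/
def Var.reg (v : Var) : ℕ := 2 * v.idx

/-- Registers for intermediate results; number `0` holds the base address of the arrays. -/
def tmp (t : ℕ) : ℕ := 2 * t + 1

open RamProg

/-- `r := r + r` four times. -/
def mulSixteen (r : ℕ) : RamProg :=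
  .seq (.add r r r) (.seq (.add r r r) (.seq (.add r r r) (.add r r r)))

/-- Turn the index in register `tmp t` into an address of array `k`. -/
def addrProg (t : ℕ) (k : Arr) : RamProg :=
  .seq (mulSixteen (tmp t)) (.seq (.add (tmp t) (tmp t) (tmp t)) (.seq (.add (tmp t) (tmp t) (tmp 0))
    (.seq (.const (tmp (t + 1)) k.idx) (.add (tmp t) (tmp t) (tmp (t + 1))))))

/-- Code that computes an expression into `tmp t`. -/
def Expr.compile : Expr → ℕ → RamProg
  | .lit c, t => .const (tmp t) c
  | .var v, t => .seq (.const (tmp t) 0) (.add (tmp t) (tmp t) v.reg)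
  | .add a b, t => .seq (a.compile t) (.seq (b.compile (t + 1)) (.add (tmp t) (tmp t) (tmp (t + 1))))
  | .sub a b, t => .seq (a.compile t) (.seq (b.compile (t + 1)) (.sub (tmp t) (tmp t) (tmp (t + 1))))
  | .arr k i, t => .seq (i.compile t) (.seq (addrProg t k) (.load (tmp t) (tmp t)))
  | .inp i, t => .seq (i.compile t) (.seq (.sub (tmp (t + 1)) (tmp 0) (tmp t))
      (.ite (tmp (t + 1)) (.load (tmp t) (tmp t)) (.const (tmp t) 0)))

/-- One round of a loop with body `P`: `tmp t` counts the remaining rounds, `tmp (t + 1)` the rounds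
done, and `tmp (t + 2)` is the corresponding power of `16`. -/
def loopRound (v w : Var) (P : RamProg) (t : ℕ) : RamProg :=
  .seq (.const v.reg 0) (.seq (.add v.reg v.reg (tmp (t + 1)))
  (.seq (.const w.reg 0) (.seq (.add w.reg w.reg (tmp (t + 2)))
  (.seq P (.seq (.const (tmp (t + 3)) 1)
  (.seq (.sub (tmp t) (tmp t) (tmp (t + 3)))
  (.seq (.add (tmp (t + 1)) (tmp (t + 1)) (tmp (t + 3))) (mulSixteen (tmp (t + 2))))))))))

/-- Code of a command, with `tmp t`, `tmp (t + 1)`, … free. -/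
def Cmd.compile : Cmd → ℕ → RamProg
  | .skip, t => .const (tmp t) 0
  | .assign v e, t => .seq (e.compile t) (.seq (.const v.reg 0) (.add v.reg v.reg (tmp t)))
  | .write k i e, t => .seq (i.compile t) (.seq (addrProg t k)
      (.seq (e.compile (t + 1)) (.store (tmp t) (tmp (t + 1)))))
  | .seq c d, t => .seq (c.compile t) (d.compile t)
  | .ite e c d, t => .seq (e.compile t) (.ite (tmp t) (c.compile t) (d.compile t))
  | .loop v w e c, t => .seq (e.compile t) (.seq (.const (tmp (t + 1)) 0)
      (.seq (.const (tmp (t + 2)) 1) (.loop (tmp t) (loopRound v w (c.compile (t + 3)) t))))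

/-! ### Correctness of the compiler -/

/-- The machine configuration `s` represents the store `σ`, with the input `I` in the cells below
`base` and the arrays interleaved in the cells from `base` on. -/
structure Represents (I : ℕ → ℕ) (base : ℕ) (σ : Store) (s : RamState) : Prop where
  var : ∀ v : Var, s.reg v.reg = σ.var v
  base_eq : s.reg (tmp 0) = base
  inp : ∀ i < base, s.mem i = I i
  inp_zero : ∀ i, base ≤ i → I i = 0
  arr : ∀ (k : Arr) (i : ℕ), s.mem (i * 32 + base + k.idx) = σ.arr k i

/-- Variables occupy the even registers and intermediate results the odd ones. -/
theorem tmp_ne_reg (t : ℕ) (v : Var) : tmp t ≠ v.reg := by unfold tmp Var.reg; omega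
theorem reg_ne_tmp (t : ℕ) (v : Var) : v.reg ≠ tmp t := by unfold tmp Var.reg; omega
@[simp] theorem tmp_inj (t u : ℕ) : tmp t = tmp u ↔ t = u := by unfold tmp; omega
@[simp] theorem reg_inj (v w : Var) : v.reg = w.reg ↔ v = w := by
  unfold Var.reg
  rw [Nat.mul_right_inj (by norm_num)]
  exact Var.idx_injective.eq_iff

/-- `s` and `s'` agree on memory, variables, and on the intermediate results below `t`. -/
structure Agree (t : ℕ) (s s' : RamState) : Prop where
  var : ∀ v : Var, s'.reg v.reg = s.reg v.reg
  tmp : ∀ u < t, s'.reg (tmp u) = s.reg (tmp u)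
  mem : s'.mem = s.mem

theorem Agree.trans {t : ℕ} {s s' s'' : RamState} (h : Agree t s s') (h' : Agree t s' s'') :
    Agree t s s'' :=
  ⟨fun v => (h'.var v).trans (h.var v), fun u hu => (h'.tmp u hu).trans (h.tmp u hu),
    h'.mem.trans h.mem⟩

theorem Agree.mono {t u : ℕ} {s s' : RamState} (h : Agree t s s') (hu : u ≤ t) : Agree u s s' :=
  ⟨h.var, fun _ hv => h.tmp _ (by omega), h.mem⟩

theorem Agree.represents {t : ℕ} (ht : 0 < t) {I : ℕ → ℕ} {base : ℕ} {σ : Store} {s s' : RamState}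
    (h : Agree t s s') (r : Represents I base σ s) : Represents I base σ s' where
  var v := (h.var v).trans (r.var v)
  base_eq := (h.tmp 0 ht).trans r.base_eq
  inp i hi := by rw [h.mem]; exact r.inp i hi
  inp_zero := r.inp_zero
  arr k i := by rw [h.mem]; exact r.arr k i

theorem agree_setReg_tmp (t u x : ℕ) (s : RamState) (h : t ≤ u) : Agree t s (s.setReg (tmp u) x) where
  var v := by simp [RamState.setReg, Function.update_of_ne (reg_ne_tmp u v)]
  tmp w hw := by
    have : tmp w ≠ tmp u := by simp; omega
    simp [RamState.setReg, Function.update_of_ne this]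
  mem := rfl

@[simp] theorem setReg_reg_self (s : RamState) (r x : ℕ) : (s.setReg r x).reg r = x := by
  simp [RamState.setReg]

theorem setReg_reg_of_ne (s : RamState) (r r' x : ℕ) (h : r' ≠ r) :
    (s.setReg r x).reg r' = s.reg r' := by
  simp [RamState.setReg, Function.update_of_ne h]

theorem setReg_tmp_of_ne (s : RamState) (t u x : ℕ) (h : u ≠ t) :
    (s.setReg (tmp t) x).reg (tmp u) = s.reg (tmp u) :=
  setReg_reg_of_ne _ _ _ _ (by simpa using h)

theorem _root_.RamProg.Exec.congr {P : RamProg} {s s₁ s₂ : RamState} {t t' : ℕ} (h : P.Exec s t s₁)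
    (ht : t = t') (hs : s₁ = s₂) : P.Exec s t' s₂ := ht ▸ hs ▸ h

theorem exec_mulSixteen (r : ℕ) (s : RamState) :
    (mulSixteen r).Exec s 4 (s.setReg r (16 * s.reg r)) := by
  have h1 := Exec.add s r r r
  have h2 := Exec.add (s.setReg r (s.reg r + s.reg r)) r r r
  have h3 := Exec.add ((s.setReg r (s.reg r + s.reg r)).setReg r
    ((s.setReg r (s.reg r + s.reg r)).reg r + (s.setReg r (s.reg r + s.reg r)).reg r)) r r r
  have h := h1.seq (h2.seq (h3.seq (Exec.add _ r r r)))
  refine h.congr rfl ?_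
  simp [RamState.setReg]
  ring

theorem exec_addrProg (t : ℕ) (ht : 0 < t) (k : Arr) (s : RamState) :
    ∃ s', (addrProg t k).Exec s 8 s' ∧ Agree t s s' ∧
      s'.reg (tmp t) = s.reg (tmp t) * 32 + s.reg (tmp 0) + k.idx := by
  refine ⟨_, (exec_mulSixteen _ _).seq ((Exec.add _ _ _ _).seq ((Exec.add _ _ _ _).seq
    ((Exec.const _ _ _).seq (Exec.add _ _ _ _)))), ?_, ?_⟩
  · exact (agree_setReg_tmp _ _ _ _ le_rfl).trans ((agree_setReg_tmp _ _ _ _ le_rfl).trans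
      ((agree_setReg_tmp _ _ _ _ le_rfl).trans ((agree_setReg_tmp _ _ _ _ (by omega)).trans
        (agree_setReg_tmp _ _ _ _ le_rfl))))
  · have h0 : (0 : ℕ) ≠ t := ht.ne
    have h1 : t ≠ t + 1 := by omega
    simp [setReg_tmp_of_ne _ _ _ _ h0, setReg_tmp_of_ne _ _ _ _ h1]
    ring

/-- Stack discipline: code compiled at level `t` preserves the intermediate results below `t`, so a
left operand survives the evaluation of the right one at level `t + 1`. The level must be positive
because `tmp 0` holds the base address. -/
theorem exec_expr (I : ℕ → ℕ) (base : ℕ) (σ : Store) (e : Expr) (t : ℕ) (ht : 0 < t)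
    (s : RamState) (r : Represents I base σ s) :
    ∃ s', (e.compile t).Exec s e.cost s' ∧ Agree t s s' ∧ s'.reg (tmp t) = e.eval I σ := by
  induction e generalizing t s with
  | lit c => exact ⟨_, Exec.const _ _ _, agree_setReg_tmp _ _ _ _ le_rfl, by simp⟩
  | var v =>
    refine ⟨_, (Exec.const _ _ _).seq (Exec.add _ _ _ _),
      (agree_setReg_tmp _ _ _ _ le_rfl).trans (agree_setReg_tmp _ _ _ _ le_rfl), ?_⟩
    simp [setReg_reg_of_ne _ _ _ _ (reg_ne_tmp t v), r.var]
  | add a b ha hb =>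
    obtain ⟨s1, e1, g1, v1⟩ := ha t ht s r
    obtain ⟨s2, e2, g2, v2⟩ := hb (t + 1) (by omega) s1 (g1.represents ht r)
    refine ⟨_, e1.seq (e2.seq (Exec.add _ _ _ _)),
      g1.trans ((g2.mono (by omega)).trans (agree_setReg_tmp _ _ _ _ le_rfl)), ?_⟩
    rw [setReg_reg_self, v2, g2.tmp t (by omega), v1]; rfl
  | sub a b ha hb =>
    obtain ⟨s1, e1, g1, v1⟩ := ha t ht s r
    obtain ⟨s2, e2, g2, v2⟩ := hb (t + 1) (by omega) s1 (g1.represents ht r)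
    refine ⟨_, e1.seq (e2.seq (Exec.sub _ _ _ _)),
      g1.trans ((g2.mono (by omega)).trans (agree_setReg_tmp _ _ _ _ le_rfl)), ?_⟩
    rw [setReg_reg_self, v2, g2.tmp t (by omega), v1]; rfl
  | arr k i hi =>
    obtain ⟨s1, e1, g1, v1⟩ := hi t ht s r
    obtain ⟨s2, e2, g2, v2⟩ := exec_addrProg t ht k s1
    refine ⟨_, e1.seq (e2.seq (Exec.load _ _ _)),
      g1.trans (g2.trans (agree_setReg_tmp _ _ _ _ le_rfl)), ?_⟩
    have r1 := g1.represents ht r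
    rw [setReg_reg_self, v2, v1, g2.mem, r1.base_eq, r1.arr]; rfl
  | inp i hi =>
    obtain ⟨s1, e1, g1, v1⟩ := hi t ht s r
    have r1 := g1.represents ht r
    have g2 := agree_setReg_tmp t (t + 1) (s1.reg (tmp 0) - s1.reg (tmp t)) s1 (by omega)
    have r2 := g2.represents ht r1
    have e2 := Exec.sub s1 (tmp (t + 1)) (tmp 0) (tmp t)
    -- Truncated subtraction tests whether the index lies beyond the input cells. There the memory
    -- belongs to the arrays, so the code returns 0, which agrees with `inp_zero`.
    by_cases h : s1.reg (tmp 0) - s1.reg (tmp t) = 0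
    · refine ⟨_, e1.seq (e2.seq (Exec.iteFalse (by simp [h]) (Exec.const _ _ _))),
        g1.trans (g2.trans (agree_setReg_tmp _ _ _ _ le_rfl)), ?_⟩
      rw [setReg_reg_self]
      rw [r1.base_eq, v1] at h
      exact (r.inp_zero _ (by omega)).symm
    · refine ⟨_, e1.seq (e2.seq (Exec.iteTrue (by simpa using h) (Exec.load _ _ _))),
        g1.trans (g2.trans (agree_setReg_tmp _ _ _ _ le_rfl)), ?_⟩
      rw [setReg_reg_self, setReg_tmp_of_ne _ _ _ _ (by omega), v1]
      rw [r1.base_eq, v1] at h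
      exact r2.inp _ (by omega)

theorem Represents.setVar {I : ℕ → ℕ} {base : ℕ} {σ : Store} {s : RamState}
    (r : Represents I base σ s) (v : Var) (x : ℕ) :
    Represents I base (σ.setVar v x) (s.setReg v.reg x) where
  var w := by
    by_cases h : w = v
    · subst h; simp
    · rw [setReg_reg_of_ne _ _ _ _ (by simpa using h), r.var]; simp [h]
  base_eq := by rw [setReg_reg_of_ne _ _ _ _ (tmp_ne_reg _ _), r.base_eq]
  inp := r.inp
  inp_zero := r.inp_zero
  arr := r.arr

/-- There is no aliasing: array cells lie at or above `base`, away from the input, and the residue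
modulo 32 of the offset from `base` identifies the array. -/
theorem Represents.setArr {I : ℕ → ℕ} {base : ℕ} {σ : Store} {s : RamState}
    (r : Represents I base σ s) (k : Arr) (i x : ℕ) :
    Represents I base (σ.setArr k i x) (s.setMem (i * 32 + base + k.idx) x) where
  var := r.var
  base_eq := r.base_eq
  inp j hj := by
    have : j ≠ i * 32 + base + k.idx := by omega
    simp only [RamState.setMem, Function.update_of_ne this, r.inp j hj]
  inp_zero := r.inp_zero
  arr k' j := by
    by_cases h : k' = k ∧ j = i
    · obtain ⟨rfl, rfl⟩ := h; simp [RamState.setMem]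
    · have hne : j * 32 + base + k'.idx ≠ i * 32 + base + k.idx := by
        intro he
        have h1 := k.idx_lt
        have h2 := k'.idx_lt
        exact h ⟨Arr.idx_injective (by omega), by omega⟩
      simp only [RamState.setMem, Function.update_of_ne hne, r.arr, Store.arr_setArr]
      split_ifs with hk
      · subst hk
        rw [Function.update_of_ne (by tauto)]
      · rfl

/-- Configurations agree on the intermediate results below `t`. -/
def AgreeTmp (t : ℕ) (s s' : RamState) : Prop := ∀ u < t, s'.reg (tmp u) = s.reg (tmp u)

theorem agreeTmp_setReg (t : ℕ) (v : Var) (x : ℕ) (s : RamState) :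
    AgreeTmp t s (s.setReg v.reg x) := fun _ _ => setReg_reg_of_ne _ _ _ _ (tmp_ne_reg _ _)

theorem AgreeTmp.trans {t : ℕ} {s s' s'' : RamState} (h : AgreeTmp t s s')
    (h' : AgreeTmp t s' s'') : AgreeTmp t s s'' := fun u hu => (h' u hu).trans (h u hu)

theorem exec_setVar (v : Var) (t : ℕ) (s : RamState) :
    (RamProg.seq (.const v.reg 0) (.add v.reg v.reg (tmp t))).Exec s 2
      (s.setReg v.reg (s.reg (tmp t))) := by
  have h := (Exec.const s v.reg 0).seq (Exec.add _ v.reg v.reg (tmp t))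
  convert h using 1
  rw [setReg_reg_self, setReg_reg_of_ne _ _ _ _ (tmp_ne_reg _ _)]
  simp [RamState.setReg]

/-- Simulation with an exact step count. Preservation of the intermediate results below `t` is part
of the claim because the counters of enclosing loops are kept there. -/
theorem exec_cmd (I : ℕ → ℕ) (base : ℕ) (c : Cmd) (t : ℕ) (ht : 0 < t) (σ : Store)
    (s : RamState) (r : Represents I base σ s) :
    ∃ s', (c.compile t).Exec s (c.cost I σ) s' ∧ Represents I base (c.run I σ) s' ∧
      AgreeTmp t s s' := by
  induction c generalizing t s σ with
  | skip =>
    have g := agree_setReg_tmp t t 0 s le_rfl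
    exact ⟨_, Exec.const _ _ _, g.represents ht r, g.tmp⟩
  | assign v e =>
    obtain ⟨s1, e1, g1, v1⟩ := exec_expr I base σ e t ht s r
    refine ⟨_, e1.seq (exec_setVar v t s1), ?_, ?_⟩
    · rw [v1]; exact (g1.represents ht r).setVar v _
    · exact AgreeTmp.trans g1.tmp (agreeTmp_setReg _ _ _ _)
  | write k i e =>
    obtain ⟨s1, e1, g1, v1⟩ := exec_expr I base σ i t ht s r
    obtain ⟨s2, e2, g2, v2⟩ := exec_addrProg t ht k s1
    have r1 := g1.represents ht r
    have r2 := g2.represents ht r1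
    obtain ⟨s3, e3, g3, v3⟩ := exec_expr I base σ e (t + 1) (by omega) s2 r2
    have r3 := g3.represents (by omega) r2
    have E := e1.seq (e2.seq (e3.seq (Exec.store s3 (tmp t) (tmp (t + 1)))))
    refine ⟨_, E.congr (by simp; omega) rfl, ?_, ?_⟩
    · rw [v3, g3.tmp t (by omega), v2, v1, r1.base_eq]
      exact r3.setArr k _ _
    · have h1 : AgreeTmp t s s3 :=
        AgreeTmp.trans g1.tmp (AgreeTmp.trans g2.tmp (g3.mono (by omega)).tmp)
      exact fun u hu => h1 u hu
  | seq c d hc hd =>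
    obtain ⟨s1, e1, r1, g1⟩ := hc t ht σ s r
    obtain ⟨s2, e2, r2, g2⟩ := hd t ht _ s1 r1
    exact ⟨s2, e1.seq e2, r2, g1.trans g2⟩
  | ite e c d hc hd =>
    obtain ⟨s1, e1, g1, v1⟩ := exec_expr I base σ e t ht s r
    have r1 := g1.represents ht r
    rw [Cmd.cost_ite, Cmd.run_ite]
    by_cases h : e.eval I σ = 0
    · obtain ⟨s2, e2, r2, g2⟩ := hd t ht σ s1 r1
      refine ⟨s2, ?_, by simpa [h] using r2, AgreeTmp.trans g1.tmp g2⟩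
      have E := e1.seq (Exec.iteFalse (P := c.compile t) (by rw [v1]; exact h) e2)
      exact E.congr (by simp [h]; ring) rfl
    · obtain ⟨s2, e2, r2, g2⟩ := hc t ht σ s1 r1
      refine ⟨s2, ?_, by simpa [h] using r2, AgreeTmp.trans g1.tmp g2⟩
      have E := e1.seq (Exec.iteTrue (Q := d.compile t) (by rw [v1]; exact h) e2)
      exact E.congr (by simp [h]; ring) rfl
  | loop v w e c hc =>
    obtain ⟨s1, e1, g1, v1⟩ := exec_expr I base σ e t ht s r
    have r1 := g1.represents ht r
    set N := e.eval I σ with hN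
    set S : ℕ → Store := fun k => Nat.rec σ (fun i τ => c.run I (Cmd.enter v w i τ)) k with hS
    set B : RamProg := loopRound v w (c.compile (t + 3)) t with hB
    -- Induction on the number `j` of rounds still to come. Besides the body, a round takes 12
    -- steps: 4 to set the two loop variables, 7 to update the three counters, and one test.
    have main : ∀ j k : ℕ, k + j = N → ∀ s2 : RamState, Represents I base (S k) s2 →
        s2.reg (tmp t) = j → s2.reg (tmp (t + 1)) = k → s2.reg (tmp (t + 2)) = 16 ^ k →
        ∃ s', (RamProg.loop (tmp t) B).Exec s2
          (1 + ∑ i ∈ Finset.Ico k N, (c.cost I (Cmd.enter v w i (S i)) + 12)) s' ∧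
          Represents I base (S N) s' ∧ AgreeTmp t s2 s' := by
      intro j
      induction j with
      | zero =>
        intro k hk s2 r2 h1 h2 h3
        obtain rfl : k = N := by omega
        exact ⟨s2, by simpa using Exec.loopExit h1, r2, fun _ _ => rfl⟩
      | succ j ih =>
        intro k hk s2 r2 h1 h2 h3
        have E1 := exec_setVar v (t + 1) s2
        have R1 := r2.setVar v (s2.reg (tmp (t + 1)))
        have E2 := exec_setVar w (t + 2) (s2.setReg v.reg (s2.reg (tmp (t + 1))))
        have R2 := R1.setVar w ((s2.setReg v.reg (s2.reg (tmp (t + 1)))).reg (tmp (t + 2)))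
        have hx : ((S k).setVar v (s2.reg (tmp (t + 1)))).setVar w
            ((s2.setReg v.reg (s2.reg (tmp (t + 1)))).reg (tmp (t + 2))) =
            Cmd.enter v w k (S k) := by
          rw [setReg_reg_of_ne _ _ _ _ (tmp_ne_reg _ _), h2, h3]; rfl
        have R2' := R2
        rw [hx] at R2'
        obtain ⟨s3, E3, R3, G3⟩ := hc (t + 3) (by omega) _ _ R2'
        have G3' : AgreeTmp (t + 3) s2 s3 :=
          AgreeTmp.trans (agreeTmp_setReg _ _ _ _) (AgreeTmp.trans (agreeTmp_setReg _ _ _ _) G3)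
        have a1 := agree_setReg_tmp t (t + 3) 1 s3 (by omega)
        set s4 := s3.setReg (tmp (t + 3)) 1 with hs4
        have a2 := agree_setReg_tmp t t (s4.reg (tmp t) - s4.reg (tmp (t + 3))) s4 (by omega)
        set s5 := s4.setReg (tmp t) (s4.reg (tmp t) - s4.reg (tmp (t + 3))) with hs5
        have a3 := agree_setReg_tmp t (t + 1) (s5.reg (tmp (t + 1)) + s5.reg (tmp (t + 3))) s5
          (by omega)
        set s6 := s5.setReg (tmp (t + 1)) (s5.reg (tmp (t + 1)) + s5.reg (tmp (t + 3))) with hs6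
        have a4 := agree_setReg_tmp t (t + 2) (16 * s6.reg (tmp (t + 2))) s6 (by omega)
        set s7 := s6.setReg (tmp (t + 2)) (16 * s6.reg (tmp (t + 2))) with hs7
        have a := a1.trans (a2.trans (a3.trans a4))
        have v4 : s7.reg (tmp t) = j := by
          rw [hs7, setReg_tmp_of_ne _ _ _ _ (by omega), hs6, setReg_tmp_of_ne _ _ _ _ (by omega),
            hs5, setReg_reg_self, hs4, setReg_reg_self, setReg_tmp_of_ne _ _ _ _ (by omega),
            G3' t (by omega), h1]; rfl
        have v5 : s7.reg (tmp (t + 1)) = k + 1 := by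
          rw [hs7, setReg_tmp_of_ne _ _ _ _ (by omega), hs6, setReg_reg_self, hs5,
            setReg_tmp_of_ne _ _ _ _ (by omega), setReg_tmp_of_ne _ _ _ _ (by omega), hs4,
            setReg_tmp_of_ne _ _ _ _ (by omega), setReg_reg_self, G3' _ (by omega), h2]
        have v6 : s7.reg (tmp (t + 2)) = 16 ^ (k + 1) := by
          rw [hs7, setReg_reg_self, hs6, setReg_tmp_of_ne _ _ _ _ (by omega), hs5,
            setReg_tmp_of_ne _ _ _ _ (by omega), hs4, setReg_tmp_of_ne _ _ _ _ (by omega),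
            G3' _ (by omega), h3, pow_succ']
        obtain ⟨s', E', R', G'⟩ := ih (k + 1) (by omega) s7 (a.represents ht R3) v4 v5 v6
        refine ⟨s', ?_, R', AgreeTmp.trans (fun u hu => G3' u (by omega)) (AgreeTmp.trans a.tmp G')⟩
        -- Reassociation: the two instructions that set a variable were executed as one block, while
        -- `loopRound` nests its sequence to the right.
        have split2 : ∀ {P Q R : RamProg} {s s' s'' : RamState} {t1 t2 : ℕ},
            (RamProg.seq P Q).Exec s t1 s' → R.Exec s' t2 s'' →
            (RamProg.seq P (.seq Q R)).Exec s (t1 + t2) s'' := by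
          intro P Q R s s' s'' t1 t2 hPQ hR
          cases hPQ with
          | seq hP hQ =>
            rw [add_assoc]
            exact hP.seq (hQ.seq hR)
        have E := Exec.loopStep (r := tmp t) (by rw [h1]; omega)
          (split2 E1 (split2 E2 (E3.seq ((Exec.const s3 (tmp (t + 3)) 1).seq
            ((Exec.sub s4 (tmp t) (tmp t) (tmp (t + 3))).seq
            ((Exec.add s5 (tmp (t + 1)) (tmp (t + 1)) (tmp (t + 3))).seq
              (exec_mulSixteen (tmp (t + 2)) s6))))))) E'
        refine E.congr ?_ rfl
        rw [Finset.sum_eq_sum_Ico_succ_bot (a := k) (b := N) (by omega)]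
        omega
    have b1 := agree_setReg_tmp (t + 1) (t + 1) 0 s1 le_rfl
    have b2 := agree_setReg_tmp (t + 1) (t + 2) 1 (s1.setReg (tmp (t + 1)) 0) (by omega)
    have bb := b1.trans b2
    obtain ⟨s', E', R', G'⟩ := main N 0 (by omega) _ (bb.represents (by omega) r1)
      ((bb.tmp t (by omega)).trans v1)
      (by rw [setReg_tmp_of_ne _ _ _ _ (by omega), setReg_reg_self]) (by simp)
    refine ⟨s', ?_, R', AgreeTmp.trans g1.tmp (AgreeTmp.trans (bb.mono (by omega)).tmp G')⟩
    have E := e1.seq ((Exec.const s1 (tmp (t + 1)) 0).seq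
      ((Exec.const _ (tmp (t + 2)) 1).seq E'))
    refine E.congr ?_ rfl
    rw [← Finset.range_eq_Ico]
    show _ = e.cost + 3 + _
    ring

end Imp

/-! ## Codes of finite sets -/

/-- The code of a finite set of natural numbers. -/
def code (S : Finset ℕ) : ℕ := ∑ s ∈ S, 16 ^ s

/-- `x` is the code of a finite set. -/
def IsCode (x : ℕ) : Prop := ∃ S, x = code S

theorem isCode_zero : IsCode 0 := ⟨∅, rfl⟩

theorem isCode_pow (i : ℕ) : IsCode (16 ^ i) := ⟨{i}, by simp [code]⟩

/-- Indices with several components. -/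
def ix2 (a b : ℕ) : ℕ := a + 2 * b
/-- Indices with several components. -/
def ix3 (a b c : ℕ) : ℕ := a + 2 * b + 4 * c
/-- Indices with several components. -/
def ix4 (a b c e : ℕ) : ℕ := a + 2 * b + 4 * c + 8 * e

/-- Peel off the lowest base 16 digit: it is the residue modulo 16, and the rest is divisible by 16.
-/
theorem digits_unique (B : ℕ) (f g : ℕ → ℕ) (hf : ∀ s, f s < 16) (hg : ∀ s, g s < 16)
    (h : ∑ s ∈ Finset.range B, f s * 16 ^ s = ∑ s ∈ Finset.range B, g s * 16 ^ s) :
    ∀ s < B, f s = g s := by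
  induction B generalizing f g with
  | zero => intro s hs; omega
  | succ B ih =>
    rw [Finset.sum_range_succ', Finset.sum_range_succ'] at h
    have e : ∀ u : ℕ → ℕ, ∑ s ∈ Finset.range B, u (s + 1) * 16 ^ (s + 1) =
        16 * ∑ s ∈ Finset.range B, u (s + 1) * 16 ^ s := by
      intro u
      rw [Finset.mul_sum]
      exact Finset.sum_congr rfl fun s _ => by ring
    rw [e, e] at h
    have h0 := hf 0
    have h1 := hg 0
    simp only [pow_zero, mul_one] at h
    intro s hs
    rcases s with _ | s
    · omega
    · exact ih (fun s => f (s + 1)) (fun s => g (s + 1)) (fun s => hf _) (fun s => hg _)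
        (by omega) s (by omega)

theorem code_eq_sum (S : Finset ℕ) (B : ℕ) (h : ∀ s ∈ S, s < B) :
    code S = ∑ s ∈ Finset.range B, (if s ∈ S then 1 else 0) * 16 ^ s := by
  simp only [ite_mul, one_mul, zero_mul]
  rw [← Finset.sum_filter]
  unfold code
  congr 1
  ext s
  simp only [Finset.mem_filter, Finset.mem_range]
  exact ⟨fun hs => ⟨h s hs, hs⟩, fun hs => hs.2⟩

/-- At each position the combined digit is a 4-bit number whose bits are the memberships in the four
sets, and no carry occurs because it stays below 16. This is why 16 is the base: four codes fit into
one index, formed by additions only. -/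
theorem ix4_code_inj {A B C E A' B' C' E' : Finset ℕ}
    (h : ix4 (code A) (code B) (code C) (code E) = ix4 (code A') (code B') (code C') (code E')) :
    A = A' ∧ B = B' ∧ C = C' ∧ E = E' := by
  set U := A ∪ B ∪ C ∪ E ∪ A' ∪ B' ∪ C' ∪ E' with hU
  obtain ⟨N, hN⟩ : ∃ N, ∀ s ∈ U, s < N :=
    ⟨U.sup id + 1, fun s hs => Nat.lt_succ_of_le (Finset.le_sup (f := id) hs)⟩
  have hs : ∀ T ⊆ U, code T = ∑ s ∈ Finset.range N, (if s ∈ T then 1 else 0) * 16 ^ s :=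
    fun T hT => code_eq_sum T N fun s h => hN s (hT h)
  let dig (A B C E : Finset ℕ) (s : ℕ) : ℕ := (if s ∈ A then 1 else 0) +
    2 * (if s ∈ B then 1 else 0) + 4 * (if s ∈ C then 1 else 0) + 8 * (if s ∈ E then 1 else 0)
  have hd : ∀ A B C E s, dig A B C E s < 16 := by
    intro A B C E s; simp only [dig]; split_ifs <;> norm_num
  have sum : ∀ A B C E : Finset ℕ, A ⊆ U → B ⊆ U → C ⊆ U → E ⊆ U →
      ix4 (code A) (code B) (code C) (code E) =
        ∑ s ∈ Finset.range N, dig A B C E s * 16 ^ s := by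
    intro A B C E a b c e
    rw [hs A a, hs B b, hs C c, hs E e, ix4, Finset.mul_sum, Finset.mul_sum, Finset.mul_sum,
      ← Finset.sum_add_distrib, ← Finset.sum_add_distrib, ← Finset.sum_add_distrib]
    exact Finset.sum_congr rfl fun s _ => by simp only [dig]; ring
  rw [sum A B C E, sum A' B' C' E'] at h
  · have key := digits_unique N _ _ (hd A B C E) (hd A' B' C' E') h
    have out : ∀ T ⊆ U, ∀ s, ¬ s < N → s ∉ T := fun T hT s h1 h2 => h1 (hN s (hT h2))
    have fin : ∀ s, (s ∈ A ↔ s ∈ A') ∧ (s ∈ B ↔ s ∈ B') ∧ (s ∈ C ↔ s ∈ C') ∧ (s ∈ E ↔ s ∈ E') := by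
      intro s
      by_cases hsN : s < N
      · have := key s hsN
        simp only [dig] at this
        have b1 : ∀ T : Finset ℕ, (if s ∈ T then 1 else 0) ≤ 1 := fun T => by split_ifs <;> simp
        have b2 : ∀ T T' : Finset ℕ, (if s ∈ T then 1 else 0) = (if s ∈ T' then 1 else 0) →
            (s ∈ T ↔ s ∈ T') := fun T T' h => by split_ifs at h <;> simp_all
        have := b1 A; have := b1 B; have := b1 C; have := b1 E
        have := b1 A'; have := b1 B'; have := b1 C'; have := b1 E'
        exact ⟨b2 _ _ (by omega), b2 _ _ (by omega), b2 _ _ (by omega), b2 _ _ (by omega)⟩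
      · have o := fun T hT => out T hT s hsN
        have hm : ∀ T ⊆ U, (s ∈ T ↔ False) := fun T hT => iff_false_intro (o T hT)
        rw [hm A, hm B, hm C, hm E, hm A', hm B', hm C', hm E']
        · simp
        all_goals (intro x hx; simp [hU, hx])
    exact ⟨Finset.ext fun s => (fin s).1, Finset.ext fun s => (fin s).2.1,
      Finset.ext fun s => (fin s).2.2.1, Finset.ext fun s => (fin s).2.2.2⟩
  all_goals (intro x hx; simp [hU, hx])

theorem ix4_inj {a b c e a' b' c' e' : ℕ} (ha : IsCode a) (hb : IsCode b) (hc : IsCode c)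
    (he : IsCode e) (ha' : IsCode a') (hb' : IsCode b') (hc' : IsCode c') (he' : IsCode e') :
    ix4 a b c e = ix4 a' b' c' e' ↔ a = a' ∧ b = b' ∧ c = c' ∧ e = e' := by
  obtain ⟨A, rfl⟩ := ha
  obtain ⟨B, rfl⟩ := hb
  obtain ⟨C, rfl⟩ := hc
  obtain ⟨E, rfl⟩ := he
  obtain ⟨A', rfl⟩ := ha'
  obtain ⟨B', rfl⟩ := hb'
  obtain ⟨C', rfl⟩ := hc'
  obtain ⟨E', rfl⟩ := he'
  constructor
  · intro h
    obtain ⟨rfl, rfl, rfl, rfl⟩ := ix4_code_inj h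
    exact ⟨rfl, rfl, rfl, rfl⟩
  · rintro ⟨h1, h2, h3, h4⟩
    rw [h1, h2, h3, h4]

theorem ix3_inj {a b c a' b' c' : ℕ} (ha : IsCode a) (hb : IsCode b) (hc : IsCode c)
    (ha' : IsCode a') (hb' : IsCode b') (hc' : IsCode c') :
    ix3 a b c = ix3 a' b' c' ↔ a = a' ∧ b = b' ∧ c = c' := by
  have := ix4_inj ha hb hc isCode_zero ha' hb' hc' isCode_zero
  simpa [ix4, ix3] using this

theorem ix2_inj {a b a' b' : ℕ} (ha : IsCode a) (hb : IsCode b) (ha' : IsCode a')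
    (hb' : IsCode b') : ix2 a b = ix2 a' b' ↔ a = a' ∧ b = b' := by
  have := ix4_inj ha hb isCode_zero isCode_zero ha' hb' isCode_zero isCode_zero
  simpa [ix4, ix2] using this

theorem code_inj {A B : Finset ℕ} : code A = code B ↔ A = B := by
  constructor
  · intro h
    have := ix4_code_inj (A := A) (B := ∅) (C := ∅) (E := ∅) (A' := B) (B' := ∅) (C' := ∅)
      (E' := ∅) (by rw [h])
    exact this.1
  · rintro rfl; rfl

theorem code_eq_zero {A : Finset ℕ} : code A = 0 ↔ A = ∅ := code_inj (B := ∅)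

theorem pow_inj16 {i j : ℕ} : 16 ^ i = 16 ^ j ↔ i = j := Nat.pow_right_inj (by norm_num)

theorem code_union {A B : Finset ℕ} (h : Disjoint A B) : code (A ∪ B) = code A + code B :=
  Finset.sum_union h

/-! ## Codes of vectors -/

/-- Division with remainder, first by d + 1 and then by q. -/
theorem place_inj {q d t i v t' i' v' : ℕ} (hi : i < q) (hi' : i' < q) (hv : v ≤ d) (hv' : v' ≤ d)
    (h : (t * q + i) * (d + 1) + v = (t' * q + i') * (d + 1) + v') : t = t' ∧ i = i' ∧ v = v' := by
  have aux : ∀ {a b r s k : ℕ}, r < k → s < k → a * k + r = b * k + s → a = b ∧ r = s := by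
    intro a b r s k hr hs h
    have h1 : (a * k + r) / k = (b * k + s) / k := by rw [h]
    have hk : 0 < k := by omega
    rw [mul_comm a, mul_comm b, Nat.mul_add_div hk, Nat.mul_add_div hk, Nat.div_eq_of_lt hr,
      Nat.div_eq_of_lt hs] at h1
    simp only [add_zero] at h1
    subst h1
    exact ⟨rfl, by omega⟩
  obtain ⟨h1, h2⟩ := aux (by omega) (by omega) h
  obtain ⟨h3, h4⟩ := aux hi hi' h1
  exact ⟨h3, h4, h2⟩

theorem place_lt {T q d t i v J : ℕ} (ht : t < T) (hi : i < q) (hv : v ≤ d)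
    (hJ : T * q * (d + 1) ≤ J) : (t * q + i) * (d + 1) + v < J := by
  have h1 : t * q + i + 1 ≤ T * q :=
    calc t * q + i + 1 ≤ t * q + q := by omega
      _ = (t + 1) * q := by ring
      _ ≤ T * q := Nat.mul_le_mul_right _ ht
  calc (t * q + i) * (d + 1) + v < (t * q + i) * (d + 1) + (d + 1) := by omega
    _ = (t * q + i + 1) * (d + 1) := by ring
    _ ≤ T * q * (d + 1) := Nat.mul_le_mul_right _ h1
    _ ≤ J := hJ

/-- The code of the `T × q` array `f` with entries at most `d`. -/
def vecCode (T q d : ℕ) (f : ℕ → ℕ → ℕ) : ℕ :=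
  ∑ t ∈ Finset.range T, ∑ i ∈ Finset.range q, 16 ^ ((t * q + i) * (d + 1) + f t i)

/-- Each entry is written in unary: it has its own block of d + 1 positions and puts a single digit
1 at the position given by its value. Different entries use different positions, so a vector becomes
a finite set and inherits the injectivity of codes. -/
theorem vecCode_eq_code (T q d : ℕ) (f : ℕ → ℕ → ℕ) (hf : ∀ t i, f t i ≤ d) :
    vecCode T q d f = code ((Finset.range T ×ˢ Finset.range q).image
      fun x => (x.1 * q + x.2) * (d + 1) + f x.1 x.2) := by
  unfold vecCode code
  rw [Finset.sum_image, Finset.sum_product]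
  rintro ⟨t, i⟩ hx ⟨t', i'⟩ hx' h
  simp only [Finset.coe_product, Finset.coe_range, Set.mem_prod, Set.mem_Iio] at hx hx'
  obtain ⟨h1, h2, -⟩ := place_inj hx.2 hx'.2 (hf _ _) (hf _ _) h
  exact Prod.ext h1 h2

theorem isCode_vecCode (T q d : ℕ) (f : ℕ → ℕ → ℕ) (hf : ∀ t i, f t i ≤ d) :
    IsCode (vecCode T q d f) := ⟨_, vecCode_eq_code T q d f hf⟩

theorem vecCode_inj {T q d : ℕ} {f g : ℕ → ℕ → ℕ} (hf : ∀ t i, f t i ≤ d) (hg : ∀ t i, g t i ≤ d) :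
    vecCode T q d f = vecCode T q d g ↔ ∀ t < T, ∀ i < q, f t i = g t i := by
  constructor
  · intro h t ht i hi
    rw [vecCode_eq_code _ _ _ _ hf, vecCode_eq_code _ _ _ _ hg, code_inj] at h
    have hm := Finset.mem_image_of_mem (fun x : ℕ × ℕ => (x.1 * q + x.2) * (d + 1) + f x.1 x.2)
      (Finset.mk_mem_product (Finset.mem_range.2 ht) (Finset.mem_range.2 hi))
    rw [h, Finset.mem_image] at hm
    obtain ⟨⟨t', i'⟩, hx, he⟩ := hm
    simp only [Finset.mem_product, Finset.mem_range] at hx he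
    obtain ⟨rfl, rfl, h3⟩ := place_inj hx.2 hi (hg _ _) (hf _ _) he
    exact h3.symm
  · intro h
    unfold vecCode
    exact Finset.sum_congr rfl fun t ht => Finset.sum_congr rfl fun i hi => by
      rw [h t (Finset.mem_range.1 ht) i (Finset.mem_range.1 hi)]

/-! ## Systems of cuts -/

/-- A graph on `{0, …, n - 1}` with degree constraints `D` on `q` labels, constant from `d` on, and a
family of vertex sets, the sides: `M` of them come in complementary pairs, and the singletons
and the empty set are appended. -/
structure CutSystem where
  n : ℕ
  q : ℕ
  d : ℕ
  M : ℕ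
  adj : ℕ → ℕ → Prop
  D : ℕ → ℕ → ℕ → Prop
  side : ℕ → Finset ℕ
  opp : ℕ → ℕ
  q_pos : 0 < q
  d_pos : 0 < d
  adj_symm : ∀ x y, adj x y → adj y x
  adj_irrefl : ∀ x, ¬ adj x x
  adj_lt : ∀ x y, adj x y → x < n
  D_min : ∀ i < q, ∀ j < q, ∀ c, D i j c ↔ D i j (min d c)
  side_lt : ∀ a, ∀ x ∈ side a, x < n
  side_single : ∀ x < n, side (M + x) = {x}
  side_empty : side (M + n) = ∅
  opp_lt : ∀ a < M, opp a < M
  opp_opp : ∀ a < M, opp (opp a) = a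
  side_opp : ∀ a < M, ∀ x < n, x ∈ side (opp a) ↔ x ∉ side a

namespace CutSystem

variable (S : CutSystem)

open Classical in
/-- The neighbours of `y` in `A`. -/
noncomputable def nbr (A : Finset ℕ) (y : ℕ) : Finset ℕ := A.filter fun x => S.adj y x

/-- The number of neighbours of `y` in `A` with label `i`. -/
noncomputable def cnt (A : Finset ℕ) (Z : ℕ → ℕ) (y i : ℕ) : ℕ :=
  ((S.nbr A y).filter fun x => Z x = i).card

/-- `Z` is a labelling. -/
def IsLab (Z : ℕ → ℕ) : Prop := ∀ x, Z x < S.q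

/-- Two labellings give the same numbers of neighbours, truncated at `d`, across the cut `a`. -/
def Same (a : ℕ) (X Y : ℕ → ℕ) : Prop := ∀ y < S.n, y ∉ S.side a → ∀ i < S.q,
  min S.d (S.cnt (S.side a) X y i) = min S.d (S.cnt (S.side a) Y y i)

/-- All vertices of side `a` satisfy their constraints. -/
def Sat (a : ℕ) (X : ℕ → ℕ) : Prop :=
  ∀ v ∈ S.side a, ∀ j < S.q, S.D (X v) j (S.cnt (Finset.range S.n) X v j)

/-- Side `a` is the disjoint union of the sides `b` and `c`. -/
structure Join (a b c : ℕ) : Prop where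
  union : S.side a = S.side b ∪ S.side c
  disj : Disjoint (S.side b) (S.side c)

variable {S}

theorem mem_nbr {A : Finset ℕ} {x y : ℕ} : x ∈ S.nbr A y ↔ x ∈ A ∧ S.adj y x := by
  simp [nbr]

theorem cnt_congr {A : Finset ℕ} {X Y : ℕ → ℕ} (h : ∀ x ∈ A, X x = Y x) (y i : ℕ) :
    S.cnt A X y i = S.cnt A Y y i := by
  unfold cnt
  congr 1
  apply Finset.filter_congr
  intro x hx
  rw [h x (mem_nbr.1 hx).1]

theorem nbr_union (A B : Finset ℕ) (y : ℕ) : S.nbr (A ∪ B) y = S.nbr A y ∪ S.nbr B y := by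
  ext x
  simp only [mem_nbr, Finset.mem_union]
  tauto

theorem nbr_disjoint {A B : Finset ℕ} (h : Disjoint A B) (y : ℕ) :
    Disjoint (S.nbr A y) (S.nbr B y) :=
  Finset.disjoint_left.2 fun _ hx hx' =>
    Finset.disjoint_left.1 h (mem_nbr.1 hx).1 (mem_nbr.1 hx').1

theorem cnt_union {A B : Finset ℕ} (h : Disjoint A B) (X : ℕ → ℕ) (y i : ℕ) :
    S.cnt (A ∪ B) X y i = S.cnt A X y i + S.cnt B X y i := by
  unfold cnt
  rw [nbr_union, Finset.filter_union, Finset.card_union_of_disjoint]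
  exact Finset.disjoint_filter_filter (nbr_disjoint h y)

theorem Join.symm {a b c : ℕ} (h : S.Join a b c) : S.Join a c b :=
  ⟨by rw [h.union, Finset.union_comm], h.disj.symm⟩

theorem Join.cnt {a b c : ℕ} (h : S.Join a b c) (X : ℕ → ℕ) (y i : ℕ) :
    S.cnt (S.side a) X y i = S.cnt (S.side b) X y i + S.cnt (S.side c) X y i := by
  rw [h.union, cnt_union h.disj]

/-- The complement of a part is the other part together with the complement of the whole. -/
theorem Join.rotate {a b c : ℕ} (h : S.Join a b c) (ha : a < S.M) (hb : b < S.M) :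
    S.Join (S.opp b) c (S.opp a) where
  union := by
    ext x
    by_cases hx : x < S.n
    · have hd : x ∈ S.side b → x ∉ S.side c := fun h1 => Finset.disjoint_left.1 h.disj h1
      rw [S.side_opp b hb x hx, Finset.mem_union, S.side_opp a ha x hx, h.union, Finset.mem_union]
      tauto
    · have := fun a => mt (S.side_lt a x) hx
      simp [this]
  disj := by
    rw [Finset.disjoint_left]
    intro x hx hx'
    rw [S.side_opp a ha x (S.side_lt _ _ hx), h.union] at hx'
    exact hx' (Finset.mem_union_right _ hx)

theorem cnt_range {a : ℕ} (ha : a < S.M) (X : ℕ → ℕ) (y i : ℕ) :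
    S.cnt (Finset.range S.n) X y i = S.cnt (S.side a) X y i + S.cnt (S.side (S.opp a)) X y i := by
  rw [← cnt_union]
  · congr 1
    ext x
    by_cases hx : x < S.n
    · have := S.side_opp a ha x hx
      simp [hx]; tauto
    · have := fun a => mt (S.side_lt a x) hx
      simp [hx, this]
  · rw [Finset.disjoint_left]
    intro x hx hx'
    rw [S.side_opp a ha x (S.side_lt _ _ hx)] at hx'
    exact hx' hx

theorem Same.symm {a : ℕ} {X Y : ℕ → ℕ} (h : S.Same a X Y) : S.Same a Y X :=
  fun y hy hya i hi => (h y hy hya i hi).symm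

theorem Same.trans {a : ℕ} {X Y Z : ℕ → ℕ} (h : S.Same a X Y) (h' : S.Same a Y Z) :
    S.Same a X Z :=
  fun y hy hya i hi => (h y hy hya i hi).trans (h' y hy hya i hi)

theorem same_of_eqOn {a : ℕ} {X Y : ℕ → ℕ} (h : ∀ x ∈ S.side a, X x = Y x) : S.Same a X Y :=
  fun y _ _ i _ => by rw [cnt_congr h]

/-- Truncation commutes with addition: min d (x + y) is determined by min d x and min d y. -/
theorem Join.same {a b c : ℕ} (h : S.Join a b c) {X Y : ℕ → ℕ} (hb : S.Same b X Y)
    (hc : S.Same c X Y) : S.Same a X Y := by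
  intro y hy hya i hi
  rw [h.union, Finset.mem_union] at hya
  push Not at hya
  have h1 := hb y hy hya.1 i hi
  have h2 := hc y hy hya.2 i hi
  rw [h.cnt, h.cnt]
  omega

/-- Whether side `a` is satisfied depends only on the labels inside and on the truncated profile of
the labels outside. -/
theorem Sat.of_same {a : ℕ} (ha : a < S.M) {X Y : ℕ → ℕ} (hX : S.IsLab X) (h : S.Sat a X)
    (heq : ∀ x ∈ S.side a, Y x = X x) (hs : S.Same (S.opp a) X Y) : S.Sat a Y := by
  intro v hv j hj
  have h1 := h v hv j hj
  rw [heq v hv, S.D_min _ (hX v) j hj]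
  rw [S.D_min _ (hX v) j hj] at h1
  have hv' : v ∉ S.side (S.opp a) := by
    rw [S.side_opp a ha v (S.side_lt a v hv)]; simpa using hv
  have h2 := hs v (S.side_lt a v hv) hv' j hj
  rw [cnt_range ha] at h1 ⊢
  rw [cnt_congr heq]
  have : min S.d (S.cnt (S.side a) X v j + S.cnt (S.side (S.opp a)) Y v j) =
      min S.d (S.cnt (S.side a) X v j + S.cnt (S.side (S.opp a)) X v j) := by omega
  rw [this]
  exact h1

/-- Partial solutions for the two parts of a side that fit to the same labelling can be combined. -/
theorem Join.glue {a b c : ℕ} (h : S.Join a b c) (ha : a < S.M) (hb : b < S.M) (hc : c < S.M)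
    {X₁ X₂ Z : ℕ → ℕ} (l₁ : S.IsLab X₁) (l₂ : S.IsLab X₂) (lZ : S.IsLab Z)
    (hb₁ : S.Same b X₁ Z) (hb₂ : S.Same (S.opp b) X₁ Z) (hbs : S.Sat b X₁)
    (hc₁ : S.Same c X₂ Z) (hc₂ : S.Same (S.opp c) X₂ Z) (hcs : S.Sat c X₂) :
    ∃ X, S.IsLab X ∧ S.Same a X Z ∧ S.Same (S.opp a) X Z ∧ S.Sat a X := by
  set X : ℕ → ℕ := fun x => if x ∈ S.side b then X₁ x else if x ∈ S.side c then X₂ x else Z x with hX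
  have eb : ∀ x ∈ S.side b, X x = X₁ x := fun x hx => by simp [hX, hx]
  have ec : ∀ x ∈ S.side c, X x = X₂ x := fun x hx => by
    simp [hX, hx, Finset.disjoint_right.1 h.disj hx]
  have ea : ∀ x ∈ S.side (S.opp a), X x = Z x := fun x hx => by
    have := (S.side_opp a ha x (S.side_lt _ _ hx)).1 hx
    rw [h.union, Finset.mem_union] at this
    push Not at this
    simp [hX, this]
  have sb : S.Same b X Z := (same_of_eqOn eb).trans hb₁
  have sc : S.Same c X Z := (same_of_eqOn ec).trans hc₁
  have sa : S.Same (S.opp a) X Z := same_of_eqOn ea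
  refine ⟨X, fun x => ?_, h.same sb sc, sa, ?_⟩
  · simp only [hX]; split_ifs
    exacts [l₁ x, l₂ x, lZ x]
  -- The complement of `b` is `c` together with the complement of `a`. On both parts the pasted
  -- labelling has the profile of `Z`, hence also on their union, where `X₁` has that profile too;
  -- symmetrically for `c`.
  · have s1 : S.Sat b X := hbs.of_same hb l₁ eb
      (hb₂.trans ((h.rotate ha hb).same sc sa).symm)
    have s2 : S.Sat c X := hcs.of_same hc l₂ ec
      (hc₂.trans ((h.symm.rotate ha hc).same sb sa).symm)
    intro v hv
    rw [h.union, Finset.mem_union] at hv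
    exact hv.elim (s1 v) (s2 v)

/-- Partial solutions for two complementary sides that fit to the same labelling give a solution. -/
theorem glue_opp {a : ℕ} (ha : a < S.M) {X₁ X₂ Z : ℕ → ℕ} (l₁ : S.IsLab X₁) (l₂ : S.IsLab X₂)
    (h₁ : S.Same a X₁ Z) (h₁' : S.Same (S.opp a) X₁ Z) (s₁ : S.Sat a X₁)
    (h₂ : S.Same a X₂ Z) (h₂' : S.Same (S.opp a) X₂ Z) (s₂ : S.Sat (S.opp a) X₂) :
    ∃ X, S.IsLab X ∧ ∀ v < S.n, ∀ j < S.q, S.D (X v) j (S.cnt (Finset.range S.n) X v j) := by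
  set X : ℕ → ℕ := fun x => if x ∈ S.side a then X₁ x else X₂ x with hX
  have e1 : ∀ x ∈ S.side a, X x = X₁ x := fun x hx => by simp [hX, hx]
  have e2 : ∀ x ∈ S.side (S.opp a), X x = X₂ x := fun x hx => by
    simp [hX, (S.side_opp a ha x (S.side_lt _ _ hx)).1 hx]
  refine ⟨X, fun x => ?_, fun v hv => ?_⟩
  · simp only [hX]; split_ifs
    exacts [l₁ x, l₂ x]
  · by_cases hva : v ∈ S.side a
    · exact s₁.of_same ha l₁ e1 (h₁'.trans (h₂'.symm.trans (same_of_eqOn e2).symm)) v hva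
    · have ho := S.opp_lt a ha
      refine s₂.of_same ho l₂ e2 ?_ v ((S.side_opp a ha v hv).2 hva)
      rw [S.opp_opp a ha]
      exact h₂.trans (h₁.symm.trans (same_of_eqOn e1).symm)

/-! ### Representatives and handles -/

variable (S)

/-- `rep a t`, for `t < rc a`, are representatives of the different nonempty neighbourhoods in side
`a` of vertices outside. -/
structure Reps (rep : ℕ → ℕ → ℕ) (rc : ℕ → ℕ) : Prop where
  lt : ∀ a < S.M, ∀ t < rc a, rep a t < S.n
  notMem : ∀ a < S.M, ∀ t < rc a, rep a t ∉ S.side a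
  nonempty : ∀ a < S.M, ∀ t < rc a, S.nbr (S.side a) (rep a t) ≠ ∅
  inj : ∀ a < S.M, ∀ t < rc a, ∀ t' < rc a,
    S.nbr (S.side a) (rep a t) = S.nbr (S.side a) (rep a t') → t = t'
  cover : ∀ a < S.M, ∀ y < S.n, y ∉ S.side a → S.nbr (S.side a) y ≠ ∅ →
    ∃ t < rc a, S.nbr (S.side a) (rep a t) = S.nbr (S.side a) y

/-- The handle of the profile of a labelling across a cut. For the appended sides, it is given by the
label of the vertex. -/
noncomputable def handle (rep : ℕ → ℕ → ℕ) (rc : ℕ → ℕ) (a : ℕ) (Z : ℕ → ℕ) : ℕ :=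
  if a < S.M then
    vecCode (rc a) S.q S.d fun t i => min S.d (S.cnt (S.side a) Z (rep a t) i)
  else if a < S.M + S.n then 16 ^ Z (a - S.M) else 0

variable {S} {rep : ℕ → ℕ → ℕ} {rc : ℕ → ℕ}

theorem isCode_handle (a : ℕ) (Z : ℕ → ℕ) : IsCode (S.handle rep rc a Z) := by
  unfold handle
  split_ifs
  · exact isCode_vecCode _ _ _ _ fun _ _ => min_le_left _ _
  · exact isCode_pow _
  · exact isCode_zero

theorem handle_congr {a : ℕ} {X Y : ℕ → ℕ} (h : ∀ x ∈ S.side a, X x = Y x) :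
    S.handle rep rc a X = S.handle rep rc a Y := by
  unfold handle
  split_ifs with h1 h2
  · congr 1
    funext t i
    rw [cnt_congr h]
  · rw [h]
    have := S.side_single (a - S.M) (by omega)
    rw [show S.M + (a - S.M) = a by omega] at this
    simp [this]
  · rfl

theorem cnt_eq_of_nbr {A : Finset ℕ} {y y' : ℕ} (h : S.nbr A y = S.nbr A y') (Z : ℕ → ℕ) (i : ℕ) :
    S.cnt A Z y i = S.cnt A Z y' i := by unfold cnt; rw [h]

/-- A count across the cut depends on the outer vertex only through its neighbourhood in the side.
An empty neighbourhood gives 0, and every other one is shared with a representative. -/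
theorem Reps.handle_eq_iff (R : S.Reps rep rc) {a : ℕ} (ha : a < S.M) {X Y : ℕ → ℕ} :
    S.handle rep rc a X = S.handle rep rc a Y ↔ S.Same a X Y := by
  unfold handle
  rw [if_pos ha, if_pos ha, vecCode_inj (fun _ _ => min_le_left _ _) (fun _ _ => min_le_left _ _)]
  constructor
  · intro h y hy hya i hi
    by_cases he : S.nbr (S.side a) y = ∅
    · simp [cnt, he]
    · obtain ⟨t, ht, e⟩ := R.cover a ha y hy hya he
      rw [← cnt_eq_of_nbr e, ← cnt_eq_of_nbr e]
      exact h t ht i hi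
  · intro h t ht i hi
    exact h _ (R.lt a ha t ht) (R.notMem a ha t ht) i hi

end CutSystem

namespace Imp

namespace Expr
/-- Indices with several components. -/
def ix2 (a b : Expr) : Expr := a + b + b
/-- Indices with several components. -/
def ix3 (a b c : Expr) : Expr := a + b + b + c + c + c + c
/-- Indices with several components. -/
def ix4 (a b c e : Expr) : Expr :=
  a + b + b + c + c + c + c + e + e + e + e + e + e + e + e

variable (I : ℕ → ℕ) (σ : Store) (a b c e : Expr)
@[simp] theorem eval_ix2 : (ix2 a b).eval I σ = _root_.ix2 (a.eval I σ) (b.eval I σ) := by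
  simp [ix2, _root_.ix2]; ring
@[simp] theorem eval_ix3 :
    (ix3 a b c).eval I σ = _root_.ix3 (a.eval I σ) (b.eval I σ) (c.eval I σ) := by
  simp [ix3, _root_.ix3]; ring
@[simp] theorem eval_ix4 : (ix4 a b c e).eval I σ =
    _root_.ix4 (a.eval I σ) (b.eval I σ) (c.eval I σ) (e.eval I σ) := by
  simp [ix4, _root_.ix4]; ring
@[simp] theorem cost_ix2 : (ix2 a b).cost = a.cost + 2 * b.cost + 2 := by
  simp [ix2]; ring
@[simp] theorem cost_ix3 : (ix3 a b c).cost = a.cost + 2 * b.cost + 4 * c.cost + 6 := by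
  simp [ix3]; ring
@[simp] theorem cost_ix4 :
    (ix4 a b c e).cost = a.cost + 2 * b.cost + 4 * c.cost + 8 * e.cost + 14 := by
  simp [ix4]; ring
end Expr

open Cmd Expr

/-! ## Tables -/

variable (S : CutSystem)

/-- The array `PW` holds the powers of `16` below `J`. -/
def PowTable (J : ℕ) (σ : Store) : Prop := ∀ j < J, σ.arr .PW j = 16 ^ j

/-- The array `KEY` holds the codes of the neighbourhoods in the sides. -/
def KeyTable (σ : Store) : Prop := ∀ a ≤ S.M + S.n, ∀ y < S.n,
  σ.arr .KEY (ix2 (16 ^ a) (16 ^ y)) = code (S.nbr (S.side a) y)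

/-- The arrays `REP` and `RC` hold the representatives. -/
def RepTable (rep : ℕ → ℕ → ℕ) (rc : ℕ → ℕ) (σ : Store) : Prop := ∀ a < S.M,
  σ.arr .RC (16 ^ a) = rc a ∧ ∀ t < rc a, σ.arr .REP (ix2 (16 ^ a) (16 ^ t)) = rep a t

/-- The array `VAL` holds the profiles across the cut `a`. -/
def ValTable (rep : ℕ → ℕ → ℕ) (rc : ℕ → ℕ) (a : ℕ) (σ : Store) : Prop :=
  ∀ Z, S.IsLab Z → ∀ y < S.n, y ∉ S.side a → ∀ i < S.q,
    σ.arr .VAL (ix4 (16 ^ a) (S.handle rep rc a Z) (code (S.nbr (S.side a) y)) (16 ^ i)) =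
      min S.d (S.cnt (S.side a) Z y i)

/-- Computes into `h` the handle for the side with code `sa` from the handles `r1`, `r2` for the two
sides with codes `sb`, `sc` of which it is composed. -/
def sumCmd (q d : ℕ) : Cmd :=
  assign .h (lit 0) ;; assign .pos (lit 0) ;;
  loop .st .sw (arr .RC Var.sa)
    (assign .rep (arr .PW (arr .REP (ix2 Var.sa Var.sw))) ;;
     assign .g1 (arr .KEY (ix2 Var.sb Var.rep)) ;;
     assign .g2 (arr .KEY (ix2 Var.sc Var.rep)) ;;
     loop .si .swi (lit q)
       (assign .val (arr .VAL (ix4 Var.sb Var.r1 Var.g1 Var.swi) +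
          arr .VAL (ix4 Var.sc Var.r2 Var.g2 Var.swi)) ;;
        assign .val (Var.val - (Var.val - lit d)) ;;
        assign .h (Var.h + arr .PW (Var.pos + Var.val)) ;;
        assign .pos (Var.pos + lit (d + 1))))

variable {S}

/-- A representative of the union lies outside both parts, so its truncated count is the truncated
sum of two tabulated counts. It need not represent anything for the parts; therefore `VAL` is
addressed by the code of its neighbourhood there, found in `KEY`. -/
theorem sumCmd_spec (I : ℕ → ℕ) {rep : ℕ → ℕ → ℕ} {rc : ℕ → ℕ} (R : S.Reps rep rc) {J : ℕ}
    {σ : Store} (hPW : PowTable J σ) (hKEY : KeyTable S σ) (hREP : RepTable S rep rc σ)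
    {a b c : ℕ} (ha : a < S.M) (hb : b ≤ S.M + S.n) (hc : c ≤ S.M + S.n) (hj : S.Join a b c)
    (hvb : ValTable S rep rc b σ) (hvc : ValTable S rep rc c σ)
    (hn : S.n ≤ J) (hrc : rc a * S.q * (S.d + 1) ≤ J)
    {Z : ℕ → ℕ} (hZ : S.IsLab Z) (h1 : σ.var .sa = 16 ^ a) (h2 : σ.var .sb = 16 ^ b)
    (h3 : σ.var .sc = 16 ^ c) (h4 : σ.var .r1 = S.handle rep rc b Z)
    (h5 : σ.var .r2 = S.handle rep rc c Z) :
    ((sumCmd S.q S.d).run I σ).var .h = S.handle rep rc a Z ∧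
      (sumCmd S.q S.d).cost I σ ≤ 200 * (rc a * (S.q + 1) + 1) := by
  set f : ℕ → ℕ → ℕ := fun t i => min S.d (S.cnt (S.side a) Z (rep a t) i) with hf
  set g : ℕ → ℕ → ℕ := fun t i => 16 ^ ((t * S.q + i) * (S.d + 1) + f t i) with hg
  have hh : S.handle rep rc a Z = ∑ t ∈ Finset.range (rc a), ∑ i ∈ Finset.range S.q, g t i := by
    simp [CutSystem.handle, ha, vecCode, hf, hg]
  unfold sumCmd
  set inner := (assign .val (arr .VAL (Expr.ix4 Var.sb Var.r1 Var.g1 Var.swi) +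
          arr .VAL (Expr.ix4 Var.sc Var.r2 Var.g2 Var.swi)) ;;
        assign .val (Var.val - (Var.val - lit S.d)) ;;
        assign .h (Var.h + arr .PW (Var.pos + Var.val)) ;;
        assign .pos (Var.pos + lit (S.d + 1))) with hinner
  set body := (assign .rep (arr .PW (arr .REP (Expr.ix2 Var.sa Var.sw))) ;;
     assign .g1 (arr .KEY (Expr.ix2 Var.sb Var.rep)) ;;
     assign .g2 (arr .KEY (Expr.ix2 Var.sc Var.rep)) ;;
     loop .si .swi (lit S.q) inner) with hbody
  -- The variable `pos` accumulates the beginning of the current block, (t q + i)(d + 1), since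
  -- products cannot be computed directly.
  have outer := loop_rule I .st .sw (arr .RC Var.sa) body
    ((assign .h (lit 0) ;; assign .pos (lit 0)).run I σ) (rc a) (180 + 180 * S.q)
    (by simp [h1, (hREP a ha).1])
    (fun t τ => τ.var .h = ∑ t' ∈ Finset.range t, ∑ i ∈ Finset.range S.q, g t' i ∧
      τ.var .pos = t * S.q * (S.d + 1)) (by simp) ?_
  · refine ⟨?_, ?_⟩
    · rw [hh]
      exact outer.1.1
    · have := outer.2
      simp only [run_seq, cost_seq, cost_assign, cost_lit, cost_arr, cost_var] at this ⊢
      nlinarith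
  · rintro t ht τ ⟨i1, i2⟩ fv fa
    have fa' : ∀ k, τ.arr k = σ.arr k := fun k => by
      rw [fa k (by simp [hbody, hinner, arrs])]; simp
    have fsa : τ.var .sa = 16 ^ a := by
      rw [fv _ (by simp [hbody, hinner, vars])]; simpa using h1
    have fsb : τ.var .sb = 16 ^ b := by
      rw [fv _ (by simp [hbody, hinner, vars])]; simpa using h2
    have fsc : τ.var .sc = 16 ^ c := by
      rw [fv _ (by simp [hbody, hinner, vars])]; simpa using h3
    have fr1 : τ.var .r1 = S.handle rep rc b Z := by
      rw [fv _ (by simp [hbody, hinner, vars])]; simpa using h4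
    have fr2 : τ.var .r2 = S.handle rep rc c Z := by
      rw [fv _ (by simp [hbody, hinner, vars])]; simpa using h5
    set y := rep a t with hy
    have hyn : y < S.n := R.lt a ha t ht
    have hya : y ∉ S.side a := R.notMem a ha t ht
    have hyb : y ∉ S.side b := fun h => hya (by rw [hj.union]; exact Finset.mem_union_left _ h)
    have hyc : y ∉ S.side c := fun h => hya (by rw [hj.union]; exact Finset.mem_union_right _ h)
    set τ' := (assign .rep (arr .PW (arr .REP (Expr.ix2 Var.sa Var.sw))) ;;
     assign .g1 (arr .KEY (Expr.ix2 Var.sb Var.rep)) ;;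
     assign .g2 (arr .KEY (Expr.ix2 Var.sc Var.rep))).run I (enter .st .sw t τ) with hτ'
    have e1 : τ'.var .rep = 16 ^ y := by
      simp [hτ', enter, fa', fsa, (hREP a ha).2 t ht, ← hy, hPW y (by omega)]
    have e2 : τ'.var .g1 = code (S.nbr (S.side b) y) := by
      simp [hτ', enter, fa', fsa, fsb, (hREP a ha).2 t ht, ← hy, hPW y (by omega), hKEY b hb y hyn]
    have e3 : τ'.var .g2 = code (S.nbr (S.side c) y) := by
      simp [hτ', enter, fa', fsa, fsc, (hREP a ha).2 t ht, ← hy, hPW y (by omega), hKEY c hc y hyn]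
    have inn := loop_rule I .si .swi (lit S.q) inner τ' S.q 160 (by simp)
      (fun i ρ => ρ.var .h = ∑ t' ∈ Finset.range t, ∑ i ∈ Finset.range S.q, g t' i +
        ∑ i' ∈ Finset.range i, g t i' ∧ ρ.var .pos = (t * S.q + i) * (S.d + 1))
      (by simp [hτ', enter, i1, i2]) ?_
    · have er : body.run I (enter .st .sw t τ) = (loop .si .swi (lit S.q) inner).run I τ' := rfl
      refine ⟨?_, ?_⟩
      · rw [er, Finset.sum_range_succ]
        refine ⟨inn.1.1, inn.1.2.trans ?_⟩
        ring
      · have ec : body.cost I (enter .st .sw t τ) =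
          (loop .si .swi (lit S.q) inner).cost I τ' + 66 := by
          simp only [hbody, cost_seq, cost_assign, cost_arr, cost_ix2, cost_var]
          simp only [hτ', run_seq]
          ring
        rw [ec]
        have := inn.2
        simp only [cost_lit] at this
        omega
    · rintro i hi ρ ⟨j1, j2⟩ gv ga
      have ga' : ∀ k, ρ.arr k = σ.arr k := fun k => by
        rw [ga k (by simp [hinner, arrs])]; simp [hτ', enter, fa']
      have gsb : ρ.var .sb = 16 ^ b := by
        rw [gv _ (by simp [hinner, vars])]; simpa [hτ', enter] using fsb
      have gsc : ρ.var .sc = 16 ^ c := by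
        rw [gv _ (by simp [hinner, vars])]; simpa [hτ', enter] using fsc
      have gr1 : ρ.var .r1 = S.handle rep rc b Z := by
        rw [gv _ (by simp [hinner, vars])]; simpa [hτ', enter] using fr1
      have gr2 : ρ.var .r2 = S.handle rep rc c Z := by
        rw [gv _ (by simp [hinner, vars])]; simpa [hτ', enter] using fr2
      have gg1 : ρ.var .g1 = code (S.nbr (S.side b) y) := by
        rw [gv _ (by simp [hinner, vars])]; exact e2
      have gg2 : ρ.var .g2 = code (S.nbr (S.side c) y) := by
        rw [gv _ (by simp [hinner, vars])]; exact e3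
      -- v - (v - d) is min v d when subtraction is truncated.
      have hv : min S.d (S.cnt (S.side b) Z y i) + min S.d (S.cnt (S.side c) Z y i) -
          (min S.d (S.cnt (S.side b) Z y i) + min S.d (S.cnt (S.side c) Z y i) - S.d) = f t i := by
        simp only [hf, ← hy, hj.cnt]
        omega
      have hp : (t * S.q + i) * (S.d + 1) + f t i < J := by
        have h6 : f t i ≤ S.d := min_le_left _ _
        exact place_lt ht hi h6 hrc
      have vb := hvb Z hZ y hyn hyb i hi
      have vc := hvc Z hZ y hyn hyc i hi
      refine ⟨?_, ?_⟩
      · simp only [hinner, run_seq, run_assign, enter, Store.var_setVar, Store.arr_setVar,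
          eval_add, eval_sub, eval_var, eval_arr, eval_ix4, eval_lit, reduceCtorEq, if_true, if_false,
          ga', gsb, gsc, gr1, gr2, gg1, gg2, vb, vc, hv, j1, j2, hPW _ hp]
        refine ⟨?_, by ring⟩
        rw [Finset.sum_range_succ, ← add_assoc]
      · simp [hinner]

end Imp

namespace Imp

open Imp.Cmd Imp.Expr

/-! ## Input, schedule, and the tables of neighbourhoods -/

theorem update_ix2 {a b a' b' : ℕ} (ha : IsCode a) (hb : IsCode b) (ha' : IsCode a')
    (hb' : IsCode b') (f : ℕ → ℕ) (v : ℕ) :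
    Function.update f (ix2 a b) v (ix2 a' b') = if a' = a ∧ b' = b then v else f (ix2 a' b') := by
  rw [Function.update_apply]
  simp only [ix2_inj ha' hb' ha hb]

theorem update_ix2_pow (a b a' b' : ℕ) (f : ℕ → ℕ) (v : ℕ) :
    Function.update f (ix2 (16 ^ a) (16 ^ b)) v (ix2 (16 ^ a') (16 ^ b')) =
      if a' = a ∧ b' = b then v else f (ix2 (16 ^ a') (16 ^ b')) := by
  rw [update_ix2 (isCode_pow _) (isCode_pow _) (isCode_pow _) (isCode_pow _)]
  simp only [pow_inj16]

/-- The input lists the `m` edges of the graph from cell `3` on. -/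
structure InputGraph (S : CutSystem) (m : ℕ) (I : ℕ → ℕ) : Prop where
  lt : ∀ p < m + m, I (3 + p) < S.n
  adj : ∀ x y, S.adj x y ↔ ∃ e < m, (I (3 + (e + e)) = x ∧ I (4 + (e + e)) = y) ∨
    (I (3 + (e + e)) = y ∧ I (4 + (e + e)) = x)

/-- `y` occurs among the ends of edges listed in the first `p` cells. -/
def Occurs (I : ℕ → ℕ) (p y : ℕ) : Prop := ∃ p' < p, I (3 + p') = y

theorem occurs_succ (I : ℕ → ℕ) (p y : ℕ) : Occurs I (p + 1) y ↔ Occurs I p y ∨ I (3 + p) = y := by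
  constructor
  · rintro ⟨p', h, e⟩
    rcases Nat.lt_succ_iff_lt_or_eq.1 h with h | rfl
    exacts [.inl ⟨p', h, e⟩, .inr e]
  · rintro (⟨p', h, e⟩ | e)
    exacts [⟨p', by omega, e⟩, ⟨p, by omega, e⟩]

theorem InputGraph.occurs {S : CutSystem} {m : ℕ} {I : ℕ → ℕ} (h : InputGraph S m I) {x y : ℕ}
    (hxy : S.adj x y) : Occurs I (m + m) x := by
  obtain ⟨e, he, (⟨h1, -⟩ | ⟨-, h1⟩)⟩ := (h.adj x y).1 hxy
  · exact ⟨e + e, by omega, h1⟩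
  · exact ⟨e + e + 1, by omega, by rw [← h1]; congr 1; omega⟩

/-- The side `b` is an appended one, or one of the first `i` in the order `Q`. -/
def Ready (S : CutSystem) (Q : ℕ → ℕ) (i b : ℕ) : Prop :=
  (S.M ≤ b ∧ b ≤ S.M + S.n) ∨ ∃ j < i, b = Q j

/-- `Q` is an ordering of the sides in which every side is composed of two earlier ones. -/
structure Schedule (S : CutSystem) (Q d₁ d₂ : ℕ → ℕ) : Prop where
  lt : ∀ i < S.M, Q i < S.M
  inj : ∀ i < S.M, ∀ j < S.M, Q i = Q j → i = j
  surj : ∀ a < S.M, ∃ i < S.M, Q i = a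
  join : ∀ a < S.M, S.Join a (d₁ a) (d₂ a)
  ready₁ : ∀ i < S.M, Ready S Q i (d₁ (Q i))
  ready₂ : ∀ i < S.M, Ready S Q i (d₂ (Q i))

/-- The schedule is stored in memory. -/
def SchedTable (S : CutSystem) (Q d₁ d₂ : ℕ → ℕ) (σ : Store) : Prop :=
  (∀ i < S.M, σ.arr .QUE i = Q i) ∧ ∀ a < S.M, σ.arr .D1 a = d₁ a ∧ σ.arr .D2 a = d₂ a

namespace Schedule

variable {S : CutSystem} {Q d₁ d₂ : ℕ → ℕ}

theorem ready_le (h : Schedule S Q d₁ d₂) {i b : ℕ} (hi : i ≤ S.M) (hb : Ready S Q i b) :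
    b ≤ S.M + S.n := by
  rcases hb with hb | ⟨j, hj, rfl⟩
  · exact hb.2
  · have := h.lt j (by omega); omega

/-- A side differs from its parts, so filling its row of a table leaves the rows being read
unchanged. -/
theorem ready_ne (h : Schedule S Q d₁ d₂) {i b : ℕ} (hi : i < S.M) (hb : Ready S Q i b) :
    b ≠ Q i := by
  have hQ := h.lt i hi
  rcases hb with hb | ⟨j, hj, rfl⟩
  · omega
  · intro he
    have := h.inj j (by omega) i hi he
    omega

theorem ready_succ {i b : ℕ} (hb : Ready S Q (i + 1) b) : Ready S Q i b ∨ b = Q i := by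
  rcases hb with hb | ⟨j, hj, rfl⟩
  · exact .inl (.inl hb)
  · rcases Nat.lt_succ_iff_lt_or_eq.1 hj with hj | rfl
    exacts [.inl (.inr ⟨j, hj, rfl⟩), .inr rfl]

theorem ready_all (h : Schedule S Q d₁ d₂) {b : ℕ} (hb : b ≤ S.M + S.n) : Ready S Q S.M b := by
  by_cases hM : b < S.M
  · obtain ⟨i, hi, rfl⟩ := h.surj b hM
    exact .inr ⟨i, hi, rfl⟩
  · exact .inl ⟨by omega, hb⟩

end Schedule

/-! ### Neighbourhoods in singletons -/

/-- Initializes `KEY` and `INS` for the appended sides. -/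
def atomCmd : Cmd :=
  loop .e .we Var.m
    (assign .x (inp (lit 3 + (Var.e + Var.e))) ;;
     assign .y (inp (lit 4 + (Var.e + Var.e))) ;;
     assign .px (arr .PW Var.x) ;; assign .py (arr .PW Var.y) ;;
     write .KEY (Expr.ix2 (arr .PW (Var.M + Var.x)) Var.py) Var.px ;;
     write .KEY (Expr.ix2 (arr .PW (Var.M + Var.y)) Var.px) Var.py) ;;
  loop .x .px Var.n (write .INS (Expr.ix2 (arr .PW (Var.M + Var.x)) Var.px) (lit 1))

variable {S : CutSystem}

-- The side M + x is {x}, so the code of the neighbourhood of y in it is 16^x or 0. One pass over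
-- the edge list writes the nonzero entries in both directions.
open Classical in
theorem atomCmd_spec (I : ℕ → ℕ) {m J : ℕ} (G : InputGraph S m I) {σ : Store}
    (hPW : PowTable J σ) (hJ : S.M + S.n < J) (hm : σ.var .m = m) (hn : σ.var .n = S.n)
    (hM : σ.var .M = S.M) (hK : ∀ i, σ.arr .KEY i = 0) (hI : ∀ i, σ.arr .INS i = 0) :
    (∀ a y, (atomCmd.run I σ).arr .KEY (ix2 (16 ^ a) (16 ^ y)) =
      if ∃ x, a = S.M + x ∧ S.adj x y then 16 ^ (a - S.M) else 0) ∧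
    (∀ a y, (atomCmd.run I σ).arr .INS (ix2 (16 ^ a) (16 ^ y)) =
      if a = S.M + y ∧ y < S.n then 1 else 0) ∧
    atomCmd.cost I σ ≤ 200 * (m + S.n + 1) := by
  set B1 := (assign .x (inp (lit 3 + (Var.e + Var.e))) ;;
     assign .y (inp (lit 4 + (Var.e + Var.e))) ;;
     assign .px (arr .PW Var.x) ;; assign .py (arr .PW Var.y) ;;
     write .KEY (Expr.ix2 (arr .PW (Var.M + Var.x)) Var.py) Var.px ;;
     write .KEY (Expr.ix2 (arr .PW (Var.M + Var.y)) Var.px) Var.py) with hB1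
  set B2 := write .INS (Expr.ix2 (arr .PW (Var.M + Var.x)) Var.px) (lit 1) with hB2
  have L1 := loop_rule I .e .we Var.m B1 σ m 150 (by simp [hm])
    (fun k τ => ∀ a y, τ.arr .KEY (ix2 (16 ^ a) (16 ^ y)) =
      if ∃ x, a = S.M + x ∧ ∃ e < k, (I (3 + (e + e)) = x ∧ I (4 + (e + e)) = y) ∨
        (I (3 + (e + e)) = y ∧ I (4 + (e + e)) = x) then 16 ^ (a - S.M) else 0)
    (by intro a y; simp [hK]) ?_
  · have L2 := loop_rule I .x .px Var.n B2 ((loop .e .we Var.m B1).run I σ) S.n 100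
      (by rw [eval_var, var_run _ _ _ _ (by simp [hB1, vars]), hn])
      (fun k τ => ∀ a y, τ.arr .INS (ix2 (16 ^ a) (16 ^ y)) =
        if a = S.M + y ∧ y < k then 1 else 0)
      (by intro a y; rw [arr_run _ _ _ _ (by simp [hB1, arrs]), hI]; simp) ?_
    · refine ⟨?_, ?_, ?_⟩
      · intro a y
        have := L1.1 a y
        simp only [atomCmd, run_seq]
        rw [arr_run _ _ _ _ (by simp [arrs])]
        refine this.trans ?_
        congr 1
        simp only [G.adj]
      · exact L2.1
      · have h1 := L1.2
        have h2 := L2.2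
        simp only [cost_var] at h1 h2
        simp only [atomCmd, cost_seq]
        rw [← hB1, ← hB2]
        omega
    · intro x hx τ i1 fv fa
      have hP : τ.arr .PW = σ.arr .PW := by
        rw [fa _ (by simp [hB2, arrs]), arr_run _ _ _ _ (by simp [hB1, arrs])]
      have hMt : τ.var .M = S.M := by
        rw [fv _ (by simp [hB2, vars]), var_run _ _ _ _ (by simp [hB1, vars]), hM]
      refine ⟨?_, by simp [hB2]⟩
      intro a y
      simp only [hB2, run_write, enter, eval_ix2, eval_arr, eval_add, eval_var, eval_lit,
        Store.arr_setArr, Store.var_setVar, Store.arr_setVar, if_true, reduceCtorEq, if_false, hP, hMt]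
      rw [hPW _ (by omega), update_ix2_pow, i1]
      by_cases h : a = S.M + x ∧ y = x
      · rw [if_pos h, if_pos (by omega)]
      · rw [if_neg h]
        congr 1
        apply propext
        constructor <;> intro h' <;> omega
  · intro k hk τ i1 fv fa
    have hP : τ.arr .PW = σ.arr .PW := fa _ (by simp [hB1, arrs])
    have hMt : τ.var .M = S.M := by rw [fv _ (by simp [hB1, vars]), hM]
    set x := I (3 + (k + k)) with hx
    set y := I (4 + (k + k)) with hy
    have hxn : x < S.n := G.lt (k + k) (by omega)
    have hyn : y < S.n := by
      have := G.lt (k + k + 1) (by omega)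
      rwa [show 3 + (k + k + 1) = 4 + (k + k) by omega] at this
    refine ⟨?_, by simp [hB1]⟩
    intro a z
    simp only [hB1, run_seq, run_assign, run_write, enter, eval_ix2, eval_arr, eval_add, eval_var,
      eval_lit, eval_inp, Store.arr_setArr, Store.var_setVar, Store.var_setArr, Store.arr_setVar,
      if_true, reduceCtorEq, if_false, hP, hMt, ← hx, ← hy]
    rw [hPW _ (by omega), hPW _ (by omega), hPW _ (by omega), hPW _ (by omega), update_ix2_pow,
      update_ix2_pow, i1]
    by_cases h1 : a = S.M + y ∧ z = x
    · rw [if_pos h1, if_pos ⟨y, h1.1, k, by omega, .inr ⟨by rw [h1.2], rfl⟩⟩, h1.1,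
        Nat.add_sub_cancel_left]
    · rw [if_neg h1]
      by_cases h2 : a = S.M + x ∧ z = y
      · rw [if_pos h2, if_pos ⟨x, h2.1, k, by omega, .inl ⟨rfl, by rw [h2.2]⟩⟩, h2.1,
          Nat.add_sub_cancel_left]
      · rw [if_neg h2]
        congr 1
        apply propext
        constructor
        · rintro ⟨w, rfl, e, he, h⟩
          exact ⟨w, rfl, e, by omega, h⟩
        · rintro ⟨w, rfl, e, he, h⟩
          refine ⟨w, rfl, e, ?_, h⟩
          by_contra hc
          obtain rfl : e = k := by omega
          rcases h with ⟨h3, h4⟩ | ⟨h3, h4⟩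
          · exact h2 ⟨by rw [hx, h3], by rw [hy, h4]⟩
          · exact h1 ⟨by rw [hy, h4], by rw [hx, h3]⟩

/-! ### Neighbourhoods in composed sides -/

/-- Computes `KEY` and `INS` for the side with code `pa` from the sides with codes `pb`, `pc`. -/
def joinCmd : Cmd :=
  loop .p .wp (Var.m + Var.m)
    (assign .py (arr .PW (inp (lit 3 + Var.p))) ;;
     write .KEY (Expr.ix2 Var.pa Var.py)
       (arr .KEY (Expr.ix2 Var.pb Var.py) + arr .KEY (Expr.ix2 Var.pc Var.py)) ;;
     write .INS (Expr.ix2 Var.pa Var.py)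
       (arr .INS (Expr.ix2 Var.pb Var.py) + arr .INS (Expr.ix2 Var.pc Var.py)))

-- The loop visits ends of edges rather than vertices, to keep the cost per side linear in m.
-- Vertices on no edge have empty neighbourhoods, for which the initial 0 is already right; repeated
-- visits write the same value, because the rows of `b` and `c` do not change.
open Classical in
theorem joinCmd_spec (I : ℕ → ℕ) {m J : ℕ} (G : InputGraph S m I) {σ : Store}
    (hPW : PowTable J σ) (hJ : S.n ≤ J) (hm : σ.var .m = m) {a b c : ℕ} (hab : b ≠ a) (hac : c ≠ a)
    (ha : σ.var .pa = 16 ^ a) (hb : σ.var .pb = 16 ^ b) (hc : σ.var .pc = 16 ^ c) :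
    (∀ a' y, (joinCmd.run I σ).arr .KEY (ix2 (16 ^ a') (16 ^ y)) =
      if a' = a ∧ Occurs I (m + m) y then
        σ.arr .KEY (ix2 (16 ^ b) (16 ^ y)) + σ.arr .KEY (ix2 (16 ^ c) (16 ^ y))
      else σ.arr .KEY (ix2 (16 ^ a') (16 ^ y))) ∧
    (∀ a' y, (joinCmd.run I σ).arr .INS (ix2 (16 ^ a') (16 ^ y)) =
      if a' = a ∧ Occurs I (m + m) y then
        σ.arr .INS (ix2 (16 ^ b) (16 ^ y)) + σ.arr .INS (ix2 (16 ^ c) (16 ^ y))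
      else σ.arr .INS (ix2 (16 ^ a') (16 ^ y))) ∧
    joinCmd.cost I σ ≤ 200 * (m + m + 1) := by
  unfold joinCmd
  set B := (assign .py (arr .PW (inp (lit 3 + Var.p))) ;;
     write .KEY (Expr.ix2 Var.pa Var.py)
       (arr .KEY (Expr.ix2 Var.pb Var.py) + arr .KEY (Expr.ix2 Var.pc Var.py)) ;;
     write .INS (Expr.ix2 Var.pa Var.py)
       (arr .INS (Expr.ix2 Var.pb Var.py) + arr .INS (Expr.ix2 Var.pc Var.py))) with hB
  have L := loop_rule I .p .wp (Var.m + Var.m) B σ (m + m) 150 (by simp [hm])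
    (fun k τ => ∀ a' y, (τ.arr .KEY (ix2 (16 ^ a') (16 ^ y)) =
      if a' = a ∧ Occurs I k y then
        σ.arr .KEY (ix2 (16 ^ b) (16 ^ y)) + σ.arr .KEY (ix2 (16 ^ c) (16 ^ y))
      else σ.arr .KEY (ix2 (16 ^ a') (16 ^ y))) ∧
      (τ.arr .INS (ix2 (16 ^ a') (16 ^ y)) =
      if a' = a ∧ Occurs I k y then
        σ.arr .INS (ix2 (16 ^ b) (16 ^ y)) + σ.arr .INS (ix2 (16 ^ c) (16 ^ y))
      else σ.arr .INS (ix2 (16 ^ a') (16 ^ y))))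
    (by intro a' y; simp [Occurs]) ?_
  · refine ⟨fun a' y => (L.1 a' y).1, fun a' y => (L.1 a' y).2, ?_⟩
    have := L.2
    simp only [cost_add, cost_var] at this
    omega
  · intro k hk τ i1 fv fa
    have hP : τ.arr .PW = σ.arr .PW := fa _ (by simp [hB, arrs])
    have ha' : τ.var .pa = 16 ^ a := by rw [fv _ (by simp [hB, vars]), ha]
    have hb' : τ.var .pb = 16 ^ b := by rw [fv _ (by simp [hB, vars]), hb]
    have hc' : τ.var .pc = 16 ^ c := by rw [fv _ (by simp [hB, vars]), hc]
    refine ⟨?_, by simp [hB]⟩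
    intro a' z
    set y := I (3 + k) with hy
    have hyn : y < S.n := G.lt k hk
    simp only [hB, run_seq, run_assign, run_write, enter, eval_ix2, eval_arr, eval_add, eval_var,
      eval_lit, eval_inp, Store.arr_setArr, Store.var_setVar, Store.var_setArr, Store.arr_setVar,
      if_true, reduceCtorEq, if_false, hP, ha', hb', hc', ← hy, hPW y (by omega)]
    rw [update_ix2_pow, update_ix2_pow, (i1 b y).1, (i1 c y).1, (i1 b y).2, (i1 c y).2,
      (i1 a' z).1, (i1 a' z).2, occurs_succ]
    simp only [hab, hac, false_and, if_false, ← hy]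
    by_cases h1 : a' = a
    · subst h1
      by_cases h2 : z = y
      · subst h2; simp
      · have h3 : ¬ y = z := fun h => h2 h.symm
        simp [h2, h3]
    · simp [h1]

/-! ### Representatives -/

/-- Collects in `REP` representatives of the neighbourhoods in the side with code `pa`. -/
def repCmd : Cmd :=
  assign .len (lit 0) ;;
  loop .p .wp (Var.m + Var.m)
    (assign .y (inp (lit 3 + Var.p)) ;; assign .py (arr .PW Var.y) ;;
     assign .k (arr .KEY (Expr.ix2 Var.pa Var.py)) ;;
     ite (arr .INS (Expr.ix2 Var.pa Var.py)) skip
      (ite Var.k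
        (ite (arr .SEEN (Expr.ix2 Var.pa Var.k)) skip
          (write .SEEN (Expr.ix2 Var.pa Var.k) (lit 1) ;;
           write .REP (Expr.ix2 Var.pa (arr .PW Var.len)) Var.y ;;
           assign .len (Var.len + lit 1)))
        skip)) ;;
  write .RC Var.pa Var.len

/-- `r t`, for `t < l`, are representatives of the different nonempty neighbourhoods in side `a`
of those vertices outside that satisfy `P`. -/
structure RepsFor (S : CutSystem) (a : ℕ) (P : ℕ → Prop) (r : ℕ → ℕ) (l : ℕ) : Prop where
  lt : ∀ t < l, r t < S.n
  notMem : ∀ t < l, r t ∉ S.side a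
  nonempty : ∀ t < l, S.nbr (S.side a) (r t) ≠ ∅
  inj : ∀ t < l, ∀ t' < l, S.nbr (S.side a) (r t) = S.nbr (S.side a) (r t') → t = t'
  cover : ∀ y < S.n, P y → y ∉ S.side a → S.nbr (S.side a) y ≠ ∅ →
    ∃ t < l, S.nbr (S.side a) (r t) = S.nbr (S.side a) y

/-- Representatives of different neighbourhoods are different vertices. The bound keeps the list
position inside the table of powers. -/
theorem RepsFor.le {a : ℕ} {P : ℕ → Prop} {r : ℕ → ℕ} {l : ℕ} (h : RepsFor S a P r l) :
    l ≤ S.n := by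
  have := Finset.card_le_card_of_injOn (s := Finset.range l) (t := Finset.range S.n) r
    (fun t ht => by simpa using h.lt t (by simpa using ht))
    (fun t ht t' ht' he => h.inj t (by simpa using ht) t' (by simpa using ht')
      (by simp only [he]))
  simpa using this

theorem RepsFor.congr {a : ℕ} {P : ℕ → Prop} {r r' : ℕ → ℕ} {l : ℕ} (h : RepsFor S a P r l)
    (hr : ∀ t < l, r' t = r t) : RepsFor S a P r' l where
  lt t ht := by rw [hr t ht]; exact h.lt t ht
  notMem t ht := by rw [hr t ht]; exact h.notMem t ht
  nonempty t ht := by rw [hr t ht]; exact h.nonempty t ht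
  inj t ht t' ht' := by rw [hr t ht, hr t' ht']; exact h.inj t ht t' ht'
  cover y hy hP hya hne := by
    obtain ⟨t, ht, e⟩ := h.cover y hy hP hya hne
    exact ⟨t, ht, by rw [hr t ht]; exact e⟩

/-- `SEEN` is a hash table without collisions, addressed by the code of a neighbourhood. A vertex
outside the side becomes a representative when its nonempty neighbourhood has not been marked yet.
-/
theorem repCmd_spec (I : ℕ → ℕ) {m J : ℕ} (G : InputGraph S m I) {σ : Store}
    (hPW : PowTable J σ) (hJ : S.n < J) (hm : σ.var .m = m) {a : ℕ} (ha : σ.var .pa = 16 ^ a)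
    (hK : ∀ y < S.n, σ.arr .KEY (ix2 (16 ^ a) (16 ^ y)) = code (S.nbr (S.side a) y))
    (hI : ∀ y < S.n, Occurs I (m + m) y →
      (σ.arr .INS (ix2 (16 ^ a) (16 ^ y)) = 0 ↔ y ∉ S.side a))
    (hS : ∀ k, IsCode k → σ.arr .SEEN (ix2 (16 ^ a) k) = 0) :
    RepsFor S a (Occurs I (m + m))
      (fun t => (repCmd.run I σ).arr .REP (ix2 (16 ^ a) (16 ^ t)))
      ((repCmd.run I σ).arr .RC (16 ^ a)) ∧
    (∀ a' ≠ a, (repCmd.run I σ).arr .RC (16 ^ a') = σ.arr .RC (16 ^ a')) ∧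
    (∀ a' ≠ a, ∀ t, (repCmd.run I σ).arr .REP (ix2 (16 ^ a') (16 ^ t)) =
      σ.arr .REP (ix2 (16 ^ a') (16 ^ t))) ∧
    (∀ a' ≠ a, ∀ k, IsCode k → (repCmd.run I σ).arr .SEEN (ix2 (16 ^ a') k) =
      σ.arr .SEEN (ix2 (16 ^ a') k)) ∧
    repCmd.cost I σ ≤ 200 * (m + m + 1) := by
  unfold repCmd
  set B := (assign .y (inp (lit 3 + Var.p)) ;; assign .py (arr .PW Var.y) ;;
     assign .k (arr .KEY (Expr.ix2 Var.pa Var.py)) ;;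
     ite (arr .INS (Expr.ix2 Var.pa Var.py)) skip
      (ite Var.k
        (ite (arr .SEEN (Expr.ix2 Var.pa Var.k)) skip
          (write .SEEN (Expr.ix2 Var.pa Var.k) (lit 1) ;;
           write .REP (Expr.ix2 Var.pa (arr .PW Var.len)) Var.y ;;
           assign .len (Var.len + lit 1)))
        skip)) with hB
  set σ0 := (assign .len (lit 0)).run I σ with hσ0
  have L := loop_rule I .p .wp (Var.m + Var.m) B σ0 (m + m) 150 (by simp [hσ0, hm])
    (fun k τ => RepsFor S a (Occurs I k) (fun t => τ.arr .REP (ix2 (16 ^ a) (16 ^ t)))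
        (τ.var .len) ∧
      (∀ κ, IsCode κ → (τ.arr .SEEN (ix2 (16 ^ a) κ) ≠ 0 ↔
        ∃ t < τ.var .len, code (S.nbr (S.side a) (τ.arr .REP (ix2 (16 ^ a) (16 ^ t)))) = κ)) ∧
      (∀ a' ≠ a, ∀ t, τ.arr .REP (ix2 (16 ^ a') (16 ^ t)) = σ.arr .REP (ix2 (16 ^ a') (16 ^ t))) ∧
      (∀ a' ≠ a, ∀ κ, IsCode κ → τ.arr .SEEN (ix2 (16 ^ a') κ) = σ.arr .SEEN (ix2 (16 ^ a') κ)))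
    ?_ ?_
  · obtain ⟨⟨h1, h2, h3, h4⟩, h5⟩ := L
    have hpa : ((loop .p .wp (Var.m + Var.m) B).run I σ0).var .pa = 16 ^ a := by
      rw [var_run _ _ _ _ (by simp [hB, vars])]; simpa [hσ0] using ha
    have hrc : ((loop .p .wp (Var.m + Var.m) B).run I σ0).arr .RC = σ.arr .RC := by
      rw [arr_run _ _ _ _ (by simp [hB, arrs])]; simp [hσ0]
    simp only [run_seq, run_write, eval_var, Store.arr_setArr, reduceCtorEq, if_false, if_true,
      ← hσ0, hpa, hrc]
    refine ⟨?_, ?_, h3, h4, ?_⟩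
    · rw [Function.update_self]; exact h1
    · intro a' ha'
      rw [Function.update_of_ne (fun h => ha' (pow_inj16.1 h))]
    · simp only [cost_seq, cost_assign, cost_write, cost_lit, cost_var, ← hσ0]
      simp only [cost_add, cost_var] at h5
      omega
  · refine ⟨⟨?_, ?_, ?_, ?_, ?_⟩, ?_, ?_, ?_⟩
    · simp [hσ0]
    · simp [hσ0]
    · simp [hσ0]
    · simp [hσ0]
    · rintro y - ⟨p, hp, -⟩; omega
    · intro κ hκ
      simp [hσ0, hS κ hκ]
    · simp [hσ0]
    · simp [hσ0]
  · rintro k hk τ ⟨i1, i2, i3, i4⟩ fv fa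
    have hP : τ.arr .PW = σ.arr .PW := by rw [fa _ (by simp [hB, arrs])]; simp [hσ0]
    have hKt : τ.arr .KEY = σ.arr .KEY := by rw [fa _ (by simp [hB, arrs])]; simp [hσ0]
    have hIt : τ.arr .INS = σ.arr .INS := by rw [fa _ (by simp [hB, arrs])]; simp [hσ0]
    have ha' : τ.var .pa = 16 ^ a := by
      rw [fv _ (by simp [hB, vars])]; simpa [hσ0] using ha
    set y := I (3 + k) with hy
    have hyn : y < S.n := G.lt k hk
    have hyo : Occurs I (m + m) y := ⟨k, hk, rfl⟩
    set ρ := (assign .y (inp (lit 3 + Var.p)) ;; assign .py (arr .PW Var.y) ;;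
     assign .k (arr .KEY (Expr.ix2 Var.pa Var.py))).run I (enter .p .wp k τ) with hρ
    have ra : ρ.arr = τ.arr := by simp [hρ, enter]
    have ry : ρ.var .y = y := by simp [hρ, enter, hy]
    have rpa : ρ.var .pa = 16 ^ a := by simp [hρ, enter, ha']
    have rpy : ρ.var .py = 16 ^ y := by simp [hρ, enter, hP, ← hy, hPW y (by omega)]
    have rk : ρ.var .k = code (S.nbr (S.side a) y) := by
      simp [hρ, enter, hP, ha', hKt, ← hy, hPW y (by omega), hK y hyn]
    have rl : ρ.var .len = τ.var .len := by simp [hρ, enter]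
    have er : B.run I (enter .p .wp k τ) = (ite (arr .INS (Expr.ix2 Var.pa Var.py)) skip
      (ite Var.k
        (ite (arr .SEEN (Expr.ix2 Var.pa Var.k)) skip
          (write .SEEN (Expr.ix2 Var.pa Var.k) (lit 1) ;;
           write .REP (Expr.ix2 Var.pa (arr .PW Var.len)) Var.y ;;
           assign .len (Var.len + lit 1)))
        skip)).run I ρ := rfl
    have hcost : B.cost I (enter .p .wp k τ) ≤ 150 := by
      simp only [hB, cost_seq, cost_assign, cost_arr, cost_inp, cost_add, cost_lit, cost_var,
        cost_ix2, cost_ite, cost_skip, cost_write]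
      split_ifs <;> norm_num
    refine ⟨?_, hcost⟩
    rw [er]
    simp only [run_ite, eval_arr, eval_ix2, eval_var, ra, rpa, rpy, rk, hIt, run_skip]
    -- If the list does not grow, it only has to be checked that the vertex just visited is covered.
    -- It may lie inside the side, have no neighbours there, or share its neighbourhood with a
    -- listed vertex.
    have stay : (y ∉ S.side a → S.nbr (S.side a) y ≠ ∅ →
        ∃ t < τ.var .len, S.nbr (S.side a) (τ.arr .REP (ix2 (16 ^ a) (16 ^ t))) =
          S.nbr (S.side a) y) →
        RepsFor S a (Occurs I (k + 1)) (fun t => τ.arr .REP (ix2 (16 ^ a) (16 ^ t))) (τ.var .len) := by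
      intro h
      refine ⟨i1.lt, i1.notMem, i1.nonempty, i1.inj, ?_⟩
      intro z hz hzo hza hne
      rw [occurs_succ] at hzo
      rcases hzo with hzo | rfl
      · exact i1.cover z hz hzo hza hne
      · exact h hza hne
    by_cases c1 : σ.arr .INS (ix2 (16 ^ a) (16 ^ y)) = 0
    swap
    · rw [if_pos c1, ra, rl]
      exact ⟨stay fun h => absurd ((hI y hyn hyo).2 h) c1, i2, i3, i4⟩
    have hya := (hI y hyn hyo).1 c1
    rw [if_neg (by simpa using c1)]
    by_cases c2 : code (S.nbr (S.side a) y) = 0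
    · rw [if_neg (by simpa using c2), ra, rl]
      exact ⟨stay fun _ h => absurd (code_eq_zero.1 c2) h, i2, i3, i4⟩
    rw [if_pos c2]
    have hne : S.nbr (S.side a) y ≠ ∅ := fun h => c2 (code_eq_zero.2 h)
    by_cases c3 : τ.arr .SEEN (ix2 (16 ^ a) (code (S.nbr (S.side a) y))) = 0
    swap
    · rw [if_pos c3, ra, rl]
      obtain ⟨t, ht, e⟩ := (i2 _ ⟨_, rfl⟩).1 c3
      exact ⟨stay fun _ _ => ⟨t, ht, code_inj.1 e⟩, i2, i3, i4⟩
    rw [if_neg (by simpa using c3)]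
    have hlen : τ.var .len ≤ S.n := i1.le
    have hnew : ∀ t < τ.var .len, S.nbr (S.side a) (τ.arr .REP (ix2 (16 ^ a) (16 ^ t))) ≠
        S.nbr (S.side a) y := by
      intro t ht he
      exact (i2 _ ⟨_, rfl⟩).2 ⟨t, ht, by rw [he]⟩ c3
    simp only [run_seq, run_assign, run_write, eval_ix2, eval_arr, eval_add, eval_var,
      eval_lit, Store.arr_setArr, Store.var_setVar, Store.var_setArr, Store.arr_setVar,
      if_true, reduceCtorEq, if_false, rpa, rk, ra, rl, ry, hP, hPW _ (show τ.var .len < J by omega),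
      update_ix2_pow]
    have old : ∀ t < τ.var .len, (if True ∧ t = τ.var .len then y else
        τ.arr .REP (ix2 (16 ^ a) (16 ^ t))) = τ.arr .REP (ix2 (16 ^ a) (16 ^ t)) := by
      intro t ht
      rw [if_neg (by rintro ⟨-, h⟩; omega)]
    have new : (if True ∧ τ.var .len = τ.var .len then y else
        τ.arr .REP (ix2 (16 ^ a) (16 ^ τ.var .len))) = y := if_pos ⟨trivial, rfl⟩
    have cases : ∀ {t}, t < τ.var .len + 1 → t < τ.var .len ∨ t = τ.var .len := by omega
    refine ⟨⟨?_, ?_, ?_, ?_, ?_⟩, ?_, ?_, ?_⟩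
    · intro t ht
      rcases cases ht with ht | rfl
      · rw [old t ht]; exact i1.lt t ht
      · rw [new]; exact hyn
    · intro t ht
      rcases cases ht with ht | rfl
      · rw [old t ht]; exact i1.notMem t ht
      · rw [new]; exact hya
    · intro t ht
      rcases cases ht with ht | rfl
      · rw [old t ht]; exact i1.nonempty t ht
      · rw [new]; exact hne
    · intro t ht t' ht'
      rcases cases ht with ht | rfl <;> rcases cases ht' with ht' | rfl
      · rw [old t ht, old t' ht']; exact i1.inj t ht t' ht'
      · rw [old t ht, new]; exact fun h => absurd h (hnew t ht)
      · rw [old t' ht', new]; exact fun h => absurd h.symm (hnew t' ht')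
      · exact fun _ => rfl
    · intro z hz hzo hza hzne
      rw [occurs_succ] at hzo
      rcases hzo with hzo | rfl
      · obtain ⟨t, ht, e⟩ := i1.cover z hz hzo hza hzne
        exact ⟨t, by omega, by rw [old t ht]; exact e⟩
      · exact ⟨_, Nat.lt_succ_self _, by rw [new]⟩
    · intro κ hκ
      rw [update_ix2 (isCode_pow _) ⟨_, rfl⟩ (isCode_pow _) hκ]
      by_cases he : κ = code (S.nbr (S.side a) y)
      · rw [if_pos ⟨rfl, he⟩]
        refine iff_of_true (by norm_num) ⟨_, Nat.lt_succ_self _, by rw [new, he]⟩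
      · rw [if_neg (by tauto), i2 κ hκ]
        constructor
        · rintro ⟨t, ht, e⟩
          exact ⟨t, by omega, by rw [old t ht]; exact e⟩
        · rintro ⟨t, ht, e⟩
          rcases cases ht with ht | rfl
          · exact ⟨t, ht, by rw [old t ht] at e; exact e⟩
          · rw [new] at e; exact absurd e.symm he
    · intro a' ha'' t
      rw [if_neg (by tauto)]
      exact i3 a' ha'' t
    · intro a' ha'' κ hκ
      rw [update_ix2 (isCode_pow _) ⟨_, rfl⟩ (isCode_pow _) hκ, if_neg (by rw [pow_inj16]; tauto)]
      exact i4 a' ha'' κ hκ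

end Imp

/-! ### Neighbourhoods and representatives for all sides -/

namespace Imp

open Imp.Cmd Imp.Expr

variable {S : CutSystem} {Q d₁ d₂ : ℕ → ℕ}

theorem Schedule.not_ready_self (h : Schedule S Q d₁ d₂) {i : ℕ} (hi : i < S.M) :
    ¬ Ready S Q i (Q i) := fun hr => h.ready_ne hi hr rfl

theorem Schedule.ready_mono {i b : ℕ} (h : Ready S Q i b) : Ready S Q (i + 1) b := by
  rcases h with h | ⟨j, hj, e⟩
  exacts [.inl h, .inr ⟨j, by omega, e⟩]

/-- Fetches side number `i` of the order and the two sides of which it is composed. -/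
def fetchCmd : Cmd :=
  assign .a (arr .QUE Var.i) ;; assign .b (arr .D1 Var.a) ;; assign .c (arr .D2 Var.a) ;;
  assign .pa (arr .PW Var.a) ;; assign .pb (arr .PW Var.b) ;; assign .pc (arr .PW Var.c)

theorem fetchCmd_spec (I : ℕ → ℕ) (h : Schedule S Q d₁ d₂) {J : ℕ} (hJ : S.M + S.n < J) {σ : Store}
    (hPW : PowTable J σ) (hT : SchedTable S Q d₁ d₂ σ) {i : ℕ} (hi : i < S.M)
    (hv : σ.var .i = i) :
    (fetchCmd.run I σ).arr = σ.arr ∧ (fetchCmd.run I σ).var .a = Q i ∧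
    (fetchCmd.run I σ).var .b = d₁ (Q i) ∧ (fetchCmd.run I σ).var .c = d₂ (Q i) ∧
    (fetchCmd.run I σ).var .pa = 16 ^ (Q i) ∧ (fetchCmd.run I σ).var .pb = 16 ^ (d₁ (Q i)) ∧
    (fetchCmd.run I σ).var .pc = 16 ^ (d₂ (Q i)) ∧ fetchCmd.cost I σ ≤ 100 := by
  have h1 := h.lt i hi
  have h2 := h.ready_le hi.le (h.ready₁ i hi)
  have h3 := h.ready_le hi.le (h.ready₂ i hi)
  have h4 := hT.2 _ h1
  have h5 := hPW (Q i) (by omega)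
  have h6 := hPW (d₁ (Q i)) (by omega)
  have h7 := hPW (d₂ (Q i)) (by omega)
  refine ⟨?_, ?_, ?_, ?_, ?_, ?_, ?_, ?_⟩ <;>
    simp [fetchCmd, hv, hT.1 i hi, h4.1, h4.2, h5, h6, h7]

/-- Computes the tables of neighbourhoods and representatives. -/
def colsCmd : Cmd :=
  atomCmd ;; loop .i .wi Var.M (fetchCmd ;; joinCmd ;; repCmd)

theorem nbr_empty_of_not_occurs {I : ℕ → ℕ} {m : ℕ} (G : InputGraph S m I) {y : ℕ}
    (h : ¬ Occurs I (m + m) y) (A : Finset ℕ) : S.nbr A y = ∅ := by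
  rw [Finset.eq_empty_iff_forall_notMem]
  intro x hx
  exact h (G.occurs (CutSystem.mem_nbr.1 hx).2)

-- The sides are treated in the scheduled order, each in time linear in m. Neighbourhood codes of a
-- disjoint union add, since disjoint sets have disjoint digits.
set_option maxHeartbeats 600000 in
theorem colsCmd_spec (I : ℕ → ℕ) {m J : ℕ} (G : InputGraph S m I) (h : Schedule S Q d₁ d₂)
    {σ : Store} (hPW : PowTable J σ) (hJ : S.M + S.n < J) (hT : SchedTable S Q d₁ d₂ σ)
    (hm : σ.var .m = m) (hn : σ.var .n = S.n) (hM : σ.var .M = S.M)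
    (hK : ∀ i, σ.arr .KEY i = 0) (hI : ∀ i, σ.arr .INS i = 0) (hS : ∀ i, σ.arr .SEEN i = 0) :
    KeyTable S (colsCmd.run I σ) ∧
    (∃ rep rc, S.Reps rep rc ∧ RepTable S rep rc (colsCmd.run I σ)) ∧
    colsCmd.cost I σ ≤ 1000 * ((S.M + 1) * (m + 1) + S.n) := by
  obtain ⟨a1, a2, a3⟩ := atomCmd_spec I G hPW hJ hm hn hM hK hI
  set σ1 := atomCmd.run I σ with hσ1
  have va : ∀ v, v ∉ atomCmd.vars → σ1.var v = σ.var v := fun v hv => var_run _ _ _ _ hv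
  have aa : ∀ k, k ∉ atomCmd.arrs → σ1.arr k = σ.arr k := fun k hk => arr_run _ _ _ _ hk
  -- The invariant also says that the rows of `KEY` and `SEEN` for untreated sides are zero:
  -- `joinCmd` writes nothing for vertices on no edge, and the marks for a new side must start
  -- empty.
  have L := loop_rule I .i .wi Var.M (fetchCmd ;; joinCmd ;; repCmd) σ1 S.M (100 + 800 * (m + 1))
    (by rw [eval_var, va _ (by simp [atomCmd, vars]), hM])
    (fun i τ => (∀ b, Ready S Q i b → ∀ y < S.n,
        τ.arr .KEY (ix2 (16 ^ b) (16 ^ y)) = code (S.nbr (S.side b) y)) ∧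
      (∀ a < S.M, ¬ Ready S Q i a → ∀ y, τ.arr .KEY (ix2 (16 ^ a) (16 ^ y)) = 0) ∧
      (∀ b, Ready S Q i b → ∀ y < S.n, Occurs I (m + m) y →
        τ.arr .INS (ix2 (16 ^ b) (16 ^ y)) = if y ∈ S.side b then 1 else 0) ∧
      (∀ a < S.M, ¬ Ready S Q i a → ∀ k, IsCode k → τ.arr .SEEN (ix2 (16 ^ a) k) = 0) ∧
      (∀ a < S.M, Ready S Q i a → RepsFor S a (Occurs I (m + m))
        (fun t => τ.arr .REP (ix2 (16 ^ a) (16 ^ t))) (τ.arr .RC (16 ^ a)))) ?_ ?_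
  · obtain ⟨⟨k1, -, -, -, k5⟩, c1⟩ := L
    refine ⟨fun a ha y hy => k1 a (h.ready_all ha) y hy,
      ⟨fun a t => (colsCmd.run I σ).arr .REP (ix2 (16 ^ a) (16 ^ t)),
        fun a => (colsCmd.run I σ).arr .RC (16 ^ a), ?_, fun a _ => ⟨rfl, fun t _ => rfl⟩⟩, ?_⟩
    · have k5' : ∀ a < S.M, RepsFor S a (Occurs I (m + m))
        (fun t => (colsCmd.run I σ).arr .REP (ix2 (16 ^ a) (16 ^ t)))
        ((colsCmd.run I σ).arr .RC (16 ^ a)) := fun a ha => k5 a ha (h.ready_all (by omega))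
      refine ⟨fun a ha => (k5' a ha).lt, fun a ha => (k5' a ha).notMem,
        fun a ha => (k5' a ha).nonempty, fun a ha => (k5' a ha).inj, ?_⟩
      intro a ha y hy hya hne
      refine (k5' a ha).cover y hy ?_ hya hne
      by_contra hc
      exact hne (nbr_empty_of_not_occurs G hc _)
    · simp only [colsCmd, cost_seq, ← hσ1]
      simp only [cost_var] at c1
      nlinarith [Nat.zero_le (S.M * m)]
  · refine ⟨?_, ?_, ?_, ?_, ?_⟩
    · rintro b (hb | ⟨j, hj, -⟩) y hy
      swap; · omega
      rw [a1]
      by_cases hbn : b = S.M + S.n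
      · rw [if_neg]
        · rw [hbn, S.side_empty]; simp [CutSystem.nbr, code]
        · rintro ⟨x, hx, hxy⟩
          have := S.adj_lt x y hxy
          omega
      · have hs := S.side_single (b - S.M) (by omega)
        rw [show S.M + (b - S.M) = b by omega] at hs
        have he : (∃ x, b = S.M + x ∧ S.adj x y) ↔ S.adj y (b - S.M) := by
          constructor
          · rintro ⟨x, rfl, hx⟩
            rw [Nat.add_sub_cancel_left]; exact S.adj_symm _ _ hx
          · intro hx
            exact ⟨b - S.M, by omega, S.adj_symm _ _ hx⟩
        by_cases hx : S.adj y (b - S.M)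
        · rw [if_pos (he.2 hx)]
          have : S.nbr (S.side b) y = {b - S.M} := by
            ext z
            rw [CutSystem.mem_nbr, hs, Finset.mem_singleton]
            constructor
            · exact fun h => h.1
            · rintro rfl; exact ⟨rfl, hx⟩
          rw [this]; simp [code]
        · rw [if_neg (fun h => hx (he.1 h))]
          have : S.nbr (S.side b) y = ∅ := by
            rw [Finset.eq_empty_iff_forall_notMem]
            intro z hz
            rw [CutSystem.mem_nbr, hs, Finset.mem_singleton] at hz
            exact hx (hz.1 ▸ hz.2)
          rw [this]; rfl
    · intro a ha _ y
      rw [a1, if_neg]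
      rintro ⟨x, rfl, -⟩; omega
    · rintro b (hb | ⟨j, hj, -⟩) y hy -
      swap; · omega
      rw [a2]
      congr 1
      apply propext
      by_cases hbn : b = S.M + S.n
      · rw [hbn, S.side_empty]
        simp only [Finset.notMem_empty, iff_false]
        omega
      · have hs := S.side_single (b - S.M) (by omega)
        rw [show S.M + (b - S.M) = b by omega] at hs
        rw [hs, Finset.mem_singleton]
        omega
    · intro a ha _ k hk
      rw [aa _ (by simp [atomCmd, arrs]), hS]
    · rintro a ha (hb | ⟨j, hj, -⟩) <;> omega
  · rintro i hi τ ⟨i1, i2, i3, i4, i5⟩ fv fa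
    have hPt : PowTable J (enter .i .wi i τ) := by
      intro j hj
      rw [show (enter .i .wi i τ).arr = τ.arr from rfl,
        fa _ (by simp [fetchCmd, joinCmd, repCmd, arrs]), aa _ (by simp [atomCmd, arrs]), hPW j hj]
    have hTt : SchedTable S Q d₁ d₂ (enter .i .wi i τ) := by
      unfold SchedTable
      rw [show (enter .i .wi i τ).arr = τ.arr from rfl,
        fa .QUE (by simp [fetchCmd, joinCmd, repCmd, arrs]),
        fa .D1 (by simp [fetchCmd, joinCmd, repCmd, arrs]),
        fa .D2 (by simp [fetchCmd, joinCmd, repCmd, arrs]),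
        aa .QUE (by simp [atomCmd, arrs]), aa .D1 (by simp [atomCmd, arrs]),
        aa .D2 (by simp [atomCmd, arrs])]
      exact hT
    obtain ⟨f1, f2, f3, f4, f5, f6, f7, f8⟩ := fetchCmd_spec I h hJ hPt hTt hi (by simp [enter])
    set ρ := fetchCmd.run I (enter .i .wi i τ) with hρ
    have f1' : ρ.arr = τ.arr := f1
    have hmr : ρ.var .m = m := by
      rw [hρ, var_run _ _ _ _ (by simp [fetchCmd, vars])]
      simp only [enter, Store.var_setVar, reduceCtorEq, if_false]
      rw [fv _ (by simp [fetchCmd, joinCmd, repCmd, vars]), va _ (by simp [atomCmd, vars]), hm]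
    have hPr : PowTable J ρ := fun j hj => by rw [f1]; exact hPt j hj
    set a := Q i with ha
    have haM : a < S.M := h.lt i hi
    have hb := h.ready₁ i hi
    have hc := h.ready₂ i hi
    have hj := h.join a haM
    have hna : ¬ Ready S Q i a := h.not_ready_self hi
    obtain ⟨j1, j2, j3⟩ := joinCmd_spec I G hPr (by omega) hmr (h.ready_ne hi hb)
      (h.ready_ne hi hc) f5 f6 f7
    set ρ2 := joinCmd.run I ρ with hρ2
    rw [f1'] at j1 j2
    have va2 : ∀ v, v ∉ joinCmd.vars → ρ2.var v = ρ.var v := fun v hv => var_run _ _ _ _ hv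
    have aa2 : ∀ k, k ∉ joinCmd.arrs → ρ2.arr k = τ.arr k := fun k hk => by
      rw [← f1']; exact arr_run _ _ _ _ hk
    have hPr2 : PowTable J ρ2 := fun j hj => by
      rw [aa2 _ (by simp [joinCmd, arrs])]; exact hPt j hj
    have keyA : ∀ y < S.n, ρ2.arr .KEY (ix2 (16 ^ a) (16 ^ y)) = code (S.nbr (S.side a) y) := by
      intro y hy
      rw [j1]
      by_cases ho : Occurs I (m + m) y
      · rw [if_pos ⟨rfl, ho⟩, i1 _ hb y hy, i1 _ hc y hy, hj.union, CutSystem.nbr_union,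
          code_union (CutSystem.nbr_disjoint hj.disj y)]
      · rw [if_neg (by tauto), i2 a haM hna, nbr_empty_of_not_occurs G ho]; rfl
    have insA : ∀ y < S.n, Occurs I (m + m) y →
        ρ2.arr .INS (ix2 (16 ^ a) (16 ^ y)) = if y ∈ S.side a then 1 else 0 := by
      intro y hy ho
      rw [j2, if_pos ⟨rfl, ho⟩, i3 _ hb y hy ho, i3 _ hc y hy ho]
      have hmem : y ∈ S.side a ↔ y ∈ S.side (d₁ a) ∨ y ∈ S.side (d₂ a) := by
        rw [← Finset.mem_union, ← hj.union]
      have : y ∈ S.side (d₁ a) → y ∉ S.side (d₂ a) := fun h => Finset.disjoint_left.1 hj.disj h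
      by_cases y1 : y ∈ S.side (d₁ a) <;> by_cases y2 : y ∈ S.side (d₂ a)
      · exact absurd y2 (this y1)
      · simp [hmem, y1, y2, ← ha]
      · simp [hmem, y1, y2, ← ha]
      · simp [hmem, y1, y2, ← ha]
    obtain ⟨r1, r2, r3, r4, r5⟩ := repCmd_spec I G hPr2 (by omega)
      ((va2 _ (by simp [joinCmd, vars])).trans hmr)
      ((va2 _ (by simp [joinCmd, vars])).trans f5) keyA
      (by intro y hy ho; rw [insA y hy ho]; by_cases hya : y ∈ S.side a <;> simp [hya])
      (by intro k hk; rw [aa2 _ (by simp [joinCmd, arrs])]; exact i4 a haM hna k hk)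
    set ρ3 := repCmd.run I ρ2 with hρ3
    have aa3 : ∀ k, k ∉ repCmd.arrs → ρ3.arr k = ρ2.arr k := fun k hk => arr_run _ _ _ _ hk
    have er : (fetchCmd ;; joinCmd ;; repCmd).run I (enter .i .wi i τ) = ρ3 := rfl
    have hne : ∀ b, Ready S Q i b → b ≠ a := fun b hb => h.ready_ne hi hb
    refine ⟨?_, ?_⟩
    · rw [er]
      refine ⟨?_, ?_, ?_, ?_, ?_⟩
      · intro b hb y hy
        rw [aa3 _ (by simp [repCmd, arrs])]
        rcases Schedule.ready_succ hb with hb | rfl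
        · rw [j1, if_neg (fun h => hne b hb h.1)]; exact i1 b hb y hy
        · exact keyA y hy
      · intro b hbM hb y
        have : b ≠ a := by rintro rfl; exact hb (.inr ⟨i, by omega, rfl⟩)
        rw [aa3 _ (by simp [repCmd, arrs]), j1, if_neg (fun h => this h.1)]
        exact i2 b hbM (fun h => hb (Schedule.ready_mono h)) y
      · intro b hb y hy ho
        rw [aa3 _ (by simp [repCmd, arrs])]
        rcases Schedule.ready_succ hb with hb | rfl
        · rw [j2, if_neg (fun h => hne b hb h.1)]; exact i3 b hb y hy ho
        · exact insA y hy ho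
      · intro b hbM hb k hk
        have : b ≠ a := by rintro rfl; exact hb (.inr ⟨i, by omega, rfl⟩)
        rw [r4 b this k hk, aa2 _ (by simp [joinCmd, arrs])]
        exact i4 b hbM (fun h => hb (Schedule.ready_mono h)) k hk
      · intro b hbM hb
        rcases Schedule.ready_succ hb with hb | rfl
        · have := hne b hb
          rw [r2 b this, aa2 _ (by simp [joinCmd, arrs])]
          refine (i5 b hbM hb).congr fun t _ => ?_
          rw [r3 b this, aa2 _ (by simp [joinCmd, arrs])]
        · exact r1
    · simp only [cost_seq]
      rw [← hρ, ← hρ2]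
      omega

end Imp

/-! ### Handles of composed sides, and merging of labellings -/

namespace CutSystem

variable {S : CutSystem} {rep : ℕ → ℕ → ℕ} {rc : ℕ → ℕ}

/-- For an appended singleton the handle is the label itself, which is finer than the profile. Hence
there is only an implication here, whereas `handle_eq_iff` covers the proper sides. -/
theorem Reps.same_of_handle_eq (R : S.Reps rep rc) {a : ℕ} (ha : a ≤ S.M + S.n) {X Y : ℕ → ℕ}
    (h : S.handle rep rc a X = S.handle rep rc a Y) : S.Same a X Y := by
  by_cases h1 : a < S.M
  · exact (R.handle_eq_iff h1).1 h
  · apply same_of_eqOn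
    intro x hx
    by_cases h2 : a < S.M + S.n
    · have hs := S.side_single (a - S.M) (by omega)
      rw [show S.M + (a - S.M) = a by omega] at hs
      rw [hs, Finset.mem_singleton] at hx
      subst hx
      simpa [handle, h1, h2] using h
    · rw [show a = S.M + S.n by omega, S.side_empty] at hx
      simp at hx

/-- The handle of a union is a function of the handles of the parts. Thus one pair of labellings per
pair of handles suffices in the enumeration. -/
theorem Join.handle_eq (R : S.Reps rep rc) {a b c : ℕ} (h : S.Join a b c) (ha : a < S.M)
    (hb : b ≤ S.M + S.n) (hc : c ≤ S.M + S.n) {X Y : ℕ → ℕ}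
    (h1 : S.handle rep rc b X = S.handle rep rc b Y)
    (h2 : S.handle rep rc c X = S.handle rep rc c Y) :
    S.handle rep rc a X = S.handle rep rc a Y :=
  (R.handle_eq_iff ha).2 (h.same (R.same_of_handle_eq hb h1) (R.same_of_handle_eq hc h2))

/-- Labellings of disjoint sides can be merged. -/
theorem merge {b c : ℕ} (h : Disjoint (S.side b) (S.side c)) {X Y : ℕ → ℕ} (hX : S.IsLab X)
    (hY : S.IsLab Y) : ∃ Z, S.IsLab Z ∧ (∀ x ∈ S.side b, Z x = X x) ∧ ∀ x, x ∉ S.side b → Z x = Y x := by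
  refine ⟨fun x => if x ∈ S.side b then X x else Y x, fun x => ?_, fun x hx => if_pos hx,
    fun x hx => if_neg hx⟩
  dsimp only
  split_ifs
  exacts [hX x, hY x]

end CutSystem

namespace Imp

open Imp.Cmd Imp.Expr

variable {S : CutSystem} {rep : ℕ → ℕ → ℕ} {rc : ℕ → ℕ}

theorem update_ix4 {a b c e a' b' c' e' : ℕ} (ha : IsCode a) (hb : IsCode b) (hc : IsCode c)
    (he : IsCode e) (ha' : IsCode a') (hb' : IsCode b') (hc' : IsCode c') (he' : IsCode e')
    (f : ℕ → ℕ) (v : ℕ) :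
    Function.update f (ix4 a b c e) v (ix4 a' b' c' e') =
      if a' = a ∧ b' = b ∧ c' = c ∧ e' = e then v else f (ix4 a' b' c' e') := by
  rw [Function.update_apply]
  simp only [ix4_inj ha' hb' hc' he' ha hb hc he]

/-- The arrays `PL` and `PC` list the handles for side `a`. -/
structure ListTable (S : CutSystem) (rep : ℕ → ℕ → ℕ) (rc : ℕ → ℕ) (a : ℕ) (σ : Store) : Prop where
  sound : ∀ j < σ.arr .PC (16 ^ a), ∃ Z, S.IsLab Z ∧
    σ.arr .PL (ix2 (16 ^ a) (16 ^ j)) = S.handle rep rc a Z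
  complete : ∀ Z, S.IsLab Z → ∃ j < σ.arr .PC (16 ^ a),
    σ.arr .PL (ix2 (16 ^ a) (16 ^ j)) = S.handle rep rc a Z
  inj : ∀ j < σ.arr .PC (16 ^ a), ∀ j' < σ.arr .PC (16 ^ a),
    σ.arr .PL (ix2 (16 ^ a) (16 ^ j)) = σ.arr .PL (ix2 (16 ^ a) (16 ^ j')) → j = j'

/-- There are at most `s` handles for every side. -/
def FewHandles (S : CutSystem) (rep : ℕ → ℕ → ℕ) (rc : ℕ → ℕ) (s : ℕ) : Prop :=
  ∀ a ≤ S.M + S.n, ∀ F : Finset ℕ, (∀ x ∈ F, ∃ Z, S.IsLab Z ∧ x = S.handle rep rc a Z) → F.card ≤ s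

/-- The list has no repetitions and contains only handles, so it is no longer than the number of
handles. -/
theorem ListTable.le {a : ℕ} {σ : Store} (h : ListTable S rep rc a σ) {s : ℕ}
    (hs : FewHandles S rep rc s) (ha : a ≤ S.M + S.n) : σ.arr .PC (16 ^ a) ≤ s := by
  have := hs a ha ((Finset.range (σ.arr .PC (16 ^ a))).image
    fun j => σ.arr .PL (ix2 (16 ^ a) (16 ^ j))) (by
      intro x hx
      obtain ⟨j, hj, rfl⟩ := Finset.mem_image.1 hx
      exact h.sound j (Finset.mem_range.1 hj))
  rwa [Finset.card_image_of_injOn, Finset.card_range] at this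
  intro j hj j' hj' he
  exact h.inj j (by simpa using hj) j' (by simpa using hj') he

theorem ListTable.congr {a : ℕ} {σ τ : Store} (h : ListTable S rep rc a σ)
    (h1 : τ.arr .PC (16 ^ a) = σ.arr .PC (16 ^ a))
    (h2 : ∀ j, τ.arr .PL (ix2 (16 ^ a) (16 ^ j)) = σ.arr .PL (ix2 (16 ^ a) (16 ^ j))) :
    ListTable S rep rc a τ := by
  constructor
  · rw [h1]; intro j hj; rw [h2]; exact h.sound j hj
  · rw [h1]; intro Z hZ; simp only [h2]; exact h.complete Z hZ
  · rw [h1]; intro j hj j' hj'; rw [h2, h2]; exact h.inj j hj j' hj'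

theorem ValTable.congr {a : ℕ} {σ τ : Store} (h : ValTable S rep rc a σ)
    (h1 : ∀ B C E, IsCode B → IsCode C → IsCode E →
      τ.arr .VAL (ix4 (16 ^ a) B C E) = σ.arr .VAL (ix4 (16 ^ a) B C E)) :
    ValTable S rep rc a τ := by
  intro Z hZ y hy hya i hi
  rw [h1 _ _ _ (CutSystem.isCode_handle _ _) ⟨_, rfl⟩ (isCode_pow _)]
  exact h Z hZ y hy hya i hi

/-! ### Handles of the appended sides -/

/-- Initializes lists and profiles for the appended sides. -/
def atomListCmd (q : ℕ) : Cmd :=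
  loop .x .px Var.n
    (assign .pa (arr .PW (Var.M + Var.x)) ;; write .PC Var.pa (lit q) ;;
     loop .j .wj (lit q)
      (write .PL (Expr.ix2 Var.pa Var.wj) Var.wj ;;
       write .VAL (Expr.ix4 Var.pa Var.wj Var.px Var.wj) (lit 1))) ;;
  write .PC (arr .PW (Var.M + Var.n)) (lit 1)

open Classical in
theorem atomListCmd_spec (I : ℕ → ℕ) {J : ℕ} {σ : Store}
    (hPW : PowTable J σ) (hJ : S.M + S.n < J) (hn : σ.var .n = S.n)
    (hM : σ.var .M = S.M) (hL : ∀ i, σ.arr .PL i = 0) (hV : ∀ i, σ.arr .VAL i = 0) :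
    ((∀ x < S.n, ((atomListCmd S.q).run I σ).arr .PC (16 ^ (S.M + x)) = S.q) ∧
      ((atomListCmd S.q).run I σ).arr .PC (16 ^ (S.M + S.n)) = 1) ∧
    (∀ a j, ((atomListCmd S.q).run I σ).arr .PL (ix2 (16 ^ a) (16 ^ j)) =
      if j < S.q ∧ ∃ x < S.n, a = S.M + x then 16 ^ j else 0) ∧
    (∀ A B C E, IsCode A → IsCode B → IsCode C → IsCode E →
      ((atomListCmd S.q).run I σ).arr .VAL (ix4 A B C E) =
        if ∃ x < S.n, ∃ j < S.q, A = 16 ^ (S.M + x) ∧ B = 16 ^ j ∧ C = 16 ^ x ∧ E = 16 ^ j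
        then 1 else 0) ∧
    (atomListCmd S.q).cost I σ ≤ 200 * (S.n * (S.q + 1) + 1) := by
  set B2 := (write .PL (Expr.ix2 Var.pa Var.wj) Var.wj ;;
       write .VAL (Expr.ix4 Var.pa Var.wj Var.px Var.wj) (lit 1)) with hB2
  set B1 := (assign .pa (arr .PW (Var.M + Var.x)) ;; write .PC Var.pa (lit S.q) ;;
     loop .j .wj (lit S.q) B2) with hB1
  have L := loop_rule I .x .px Var.n B1 σ S.n (60 + S.q * 112) (by simp [hn])
    (fun k τ => (∀ x < k, τ.arr .PC (16 ^ (S.M + x)) = S.q) ∧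
      (∀ a j, τ.arr .PL (ix2 (16 ^ a) (16 ^ j)) =
        if j < S.q ∧ ∃ x < k, a = S.M + x then 16 ^ j else 0) ∧
      (∀ A B C E, IsCode A → IsCode B → IsCode C → IsCode E → τ.arr .VAL (ix4 A B C E) =
        if ∃ x < k, ∃ j < S.q, A = 16 ^ (S.M + x) ∧ B = 16 ^ j ∧ C = 16 ^ x ∧ E = 16 ^ j
        then 1 else 0)) (by simp [hL, hV]) ?_
  · obtain ⟨⟨i1, i2, i3⟩, i4⟩ := L
    have er : (atomListCmd S.q).run I σ = (write .PC (arr .PW (Var.M + Var.n)) (lit 1)).run I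
      ((loop .x .px Var.n B1).run I σ) := rfl
    have hMt : ((loop .x .px Var.n B1).run I σ).var .M = S.M := by
      rw [var_run _ _ _ _ (by simp [hB1, hB2, vars]), hM]
    have hnt : ((loop .x .px Var.n B1).run I σ).var .n = S.n := by
      rw [var_run _ _ _ _ (by simp [hB1, hB2, vars]), hn]
    have hPt : ((loop .x .px Var.n B1).run I σ).arr .PW = σ.arr .PW := by
      rw [arr_run _ _ _ _ (by simp [hB1, hB2, arrs])]
    rw [er]
    simp only [run_write, eval_arr, eval_add, eval_var, eval_lit, hMt, hnt, hPt, hPW _ hJ,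
      Store.arr_setArr, if_true, reduceCtorEq, if_false]
    refine ⟨⟨?_, Function.update_self _ _ _⟩, i2, i3, ?_⟩
    · intro x hx
      rw [Function.update_of_ne (fun h => by have := pow_inj16.1 h; omega)]
      exact i1 x hx
    · simp only [atomListCmd, cost_seq]
      rw [← hB2, ← hB1]
      simp only [cost_var] at i4
      simp only [cost_write, cost_arr, cost_add, cost_var, cost_lit]
      nlinarith [Nat.zero_le (S.n * S.q)]
  · rintro k hk τ ⟨i1, i2, i3⟩ fv fa
    have hP : τ.arr .PW = σ.arr .PW := fa _ (by simp [hB1, hB2, arrs])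
    have hMt : τ.var .M = S.M := by rw [fv _ (by simp [hB1, hB2, vars]), hM]
    set ρ := (assign .pa (arr .PW (Var.M + Var.x)) ;; write .PC Var.pa (lit S.q)).run I
      (enter .x .px k τ) with hρ
    have ρpa : ρ.var .pa = 16 ^ (S.M + k) := by
      simp [hρ, enter, hP, hMt, hPW _ (show S.M + k < J by omega)]
    have ρpx : ρ.var .px = 16 ^ k := by simp [hρ, enter]
    have ρPC : ρ.arr .PC = Function.update (τ.arr .PC) (16 ^ (S.M + k)) S.q := by
      simp [hρ, enter, hP, hMt, hPW _ (show S.M + k < J by omega)]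
    have ρPL : ρ.arr .PL = τ.arr .PL := by simp [hρ, enter]
    have ρVAL : ρ.arr .VAL = τ.arr .VAL := by simp [hρ, enter]
    have L2 := loop_rule I .j .wj (lit S.q) B2 ρ S.q 100 (by simp)
      (fun l τ' => (∀ a j, τ'.arr .PL (ix2 (16 ^ a) (16 ^ j)) =
        if a = S.M + k ∧ j < l then 16 ^ j else τ.arr .PL (ix2 (16 ^ a) (16 ^ j))) ∧
      (∀ A B C E, IsCode A → IsCode B → IsCode C → IsCode E → τ'.arr .VAL (ix4 A B C E) =
        if ∃ j < l, A = 16 ^ (S.M + k) ∧ B = 16 ^ j ∧ C = 16 ^ k ∧ E = 16 ^ j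
        then 1 else τ.arr .VAL (ix4 A B C E))) (by simp [ρPL, ρVAL]) ?_
    · have er : B1.run I (enter .x .px k τ) = (loop .j .wj (lit S.q) B2).run I ρ := rfl
      obtain ⟨⟨l1, l2⟩, l3⟩ := L2
      rw [er]
      refine ⟨⟨?_, ?_, ?_⟩, ?_⟩
      · intro x hx
        rw [arr_run _ _ _ _ (by simp [hB2, arrs]), ρPC]
        by_cases h : x = k
        · subst h; exact Function.update_self _ _ _
        · rw [Function.update_of_ne (fun h' => by have := pow_inj16.1 h'; omega)]
          exact i1 x (by omega)
      · intro a j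
        rw [l1, i2]
        by_cases h1 : j < S.q
        · by_cases h2 : a = S.M + k
          · rw [if_pos ⟨h2, h1⟩, if_pos ⟨h1, k, by omega, h2⟩]
          · rw [if_neg (by tauto)]
            congr 1
            apply propext
            constructor
            · rintro ⟨_, x, hx, e⟩; exact ⟨h1, x, by omega, e⟩
            · rintro ⟨_, x, hx, e⟩; exact ⟨h1, x, by omega, e⟩
        · simp [h1]
      · intro A B C E hA hB hC hE
        rw [l2 A B C E hA hB hC hE, i3 A B C E hA hB hC hE]
        by_cases h1 : ∃ j < S.q, A = 16 ^ (S.M + k) ∧ B = 16 ^ j ∧ C = 16 ^ k ∧ E = 16 ^ j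
        · rw [if_pos h1, if_pos ⟨k, by omega, h1⟩]
        · rw [if_neg h1]
          congr 1
          apply propext
          constructor
          · rintro ⟨x, hx, h⟩; exact ⟨x, by omega, h⟩
          · rintro ⟨x, hx, h⟩
            refine ⟨x, ?_, h⟩
            by_contra hc
            obtain rfl : x = k := by omega
            exact h1 h
      · have ec : B1.cost I (enter .x .px k τ) =
            (loop .j .wj (lit S.q) B2).cost I ρ + 28 := by
          simp only [hB1, cost_seq, cost_assign, cost_write, cost_arr, cost_add, cost_var, cost_lit]
          simp only [hρ, run_seq]
          ring
        rw [ec]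
        simp only [cost_lit] at l3
        omega
    · rintro l hl τ' ⟨j1, j2⟩ gv ga
      have gpa : τ'.var .pa = 16 ^ (S.M + k) := by rw [gv _ (by simp [hB2, vars]), ρpa]
      have gpx : τ'.var .px = 16 ^ k := by rw [gv _ (by simp [hB2, vars]), ρpx]
      refine ⟨⟨?_, ?_⟩, by simp [hB2]⟩
      · intro a j
        simp only [hB2, run_seq, run_write, enter, eval_ix2, eval_ix4, eval_var, eval_lit,
          Store.arr_setArr, Store.var_setVar, Store.var_setArr, Store.arr_setVar,
          if_true, reduceCtorEq, if_false, gpa]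
        rw [update_ix2_pow, j1]
        by_cases h1 : a = S.M + k
        · by_cases h2 : j = l
          · rw [if_pos ⟨h1, h2⟩, if_pos ⟨h1, by omega⟩, h2]
          · rw [if_neg (by tauto)]
            congr 1
            apply propext
            constructor <;> rintro ⟨h3, h4⟩ <;> exact ⟨h3, by omega⟩
        · simp [h1]
      · intro A B C E hA hB hC hE
        simp only [hB2, run_seq, run_write, enter, eval_ix2, eval_ix4, eval_var, eval_lit,
          Store.arr_setArr, Store.var_setVar, Store.var_setArr, Store.arr_setVar,
          if_true, reduceCtorEq, if_false, gpa, gpx]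
        rw [update_ix4 (isCode_pow _) (isCode_pow _) (isCode_pow _) (isCode_pow _) hA hB hC hE,
          j2 A B C E hA hB hC hE]
        by_cases h1 : A = 16 ^ (S.M + k) ∧ B = 16 ^ l ∧ C = 16 ^ k ∧ E = 16 ^ l
        · rw [if_pos h1, if_pos ⟨l, by omega, h1⟩]
        · rw [if_neg h1]
          congr 1
          apply propext
          constructor
          · rintro ⟨x, hx, h⟩; exact ⟨x, by omega, h⟩
          · rintro ⟨x, hx, h⟩
            refine ⟨x, ?_, h⟩
            by_contra hc
            obtain rfl : x = l := by omega
            exact h1 h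

theorem handle_single {x : ℕ} (hx : x < S.n) (Z : ℕ → ℕ) :
    S.handle rep rc (S.M + x) Z = 16 ^ Z x := by
  simp [CutSystem.handle, hx]

theorem handle_empty (Z : ℕ → ℕ) : S.handle rep rc (S.M + S.n) Z = 0 := by
  simp [CutSystem.handle]

-- For {x} the handles are the q labels, and the profile of label j at a neighbour of x is 1 for the
-- label j and 0 otherwise. For the empty side there is one handle, 0, and the zero profile, so
-- untouched cells of the tables are already correct.
open Classical in
theorem atom_tables {σ : Store}
    (h1 : ∀ x < S.n, σ.arr .PC (16 ^ (S.M + x)) = S.q) (h2 : σ.arr .PC (16 ^ (S.M + S.n)) = 1)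
    (h3 : ∀ a j, σ.arr .PL (ix2 (16 ^ a) (16 ^ j)) =
      if j < S.q ∧ ∃ x < S.n, a = S.M + x then 16 ^ j else 0)
    (h4 : ∀ A B C E, IsCode A → IsCode B → IsCode C → IsCode E → σ.arr .VAL (ix4 A B C E) =
        if ∃ x < S.n, ∃ j < S.q, A = 16 ^ (S.M + x) ∧ B = 16 ^ j ∧ C = 16 ^ x ∧ E = 16 ^ j
        then 1 else 0) {b : ℕ} (hb : S.M ≤ b) (hb' : b ≤ S.M + S.n) :
    ListTable S rep rc b σ ∧ ValTable S rep rc b σ := by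
  obtain ⟨x, rfl⟩ : ∃ x, b = S.M + x := ⟨b - S.M, by omega⟩
  by_cases hx : x < S.n
  · have hl : ∀ j < S.q, σ.arr .PL (ix2 (16 ^ (S.M + x)) (16 ^ j)) = 16 ^ j := by
      intro j hj
      rw [h3, if_pos ⟨hj, x, hx, rfl⟩]
    refine ⟨⟨?_, ?_, ?_⟩, ?_⟩
    · rw [h1 x hx]
      intro j hj
      exact ⟨fun _ => j, fun _ => hj, by rw [hl j hj, handle_single hx]⟩
    · rw [h1 x hx]
      intro Z hZ
      exact ⟨Z x, hZ x, by rw [hl _ (hZ x), handle_single hx]⟩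
    · rw [h1 x hx]
      intro j hj j' hj'
      rw [hl j hj, hl j' hj', pow_inj16]
      exact id
    · intro Z hZ y hy hya i hi
      rw [handle_single hx, h4 _ _ _ _ (isCode_pow _) (isCode_pow _) ⟨_, rfl⟩ (isCode_pow _),
        S.side_single x hx]
      by_cases hxy : S.adj y x
      · have hnb : S.nbr {x} y = {x} := by
          ext z
          rw [CutSystem.mem_nbr, Finset.mem_singleton]
          constructor
          · exact fun h => h.1
          · rintro rfl; exact ⟨rfl, hxy⟩
        -- The value 1 stored in `VAL` is the truncation of the count 1, because d ≥ 1.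
        have hd := S.d_pos
        rw [hnb, CutSystem.cnt, hnb, Finset.filter_singleton]
        by_cases hz : Z x = i
        · rw [if_pos ⟨x, hx, i, hi, rfl, by rw [hz], by simp [code], rfl⟩, if_pos hz]
          simp; omega
        · rw [if_neg, if_neg hz]
          · simp
          · rintro ⟨x', _, j, _, _, e2, _, e4⟩
            exact hz ((pow_inj16.1 e2).trans (pow_inj16.1 e4).symm)
      · have hnb : S.nbr {x} y = ∅ := by
          rw [Finset.eq_empty_iff_forall_notMem]
          intro z hz
          rw [CutSystem.mem_nbr, Finset.mem_singleton] at hz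
          exact hxy (hz.1 ▸ hz.2)
        rw [hnb, CutSystem.cnt, hnb, if_neg]
        · simp
        · rintro ⟨x', _, j, _, _, _, e3, _⟩
          rw [show code ∅ = 0 from rfl] at e3
          exact absurd e3.symm (by positivity)
  · obtain rfl : x = S.n := by omega
    have hno : ∀ j, ¬ (j < S.q ∧ ∃ x < S.n, S.M + S.n = S.M + x) := by
      rintro j ⟨_, x, hx, e⟩; omega
    refine ⟨⟨?_, ?_, ?_⟩, ?_⟩
    · rw [h2]
      intro j hj
      exact ⟨fun _ => 0, fun _ => S.q_pos, by rw [h3, if_neg (hno j), handle_empty]⟩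
    · rw [h2]
      intro Z hZ
      exact ⟨0, by norm_num, by rw [h3, if_neg (hno 0), handle_empty]⟩
    · rw [h2]
      intro j hj j' hj' _
      omega
    · intro Z hZ y hy hya i hi
      rw [handle_empty, h4 _ _ _ _ (isCode_pow _) isCode_zero ⟨_, rfl⟩ (isCode_pow _), if_neg,
        S.side_empty]
      · simp [CutSystem.cnt, CutSystem.nbr]
      · rintro ⟨x, hx, j, _, e, _⟩
        have := pow_inj16.1 e
        omega

end Imp

namespace Imp

open Imp.Cmd Imp.Expr

variable {S : CutSystem} {rep : ℕ → ℕ → ℕ} {rc : ℕ → ℕ}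

/-- The tables of powers, neighbourhoods and representatives. -/
structure Tables (S : CutSystem) (rep : ℕ → ℕ → ℕ) (rc : ℕ → ℕ) (J : ℕ) (σ : Store) : Prop where
  pow : PowTable J σ
  key : KeyTable S σ
  reps : RepTable S rep rc σ

theorem Tables.congr {J : ℕ} {σ τ : Store} (h : Tables S rep rc J σ)
    (h1 : τ.arr .PW = σ.arr .PW) (h2 : τ.arr .KEY = σ.arr .KEY) (h3 : τ.arr .REP = σ.arr .REP)
    (h4 : τ.arr .RC = σ.arr .RC) : Tables S rep rc J τ where
  pow := by unfold PowTable; rw [h1]; exact h.pow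
  key := by unfold KeyTable; rw [h2]; exact h.key
  reps := by unfold RepTable; rw [h3, h4]; exact h.reps

/-- The table of powers is large enough. -/
structure Fits (S : CutSystem) (rc : ℕ → ℕ) (J : ℕ) : Prop where
  lt : S.M + S.n < J
  le : ∀ a < S.M, rc a * S.q * (S.d + 1) ≤ J

/-! ### Profiles of composed sides -/

/-- Computes the profile with handle `h` from the profiles `r1`, `r2`. -/
def valsCmd (q d : ℕ) : Cmd :=
  loop .j .wj (arr .RC Var.pa)
    (assign .py (arr .PW (arr .REP (Expr.ix2 Var.pa Var.wj))) ;;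
     assign .k (arr .KEY (Expr.ix2 Var.pa Var.py)) ;;
     assign .g1 (arr .KEY (Expr.ix2 Var.pb Var.py)) ;;
     assign .g2 (arr .KEY (Expr.ix2 Var.pc Var.py)) ;;
     loop .e .we (lit q)
       (assign .val (arr .VAL (Expr.ix4 Var.pb Var.r1 Var.g1 Var.we) +
          arr .VAL (Expr.ix4 Var.pc Var.r2 Var.g2 Var.we)) ;;
        assign .val (Var.val - (Var.val - lit d)) ;;
        write .VAL (Expr.ix4 Var.pa Var.h Var.k Var.we) Var.val))

-- Profiles are stored only at the neighbourhoods of representatives. The condition `C = 0` in the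
-- frame records that the cells of the empty neighbourhood are never written and so keep their
-- correct value 0.
set_option maxHeartbeats 600000 in
theorem valsCmd_spec (I : ℕ → ℕ) (R : S.Reps rep rc) {J : ℕ} (F : Fits S rc J)
    {σ : Store} (hT : Tables S rep rc J σ)
    {a b c : ℕ} (ha : a < S.M) (hb : b ≤ S.M + S.n) (hc : c ≤ S.M + S.n) (hj : S.Join a b c)
    (hab : b ≠ a) (hac : c ≠ a)
    (hvb : ValTable S rep rc b σ) (hvc : ValTable S rep rc c σ)
    {Z : ℕ → ℕ} (hZ : S.IsLab Z) (h1 : σ.var .pa = 16 ^ a) (h2 : σ.var .pb = 16 ^ b)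
    (h3 : σ.var .pc = 16 ^ c) (h4 : σ.var .r1 = S.handle rep rc b Z)
    (h5 : σ.var .r2 = S.handle rep rc c Z) (h6 : σ.var .h = S.handle rep rc a Z) :
    (∀ t < rc a, ∀ i < S.q, ((valsCmd S.q S.d).run I σ).arr .VAL (ix4 (16 ^ a)
      (S.handle rep rc a Z) (code (S.nbr (S.side a) (rep a t))) (16 ^ i)) =
        min S.d (S.cnt (S.side a) Z (rep a t) i)) ∧
    (∀ A B C E, IsCode A → IsCode B → IsCode C → IsCode E →
      (A ≠ 16 ^ a ∨ B ≠ S.handle rep rc a Z ∨ C = 0) →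
      ((valsCmd S.q S.d).run I σ).arr .VAL (ix4 A B C E) = σ.arr .VAL (ix4 A B C E)) ∧
    (valsCmd S.q S.d).cost I σ ≤ 300 * (rc a * (S.q + 1) + 1) := by
  set H := S.handle rep rc a Z with hH
  have hHc : IsCode H := CutSystem.isCode_handle _ _
  unfold valsCmd
  set B2 := (assign .val (arr .VAL (Expr.ix4 Var.pb Var.r1 Var.g1 Var.we) +
          arr .VAL (Expr.ix4 Var.pc Var.r2 Var.g2 Var.we)) ;;
        assign .val (Var.val - (Var.val - lit S.d)) ;;
        write .VAL (Expr.ix4 Var.pa Var.h Var.k Var.we) Var.val) with hB2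
  set B1 := (assign .py (arr .PW (arr .REP (Expr.ix2 Var.pa Var.wj))) ;;
     assign .k (arr .KEY (Expr.ix2 Var.pa Var.py)) ;;
     assign .g1 (arr .KEY (Expr.ix2 Var.pb Var.py)) ;;
     assign .g2 (arr .KEY (Expr.ix2 Var.pc Var.py)) ;;
     loop .e .we (lit S.q) B2) with hB1
  have L := loop_rule I .j .wj (arr .RC Var.pa) B1 σ (rc a) (100 + S.q * 192)
    (by simp [h1, (hT.reps a ha).1])
    (fun k τ => (∀ t < k, ∀ i < S.q, τ.arr .VAL (ix4 (16 ^ a) H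
        (code (S.nbr (S.side a) (rep a t))) (16 ^ i)) = min S.d (S.cnt (S.side a) Z (rep a t) i)) ∧
      (∀ A B C E, IsCode A → IsCode B → IsCode C → IsCode E → (A ≠ 16 ^ a ∨ B ≠ H ∨ C = 0) →
        τ.arr .VAL (ix4 A B C E) = σ.arr .VAL (ix4 A B C E))) (by simp) ?_
  · refine ⟨L.1.1, L.1.2, ?_⟩
    have := L.2
    simp only [cost_arr, cost_var] at this
    nlinarith [Nat.zero_le (rc a * S.q), Nat.zero_le (rc a)]
  · rintro t ht τ ⟨i1, i2⟩ fv fa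
    have fP : τ.arr .PW = σ.arr .PW := fa _ (by simp [hB1, hB2, arrs])
    have fK : τ.arr .KEY = σ.arr .KEY := fa _ (by simp [hB1, hB2, arrs])
    have fR : τ.arr .REP = σ.arr .REP := fa _ (by simp [hB1, hB2, arrs])
    have fpa : τ.var .pa = 16 ^ a := by rw [fv _ (by simp [hB1, hB2, vars]), h1]
    have fpb : τ.var .pb = 16 ^ b := by rw [fv _ (by simp [hB1, hB2, vars]), h2]
    have fpc : τ.var .pc = 16 ^ c := by rw [fv _ (by simp [hB1, hB2, vars]), h3]
    have fr1 : τ.var .r1 = S.handle rep rc b Z := by rw [fv _ (by simp [hB1, hB2, vars]), h4]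
    have fr2 : τ.var .r2 = S.handle rep rc c Z := by rw [fv _ (by simp [hB1, hB2, vars]), h5]
    have fh : τ.var .h = H := by rw [fv _ (by simp [hB1, hB2, vars]), h6]
    set y := rep a t with hy
    have hyn : y < S.n := R.lt a ha t ht
    have hya : y ∉ S.side a := R.notMem a ha t ht
    have hyb : y ∉ S.side b := fun h => hya (by rw [hj.union]; exact Finset.mem_union_left _ h)
    have hyc : y ∉ S.side c := fun h => hya (by rw [hj.union]; exact Finset.mem_union_right _ h)
    have hPy := hT.pow y (lt_of_lt_of_le hyn (by have := F.lt; omega))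
    set ρ := (assign .py (arr .PW (arr .REP (Expr.ix2 Var.pa Var.wj))) ;;
     assign .k (arr .KEY (Expr.ix2 Var.pa Var.py)) ;;
     assign .g1 (arr .KEY (Expr.ix2 Var.pb Var.py)) ;;
     assign .g2 (arr .KEY (Expr.ix2 Var.pc Var.py))).run I (enter .j .wj t τ) with hρ
    have hRt := (hT.reps a ha).2 t ht
    have ρk : ρ.var .k = code (S.nbr (S.side a) y) := by
      simp [hρ, enter, fP, fK, fR, fpa, hRt, ← hy, hPy, hT.key a (by omega) y hyn]
    have ρg1 : ρ.var .g1 = code (S.nbr (S.side b) y) := by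
      simp [hρ, enter, fP, fK, fR, fpa, fpb, hRt, ← hy, hPy, hT.key b hb y hyn]
    have ρg2 : ρ.var .g2 = code (S.nbr (S.side c) y) := by
      simp [hρ, enter, fP, fK, fR, fpa, fpc, hRt, ← hy, hPy, hT.key c hc y hyn]
    have ρV : ρ.arr = τ.arr := by simp [hρ, enter]
    have L2 := loop_rule I .e .we (lit S.q) B2 ρ S.q 180 (by simp)
      (fun l τ' => (∀ t' < t, ∀ i < S.q, τ'.arr .VAL (ix4 (16 ^ a) H
        (code (S.nbr (S.side a) (rep a t'))) (16 ^ i)) =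
          min S.d (S.cnt (S.side a) Z (rep a t') i)) ∧
        (∀ i < l, τ'.arr .VAL (ix4 (16 ^ a) H (code (S.nbr (S.side a) y)) (16 ^ i)) =
          min S.d (S.cnt (S.side a) Z y i)) ∧
        (∀ A B C E, IsCode A → IsCode B → IsCode C → IsCode E → (A ≠ 16 ^ a ∨ B ≠ H ∨ C = 0) →
        τ'.arr .VAL (ix4 A B C E) = σ.arr .VAL (ix4 A B C E)))
      (by rw [ρV]; exact ⟨i1, by simp, i2⟩) ?_
    · obtain ⟨⟨l1, l2, l3⟩, l4⟩ := L2
      have er : B1.run I (enter .j .wj t τ) = (loop .e .we (lit S.q) B2).run I ρ := rfl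
      rw [er]
      refine ⟨⟨?_, l3⟩, ?_⟩
      · intro t' ht'
        rcases Nat.lt_succ_iff_lt_or_eq.1 ht' with h | rfl
        exacts [l1 t' h, l2]
      · have ec : B1.cost I (enter .j .wj t τ) = (loop .e .we (lit S.q) B2).cost I ρ + 85 := by
          simp only [hB1, cost_seq, cost_assign, cost_arr, cost_ix2, cost_var]
          simp only [hρ, run_seq]
          ring
        rw [ec]
        simp only [cost_lit] at l4
        omega
    · rintro l hl τ' ⟨j1, j2, j3⟩ gv ga
      have gpa : τ'.var .pa = 16 ^ a := by rw [gv _ (by simp [hB2, vars])]; simp [hρ, enter, fpa]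
      have gpb : τ'.var .pb = 16 ^ b := by rw [gv _ (by simp [hB2, vars])]; simp [hρ, enter, fpb]
      have gpc : τ'.var .pc = 16 ^ c := by rw [gv _ (by simp [hB2, vars])]; simp [hρ, enter, fpc]
      have gr1 : τ'.var .r1 = S.handle rep rc b Z := by
        rw [gv _ (by simp [hB2, vars])]; simp [hρ, enter, fr1]
      have gr2 : τ'.var .r2 = S.handle rep rc c Z := by
        rw [gv _ (by simp [hB2, vars])]; simp [hρ, enter, fr2]
      have gh : τ'.var .h = H := by rw [gv _ (by simp [hB2, vars])]; simp [hρ, enter, fh]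
      have gk : τ'.var .k = code (S.nbr (S.side a) y) := by rw [gv _ (by simp [hB2, vars]), ρk]
      have gg1 : τ'.var .g1 = code (S.nbr (S.side b) y) := by rw [gv _ (by simp [hB2, vars]), ρg1]
      have gg2 : τ'.var .g2 = code (S.nbr (S.side c) y) := by rw [gv _ (by simp [hB2, vars]), ρg2]
      have vb := hvb Z hZ y hyn hyb l hl
      have vc := hvc Z hZ y hyn hyc l hl
      -- The profiles of the parts can still be read in the current store, since so far only cells
      -- of row `a` were written.
      rw [← j3 _ _ _ _ (isCode_pow _) (CutSystem.isCode_handle _ _) ⟨_, rfl⟩ (isCode_pow _)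
        (.inl fun h => hab (pow_inj16.1 h))] at vb
      rw [← j3 _ _ _ _ (isCode_pow _) (CutSystem.isCode_handle _ _) ⟨_, rfl⟩ (isCode_pow _)
        (.inl fun h => hac (pow_inj16.1 h))] at vc
      have hv : min S.d (S.cnt (S.side b) Z y l) + min S.d (S.cnt (S.side c) Z y l) -
          (min S.d (S.cnt (S.side b) Z y l) + min S.d (S.cnt (S.side c) Z y l) - S.d) =
            min S.d (S.cnt (S.side a) Z y l) := by
        simp only [hj.cnt]
        omega
      have er : (B2.run I (enter .e .we l τ')).arr .VAL = Function.update (τ'.arr .VAL)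
          (ix4 (16 ^ a) H (code (S.nbr (S.side a) y)) (16 ^ l))
          (min S.d (S.cnt (S.side a) Z y l)) := by
        simp only [hB2, run_seq, run_assign, run_write, enter, Store.var_setVar, Store.arr_setVar,
          Store.arr_setArr, eval_add, eval_sub, eval_var, eval_arr, eval_ix4, eval_lit, reduceCtorEq,
          if_true, if_false, gpa, gpb, gpc, gr1, gr2, gg1, gg2, gk, gh, vb, vc, hv]
      rw [er]
      refine ⟨⟨?_, ?_, ?_⟩, by simp [hB2]⟩
      · intro t' ht' i hi
        rw [update_ix4 (isCode_pow _) hHc ⟨_, rfl⟩ (isCode_pow _) (isCode_pow _) hHc ⟨_, rfl⟩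
          (isCode_pow _), if_neg, j1 t' ht' i hi]
        rintro ⟨-, -, e, -⟩
        have := R.inj a ha t' (by omega) t ht (code_inj.1 e)
        omega
      · intro i hi
        rw [update_ix4 (isCode_pow _) hHc ⟨_, rfl⟩ (isCode_pow _) (isCode_pow _) hHc ⟨_, rfl⟩
          (isCode_pow _)]
        by_cases h : i = l
        · rw [if_pos ⟨rfl, rfl, rfl, by rw [h]⟩, h]
        · rw [if_neg (fun hh => h (pow_inj16.1 hh.2.2.2)), j2 i (by omega)]
      · intro A B C E hA hB hC hE hne
        rw [update_ix4 (isCode_pow _) hHc ⟨_, rfl⟩ (isCode_pow _) hA hB hC hE, if_neg,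
          j3 A B C E hA hB hC hE hne]
        rintro ⟨e1, e2, e3, -⟩
        rcases hne with h | h | h
        · exact h e1
        · exact h e2
        · exact R.nonempty a ha t ht (code_eq_zero.1 (e3.symm.trans h))

/-! ### Lists of handles -/

/-- Puts the handle `h` on the list for side `a`, unless it is there already. -/
def addCmd (q d : ℕ) : Cmd :=
  ite (arr .EX (Expr.ix2 Var.pa Var.h)) skip
    (write .EX (Expr.ix2 Var.pa Var.h) (lit 1) ;;
     write .PL (Expr.ix2 Var.pa Var.plen) Var.h ;;
     assign .len (Var.len + lit 1) ;;
     assign .plen (Var.plen + Var.plen + Var.plen + Var.plen) ;;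
     assign .plen (Var.plen + Var.plen + Var.plen + Var.plen) ;;
     valsCmd q d)

/-- A list of handles for side `a` under construction. -/
structure Building (S : CutSystem) (rep : ℕ → ℕ → ℕ) (rc : ℕ → ℕ) (a : ℕ) (σ : Store) : Prop where
  plen : σ.var .plen = 16 ^ σ.var .len
  sound : ∀ j < σ.var .len, ∃ Z, S.IsLab Z ∧
    σ.arr .PL (ix2 (16 ^ a) (16 ^ j)) = S.handle rep rc a Z ∧
    ∀ t < rc a, ∀ i < S.q, σ.arr .VAL (ix4 (16 ^ a) (S.handle rep rc a Z)
      (code (S.nbr (S.side a) (rep a t))) (16 ^ i)) = min S.d (S.cnt (S.side a) Z (rep a t) i)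
  inj : ∀ j < σ.var .len, ∀ j' < σ.var .len,
    σ.arr .PL (ix2 (16 ^ a) (16 ^ j)) = σ.arr .PL (ix2 (16 ^ a) (16 ^ j')) → j = j'
  ex : ∀ κ, IsCode κ → (σ.arr .EX (ix2 (16 ^ a) κ) ≠ 0 ↔
    ∃ j < σ.var .len, σ.arr .PL (ix2 (16 ^ a) (16 ^ j)) = κ)
  zero : ∀ κ, IsCode κ → ∀ E, IsCode E → σ.arr .VAL (ix4 (16 ^ a) κ 0 E) = 0

/-- Outside of side `a`, the lists, marks and profiles agree. -/
structure SameLists (a : ℕ) (σ τ : Store) : Prop where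
  PL : ∀ a' ≠ a, ∀ j, τ.arr .PL (ix2 (16 ^ a') (16 ^ j)) = σ.arr .PL (ix2 (16 ^ a') (16 ^ j))
  EX : ∀ a' ≠ a, ∀ κ, IsCode κ → τ.arr .EX (ix2 (16 ^ a') κ) = σ.arr .EX (ix2 (16 ^ a') κ)
  VAL : ∀ a' ≠ a, ∀ B C E, IsCode B → IsCode C → IsCode E →
    τ.arr .VAL (ix4 (16 ^ a') B C E) = σ.arr .VAL (ix4 (16 ^ a') B C E)

theorem SameLists.trans {a : ℕ} {σ τ ρ : Store} (h : SameLists a σ τ) (h' : SameLists a τ ρ) :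
    SameLists a σ ρ where
  PL a' ha j := (h'.PL a' ha j).trans (h.PL a' ha j)
  EX a' ha κ hκ := (h'.EX a' ha κ hκ).trans (h.EX a' ha κ hκ)
  VAL a' ha B C E hB hC hE := (h'.VAL a' ha B C E hB hC hE).trans (h.VAL a' ha B C E hB hC hE)

theorem Building.congr {a : ℕ} {σ τ : Store} (h : Building S rep rc a σ)
    (h1 : τ.var .plen = σ.var .plen) (h2 : τ.var .len = σ.var .len) (h3 : τ.arr = σ.arr) :
    Building S rep rc a τ := by
  obtain ⟨i1, i2, i3, i4, i5⟩ := h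
  constructor
  · rw [h1, h2]; exact i1
  · rw [h2, h3]; exact i2
  · rw [h2, h3]; exact i3
  · rw [h2, h3]; exact i4
  · rw [h3]; exact i5

-- `EX` marks the handles already listed, so membership is tested in constant time. A new handle
-- comes with its profile, whose cells no earlier handle of the same side has used.
set_option maxHeartbeats 600000 in
theorem addCmd_spec (I : ℕ → ℕ) (R : S.Reps rep rc) {J : ℕ} (F : Fits S rc J)
    {σ : Store} (hT : Tables S rep rc J σ)
    {a b c : ℕ} (ha : a < S.M) (hb : b ≤ S.M + S.n) (hc : c ≤ S.M + S.n) (hj : S.Join a b c)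
    (hab : b ≠ a) (hac : c ≠ a)
    (hvb : ValTable S rep rc b σ) (hvc : ValTable S rep rc c σ)
    {Z : ℕ → ℕ} (hZ : S.IsLab Z) (h1 : σ.var .pa = 16 ^ a) (h2 : σ.var .pb = 16 ^ b)
    (h3 : σ.var .pc = 16 ^ c) (h4 : σ.var .r1 = S.handle rep rc b Z)
    (h5 : σ.var .r2 = S.handle rep rc c Z) (h6 : σ.var .h = S.handle rep rc a Z)
    (hB : Building S rep rc a σ) :
    Building S rep rc a ((addCmd S.q S.d).run I σ) ∧
    (∃ j < ((addCmd S.q S.d).run I σ).var .len,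
      ((addCmd S.q S.d).run I σ).arr .PL (ix2 (16 ^ a) (16 ^ j)) = S.handle rep rc a Z) ∧
    (∀ κ, (∃ j < σ.var .len, σ.arr .PL (ix2 (16 ^ a) (16 ^ j)) = κ) →
      ∃ j < ((addCmd S.q S.d).run I σ).var .len,
        ((addCmd S.q S.d).run I σ).arr .PL (ix2 (16 ^ a) (16 ^ j)) = κ) ∧
    SameLists a σ ((addCmd S.q S.d).run I σ) ∧
    (addCmd S.q S.d).cost I σ ≤ 500 * (rc a * (S.q + 1) + 1) := by
  set H := S.handle rep rc a Z with hH
  have hHc : IsCode H := CutSystem.isCode_handle _ _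
  set ρ := (write .EX (Expr.ix2 Var.pa Var.h) (lit 1) ;;
     write .PL (Expr.ix2 Var.pa Var.plen) Var.h ;;
     assign .len (Var.len + lit 1) ;;
     assign .plen (Var.plen + Var.plen + Var.plen + Var.plen) ;;
     assign .plen (Var.plen + Var.plen + Var.plen + Var.plen)).run I σ with hρ
  by_cases hex : σ.arr .EX (ix2 (16 ^ a) H) = 0
  swap
  · have er : (addCmd S.q S.d).run I σ = σ := by
      rw [addCmd, run_ite, if_pos (by simpa [h1, h6] using hex), run_skip]
    have ec : (addCmd S.q S.d).cost I σ ≤ 50 := by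
      rw [addCmd, cost_ite, if_pos (by simpa [h1, h6] using hex)]; simp
    rw [er]
    exact ⟨hB, (hB.ex H hHc).1 hex, fun κ h => h, ⟨fun _ _ _ => rfl, fun _ _ _ _ => rfl,
      fun _ _ _ _ _ _ _ _ => rfl⟩, by nlinarith [Nat.zero_le (rc a * (S.q + 1))]⟩
  have hno : ¬ ∃ j < σ.var .len, σ.arr .PL (ix2 (16 ^ a) (16 ^ j)) = H :=
    fun h => (hB.ex H hHc).2 h hex
  have er : (addCmd S.q S.d).run I σ = (valsCmd S.q S.d).run I ρ := by
    rw [addCmd, run_ite, if_neg (by simpa [h1, h6] using hex)]; rfl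
  have ec : (addCmd S.q S.d).cost I σ = (valsCmd S.q S.d).cost I ρ + 87 := by
    rw [addCmd, cost_ite, if_neg (by simpa [h1, h6] using hex)]
    simp only [cost_seq, cost_write, cost_assign, cost_arr, cost_ix2, cost_add, cost_var, cost_lit]
    simp only [hρ, run_seq]
    ring
  set L := σ.var .len with hL
  have ρEX : ρ.arr .EX = Function.update (σ.arr .EX) (ix2 (16 ^ a) H) 1 := by simp [hρ, h1, h6]
  have ρPL : ρ.arr .PL = Function.update (σ.arr .PL) (ix2 (16 ^ a) (16 ^ L)) H := by
    simp [hρ, h1, h6, hB.plen, ← hL]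
  have ρo : ∀ k, k ≠ .EX → k ≠ .PL → ρ.arr k = σ.arr k := by
    intro k hk hk'; simp [hρ, hk, hk']
  have ρv : ∀ v, v ≠ .len → v ≠ .plen → ρ.var v = σ.var v := by
    intro v hv hv'; simp [hρ, hv, hv']
  have ρlen : ρ.var .len = L + 1 := by simp [hρ, ← hL]
  -- The power for the next list position is updated by two quadruplings. The table `PW` would not
  -- do, since a list of handles may be longer than that table.
  have ρplen : ρ.var .plen = 16 ^ (L + 1) := by
    simp [hρ, hB.plen, ← hL, pow_succ]; ring
  have hT' : Tables S rep rc J ρ := hT.congr (ρo _ (by simp) (by simp)) (ρo _ (by simp) (by simp))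
    (ρo _ (by simp) (by simp)) (ρo _ (by simp) (by simp))
  have hV' : ρ.arr .VAL = σ.arr .VAL := ρo _ (by simp) (by simp)
  obtain ⟨v1, v2, v3⟩ := valsCmd_spec I R F hT' ha hb hc hj hab hac
    (hvb.congr fun _ _ _ _ _ _ => by rw [hV']) (hvc.congr fun _ _ _ _ _ _ => by rw [hV']) hZ
    (by rw [ρv _ (by simp) (by simp), h1]) (by rw [ρv _ (by simp) (by simp), h2])
    (by rw [ρv _ (by simp) (by simp), h3]) (by rw [ρv _ (by simp) (by simp), h4])
    (by rw [ρv _ (by simp) (by simp), h5]) (by rw [ρv _ (by simp) (by simp), h6])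
  rw [← hH] at v1 v2
  have hvars : ∀ v, v ∉ (valsCmd S.q S.d).vars → ((valsCmd S.q S.d).run I ρ).var v = ρ.var v :=
    fun v hv => var_run _ _ _ _ hv
  have harrs : ∀ k, k ≠ .VAL → ((valsCmd S.q S.d).run I ρ).arr k = ρ.arr k :=
    fun k hk => arr_run _ _ _ _ (by simp [valsCmd, arrs, hk])
  rw [er, ec]
  have eL : ((valsCmd S.q S.d).run I ρ).var .len = L + 1 := by
    rw [hvars _ (by simp [valsCmd, vars]), ρlen]
  have ePL : ∀ a' j, ((valsCmd S.q S.d).run I ρ).arr .PL (ix2 (16 ^ a') (16 ^ j)) =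
      if a' = a ∧ j = L then H else σ.arr .PL (ix2 (16 ^ a') (16 ^ j)) := by
    intro a' j
    rw [harrs _ (by simp), ρPL, update_ix2_pow]
  have eEX : ∀ a' κ, IsCode κ → ((valsCmd S.q S.d).run I ρ).arr .EX (ix2 (16 ^ a') κ) =
      if a' = a ∧ κ = H then 1 else σ.arr .EX (ix2 (16 ^ a') κ) := by
    intro a' κ hκ
    rw [harrs _ (by simp), ρEX, update_ix2 (isCode_pow _) hHc (isCode_pow _) hκ]
    simp only [pow_inj16]
  have old : ∀ j < L, ((valsCmd S.q S.d).run I ρ).arr .PL (ix2 (16 ^ a) (16 ^ j)) =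
      σ.arr .PL (ix2 (16 ^ a) (16 ^ j)) := fun j hj => by
    rw [ePL, if_neg (by rintro ⟨-, h⟩; omega)]
  have new : ((valsCmd S.q S.d).run I ρ).arr .PL (ix2 (16 ^ a) (16 ^ L)) = H := by
    rw [ePL, if_pos ⟨rfl, rfl⟩]
  have cases : ∀ {t}, t < L + 1 → t < L ∨ t = L := by omega
  refine ⟨⟨?_, ?_, ?_, ?_, ?_⟩, ?_, ?_, ⟨?_, ?_, ?_⟩, ?_⟩
  · rw [eL, hvars _ (by simp [valsCmd, vars]), ρplen]
  · rw [eL]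
    intro j hj'
    rcases cases hj' with hj' | rfl
    · obtain ⟨Z', hZ', e, f⟩ := hB.sound j hj'
      refine ⟨Z', hZ', by rw [old j hj', e], fun t ht i hi => ?_⟩
      rw [v2 _ _ _ _ (isCode_pow _) (CutSystem.isCode_handle _ _) ⟨_, rfl⟩ (isCode_pow _)
        (.inr (.inl fun h => hno ⟨j, hj', e.trans h⟩)), hV']
      exact f t ht i hi
    · exact ⟨Z, hZ, new, v1⟩
  · rw [eL]
    intro j hj1 j' hj2 he
    rcases cases hj1 with hj1 | rfl <;> rcases cases hj2 with hj2 | rfl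
    · rw [old j hj1, old j' hj2] at he; exact hB.inj j hj1 j' hj2 he
    · rw [old j hj1, new] at he; exact absurd ⟨j, hj1, he⟩ hno
    · rw [old j' hj2, new] at he; exact absurd ⟨j', hj2, he.symm⟩ hno
    · rfl
  · intro κ hκ
    rw [eEX a κ hκ, eL]
    by_cases h : κ = H
    · rw [if_pos ⟨rfl, h⟩]
      exact iff_of_true (by norm_num) ⟨L, by omega, by rw [new, h]⟩
    · rw [if_neg (by tauto), hB.ex κ hκ]
      constructor
      · rintro ⟨j, hj', e⟩; exact ⟨j, by omega, by rw [old j hj', e]⟩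
      · rintro ⟨j, hj', e⟩
        rcases cases hj' with hj' | rfl
        · exact ⟨j, hj', by rw [← old j hj', e]⟩
        · exact absurd (e.symm.trans new) h
  · intro κ hκ E hE
    rw [v2 _ _ _ _ (isCode_pow _) hκ isCode_zero hE (.inr (.inr rfl)), hV']
    exact hB.zero κ hκ E hE
  · rw [eL]; exact ⟨L, by omega, new⟩
  · rintro κ ⟨j, hj', e⟩
    rw [eL]; exact ⟨j, by omega, by rw [old j hj', e]⟩
  · intro a' ha' j
    rw [ePL, if_neg (by tauto)]
  · intro a' ha' κ hκ
    rw [eEX a' κ hκ, if_neg (by tauto)]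
  · intro a' ha' B C E hB' hC' hE'
    rw [v2 _ _ _ _ (isCode_pow _) hB' hC' hE' (.inl fun h => ha' (pow_inj16.1 h)), hV']
  · have := v3; omega

end Imp

/-! ### Enumeration of the handles of all sides -/

namespace Imp

open Imp.Cmd Imp.Expr

variable {S : CutSystem} {rep : ℕ → ℕ → ℕ} {rc : ℕ → ℕ} {Q d₁ d₂ : ℕ → ℕ}

theorem SameLists.refl (a : ℕ) (σ : Store) : SameLists a σ σ :=
  ⟨fun _ _ _ => rfl, fun _ _ _ _ => rfl, fun _ _ _ _ _ _ _ _ => rfl⟩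

/-- Adds the handles for side `a` that come from all pairs of handles for the two parts. -/
def pairsCmd (q d : ℕ) : Cmd :=
  loop .j1 .w1 (arr .PC Var.pb)
    (assign .r1 (arr .PL (Expr.ix2 Var.pb Var.w1)) ;;
     loop .j2 .w2 (arr .PC Var.pc)
       (assign .r2 (arr .PL (Expr.ix2 Var.pc Var.w2)) ;; sumCmd q d ;; addCmd q d))

theorem sumCmd_vars (q d : ℕ) : (sumCmd q d).vars =
    [.h, .pos, .st, .sw, .rep, .g1, .g2, .si, .swi, .val, .val, .h, .pos] := rfl

theorem sumCmd_arrs (q d : ℕ) : (sumCmd q d).arrs = [] := rfl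

theorem addCmd_vars (q d : ℕ) : (addCmd q d).vars =
    [.len, .plen, .plen, .j, .wj, .py, .k, .g1, .g2, .e, .we, .val, .val] := rfl

theorem addCmd_arrs (q d : ℕ) : (addCmd q d).arrs = [.EX, .PL, .VAL] := rfl

-- All handles of a composed side arise from pairs of handles of its parts: at most s² pairs, with
-- work W each. Conversely every pair comes from a single labelling, because the parts are disjoint.
set_option maxHeartbeats 1000000 in
theorem pairsCmd_spec (I : ℕ → ℕ) (R : S.Reps rep rc) {J : ℕ} (F : Fits S rc J)
    {σ : Store} (hT : Tables S rep rc J σ)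
    {a b c : ℕ} (ha : a < S.M) (hb : b ≤ S.M + S.n) (hc : c ≤ S.M + S.n) (hj : S.Join a b c)
    (hab : b ≠ a) (hac : c ≠ a)
    (hvb : ValTable S rep rc b σ) (hvc : ValTable S rep rc c σ)
    (hlb : ListTable S rep rc b σ) (hlc : ListTable S rep rc c σ)
    (h1 : σ.var .pa = 16 ^ a) (h2 : σ.var .pb = 16 ^ b) (h3 : σ.var .pc = 16 ^ c)
    (g1 : σ.var .sa = 16 ^ a) (g2 : σ.var .sb = 16 ^ b) (g3 : σ.var .sc = 16 ^ c)
    (hB : Building S rep rc a σ) {s W : ℕ} (hs : FewHandles S rep rc s)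
    (hW : rc a * (S.q + 1) + 1 ≤ W) :
    Building S rep rc a ((pairsCmd S.q S.d).run I σ) ∧
    (∀ Z, S.IsLab Z → ∃ j < ((pairsCmd S.q S.d).run I σ).var .len,
      ((pairsCmd S.q S.d).run I σ).arr .PL (ix2 (16 ^ a) (16 ^ j)) = S.handle rep rc a Z) ∧
    SameLists a σ ((pairsCmd S.q S.d).run I σ) ∧
    (pairsCmd S.q S.d).cost I σ ≤ 14 + s * (45 + s * (800 * W)) := by
  unfold pairsCmd
  set B2 := (assign .r2 (arr .PL (Expr.ix2 Var.pc Var.w2)) ;; sumCmd S.q S.d ;; addCmd S.q S.d)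
    with hB2
  set B1 := (assign .r1 (arr .PL (Expr.ix2 Var.pb Var.w1)) ;; loop .j2 .w2 (arr .PC Var.pc) B2)
    with hB1
  have B2v : B2.vars = .r2 :: ((sumCmd S.q S.d).vars ++ (addCmd S.q S.d).vars) := rfl
  have B2a : B2.arrs = [.EX, .PL, .VAL] := rfl
  have B1v : B1.vars = .r1 :: .j2 :: .w2 :: B2.vars := rfl
  have B1a : B1.arrs = [.EX, .PL, .VAL] := rfl
  have hsb := hlb.le hs hb
  have hsc := hlc.le hs hc
  have L := loop_rule I .j1 .w1 (arr .PC Var.pb) B1 σ (σ.arr .PC (16 ^ b)) (33 + s * (800 * W))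
    (by simp [h2])
    (fun k τ => Building S rep rc a τ ∧ SameLists a σ τ ∧
      ∀ Z, S.IsLab Z → (∃ t < k, σ.arr .PL (ix2 (16 ^ b) (16 ^ t)) = S.handle rep rc b Z) →
        ∃ j < τ.var .len, τ.arr .PL (ix2 (16 ^ a) (16 ^ j)) = S.handle rep rc a Z)
    ⟨hB, SameLists.refl a σ, by simp⟩ ?_
  · obtain ⟨⟨i1, i2, i3⟩, i4⟩ := L
    refine ⟨i1, fun Z hZ => i3 Z hZ (hlb.complete Z hZ), i2, i4.trans ?_⟩
    simp only [cost_arr, cost_var]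
    calc _ ≤ 14 + s * (33 + s * (800 * W) + 12) := by gcongr
      _ = _ := by ring
  · rintro k hk τ ⟨i1, i2, i3⟩ fv fa
    have fa' : ∀ x, x ≠ .EX → x ≠ .PL → x ≠ .VAL → τ.arr x = σ.arr x := fun x hx hx' hx'' =>
      fa x (by simp [B1a, hx, hx', hx''])
    have fPC : τ.arr .PC = σ.arr .PC := fa' _ (by simp) (by simp) (by simp)
    have fv' : ∀ x, x ∉ (.j1 :: .w1 :: B1.vars : List Var) → τ.var x = σ.var x := fv
    obtain ⟨X, hX, eX⟩ := hlb.sound k hk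
    set ρ := (assign .r1 (arr .PL (Expr.ix2 Var.pb Var.w1))).run I (enter .j1 .w1 k τ) with hρ
    have ρa : ρ.arr = τ.arr := rfl
    have ρv : ∀ x, x ≠ .j1 → x ≠ .w1 → x ≠ .r1 → ρ.var x = τ.var x := by
      intro x h1 h2 h3; simp [hρ, enter, h1, h2, h3]
    have ρr : ρ.var .r1 = S.handle rep rc b X := by
      have : τ.var .pb = 16 ^ b := by
        rw [fv' _ (by simp [B1v, B2v, sumCmd_vars, addCmd_vars]), h2]
      simp [hρ, enter, this, i2.PL b hab, eX]
    have er : B1.run I (enter .j1 .w1 k τ) = (loop .j2 .w2 (arr .PC Var.pc) B2).run I ρ := rfl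
    have ec : B1.cost I (enter .j1 .w1 k τ) = 19 + (loop .j2 .w2 (arr .PC Var.pc) B2).cost I ρ := rfl
    have kv : ∀ x, x ∉ (.j1 :: .w1 :: B1.vars : List Var) → ρ.var x = σ.var x := by
      intro x hx
      rw [ρv x (fun h => hx (by simp [h])) (fun h => hx (by simp [h]))
        (fun h => hx (by simp [h, B1v])), fv' x hx]
    have L2 := loop_rule I .j2 .w2 (arr .PC Var.pc) B2 ρ (σ.arr .PC (16 ^ c)) (730 * W)
      (by simp [ρa, fPC, kv .pc (by simp [B1v, B2v, sumCmd_vars, addCmd_vars]), h3])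
      (fun l τ' => Building S rep rc a τ' ∧ SameLists a σ τ' ∧
        (∀ Z, S.IsLab Z → (∃ t < k, σ.arr .PL (ix2 (16 ^ b) (16 ^ t)) = S.handle rep rc b Z) →
          ∃ j < τ'.var .len, τ'.arr .PL (ix2 (16 ^ a) (16 ^ j)) = S.handle rep rc a Z) ∧
        ∀ Z, S.IsLab Z → S.handle rep rc b X = S.handle rep rc b Z →
          (∃ t < l, σ.arr .PL (ix2 (16 ^ c) (16 ^ t)) = S.handle rep rc c Z) →
          ∃ j < τ'.var .len, τ'.arr .PL (ix2 (16 ^ a) (16 ^ j)) = S.handle rep rc a Z)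
      ⟨i1.congr (ρv _ (by simp) (by simp) (by simp)) (ρv _ (by simp) (by simp) (by simp)) ρa,
        ⟨i2.PL, i2.EX, i2.VAL⟩, by
          rw [ρv _ (by simp) (by simp) (by simp), ρa]; exact i3, by simp⟩ ?_
    · obtain ⟨⟨l1, l2, l3, l4⟩, l5⟩ := L2
      rw [er, ec]
      refine ⟨⟨l1, l2, ?_⟩, ?_⟩
      · rintro Z hZ ⟨t, ht, e⟩
        rcases Nat.lt_succ_iff_lt_or_eq.1 ht with ht | rfl
        · exact l3 Z hZ ⟨t, ht, e⟩
        · exact l4 Z hZ (eX.symm.trans e) (hlc.complete Z hZ)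
      · have : σ.arr .PC (16 ^ c) * (730 * W + 12) ≤ s * (800 * W) := by
          gcongr
          omega
        simp only [cost_arr, cost_var] at l5
        omega
    · rintro l hl τ' ⟨j1, j2, j3, j4⟩ gv ga
      have ga' : ∀ x, x ≠ .EX → x ≠ .PL → x ≠ .VAL → τ'.arr x = σ.arr x := fun x hx hx' hx'' => by
        rw [ga x (by simp [B2a, hx, hx', hx'']), ρa, fa' x hx hx' hx'']
      have gv' : ∀ x, x ∉ (.j1 :: .w1 :: B1.vars : List Var) → τ'.var x = σ.var x := by
        intro x hx
        rw [← kv x hx]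
        apply gv
        intro h
        apply hx
        rw [B1v]
        change x ∈ (.j2 :: .w2 :: B2.vars : List Var) at h
        simp only [List.mem_cons] at h ⊢
        tauto
      obtain ⟨Y, hY, eY⟩ := hlc.sound l hl
      -- The two handles come from unrelated labellings `X` and `Y`; `Z` carries both at once, as
      -- `sumCmd_spec` requires.
      obtain ⟨Z, hZ, zb, zc⟩ := CutSystem.merge hj.disj hX hY
      have hZb : S.handle rep rc b Z = S.handle rep rc b X := CutSystem.handle_congr zb
      have hZc : S.handle rep rc c Z = S.handle rep rc c Y :=
        CutSystem.handle_congr fun x hx => zc x (Finset.disjoint_right.1 hj.disj hx)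
      set π := (assign .r2 (arr .PL (Expr.ix2 Var.pc Var.w2))).run I (enter .j2 .w2 l τ') with hπ
      have πa : π.arr = τ'.arr := rfl
      have πv : ∀ x, x ≠ .j2 → x ≠ .w2 → x ≠ .r2 → π.var x = τ'.var x := by
        intro x h1 h2 h3; simp [hπ, enter, h1, h2, h3]
      have πr : π.var .r2 = S.handle rep rc c Z := by
        have : τ'.var .pc = 16 ^ c := by
          rw [gv' _ (by simp [B1v, B2v, sumCmd_vars, addCmd_vars]), h3]
        simp [hπ, enter, this, j2.PL c hac, eY, hZc]
      have πr1 : π.var .r1 = S.handle rep rc b Z := by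
        rw [πv _ (by simp) (by simp) (by simp), gv _ (by
          simp [vars, B2v, sumCmd_vars, addCmd_vars]), ρr, hZb]
      have πkv : ∀ x, x ∉ (.j1 :: .w1 :: B1.vars : List Var) → π.var x = σ.var x := by
        intro x hx
        rw [πv x (fun h => hx (by simp [h, B1v])) (fun h => hx (by simp [h, B1v]))
          (fun h => hx (by simp [h, B1v, B2v])), gv' x hx]
      have Tπ : Tables S rep rc J π := by
        apply hT.congr <;> rw [πa] <;> exact ga' _ (by simp) (by simp) (by simp)
      have Vb : ValTable S rep rc b π := hvb.congr (j2.VAL b hab)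
      have Vc : ValTable S rep rc c π := hvc.congr (j2.VAL c hac)
      have hFl := F.lt
      obtain ⟨s1, s2⟩ := sumCmd_spec I R Tπ.pow Tπ.key Tπ.reps ha hb hc hj Vb Vc (by omega) (F.le a ha)
        hZ (by rw [πkv _ (by simp [B1v, B2v, sumCmd_vars, addCmd_vars]), g1])
        (by rw [πkv _ (by simp [B1v, B2v, sumCmd_vars, addCmd_vars]), g2])
        (by rw [πkv _ (by simp [B1v, B2v, sumCmd_vars, addCmd_vars]), g3]) πr1 πr
      set π' := (sumCmd S.q S.d).run I π with hπ'
      have π'a : π'.arr = τ'.arr := by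
        rw [← πa]; funext x; exact arr_run _ _ _ _ (by simp [sumCmd_arrs])
      have π'v : ∀ x, x ∉ (sumCmd S.q S.d).vars → π'.var x = π.var x := fun x hx => var_run _ _ _ _ hx
      have π'kv : ∀ x, x ∉ (.j1 :: .w1 :: B1.vars : List Var) → π'.var x = σ.var x := by
        intro x hx
        rw [π'v x (fun h => hx (by simp [h, B1v, B2v])), πkv x hx]
      have hB' : Building S rep rc a π' := j1.congr
        (by rw [π'v _ (by simp [sumCmd_vars]), πv _ (by simp) (by simp) (by simp)])
        (by rw [π'v _ (by simp [sumCmd_vars]), πv _ (by simp) (by simp) (by simp)]) π'a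
      have elen : π'.var .len = τ'.var .len := by
        rw [π'v _ (by simp [sumCmd_vars]), πv _ (by simp) (by simp) (by simp)]
      have Tπ' : Tables S rep rc J π' := by
        apply hT.congr <;> rw [π'a] <;> exact ga' _ (by simp) (by simp) (by simp)
      obtain ⟨t1, t2, t3, t4, t5⟩ := addCmd_spec I R F Tπ' ha hb hc hj hab hac
        (Vb.congr fun _ _ _ _ _ _ => by rw [π'a, πa]) (Vc.congr fun _ _ _ _ _ _ => by rw [π'a, πa]) hZ
        (by rw [π'kv _ (by simp [B1v, B2v, sumCmd_vars, addCmd_vars]), h1])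
        (by rw [π'kv _ (by simp [B1v, B2v, sumCmd_vars, addCmd_vars]), h2])
        (by rw [π'kv _ (by simp [B1v, B2v, sumCmd_vars, addCmd_vars]), h3])
        (by rw [π'v _ (by simp [sumCmd_vars]), πr1]) (by rw [π'v _ (by simp [sumCmd_vars]), πr])
        s1 hB'
      have er2 : B2.run I (enter .j2 .w2 l τ') = (addCmd S.q S.d).run I π' := rfl
      have ec2 : B2.cost I (enter .j2 .w2 l τ') =
        19 + ((sumCmd S.q S.d).cost I π + (addCmd S.q S.d).cost I π') := rfl
      rw [er2, ec2]
      rw [elen, π'a] at t3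
      refine ⟨⟨t1, ?_, ?_, ?_⟩, by omega⟩
      · refine j2.trans ⟨?_, ?_, ?_⟩
        · intro a' ha'; rw [← π'a]; exact t4.PL a' ha'
        · intro a' ha'; rw [← π'a]; exact t4.EX a' ha'
        · intro a' ha'; rw [← π'a]; exact t4.VAL a' ha'
      · intro Z' hZ' ht; exact t3 _ (j3 Z' hZ' ht)
      · rintro Z' hZ' e1 ⟨t, ht, e2⟩
        rcases Nat.lt_succ_iff_lt_or_eq.1 ht with ht | rfl
        · exact t3 _ (j4 Z' hZ' e1 ⟨t, ht, e2⟩)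
        -- Any labelling with the current pair of handles has the handle just added, even if it
        -- differs from `Z` as a labelling.
        · rw [← hj.handle_eq R ha hb hc (hZb.trans e1) (hZc.trans (eY.symm.trans e2))]
          exact t2

/-- Computes lists of handles, and their profiles, for all sides. -/
def listsCmd (q d : ℕ) : Cmd :=
  atomListCmd q ;;
  loop .i .wi Var.M
    (fetchCmd ;; assign .len (lit 0) ;; assign .plen (lit 1) ;; assign .sa Var.pa ;;
     assign .sb Var.pb ;; assign .sc Var.pc ;; pairsCmd q d ;; write .PC Var.pa Var.len)

/-- From representatives to all outer vertices: equal neighbourhoods give equal counts, the empty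
neighbourhood is read from the cells with code 0, and labellings with equal handles have equal
profiles. -/
theorem Building.valTable (R : S.Reps rep rc) {a : ℕ} (ha : a < S.M) {σ : Store}
    (hB : Building S rep rc a σ)
    (hc : ∀ Z, S.IsLab Z → ∃ j < σ.var .len,
      σ.arr .PL (ix2 (16 ^ a) (16 ^ j)) = S.handle rep rc a Z) : ValTable S rep rc a σ := by
  intro Z hZ y hy hya i hi
  by_cases hne : S.nbr (S.side a) y = ∅
  · rw [hne, show code ∅ = 0 from rfl, hB.zero _ (CutSystem.isCode_handle _ _) _ (isCode_pow _)]
    simp [CutSystem.cnt, hne]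
  · obtain ⟨t, ht, e⟩ := R.cover a ha y hy hya hne
    obtain ⟨j, hj, ej⟩ := hc Z hZ
    obtain ⟨Z', hZ', e', f⟩ := hB.sound j hj
    rw [← e, ← ej, e', f t ht i hi, ← CutSystem.cnt_eq_of_nbr e]
    exact (R.handle_eq_iff ha).1 (e'.symm.trans ej) _ (R.lt a ha t ht) (R.notMem a ha t ht) i hi

-- Lists are built along the schedule, with the appended sides as start. The cost is quadratic in
-- the number of handles; only the partial solutions are cubic.
set_option maxHeartbeats 1000000 in
theorem listsCmd_spec (I : ℕ → ℕ) (R : S.Reps rep rc) {J : ℕ} (F : Fits S rc J)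
    (h : Schedule S Q d₁ d₂) {σ : Store} (hT : Tables S rep rc J σ)
    (hQ : SchedTable S Q d₁ d₂ σ) (hn : σ.var .n = S.n) (hM : σ.var .M = S.M)
    (hL : ∀ i, σ.arr .PL i = 0) (hV : ∀ i, σ.arr .VAL i = 0) (hE : ∀ i, σ.arr .EX i = 0)
    {s W : ℕ} (hs : FewHandles S rep rc s) (hs1 : 1 ≤ s)
    (hW : ∀ a < S.M, rc a * (S.q + 1) + 1 ≤ W) :
    (∀ b ≤ S.M + S.n, ListTable S rep rc b ((listsCmd S.q S.d).run I σ) ∧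
      ValTable S rep rc b ((listsCmd S.q S.d).run I σ)) ∧
    (listsCmd S.q S.d).cost I σ ≤ 300 * (S.n * (S.q + 1) + 1) + 2000 * (S.M * (s * s * W)) := by
  obtain ⟨⟨p1, p1'⟩, p2, p3, p4⟩ := atomListCmd_spec I hT.pow F.lt hn hM hL hV
  set σ1 := (atomListCmd S.q).run I σ with hσ1
  have va : ∀ v, v ∉ (atomListCmd S.q).vars → σ1.var v = σ.var v := fun v hv => var_run _ _ _ _ hv
  have aa : ∀ k, k ≠ .PC → k ≠ .PL → k ≠ .VAL → σ1.arr k = σ.arr k :=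
    fun k hk hk' hk'' => arr_run _ _ _ _ (by simp [atomListCmd, arrs, hk, hk', hk''])
  set B := (fetchCmd ;; assign .len (lit 0) ;; assign .plen (lit 1) ;; assign .sa Var.pa ;;
     assign .sb Var.pb ;; assign .sc Var.pc ;; pairsCmd S.q S.d ;; write .PC Var.pa Var.len) with hB
  have Ba : B.arrs = [.EX, .PL, .VAL, .PC] := rfl
  have L := loop_rule I .i .wi Var.M B σ1 S.M (200 + s * (45 + s * (800 * W)))
    (by rw [eval_var, va _ (by simp [atomListCmd, vars]), hM])
    (fun i τ => (∀ b, Ready S Q i b → ListTable S rep rc b τ ∧ ValTable S rep rc b τ) ∧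
      (∀ a < S.M, ¬ Ready S Q i a → (∀ κ, IsCode κ → τ.arr .EX (ix2 (16 ^ a) κ) = 0) ∧
        ∀ B C E, IsCode B → IsCode C → IsCode E → τ.arr .VAL (ix4 (16 ^ a) B C E) = 0)) ?_ ?_
  · refine ⟨fun b hb => L.1.1 b (h.ready_all hb), ?_⟩
    have ec : (listsCmd S.q S.d).cost I σ =
      (atomListCmd S.q).cost I σ + (loop .i .wi Var.M B).cost I σ1 := rfl
    rw [ec]
    have hcost := L.2
    simp only [cost_var] at hcost
    by_cases hM0 : S.M = 0
    · rw [hM0] at hcost ⊢; simp only [zero_mul] at hcost ⊢; omega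
    · have hW1 : 1 ≤ W := by have := hW 0 (by omega); omega
      have : 200 + s * (45 + s * (800 * W)) + 12 ≤ 2000 * (s * s * W) := by
        have e1 : 1 ≤ s * s * W := Nat.mul_pos (Nat.mul_pos hs1 hs1) hW1
        have e2 : s ≤ s * s * W := by
          calc s = s * 1 * 1 := by ring
            _ ≤ _ := by gcongr
        calc _ = 212 + 45 * s + 800 * (s * s * W) := by ring
          _ ≤ _ := by omega
      calc _ ≤ 200 * (S.n * (S.q + 1) + 1) + (2 + 3 + S.M * (2000 * (s * s * W))) := by
            refine Nat.add_le_add p4 (hcost.trans ?_)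
            gcongr
        _ ≤ _ := by
            have : S.M * (2000 * (s * s * W)) = 2000 * (S.M * (s * s * W)) := by ring
            omega
  · refine ⟨?_, ?_⟩
    · rintro b (⟨hb, hb'⟩ | ⟨j, hj, -⟩)
      · exact atom_tables p1 p1' p2 p3 hb hb'
      · omega
    · intro a ha _
      refine ⟨fun κ _ => by rw [aa _ (by simp) (by simp) (by simp)]; exact hE _, ?_⟩
      intro B C E hB hC hE
      rw [p3 _ _ _ _ (isCode_pow _) hB hC hE, if_neg]
      rintro ⟨x, -, j, -, e, -⟩
      have := pow_inj16.1 e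
      omega
  · rintro i hi τ ⟨i1, i2⟩ fv fa
    have fa' : ∀ k, k ≠ .EX → k ≠ .PL → k ≠ .VAL → k ≠ .PC → τ.arr k = σ.arr k := by
      intro k h1 h2 h3 h4
      rw [fa k (by simp [Ba, h1, h2, h3, h4]), aa k h4 h2 h3]
    have Tτ : Tables S rep rc J (enter .i .wi i τ) := by
      apply hT.congr <;> exact fa' _ (by simp) (by simp) (by simp) (by simp)
    have Qτ : SchedTable S Q d₁ d₂ (enter .i .wi i τ) := by
      have e1 : (enter .i .wi i τ).arr .QUE = σ.arr .QUE := fa' _ (by simp) (by simp) (by simp) (by simp)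
      have e2 : (enter .i .wi i τ).arr .D1 = σ.arr .D1 := fa' _ (by simp) (by simp) (by simp) (by simp)
      have e3 : (enter .i .wi i τ).arr .D2 = σ.arr .D2 := fa' _ (by simp) (by simp) (by simp) (by simp)
      unfold SchedTable; rw [e1, e2, e3]; exact hQ
    obtain ⟨f1, f2, f3, f4, f5, f6, f7, f8⟩ := fetchCmd_spec I h F.lt Tτ.pow Qτ hi (by simp [enter])
    set a := Q i with haQ
    set b := d₁ a with hbQ
    set c := d₂ a with hcQ
    have ha : a < S.M := h.lt i hi
    have rb : Ready S Q i b := h.ready₁ i hi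
    have rcc : Ready S Q i c := h.ready₂ i hi
    have hb := h.ready_le hi.le rb
    have hc := h.ready_le hi.le rcc
    have hab : b ≠ a := h.ready_ne hi rb
    have hac : c ≠ a := h.ready_ne hi rcc
    have hna : ¬ Ready S Q i a := h.not_ready_self hi
    set ρ := (fetchCmd ;; assign .len (lit 0) ;; assign .plen (lit 1) ;; assign .sa Var.pa ;;
     assign .sb Var.pb ;; assign .sc Var.pc).run I (enter .i .wi i τ) with hρ
    have ρa : ρ.arr = τ.arr := f1
    have Tρ : Tables S rep rc J ρ := by
      apply hT.congr <;> rw [ρa] <;> exact fa' _ (by simp) (by simp) (by simp) (by simp)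
    have ρlen : ρ.var .len = 0 := by simp [hρ]
    obtain ⟨z1, z2⟩ := i2 a ha hna
    have hBρ : Building S rep rc a ρ := by
      refine ⟨by simp [hρ], ?_, ?_, ?_, ?_⟩
      · intro j hj; omega
      · intro j hj; omega
      · intro κ hκ
        rw [ρa, z1 κ hκ, ρlen]
        simp
      · intro κ hκ E hE
        rw [ρa]; exact z2 _ _ _ hκ isCode_zero hE
    obtain ⟨q1, q2, q3, q4⟩ := pairsCmd_spec I R F Tρ ha hb hc (h.join a ha) hab hac
      ((i1 b rb).2.congr fun _ _ _ _ _ _ => by rw [ρa])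
      ((i1 c rcc).2.congr fun _ _ _ _ _ _ => by rw [ρa])
      ((i1 b rb).1.congr (by rw [ρa]) fun _ => by rw [ρa])
      ((i1 c rcc).1.congr (by rw [ρa]) fun _ => by rw [ρa])
      (by simp [hρ, f5]) (by simp [hρ, f6]) (by simp [hρ, f7]) (by simp [hρ, f5]) (by simp [hρ, f6])
      (by simp [hρ, f7]) hBρ hs (hW a ha)
    set π := (pairsCmd S.q S.d).run I ρ with hπ
    have πpa : π.var .pa = 16 ^ a := by
      rw [var_run _ _ _ _ (by simp [pairsCmd, vars, sumCmd_vars, addCmd_vars])]; simp [hρ, f5]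
    have πPC : π.arr .PC = τ.arr .PC := by
      rw [arr_run _ _ _ _ (by simp [pairsCmd, arrs, sumCmd_arrs, addCmd_arrs]), ρa]
    have er : B.run I (enter .i .wi i τ) = π.setArr .PC (16 ^ a) (π.var .len) := by
      rw [← πpa]; rfl
    have ec : B.cost I (enter .i .wi i τ) = fetchCmd.cost I (enter .i .wi i τ) +
        (3 + (3 + (4 + (4 + (4 + ((pairsCmd S.q S.d).cost I ρ + 13)))))) := rfl
    rw [er, ec]
    set υ := π.setArr .PC (16 ^ a) (π.var .len) with hυ
    have υo : ∀ k, k ≠ .PC → υ.arr k = π.arr k := by intro k hk; simp [hυ, hk]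
    have υPC : υ.arr .PC = Function.update (τ.arr .PC) (16 ^ a) (π.var .len) := by simp [hυ, πPC]
    refine ⟨⟨?_, ?_⟩, by omega⟩
    · intro b' hb'
      by_cases hb'a : b' = a
      · subst hb'a
        refine ⟨⟨?_, ?_, ?_⟩, (q1.valTable R ha q2).congr fun _ _ _ _ _ _ => by
          rw [υo _ (by simp)]⟩
        · rw [υPC, Function.update_self, υo _ (by simp)]
          intro j hj
          obtain ⟨Z, hZ, e, -⟩ := q1.sound j hj
          exact ⟨Z, hZ, e⟩
        · rw [υPC, Function.update_self, υo _ (by simp)]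
          exact q2
        · rw [υPC, Function.update_self, υo _ (by simp)]
          exact q1.inj
      · have hr := (Schedule.ready_succ hb').resolve_right hb'a
        refine ⟨(i1 b' hr).1.congr ?_ ?_, (i1 b' hr).2.congr ?_⟩
        · rw [υPC, Function.update_of_ne (fun h => hb'a (pow_inj16.1 h))]
        · intro j
          rw [υo _ (by simp), q3.PL b' hb'a, ρa]
        · intro B C E hB hC hE
          rw [υo _ (by simp), q3.VAL b' hb'a B C E hB hC hE, ρa]
    · intro a' ha' hr'
      have hne : a' ≠ a := by
        rintro rfl
        exact hr' (.inr ⟨i, by omega, rfl⟩)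
      have hr : ¬ Ready S Q i a' := fun hr => hr' (Schedule.ready_mono hr)
      obtain ⟨y1, y2⟩ := i2 a' ha' hr
      refine ⟨?_, ?_⟩
      · intro κ hκ
        rw [υo _ (by simp), q3.EX a' hne κ hκ, ρa, y1 κ hκ]
      · intro B C E hB hC hE
        rw [υo _ (by simp), q3.VAL a' hne B C E hB hC hE, ρa, y2 B C E hB hC hE]

end Imp

/-! ### Nested loops, and the tests for partial solutions -/

namespace Imp

open Imp.Cmd Imp.Expr

namespace Cmd

/-- `τ` differs from `σ` at most in the variables `V` and the arrays `A`. -/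
def Frame (V : List Var) (A : List Arr) (σ τ : Store) : Prop :=
  (∀ x, x ∉ V → τ.var x = σ.var x) ∧ ∀ k, k ∉ A → τ.arr k = σ.arr k

theorem Frame.trans {V : List Var} {A : List Arr} {σ τ ρ : Store} (h : Frame V A σ τ)
    (h' : Frame V A τ ρ) : Frame V A σ ρ :=
  ⟨fun x hx => (h'.1 x hx).trans (h.1 x hx), fun k hk => (h'.2 k hk).trans (h.2 k hk)⟩

theorem Frame.enter {V : List Var} {A : List Arr} (σ : Store) {v w : Var} (hv : v ∈ V) (hw : w ∈ V)
    (i : ℕ) : Frame V A σ (enter v w i σ) := by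
  refine ⟨fun x hx => ?_, fun _ _ => rfl⟩
  simp only [Cmd.enter, Store.var_setVar]
  rw [if_neg (by rintro rfl; exact hx hw), if_neg (by rintro rfl; exact hx hv)]

/-- The rule for three nested loops; `Inv D` is the invariant after the rounds in `D`. -/
theorem loop3_rule (I : ℕ → ℕ) (v₁ w₁ v₂ w₂ v₃ w₃ : Var) (e₁ e₂ e₃ : Expr) (c : Cmd) (σ : Store)
    (N₁ N₂ N₃ B : ℕ) (hnd : [v₁, w₁, v₂, w₂, v₃, w₃].Nodup)
    (hdis : ∀ v ∈ [v₁, w₁, v₂, w₂, v₃, w₃], v ∉ c.vars)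
    (h₁ : e₁.eval I σ = N₁)
    (h₂ : ∀ τ, Frame (v₁ :: w₁ :: v₂ :: w₂ :: v₃ :: w₃ :: c.vars) c.arrs σ τ → e₂.eval I τ = N₂)
    (h₃ : ∀ τ, Frame (v₁ :: w₁ :: v₂ :: w₂ :: v₃ :: w₃ :: c.vars) c.arrs σ τ → e₃.eval I τ = N₃)
    (Inv : Set (ℕ × ℕ × ℕ) → Store → Prop) (h0 : Inv ∅ σ)
    (hinv : ∀ D τ x, ∀ v ∈ [v₁, w₁, v₂, w₂, v₃, w₃], Inv D τ → Inv D (τ.setVar v x))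
    (step : ∀ i < N₁, ∀ j < N₂, ∀ k < N₃, ∀ D τ, Inv D τ →
      Frame (v₁ :: w₁ :: v₂ :: w₂ :: v₃ :: w₃ :: c.vars) c.arrs σ τ →
      τ.var w₁ = 16 ^ i → τ.var w₂ = 16 ^ j → τ.var w₃ = 16 ^ k →
      Inv (insert (i, j, k) D) (c.run I τ) ∧ c.cost I τ ≤ B) :
    Inv {p | p.1 < N₁ ∧ p.2.1 < N₂ ∧ p.2.2 < N₃}
        ((loop v₁ w₁ e₁ (loop v₂ w₂ e₂ (loop v₃ w₃ e₃ c))).run I σ) ∧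
      (loop v₁ w₁ e₁ (loop v₂ w₂ e₂ (loop v₃ w₃ e₃ c))).cost I σ ≤
        e₁.cost + 3 + N₁ * (e₂.cost + 3 + N₂ * (e₃.cost + 3 + N₃ * (B + 12) + 12) + 12) := by
  set V := v₁ :: w₁ :: v₂ :: w₂ :: v₃ :: w₃ :: c.vars with hV
  have henter : ∀ D τ v w i, v ∈ [v₁, w₁, v₂, w₂, v₃, w₃] → w ∈ [v₁, w₁, v₂, w₂, v₃, w₃] →
      Inv D τ → Inv D (enter v w i τ) := fun D τ v w i hv hw h => hinv _ _ _ _ hw (hinv _ _ _ _ hv h)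
  simp only [List.nodup_cons, List.mem_cons, List.not_mem_nil, not_or, not_false_eq_true,
    List.nodup_nil, or_false, and_true] at hnd
  have hdis1 := hdis w₁ (by simp)
  have hdis2 := hdis w₂ (by simp)
  have L := loop_rule I v₁ w₁ e₁ (loop v₂ w₂ e₂ (loop v₃ w₃ e₃ c)) σ N₁
    (e₂.cost + 3 + N₂ * (e₃.cost + 3 + N₃ * (B + 12) + 12)) h₁
    (fun i τ => Inv {p | p.1 < i ∧ p.2.1 < N₂ ∧ p.2.2 < N₃} τ) (by simpa using h0) ?_
  · exact L
  intro i hi τ hτ fv fa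
  have Fτ : Frame V c.arrs σ (enter v₁ w₁ i τ) :=
    Frame.trans ⟨fun x hx => fv x (by simpa [vars, hV] using hx), fun k hk => fa k (by simpa [arrs] using hk)⟩
      (Frame.enter τ (by simp [hV]) (by simp [hV]) i)
  -- The triples treated so far are those that precede the current round lexicographically.
  have M := loop_rule I v₂ w₂ e₂ (loop v₃ w₃ e₃ c) (enter v₁ w₁ i τ) N₂
    (e₃.cost + 3 + N₃ * (B + 12)) (h₂ _ Fτ)
    (fun j τ => Inv {p | (p.1 < i ∧ p.2.1 < N₂ ∨ p.1 = i ∧ p.2.1 < j) ∧ p.2.2 < N₃} τ)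
    (by simpa [and_assoc] using henter _ _ v₁ w₁ i (by simp) (by simp) hτ) ?_
  · refine ⟨?_, M.2⟩
    convert M.1 using 1
    ext ⟨a, b, k⟩
    simp only [Set.mem_ofPred_eq]
    omega
  intro j hj ρ hρ gv ga
  have Fρ' : Frame V c.arrs (enter v₁ w₁ i τ) ρ :=
    ⟨fun x hx => gv x (by simp only [hV, List.mem_cons, not_or] at hx; simp [vars, hx]),
      fun k hk => ga k (by simpa [arrs] using hk)⟩
  have Fρ : Frame V c.arrs σ (enter v₂ w₂ j ρ) :=
    (Fτ.trans Fρ').trans (Frame.enter ρ (by simp [hV]) (by simp [hV]) j)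
  have ρw : (enter v₂ w₂ j ρ).var w₁ = 16 ^ i := by
    have : ρ.var w₁ = 16 ^ i := by
      rw [gv _ (by simp [vars, hdis1]; tauto)]; simp [enter]
    simp only [enter, Store.var_setVar]
    rw [if_neg (by tauto), if_neg (by tauto), this]
  have K := loop_rule I v₃ w₃ e₃ c (enter v₂ w₂ j ρ) N₃ B (h₃ _ Fρ)
    (fun k τ => Inv {p | (p.1 < i ∧ p.2.1 < N₂ ∨ p.1 = i ∧ p.2.1 < j) ∧ p.2.2 < N₃ ∨
      p.1 = i ∧ p.2.1 = j ∧ p.2.2 < k} τ)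
    (by simpa using henter _ _ v₂ w₂ j (by simp) (by simp) hρ) ?_
  · refine ⟨?_, K.2⟩
    convert K.1 using 1
    ext ⟨a, b, k⟩
    simp only [Set.mem_ofPred_eq]
    omega
  intro k hk π hπ kv ka
  have Fπ' : Frame V c.arrs (enter v₂ w₂ j ρ) π :=
    ⟨fun x hx => kv x (by simp only [hV, List.mem_cons, not_or] at hx; simp [vars, hx]),
      fun k hk => ka k hk⟩
  have Fπ : Frame V c.arrs σ (enter v₃ w₃ k π) :=
    (Fρ.trans Fπ').trans (Frame.enter π (by simp [hV]) (by simp [hV]) k)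
  have πw1 : (enter v₃ w₃ k π).var w₁ = 16 ^ i := by
    have : π.var w₁ = 16 ^ i := by
      rw [kv _ (by simp [vars, hdis1]; tauto), ρw]
    simp only [enter, Store.var_setVar]
    rw [if_neg (by tauto), if_neg (by tauto), this]
  have πw2 : (enter v₃ w₃ k π).var w₂ = 16 ^ j := by
    have : π.var w₂ = 16 ^ j := by
      rw [kv _ (by simp [vars, hdis2]; tauto)]; simp [enter]
    simp only [enter, Store.var_setVar]
    rw [if_neg (by tauto), if_neg (by tauto), this]
  obtain ⟨s1, s2⟩ := step i hi j hj k hk _ _ (henter _ _ v₃ w₃ k (by simp) (by simp) hπ) Fπ πw1 πw2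
    (by simp [enter])
  refine ⟨?_, s2⟩
  convert s1 using 1
  ext ⟨a, b, l⟩
  simp only [Set.mem_ofPred_eq, Set.mem_insert_iff, Prod.mk.injEq]
  omega

end Cmd

/-! ### Partial solutions -/

variable {S : CutSystem} {rep : ℕ → ℕ → ℕ} {rc : ℕ → ℕ} {Q d₁ d₂ : ℕ → ℕ}

/-- Every side is a singleton, or composed of two of the first `M` sides. -/
def Leafy (S : CutSystem) (d₁ d₂ : ℕ → ℕ) : Prop := ∀ a < S.M,
  (∃ x < S.n, d₁ a = S.M + x ∧ d₂ a = S.M + S.n) ∨ (d₁ a < S.M ∧ d₂ a < S.M)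

/-- The array `DT` holds the constraints. -/
def DegTable (S : CutSystem) (σ : Store) : Prop := ∀ i < S.q, ∀ j < S.q, ∀ v ≤ S.d,
  (σ.arr .DT (ix3 (16 ^ i) (16 ^ j) (16 ^ v)) ≠ 0 ↔ S.D i j v)

/-- The array `OPP` holds the complementary sides. -/
def OppTable (S : CutSystem) (σ : Store) : Prop := ∀ a < S.M, σ.arr .OPP a = S.opp a

/-- The array `TB` marks the pairs of handles of partial solutions for side `a`. -/
structure TabTable (S : CutSystem) (rep : ℕ → ℕ → ℕ) (rc : ℕ → ℕ) (a : ℕ) (σ : Store) : Prop where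
  sound : ∀ r e, IsCode r → IsCode e → σ.arr .TB (ix3 (16 ^ a) r e) ≠ 0 →
    ∃ X, S.IsLab X ∧ r = S.handle rep rc a X ∧ e = S.handle rep rc (S.opp a) X ∧ S.Sat a X
  complete : ∀ X, S.IsLab X → S.Sat a X →
    σ.arr .TB (ix3 (16 ^ a) (S.handle rep rc a X) (S.handle rep rc (S.opp a) X)) ≠ 0

/-- Tests whether a vertex can have a label, given the profile of the other vertices. -/
def leafTest (q : ℕ) : Cmd :=
  assign .ok (lit 1) ;; assign .k (arr .KEY (Expr.ix2 Var.po (arr .PW (Var.b - Var.M)))) ;;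
  loop .j .wj (lit q)
    (assign .val (arr .VAL (Expr.ix4 Var.po Var.q3 Var.k Var.wj)) ;;
     ite (arr .DT (Expr.ix3 Var.q1 Var.wj (arr .PW Var.val))) skip (assign .ok (lit 0)))

/-- Tests whether partial solutions for the parts can be combined. -/
def innerTest (q d : ℕ) : Cmd :=
  assign .ok (lit 0) ;;
  assign .sa Var.pbo ;; assign .sb Var.pc ;; assign .sc Var.po ;; assign .r1 Var.q2 ;;
  assign .r2 Var.q3 ;; sumCmd q d ;; assign .o Var.h ;;
  assign .sa Var.pco ;; assign .sb Var.pb ;; assign .sc Var.po ;; assign .r1 Var.q1 ;;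
  assign .r2 Var.q3 ;; sumCmd q d ;;
  ite (arr .TB (Expr.ix3 Var.pb Var.q1 Var.o))
    (ite (arr .TB (Expr.ix3 Var.pc Var.q2 Var.h)) (assign .ok (lit 1)) skip) skip

/-- For a side {x} all neighbours of x lie on the other side, so the profile of the complement at x
contains every degree that matters. It is read off in q steps and compared with the constraints for
the label of x. -/
theorem leafTest_spec (I : ℕ → ℕ) {J : ℕ} (F : Fits S rc J) {σ : Store}
    (hT : Tables S rep rc J σ) (hD : DegTable S σ) {a x : ℕ} (ha : a < S.M) (hx : x < S.n)
    (hs : S.side a = {x}) (hd : S.d < J) (hv : ValTable S rep rc (S.opp a) σ) {Z : ℕ → ℕ}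
    (hZ : S.IsLab Z)
    (hb : σ.var .b = S.M + x) (hM : σ.var .M = S.M) (hpo : σ.var .po = 16 ^ S.opp a)
    (hq1 : σ.var .q1 = 16 ^ Z x) (hq3 : σ.var .q3 = S.handle rep rc (S.opp a) Z) :
    (((leafTest S.q).run I σ).var .ok ≠ 0 ↔ S.Sat a Z) ∧
      (leafTest S.q).cost I σ ≤ 200 * (S.q + 1) := by
  have ho := S.opp_lt a ha
  have hxo : x ∉ S.side (S.opp a) := by
    rw [S.side_opp a ha x hx, hs]; simp
  have hsat : S.Sat a Z ↔ ∀ j < S.q, S.D (Z x) j (min S.d (S.cnt (S.side (S.opp a)) Z x j)) := by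
    unfold CutSystem.Sat
    rw [hs]
    simp only [Finset.mem_singleton, forall_eq]
    refine forall₂_congr fun j hj => ?_
    -- A vertex is not its own neighbour.
    have h0 : S.cnt {x} Z x j = 0 := by
      have : S.nbr {x} x = ∅ := by
        rw [Finset.eq_empty_iff_forall_notMem]
        intro z hz
        rw [CutSystem.mem_nbr, Finset.mem_singleton] at hz
        exact S.adj_irrefl x (hz.1 ▸ hz.2)
      simp [CutSystem.cnt, this]
    rw [CutSystem.cnt_range ha, hs, h0, zero_add, ← S.D_min _ (hZ x) j hj]
  set B := (assign .val (arr .VAL (Expr.ix4 Var.po Var.q3 Var.k Var.wj)) ;;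
     ite (arr .DT (Expr.ix3 Var.q1 Var.wj (arr .PW Var.val))) skip (assign .ok (lit 0))) with hB
  set ρ := (assign .ok (lit 1) ;; assign .k (arr .KEY (Expr.ix2 Var.po (arr .PW (Var.b - Var.M))))).run
    I σ with hρ
  have hFl := F.lt
  have ρk : ρ.var .k = code (S.nbr (S.side (S.opp a)) x) := by
    simp [hρ, hb, hM, hpo, hT.pow x (by omega), hT.key _ (show S.opp a ≤ S.M + S.n by omega) x hx]
  have L := loop_rule I .j .wj (lit S.q) B ρ S.q 130 (by simp)
    (fun l τ => τ.var .ok ≠ 0 ↔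
      ∀ j < l, S.D (Z x) j (min S.d (S.cnt (S.side (S.opp a)) Z x j))) (by simp [hρ]) ?_
  · have er : (leafTest S.q).run I σ = (loop .j .wj (lit S.q) B).run I ρ := rfl
    have ec : (leafTest S.q).cost I σ = 46 + (loop .j .wj (lit S.q) B).cost I ρ := by
      simp only [leafTest, cost_seq, cost_assign, cost_lit, cost_arr, cost_ix2, cost_var, cost_sub]
      simp only [hρ, run_seq]
      ring
    rw [er, ec]
    refine ⟨L.1.trans hsat.symm, ?_⟩
    have := L.2
    simp only [cost_lit] at this
    omega
  · intro l hl τ i1 fv fa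
    have fa' : τ.arr = σ.arr := by funext k; rw [fa k (by simp [hB, arrs])]; rfl
    have fpo : τ.var .po = 16 ^ S.opp a := by rw [fv _ (by simp [hB, vars])]; simp [hρ, hpo]
    have fq1 : τ.var .q1 = 16 ^ Z x := by rw [fv _ (by simp [hB, vars])]; simp [hρ, hq1]
    have fq3 : τ.var .q3 = S.handle rep rc (S.opp a) Z := by
      rw [fv _ (by simp [hB, vars])]; simp [hρ, hq3]
    have fk : τ.var .k = code (S.nbr (S.side (S.opp a)) x) := by
      rw [fv _ (by simp [hB, vars])]; exact ρk
    have hval := hv Z hZ x hx hxo l hl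
    have hle : min S.d (S.cnt (S.side (S.opp a)) Z x l) ≤ S.d := min_le_left _ _
    have hPW := hT.pow (min S.d (S.cnt (S.side (S.opp a)) Z x l)) (by omega)
    have hDT := hD (Z x) (hZ x) l hl _ hle
    refine ⟨?_, ?_⟩
    · simp only [hB, run_seq, run_ite, run_skip, run_assign, enter, eval_arr, eval_ix4, eval_ix3,
        eval_var, eval_lit, Store.var_setVar, Store.arr_setVar, reduceCtorEq, if_true, if_false,
        fa', fpo, fq1, fq3, fk, hval, hPW]
      by_cases hc : S.D (Z x) l (min S.d (S.cnt (S.side (S.opp a)) Z x l))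
      · rw [if_pos (hDT.2 hc)]
        simp only [Store.var_setVar, reduceCtorEq, if_false, i1]
        constructor
        · intro h j hj
          rcases Nat.lt_succ_iff_lt_or_eq.1 hj with hj | rfl
          exacts [h j hj, hc]
        · exact fun h j hj => h j (by omega)
      · rw [if_neg (fun h => hc (hDT.1 h))]
        simp only [Store.var_setVar, if_true, ne_eq, not_true_eq_false, false_iff]
        exact fun h => hc (h l (by omega))
    · simp only [hB, cost_seq, cost_assign, cost_arr, cost_ix4, cost_var, cost_ite, cost_ix3,
        cost_skip, cost_lit]
      split_ifs <;> norm_num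

theorem Join.sat_left {a b c : ℕ} (h : S.Join a b c) {X : ℕ → ℕ} (hX : S.Sat a X) : S.Sat b X :=
  fun v hv => hX v (by rw [h.union]; exact Finset.mem_union_left _ hv)

-- The complement of `b` is `c` together with the complement of `a`, and likewise for `c`. Hence the
-- three given handles yield the two complementary handles needed to look up the tables of both
-- parts. If both entries are marked, `Join.glue` combines the solutions; conversely a solution for
-- `a` restricts to both parts and leaves both marks.
set_option maxHeartbeats 600000 in
theorem innerTest_spec (I : ℕ → ℕ) (R : S.Reps rep rc) {J : ℕ} (F : Fits S rc J) {σ : Store}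
    (hT : Tables S rep rc J σ) {a b c : ℕ} (ha : a < S.M) (hb : b < S.M) (hc : c < S.M)
    (hj : S.Join a b c) (hv : ∀ b ≤ S.M + S.n, ValTable S rep rc b σ)
    (tb : TabTable S rep rc b σ) (tc : TabTable S rep rc c σ) {W : ℕ}
    (hW : ∀ a < S.M, rc a * (S.q + 1) + 1 ≤ W) {Z : ℕ → ℕ} (hZ : S.IsLab Z)
    (hpb : σ.var .pb = 16 ^ b) (hpc : σ.var .pc = 16 ^ c) (hpo : σ.var .po = 16 ^ S.opp a)
    (hpbo : σ.var .pbo = 16 ^ S.opp b) (hpco : σ.var .pco = 16 ^ S.opp c)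
    (hq1 : σ.var .q1 = S.handle rep rc b Z) (hq2 : σ.var .q2 = S.handle rep rc c Z)
    (hq3 : σ.var .q3 = S.handle rep rc (S.opp a) Z) :
    (((innerTest S.q S.d).run I σ).var .ok ≠ 0 →
      ∃ X, S.IsLab X ∧ S.Same a X Z ∧ S.Same (S.opp a) X Z ∧ S.Sat a X) ∧
    (∀ X, S.IsLab X → S.handle rep rc b X = S.handle rep rc b Z →
      S.handle rep rc c X = S.handle rep rc c Z →
      S.handle rep rc (S.opp a) X = S.handle rep rc (S.opp a) Z → S.Sat a X →
      ((innerTest S.q S.d).run I σ).var .ok ≠ 0) ∧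
    (innerTest S.q S.d).cost I σ ≤ 600 * W := by
  have hoa := S.opp_lt a ha
  have hob := S.opp_lt b hb
  have hoc := S.opp_lt c hc
  have jb := hj.rotate ha hb
  have jc := hj.symm.rotate ha hc
  have hFl := F.lt
  set ρ := (assign .ok (lit 0) ;;
  assign .sa Var.pbo ;; assign .sb Var.pc ;; assign .sc Var.po ;; assign .r1 Var.q2 ;;
  assign .r2 Var.q3).run I σ with hρ
  have ρa : ρ.arr = σ.arr := rfl
  have Tρ : Tables S rep rc J ρ := hT.congr rfl rfl rfl rfl
  obtain ⟨s1, s2⟩ := sumCmd_spec I R Tρ.pow Tρ.key Tρ.reps hob (by omega) (by omega) jb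
    ((hv c (by omega)).congr fun _ _ _ _ _ _ => rfl)
    ((hv (S.opp a) (by omega)).congr fun _ _ _ _ _ _ => rfl) (by omega) (F.le _ hob) hZ
    (by simp [hρ, hpbo]) (by simp [hρ, hpc]) (by simp [hρ, hpo]) (by simp [hρ, hq2]) (by simp [hρ, hq3])
  set π := (sumCmd S.q S.d).run I ρ with hπ
  have πa : π.arr = σ.arr := by
    rw [← ρa]; funext x; exact arr_run _ _ _ _ (by simp [sumCmd_arrs])
  have πv : ∀ x, x ∉ (sumCmd S.q S.d).vars → π.var x = ρ.var x := fun x hx => var_run _ _ _ _ hx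
  set υ := (assign .o Var.h ;;
  assign .sa Var.pco ;; assign .sb Var.pb ;; assign .sc Var.po ;; assign .r1 Var.q1 ;;
  assign .r2 Var.q3).run I π with hυ
  have υa : υ.arr = σ.arr := by rw [← πa]; rfl
  have Tυ : Tables S rep rc J υ := by apply hT.congr <;> rw [υa]
  have kv : ∀ x ∈ [Var.pb, .pc, .po, .pbo, .pco, .q1, .q2, .q3], π.var x = σ.var x := by
    intro x hx
    rw [πv x (by simp only [List.mem_cons, List.not_mem_nil, or_false] at hx
                 rcases hx with rfl | rfl | rfl | rfl | rfl | rfl | rfl | rfl <;> simp [sumCmd_vars])]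
    simp only [List.mem_cons, List.not_mem_nil, or_false] at hx
    rcases hx with rfl | rfl | rfl | rfl | rfl | rfl | rfl | rfl <;> simp [hρ]
  obtain ⟨t1, t2⟩ := sumCmd_spec I R Tυ.pow Tυ.key Tυ.reps hoc (by omega) (by omega) jc
    ((hv b (by omega)).congr fun _ _ _ _ _ _ => by rw [υa])
    ((hv (S.opp a) (by omega)).congr fun _ _ _ _ _ _ => by rw [υa]) (by omega) (F.le _ hoc) hZ
    (by simp [hυ, hpco, kv]) (by simp [hυ, hpb, kv]) (by simp [hυ, hpo, kv]) (by simp [hυ, hq1, kv])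
    (by simp [hυ, hq3, kv])
  set χ := (sumCmd S.q S.d).run I υ with hχ
  have χa : χ.arr = σ.arr := by
    rw [← υa]; funext x; exact arr_run _ _ _ _ (by simp [sumCmd_arrs])
  have χv : ∀ x, x ∉ (sumCmd S.q S.d).vars → χ.var x = υ.var x := fun x hx => var_run _ _ _ _ hx
  have er : (innerTest S.q S.d).run I σ = (ite (arr .TB (Expr.ix3 Var.pb Var.q1 Var.o))
    (ite (arr .TB (Expr.ix3 Var.pc Var.q2 Var.h)) (assign .ok (lit 1)) skip) skip).run I χ := rfl
  have χpb : χ.var .pb = 16 ^ b := by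
    rw [χv _ (by simp [sumCmd_vars])]; simp [hυ, kv, hpb]
  have χpc : χ.var .pc = 16 ^ c := by
    rw [χv _ (by simp [sumCmd_vars])]; simp [hυ, kv, hpc]
  have χq1 : χ.var .q1 = S.handle rep rc b Z := by
    rw [χv _ (by simp [sumCmd_vars])]; simp [hυ, kv, hq1]
  have χq2 : χ.var .q2 = S.handle rep rc c Z := by
    rw [χv _ (by simp [sumCmd_vars])]; simp [hυ, kv, hq2]
  have χo : χ.var .o = S.handle rep rc (S.opp b) Z := by
    rw [χv _ (by simp [sumCmd_vars]), ← s1]; simp [hυ]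
  have χok : χ.var .ok = 0 := by
    rw [χv _ (by simp [sumCmd_vars])]
    have : π.var .ok = 0 := by rw [πv _ (by simp [sumCmd_vars])]; simp [hρ]
    simp [hυ, this]
  have key : ((innerTest S.q S.d).run I σ).var .ok ≠ 0 ↔
      σ.arr .TB (ix3 (16 ^ b) (S.handle rep rc b Z) (S.handle rep rc (S.opp b) Z)) ≠ 0 ∧
      σ.arr .TB (ix3 (16 ^ c) (S.handle rep rc c Z) (S.handle rep rc (S.opp c) Z)) ≠ 0 := by
    rw [er]
    simp only [run_ite, run_skip, run_assign, eval_arr, eval_ix3, eval_var, eval_lit, χa, χpb, χpc,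
      χq1, χq2, χo, t1]
    split_ifs with h1 h2
    · simp [h1, h2]
    · simp [χok, h2]
    · simp [χok, h1]
  have hc1 := CutSystem.isCode_handle (S := S) (rep := rep) (rc := rc)
  refine ⟨?_, ?_, ?_⟩
  · rw [key]
    rintro ⟨k1, k2⟩
    obtain ⟨X₁, l1, e1, e1', f1⟩ := tb.sound _ _ (hc1 _ _) (hc1 _ _) k1
    obtain ⟨X₂, l2, e2, e2', f2⟩ := tc.sound _ _ (hc1 _ _) (hc1 _ _) k2
    exact hj.glue ha hb hc l1 l2 hZ ((R.handle_eq_iff hb).1 e1.symm)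
      ((R.handle_eq_iff hob).1 e1'.symm) f1 ((R.handle_eq_iff hc).1 e2.symm)
      ((R.handle_eq_iff hoc).1 e2'.symm) f2
  · intro X hX e1 e2 e3 hs
    rw [key]
    have k1 := tb.complete X hX (Join.sat_left hj hs)
    have k2 := tc.complete X hX (Join.sat_left hj.symm hs)
    -- The entry belonging to `X` is the entry looked up for `Z`: the handle across the complement
    -- of `b` is determined by those of `c` and of the complement of `a`.
    rw [e1, jb.handle_eq R hob (by omega) (by omega) e2 e3] at k1
    rw [e2, jc.handle_eq R hoc (by omega) (by omega) e1 e3] at k2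
    exact ⟨k1, k2⟩
  · have ec : (innerTest S.q S.d).cost I σ = 3 + (4 + (4 + (4 + (4 + (4 + ((sumCmd S.q S.d).cost I ρ +
        (4 + (4 + (4 + (4 + (4 + (4 + ((sumCmd S.q S.d).cost I υ +
        (ite (arr .TB (Expr.ix3 Var.pb Var.q1 Var.o))
    (ite (arr .TB (Expr.ix3 Var.pc Var.q2 Var.h)) (assign .ok (lit 1)) skip) skip).cost I χ))))))))))))) :=
      rfl
    have e3 : (ite (arr .TB (Expr.ix3 Var.pb Var.q1 Var.o))
      (ite (arr .TB (Expr.ix3 Var.pc Var.q2 Var.h)) (assign .ok (lit 1)) skip) skip).cost I χ ≤ 70 := by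
      simp only [cost_ite, cost_arr, cost_ix3, cost_var, cost_skip, cost_assign, cost_lit]
      split_ifs <;> norm_num
    have w1 := hW _ hob
    have w2 := hW _ hoc
    omega

end Imp

/-! ### The table of partial solutions -/

namespace Imp

open Imp.Cmd Imp.Expr

variable {S : CutSystem} {rep : ℕ → ℕ → ℕ} {rc : ℕ → ℕ} {Q d₁ d₂ : ℕ → ℕ}

/-- Treats one triple of handles, for the two parts and for the complement of a side. -/
def tabBody (q d : ℕ) : Cmd :=
  assign .q1 (arr .PL (Expr.ix2 Var.pb Var.w1)) ;;
  assign .q2 (arr .PL (Expr.ix2 Var.pc Var.w2)) ;;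
  assign .q3 (arr .PL (Expr.ix2 Var.po Var.w3)) ;;
  assign .sa Var.pa ;; assign .sb Var.pb ;; assign .sc Var.pc ;; assign .r1 Var.q1 ;;
  assign .r2 Var.q2 ;; sumCmd q d ;; assign .u Var.h ;;
  ite (Var.b + lit 1 - Var.M) (leafTest q) (innerTest q d) ;;
  ite Var.ok (write .TB (Expr.ix3 Var.pa Var.u Var.q3) (lit 1)) skip

/-- Marks the pairs of handles of partial solutions. -/
def tabCmd (q d : ℕ) : Cmd :=
  loop .i .wi Var.M
    (fetchCmd ;; assign .po (arr .PW (arr .OPP Var.a)) ;; assign .pbo (arr .PW (arr .OPP Var.b)) ;;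
     assign .pco (arr .PW (arr .OPP Var.c)) ;;
     loop .j1 .w1 (arr .PC Var.pb) (loop .j2 .w2 (arr .PC Var.pc) (loop .j3 .w3 (arr .PC Var.po)
       (tabBody q d))))

/-- The sides b, c and the complement of a partition the vertex set, so three labellings can be
prescribed on them independently. Hence no triple of handles is spurious. -/
theorem exists_merge {a b c : ℕ} (ha : a < S.M) (hj : S.Join a b c) {X Y U : ℕ → ℕ}
    (hX : S.IsLab X) (hY : S.IsLab Y) (hU : S.IsLab U) : ∃ Z, S.IsLab Z ∧
      S.handle rep rc b Z = S.handle rep rc b X ∧ S.handle rep rc c Z = S.handle rep rc c Y ∧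
      S.handle rep rc (S.opp a) Z = S.handle rep rc (S.opp a) U := by
  obtain ⟨Z, hZ, z1, z2⟩ := CutSystem.merge hj.disj hX hY
  have hd : Disjoint (S.side a) (S.side (S.opp a)) := by
    rw [Finset.disjoint_left]
    intro x hx hx'
    exact (S.side_opp a ha x (S.side_lt _ _ hx)).1 hx' hx
  obtain ⟨Z', hZ', z3, z4⟩ := CutSystem.merge hd hZ hU
  rw [hj.union] at z3
  refine ⟨Z', hZ', CutSystem.handle_congr fun x hx => ?_, CutSystem.handle_congr fun x hx => ?_,
    CutSystem.handle_congr fun x hx => z4 x (Finset.disjoint_right.1 hd hx)⟩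
  · rw [z3 x (Finset.mem_union_left _ hx), z1 x hx]
  · rw [z3 x (Finset.mem_union_right _ hx), z2 x (Finset.disjoint_right.1 hj.disj hx)]

theorem update_ix3 {a b c a' b' c' : ℕ} (ha : IsCode a) (hb : IsCode b) (hc : IsCode c)
    (ha' : IsCode a') (hb' : IsCode b') (hc' : IsCode c') (f : ℕ → ℕ) (v : ℕ) :
    Function.update f (ix3 a b c) v (ix3 a' b' c') =
      if a' = a ∧ b' = b ∧ c' = c then v else f (ix3 a' b' c') := by
  rw [Function.update_apply]
  simp only [ix3_inj ha' hb' hc' ha hb hc]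

theorem Join.side_eq_singleton {a x : ℕ} (hx : x < S.n) (hj : S.Join a (S.M + x) (S.M + S.n)) :
    S.side a = {x} := by
  rw [hj.union, S.side_single x hx, S.side_empty, Finset.union_empty]

/-- The tables that are complete before the partial solutions are computed. -/
structure AllTables (S : CutSystem) (rep : ℕ → ℕ → ℕ) (rc : ℕ → ℕ) (J : ℕ) (σ : Store) : Prop where
  tables : Tables S rep rc J σ
  deg : DegTable S σ
  opp : OppTable S σ
  list : ∀ b ≤ S.M + S.n, ListTable S rep rc b σ
  val : ∀ b ≤ S.M + S.n, ValTable S rep rc b σ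

theorem AllTables.congr {J : ℕ} {σ τ : Store} (h : AllTables S rep rc J σ)
    (he : ∀ k, k ≠ .TB → τ.arr k = σ.arr k) : AllTables S rep rc J τ where
  tables := h.tables.congr (he _ (by simp)) (he _ (by simp)) (he _ (by simp)) (he _ (by simp))
  deg := by unfold DegTable; rw [he _ (by simp)]; exact h.deg
  opp := by unfold OppTable; rw [he _ (by simp)]; exact h.opp
  list b hb := (h.list b hb).congr (by rw [he _ (by simp)]) fun _ => by rw [he _ (by simp)]
  val b hb := (h.val b hb).congr fun _ _ _ _ _ _ => by rw [he _ (by simp)]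

theorem innerTest_vars (q d : ℕ) : (innerTest q d).vars =
    .ok :: .sa :: .sb :: .sc :: .r1 :: .r2 :: ((sumCmd q d).vars ++ .o :: .sa :: .sb :: .sc :: .r1 ::
      .r2 :: ((sumCmd q d).vars ++ [.ok])) := rfl

theorem leafTest_vars (q : ℕ) : (leafTest q).vars = [.ok, .k, .j, .wj, .val, .ok] := rfl

theorem tabBody_vars (q d : ℕ) : (tabBody q d).vars =
    .q1 :: .q2 :: .q3 :: .sa :: .sb :: .sc :: .r1 :: .r2 :: ((sumCmd q d).vars ++ .u ::
      ((leafTest q).vars ++ (innerTest q d).vars ++ [])) := rfl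

theorem tabBody_arrs (q d : ℕ) : (tabBody q d).arrs = [.TB] := rfl

theorem notMem_tabBody_vars (q d : ℕ) : ∀ x ∈ [Var.b, .M, .pa, .pb, .pc, .po, .pbo, .pco],
    x ∉ (Var.j1 :: .w1 :: .j2 :: .w2 :: .j3 :: .w3 :: (tabBody q d).vars) := by
  rw [tabBody_vars, leafTest_vars, innerTest_vars, sumCmd_vars]
  decide

theorem disjoint_tabBody_vars (q d : ℕ) : ∀ v ∈ [Var.j1, .w1, .j2, .w2, .j3, .w3],
    v ∉ (tabBody q d).vars := by
  rw [tabBody_vars, leafTest_vars, innerTest_vars, sumCmd_vars]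
  decide

-- The Boolean `t` is the outcome of the test. Completeness is claimed for every satisfying
-- labelling with the same three handles as `Z`, not just for `Z`, so that a triple is treated once
-- for all labellings behind it.
set_option maxHeartbeats 800000 in
theorem tabBody_spec (I : ℕ → ℕ) (R : S.Reps rep rc) {J : ℕ} (F : Fits S rc J) (hdJ : S.d < J)
    {σ : Store} (hT : AllTables S rep rc J σ) {a b c : ℕ} (ha : a < S.M) (hb : b ≤ S.M + S.n)
    (hc : c ≤ S.M + S.n) (hj : S.Join a b c)
    (hl : (∃ x < S.n, b = S.M + x ∧ c = S.M + S.n) ∨ (b < S.M ∧ c < S.M))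
    (tb : b < S.M → TabTable S rep rc b σ) (tc : c < S.M → TabTable S rep rc c σ) {W : ℕ}
    (hW : ∀ a < S.M, rc a * (S.q + 1) + 1 ≤ W) (hqW : S.q ≤ W)
    {Z : ℕ → ℕ} (hZ : S.IsLab Z)
    (hbv : σ.var .b = b) (hMv : σ.var .M = S.M)
    (hpa : σ.var .pa = 16 ^ a) (hpb : σ.var .pb = 16 ^ b) (hpc : σ.var .pc = 16 ^ c)
    (hpo : σ.var .po = 16 ^ S.opp a) (hpbo : b < S.M → σ.var .pbo = 16 ^ S.opp b)
    (hpco : c < S.M → σ.var .pco = 16 ^ S.opp c)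
    (hq1 : σ.arr .PL (ix2 (16 ^ b) (σ.var .w1)) = S.handle rep rc b Z)
    (hq2 : σ.arr .PL (ix2 (16 ^ c) (σ.var .w2)) = S.handle rep rc c Z)
    (hq3 : σ.arr .PL (ix2 (16 ^ S.opp a) (σ.var .w3)) = S.handle rep rc (S.opp a) Z) :
    ∃ t : Bool, ((tabBody S.q S.d).run I σ).arr .TB =
      (if t then Function.update (σ.arr .TB)
        (ix3 (16 ^ a) (S.handle rep rc a Z) (S.handle rep rc (S.opp a) Z)) 1 else σ.arr .TB) ∧
      (t → ∃ X, S.IsLab X ∧ S.Same a X Z ∧ S.Same (S.opp a) X Z ∧ S.Sat a X) ∧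
      (∀ X, S.IsLab X → S.handle rep rc b X = S.handle rep rc b Z →
        S.handle rep rc c X = S.handle rep rc c Z →
        S.handle rep rc (S.opp a) X = S.handle rep rc (S.opp a) Z → S.Sat a X → t) ∧
      (tabBody S.q S.d).cost I σ ≤ 1400 * W := by
  have ho := S.opp_lt a ha
  have hFl := F.lt
  set ρ := (assign .q1 (arr .PL (Expr.ix2 Var.pb Var.w1)) ;;
  assign .q2 (arr .PL (Expr.ix2 Var.pc Var.w2)) ;;
  assign .q3 (arr .PL (Expr.ix2 Var.po Var.w3)) ;;
  assign .sa Var.pa ;; assign .sb Var.pb ;; assign .sc Var.pc ;; assign .r1 Var.q1 ;;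
  assign .r2 Var.q2).run I σ with hρ
  have ρa : ρ.arr = σ.arr := rfl
  have Tρ : AllTables S rep rc J ρ := hT.congr fun _ _ => rfl
  obtain ⟨s1, s2⟩ := sumCmd_spec I R Tρ.tables.pow Tρ.tables.key Tρ.tables.reps ha hb hc hj
    (Tρ.val b hb) (Tρ.val c hc) (by omega) (F.le a ha) hZ
    (by simp [hρ, hpa]) (by simp [hρ, hpb]) (by simp [hρ, hpc]) (by simp [hρ, hpb, hq1])
    (by simp [hρ, hpc, hq2])
  set π := (sumCmd S.q S.d ;; assign .u Var.h).run I ρ with hπ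
  have πa : π.arr = σ.arr := by
    rw [← ρa]; funext x; exact arr_run I (sumCmd S.q S.d ;; assign .u Var.h) _ _
      (by simp [sumCmd_arrs, arrs])
  have πv : ∀ x, x ≠ .u → x ∉ (sumCmd S.q S.d).vars → π.var x = ρ.var x := fun x hx hx' =>
    var_run I (sumCmd S.q S.d ;; assign .u Var.h) _ _ (by simp [vars, hx, hx'])
  have πu : π.var .u = S.handle rep rc a Z := by rw [← s1]; simp [hπ]
  have Tπ : AllTables S rep rc J π := hT.congr fun _ _ => by rw [πa]
  have kv : ∀ x ∈ [Var.b, .M, .pa, .pb, .pc, .po, .pbo, .pco], π.var x = σ.var x := by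
    intro x hx
    simp only [List.mem_cons, List.not_mem_nil, or_false] at hx
    rcases hx with rfl | rfl | rfl | rfl | rfl | rfl | rfl | rfl <;>
      (rw [πv _ (by simp) (by simp [sumCmd_vars])]; simp [hρ])
  have πq1 : π.var .q1 = S.handle rep rc b Z := by
    rw [πv _ (by simp) (by simp [sumCmd_vars])]; simp [hρ, hpb, hq1]
  have πq2 : π.var .q2 = S.handle rep rc c Z := by
    rw [πv _ (by simp) (by simp [sumCmd_vars])]; simp [hρ, hpc, hq2]
  have πq3 : π.var .q3 = S.handle rep rc (S.opp a) Z := by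
    rw [πv _ (by simp) (by simp [sumCmd_vars])]; simp [hρ, hpo, hq3]
  have hW0 := hW a ha
  -- b + 1 - M is nonzero exactly when b ≥ M, that is, when the part is an appended singleton. The
  -- complement of b is then never consulted, so `pbo` and `pco` may contain anything.
  set test := ite (Var.b + lit 1 - Var.M) (leafTest S.q) (innerTest S.q S.d) with htest
  have htv : test.vars = (leafTest S.q).vars ++ (innerTest S.q S.d).vars := rfl
  have hta : test.arrs = [] := rfl
  have main : ((test.run I π).var .ok ≠ 0 →
        ∃ X, S.IsLab X ∧ S.Same a X Z ∧ S.Same (S.opp a) X Z ∧ S.Sat a X) ∧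
      (∀ X, S.IsLab X → S.handle rep rc b X = S.handle rep rc b Z →
        S.handle rep rc c X = S.handle rep rc c Z →
        S.handle rep rc (S.opp a) X = S.handle rep rc (S.opp a) Z → S.Sat a X →
        (test.run I π).var .ok ≠ 0) ∧ test.cost I π ≤ 700 * W := by
    rw [htest, run_ite, cost_ite]
    simp only [eval_sub, eval_add, eval_var, eval_lit, kv, List.mem_cons, true_or, or_true, hbv, hMv]
    rcases hl with ⟨x, hx, rfl, rfl⟩ | ⟨hb', hc'⟩
    · have hside := Join.side_eq_singleton hx hj
      obtain ⟨l1, l2⟩ := leafTest_spec I F Tπ.tables Tπ.deg ha hx hside hdJ (Tπ.val _ (by omega)) hZ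
        (by simp [kv, hbv]) (by simp [kv, hMv]) (by simp [kv, hpo])
        (by rw [πq1, handle_single hx]) πq3
      rw [if_pos (by omega), if_pos (by omega), l1]
      -- At a leaf the test is exact for `Z`. Another labelling with the same handles has the same
      -- label at x and the same outer profile, so it is satisfied if and only if `Z` is; one
      -- direction is used.
      refine ⟨fun hs => ⟨Z, hZ, fun _ _ _ _ _ => rfl, fun _ _ _ _ _ => rfl, hs⟩, ?_, ?_⟩
      · intro X hX e1 _ e3 hs
        rw [handle_single hx, handle_single hx, pow_inj16] at e1
        refine hs.of_same ha hX (fun y hy => ?_) ((R.handle_eq_iff ho).1 e3)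
        rw [hside, Finset.mem_singleton] at hy
        rw [hy, e1]
      · simp only [cost_sub, cost_add, cost_var, cost_lit]
        have : 200 * (S.q + 1) ≤ 400 * W := by omega
        omega
    · obtain ⟨l1, l2, l3⟩ := innerTest_spec I R F Tπ.tables ha hb' hc' hj Tπ.val
        (⟨by rw [πa]; exact (tb hb').sound, by rw [πa]; exact (tb hb').complete⟩)
        (⟨by rw [πa]; exact (tc hc').sound, by rw [πa]; exact (tc hc').complete⟩) hW hZ
        (by simp [kv, hpb]) (by simp [kv, hpc]) (by simp [kv, hpo]) (by simp [kv, hpbo hb'])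
        (by simp [kv, hpco hc']) πq1 πq2 πq3
      rw [if_neg (by omega), if_neg (by omega)]
      refine ⟨l1, l2, ?_⟩
      simp only [cost_sub, cost_add, cost_var, cost_lit]
      omega
  obtain ⟨m1, m2, m3⟩ := main
  set χ := test.run I π with hχ
  have χa : χ.arr = σ.arr := by
    rw [← πa]; funext x; exact arr_run _ _ _ _ (by simp [hta])
  have χpa : χ.var .pa = 16 ^ a := by
    rw [var_run _ _ _ _ (by simp [htv, leafTest_vars, innerTest_vars, sumCmd_vars])]; simp [kv, hpa]
  have χu : χ.var .u = S.handle rep rc a Z := by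
    rw [var_run _ _ _ _ (by simp [htv, leafTest_vars, innerTest_vars, sumCmd_vars]), πu]
  have χq3 : χ.var .q3 = S.handle rep rc (S.opp a) Z := by
    rw [var_run _ _ _ _ (by simp [htv, leafTest_vars, innerTest_vars, sumCmd_vars]), πq3]
  have er : (tabBody S.q S.d).run I σ =
    (ite Var.ok (write .TB (Expr.ix3 Var.pa Var.u Var.q3) (lit 1)) skip).run I χ := rfl
  have ec : (tabBody S.q S.d).cost I σ = 19 + (19 + (19 + (4 + (4 + (4 + (4 + (4 + (
    (sumCmd S.q S.d).cost I ρ + (4 + (test.cost I π +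
    (ite Var.ok (write .TB (Expr.ix3 Var.pa Var.u Var.q3) (lit 1)) skip).cost I χ)))))))))) := rfl
  refine ⟨decide (χ.var .ok ≠ 0), ?_, ?_, ?_, ?_⟩
  · rw [er, run_ite]
    by_cases h : χ.var .ok = 0
    · simp [h, χa]
    · simp [h, χa, χpa, χu, χq3]
  · simpa using m1
  · simpa using m2
  · rw [ec]
    have : (ite Var.ok (write .TB (Expr.ix3 Var.pa Var.u Var.q3) (lit 1)) skip).cost I χ ≤ 60 := by
      simp only [cost_ite, cost_var, cost_write, cost_ix3, cost_lit, cost_skip]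
      split_ifs <;> norm_num
    omega

-- All triples of handles for the two parts and the complement are tested, s³ of them for each side.
-- Every satisfying labelling of the side shows up under the triple of its own handles.
set_option maxHeartbeats 1000000 in
theorem tabCmd_spec (I : ℕ → ℕ) (R : S.Reps rep rc) {J : ℕ} (F : Fits S rc J) (hdJ : S.d < J)
    (h : Schedule S Q d₁ d₂) (hleaf : Leafy S d₁ d₂) {σ : Store} (hT : AllTables S rep rc J σ)
    (hQ : SchedTable S Q d₁ d₂ σ) (hM : σ.var .M = S.M) (hTB : ∀ i, σ.arr .TB i = 0)
    {s W : ℕ} (hs : FewHandles S rep rc s) (hs1 : 1 ≤ s)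
    (hW : ∀ a < S.M, rc a * (S.q + 1) + 1 ≤ W) (hqW : S.q ≤ W) :
    (∀ a < S.M, TabTable S rep rc a ((tabCmd S.q S.d).run I σ)) ∧
    (tabCmd S.q S.d).cost I σ ≤ 5 + 2000 * (S.M * (s * s * s * W)) := by
  unfold tabCmd
  set B := (fetchCmd ;; assign .po (arr .PW (arr .OPP Var.a)) ;;
     assign .pbo (arr .PW (arr .OPP Var.b)) ;;
     assign .pco (arr .PW (arr .OPP Var.c)) ;;
     loop .j1 .w1 (arr .PC Var.pb) (loop .j2 .w2 (arr .PC Var.pc) (loop .j3 .w3 (arr .PC Var.po)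
       (tabBody S.q S.d)))) with hB
  have Ba : B.arrs = [.TB] := rfl
  have L := loop_rule I .i .wi Var.M B σ S.M
    (200 + s * (26 + s * (26 + s * (1400 * W + 12)))) (by rw [eval_var, hM])
    (fun i τ => (∀ b < S.M, Ready S Q i b → TabTable S rep rc b τ) ∧
      (∀ a < S.M, ¬ Ready S Q i a → ∀ r e, IsCode r → IsCode e →
        τ.arr .TB (ix3 (16 ^ a) r e) = 0)) ?_ ?_
  · refine ⟨fun b hb => L.1.1 b hb (h.ready_all (by omega)), ?_⟩
    have hcost := L.2
    simp only [cost_var] at hcost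
    refine hcost.trans ?_
    by_cases hM0 : S.M = 0
    · simp [hM0]
    have hW1 : 1 ≤ W := by have := hW 0 (by omega); omega
    have : 200 + s * (26 + s * (26 + s * (1400 * W + 12))) + 12 ≤ 2000 * (s * s * s * W) := by
      have e1 : s ≤ s * s := Nat.le_mul_of_pos_left _ hs1
      have e2 : s * s ≤ s * s * s := Nat.le_mul_of_pos_right _ hs1
      have e3 : s * s * s ≤ s * s * s * W := Nat.le_mul_of_pos_right _ hW1
      calc _ = 212 + 26 * s + 26 * (s * s) + 12 * (s * s * s) + 1400 * (s * s * s * W) := by ring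
        _ ≤ _ := by omega
    calc _ ≤ 2 + 3 + S.M * (2000 * (s * s * s * W)) := by gcongr
      _ = _ := by ring
  · refine ⟨?_, fun a ha _ r e _ _ => hTB _⟩
    rintro b hb (⟨hb', -⟩ | ⟨j, hj, -⟩) <;> omega
  · rintro i hi τ ⟨i1, i2⟩ fv fa
    have fa' : ∀ k, k ≠ .TB → τ.arr k = σ.arr k := fun k hk => fa k (by simp [Ba, hk])
    have Qτ : SchedTable S Q d₁ d₂ (enter .i .wi i τ) := by
      have e1 : (enter .i .wi i τ).arr .QUE = σ.arr .QUE := fa' _ (by simp)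
      have e2 : (enter .i .wi i τ).arr .D1 = σ.arr .D1 := fa' _ (by simp)
      have e3 : (enter .i .wi i τ).arr .D2 = σ.arr .D2 := fa' _ (by simp)
      unfold SchedTable; rw [e1, e2, e3]; exact hQ
    have Tτ : AllTables S rep rc J (enter .i .wi i τ) := hT.congr fa'
    obtain ⟨f1, f2, f3, f4, f5, f6, f7, f8⟩ :=
      fetchCmd_spec I h F.lt Tτ.tables.pow Qτ hi (by simp [enter])
    have fM : (fetchCmd.run I (enter .i .wi i τ)).var .M = S.M := by
      rw [var_run _ _ _ _ (by simp [fetchCmd, vars])]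
      simp only [enter, Store.var_setVar, reduceCtorEq, if_false]
      rw [fv _ (by simp [hB, vars, fetchCmd, tabBody_vars, sumCmd_vars, leafTest_vars,
        innerTest_vars]), hM]
    set a := Q i with haQ
    set b := d₁ a with hbQ
    set c := d₂ a with hcQ
    have ha : a < S.M := h.lt i hi
    have rb : Ready S Q i b := h.ready₁ i hi
    have rcc : Ready S Q i c := h.ready₂ i hi
    have hb := h.ready_le hi.le rb
    have hc := h.ready_le hi.le rcc
    have hab : b ≠ a := h.ready_ne hi rb
    have hac : c ≠ a := h.ready_ne hi rcc
    have hna : ¬ Ready S Q i a := h.not_ready_self hi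
    have hj := h.join a ha
    have ho := S.opp_lt a ha
    have hFl := F.lt
    have hoppA := Tτ.opp
    set ρ := (fetchCmd ;; assign .po (arr .PW (arr .OPP Var.a)) ;;
     assign .pbo (arr .PW (arr .OPP Var.b)) ;;
     assign .pco (arr .PW (arr .OPP Var.c))).run I (enter .i .wi i τ) with hρ
    have ρa : ρ.arr = τ.arr := f1
    have Tρ : AllTables S rep rc J ρ := hT.congr fun k hk => by rw [ρa]; exact fa' k hk
    have hPW : ∀ j < J, τ.arr .PW j = 16 ^ j := Tτ.tables.pow
    have hOP : ∀ a < S.M, τ.arr .OPP a = S.opp a := Tτ.opp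
    have f1' : (fetchCmd.run I (enter .i .wi i τ)).arr = τ.arr := f1
    have ρpo : ρ.var .po = 16 ^ S.opp a := by
      simp [hρ, f1', f2, hOP a ha, hPW _ (show S.opp a < J by omega)]
    have ρpbo : b < S.M → ρ.var .pbo = 16 ^ S.opp b := fun hb' => by
      have := S.opp_lt b hb'
      simp [hρ, f1', f3, hOP b hb', hPW _ (show S.opp b < J by omega)]
    have ρpco : c < S.M → ρ.var .pco = 16 ^ S.opp c := fun hc' => by
      have := S.opp_lt c hc'
      simp [hρ, f1', f4, hOP c hc', hPW _ (show S.opp c < J by omega)]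
    have ρpa : ρ.var .pa = 16 ^ a := by simp [hρ, f5]
    have ρpb : ρ.var .pb = 16 ^ b := by simp [hρ, f6]
    have ρpc : ρ.var .pc = 16 ^ c := by simp [hρ, f7]
    have ρb : ρ.var .b = b := by simp [hρ, f3]
    have ρM : ρ.var .M = S.M := by simp [hρ, fM]
    have ρPC : ρ.arr .PC = σ.arr .PC := by rw [ρa, fa' _ (by simp)]
    have ρPL : ρ.arr .PL = σ.arr .PL := by rw [ρa, fa' _ (by simp)]
    have lb := hT.list b hb
    have lc := hT.list c hc
    have lo := hT.list (S.opp a) (by omega)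
    have hcode := CutSystem.isCode_handle (S := S) (rep := rep) (rc := rc)
    -- Marks are sound throughout. After the rounds in `D`, completeness is asserted for the
    -- satisfying labellings whose three handles stand at positions in `D`.
    have K := loop3_rule I .j1 .w1 .j2 .w2 .j3 .w3 (arr .PC Var.pb) (arr .PC Var.pc)
      (arr .PC Var.po) (tabBody S.q S.d) ρ (σ.arr .PC (16 ^ b)) (σ.arr .PC (16 ^ c))
      (σ.arr .PC (16 ^ S.opp a)) (1400 * W) (by decide)
      (disjoint_tabBody_vars _ _)
      (by simp [ρpb, ρPC])
      (fun υ hυ => by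
        have e1 : υ.var .pc = 16 ^ c := by
          rw [hυ.1 _ (notMem_tabBody_vars _ _ _ (by simp)), ρpc]
        have e2 : υ.arr .PC = σ.arr .PC := by rw [hυ.2 _ (by simp [tabBody_arrs]), ρPC]
        simp [e1, e2])
      (fun υ hυ => by
        have e1 : υ.var .po = 16 ^ S.opp a := by
          rw [hυ.1 _ (notMem_tabBody_vars _ _ _ (by simp)), ρpo]
        have e2 : υ.arr .PC = σ.arr .PC := by rw [hυ.2 _ (by simp [tabBody_arrs]), ρPC]
        simp [e1, e2])
      (fun D υ => (∀ a' ≠ a, ∀ r e, IsCode r → IsCode e →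
          υ.arr .TB (ix3 (16 ^ a') r e) = τ.arr .TB (ix3 (16 ^ a') r e)) ∧
        (∀ r e, IsCode r → IsCode e → υ.arr .TB (ix3 (16 ^ a) r e) ≠ 0 →
          ∃ X, S.IsLab X ∧ r = S.handle rep rc a X ∧ e = S.handle rep rc (S.opp a) X ∧ S.Sat a X) ∧
        ∀ X, S.IsLab X → S.Sat a X → (∃ p ∈ D,
          σ.arr .PL (ix2 (16 ^ b) (16 ^ p.1)) = S.handle rep rc b X ∧
          σ.arr .PL (ix2 (16 ^ c) (16 ^ p.2.1)) = S.handle rep rc c X ∧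
          σ.arr .PL (ix2 (16 ^ S.opp a) (16 ^ p.2.2)) = S.handle rep rc (S.opp a) X) →
          υ.arr .TB (ix3 (16 ^ a) (S.handle rep rc a X) (S.handle rep rc (S.opp a) X)) ≠ 0)
      ⟨fun _ _ _ _ _ _ => by rw [ρa], fun r e hr he hne => by
        rw [ρa, i2 a ha hna r e hr he] at hne; exact absurd rfl hne, by simp⟩
      (fun D υ x v _ hυ => hυ) ?_
    · obtain ⟨⟨k1, k2, k3⟩, k4⟩ := K
      set υ := (loop .j1 .w1 (arr .PC Var.pb) (loop .j2 .w2 (arr .PC Var.pc)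
        (loop .j3 .w3 (arr .PC Var.po) (tabBody S.q S.d)))).run I ρ with hυ
      have er : B.run I (enter .i .wi i τ) = υ := rfl
      have ec : B.cost I (enter .i .wi i τ) = fetchCmd.cost I (enter .i .wi i τ) +
        (22 + (22 + (22 + (loop .j1 .w1 (arr .PC Var.pb) (loop .j2 .w2 (arr .PC Var.pc)
        (loop .j3 .w3 (arr .PC Var.po) (tabBody S.q S.d)))).cost I ρ))) := rfl
      rw [er, ec]
      refine ⟨⟨?_, ?_⟩, ?_⟩
      · intro b' hb' hr'
        by_cases hne : b' = a
        · subst hne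
          refine ⟨k2, fun X hX hsX => k3 X hX hsX ?_⟩
          obtain ⟨t1, ht1, e1⟩ := lb.complete X hX
          obtain ⟨t2, ht2, e2⟩ := lc.complete X hX
          obtain ⟨t3, ht3, e3⟩ := lo.complete X hX
          exact ⟨(t1, t2, t3), ⟨ht1, ht2, ht3⟩, e1, e2, e3⟩
        · have := i1 b' hb' ((Schedule.ready_succ hr').resolve_right hne)
          refine ⟨fun r e hr he => ?_, fun X hX hsX => ?_⟩
          · rw [k1 b' hne r e hr he]; exact this.sound r e hr he
          · rw [k1 b' hne _ _ (hcode _ _) (hcode _ _)]; exact this.complete X hX hsX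
      · intro a' ha' hr' r e hr he
        have hne : a' ≠ a := by
          rintro rfl
          exact hr' (.inr ⟨i, by omega, rfl⟩)
        rw [k1 a' hne r e hr he]
        exact i2 a' ha' (fun hr => hr' (Schedule.ready_mono hr)) r e hr he
      · simp only [cost_arr, cost_var] at k4
        have n1 := lb.le hs hb
        have n2 := lc.le hs hc
        have n3 := lo.le hs (by omega)
        have : σ.arr .PC (16 ^ b) * (2 + 9 + 3 + σ.arr .PC (16 ^ c) * (2 + 9 + 3 +
            σ.arr .PC (16 ^ S.opp a) * (1400 * W + 12) + 12) + 12) ≤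
            s * (26 + s * (26 + s * (1400 * W + 12))) := by
          calc _ ≤ s * (2 + 9 + 3 + s * (2 + 9 + 3 + s * (1400 * W + 12) + 12) + 12) := by gcongr
            _ = _ := by ring
        omega
    · rintro t1 ht1 t2 ht2 t3 ht3 D υ ⟨j1, j2, j3⟩ hF hw1 hw2 hw3
      obtain ⟨X₁, l1, e1⟩ := lb.sound t1 ht1
      obtain ⟨X₂, l2, e2⟩ := lc.sound t2 ht2
      obtain ⟨X₃, l3, e3⟩ := lo.sound t3 ht3
      obtain ⟨Z, hZ, z1, z2, z3⟩ := exists_merge (rep := rep) (rc := rc) ha hj l1 l2 l3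
      have kv : ∀ x ∈ [Var.b, .M, .pa, .pb, .pc, .po, .pbo, .pco], υ.var x = ρ.var x :=
        fun x hx => hF.1 _ (notMem_tabBody_vars _ _ _ hx)
      have υa : ∀ k, k ≠ .TB → υ.arr k = σ.arr k := fun k hk => by
        rw [hF.2 k (by simp [tabBody_arrs, hk]), ρa, fa' k hk]
      have υPL : υ.arr .PL = σ.arr .PL := υa _ (by simp)
      have tab : ∀ b', b' ≠ a → b' < S.M → Ready S Q i b' → TabTable S rep rc b' υ := by
        intro b' hne hb' hr'
        have := i1 b' hb' hr'
        refine ⟨fun r e hr he => ?_, fun X hX hsX => ?_⟩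
        · rw [j1 b' hne r e hr he]; exact this.sound r e hr he
        · rw [j1 b' hne _ _ (hcode _ _) (hcode _ _)]; exact this.complete X hX hsX
      obtain ⟨t, u1, u2, u3, u4⟩ := tabBody_spec I R F hdJ (hT.congr υa) ha hb hc hj (hleaf a ha)
        (fun hb' => tab b hab hb' rb) (fun hc' => tab c hac hc' rcc) hW hqW hZ
        (by simp [kv, ρb]) (by simp [kv, ρM]) (by simp [kv, ρpa]) (by simp [kv, ρpb])
        (by simp [kv, ρpc]) (by simp [kv, ρpo]) (fun hb' => by simp [kv, ρpbo hb'])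
        (fun hc' => by simp [kv, ρpco hc']) (by rw [υPL, hw1, e1, z1]) (by rw [υPL, hw2, e2, z2])
        (by rw [υPL, hw3, e3, z3])
      refine ⟨?_, u4⟩
      rw [u1]
      cases t with
      | false =>
        refine ⟨j1, j2, ?_⟩
        rintro X hX hsX ⟨p, hp, p1, p2, p3⟩
        rcases Set.mem_insert_iff.1 hp with rfl | hp
        · exact absurd (u3 X hX (p1.symm.trans (e1.trans z1.symm))
            (p2.symm.trans (e2.trans z2.symm)) (p3.symm.trans (e3.trans z3.symm)) hsX) (by simp)
        · exact j3 X hX hsX ⟨p, hp, p1, p2, p3⟩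
      | true =>
        rw [if_pos rfl]
        have upd : ∀ a' r e, IsCode r → IsCode e → Function.update (υ.arr .TB)
            (ix3 (16 ^ a) (S.handle rep rc a Z) (S.handle rep rc (S.opp a) Z)) 1 (ix3 (16 ^ a') r e) =
            if a' = a ∧ r = S.handle rep rc a Z ∧ e = S.handle rep rc (S.opp a) Z then 1
            else υ.arr .TB (ix3 (16 ^ a') r e) := by
          intro a' r e hr he
          rw [update_ix3 (isCode_pow _) (hcode _ _) (hcode _ _) (isCode_pow _) hr he]
          simp only [pow_inj16]
        refine ⟨?_, ?_, ?_⟩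
        · intro a' hne r e hr he
          rw [upd a' r e hr he, if_neg (fun hh => hne hh.1)]
          exact j1 a' hne r e hr he
        · intro r e hr he
          rw [upd a r e hr he]
          split_ifs with hc'
          · intro _
            obtain ⟨X, hX, x1, x2, x3⟩ := u2 rfl
            exact ⟨X, hX, hc'.2.1.trans ((R.handle_eq_iff ha).2 x1).symm,
              hc'.2.2.trans ((R.handle_eq_iff ho).2 x2).symm, x3⟩
          · exact j2 r e hr he
        · rintro X hX hsX ⟨p, hp, p1, p2, p3⟩
          rw [upd a _ _ (hcode _ _) (hcode _ _)]
          split_ifs with hc'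
          · norm_num
          · rcases Set.mem_insert_iff.1 hp with rfl | hp
            · exfalso
              apply hc'
              have y1 := p1.symm.trans (e1.trans z1.symm)
              have y2 := p2.symm.trans (e2.trans z2.symm)
              exact ⟨rfl, hj.handle_eq R ha hb hc y1 y2, p3.symm.trans (e3.trans z3.symm)⟩
            · exact j3 X hX hsX ⟨p, hp, p1, p2, p3⟩

/-! ### The answer -/

/-- Looks for partial solutions for the sides `0` and `1` that can be combined. -/
def answerCmd : Cmd :=
  assign .res (lit 0) ;;
  loop .j1 .w1 (arr .PC (lit 1)) (loop .j2 .w2 (arr .PC (lit 16)) (loop .j3 .w3 (lit 1)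
    (assign .q1 (arr .PL (Expr.ix2 (lit 1) Var.w1)) ;;
     assign .q2 (arr .PL (Expr.ix2 (lit 16) Var.w2)) ;;
     ite (arr .TB (Expr.ix3 (lit 1) Var.q1 Var.q2))
       (ite (arr .TB (Expr.ix3 (lit 16) Var.q2 Var.q1)) (assign .res (lit 1)) skip) skip)))

-- A solution restricts to both of the complementary sides 0 and 1 and marks the same two handles in
-- opposite order in their tables. Conversely two such marks give partial solutions that `glue_opp`
-- pastes together.
open Classical in
theorem answerCmd_spec (I : ℕ → ℕ) (R : S.Reps rep rc) (hM : 0 < S.M) (h01 : S.opp 0 = 1)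
    {σ : Store} (hl : ∀ b ≤ S.M + S.n, ListTable S rep rc b σ)
    (hT : ∀ a < S.M, TabTable S rep rc a σ) {s : ℕ} (hs : FewHandles S rep rc s) (hs1 : 1 ≤ s) :
    (answerCmd.run I σ).var .res =
      (if ∃ X, S.IsLab X ∧ ∀ v < S.n, ∀ j < S.q, S.D (X v) j (S.cnt (Finset.range S.n) X v j)
        then 1 else 0) ∧
    answerCmd.cost I σ ≤ 300 * (s * s) := by
  have h1M : 1 < S.M := h01 ▸ S.opp_lt 0 hM
  have h10 : S.opp 1 = 0 := by rw [← h01, S.opp_opp 0 hM]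
  have l0 := hl 0 (by omega)
  have l1 := hl 1 (by omega)
  have T0 := hT 0 hM
  have T1 := hT 1 h1M
  have n0 := l0.le hs (by omega)
  have n1 := l1.le hs (by omega)
  rw [pow_zero] at n0
  rw [pow_one] at n1
  set P := ∃ X, S.IsLab X ∧ ∀ v < S.n, ∀ j < S.q, S.D (X v) j (S.cnt (Finset.range S.n) X v j) with hP
  set B := (assign .q1 (arr .PL (Expr.ix2 (lit 1) Var.w1)) ;;
     assign .q2 (arr .PL (Expr.ix2 (lit 16) Var.w2)) ;;
     ite (arr .TB (Expr.ix3 (lit 1) Var.q1 Var.q2))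
       (ite (arr .TB (Expr.ix3 (lit 16) Var.q2 Var.q1)) (assign .res (lit 1)) skip) skip) with hB
  set ρ := (assign .res (lit 0)).run I σ with hρ
  have ρa : ρ.arr = σ.arr := rfl
  -- The literals 1 and 16 are 16^0 and 16^1, the codes of the sides 0 and 1. The third loop has one
  -- round and only serves to apply the rule for three loops.
  have K := loop3_rule I .j1 .w1 .j2 .w2 .j3 .w3 (arr .PC (lit 1)) (arr .PC (lit 16))
      (lit 1) B ρ (σ.arr .PC 1) (σ.arr .PC 16) 1 120 (by decide)
      (by simp [hB, vars]) (by simp [ρa])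
      (fun υ hυ => by rw [eval_arr, hυ.2 _ (by simp [hB, arrs])]; rfl) (fun υ hυ => rfl)
      (fun D υ => (υ.var .res = 0 ∨ υ.var .res = 1) ∧ (υ.var .res = 1 → P) ∧
        ∀ X, S.IsLab X → S.Sat 0 X → S.Sat 1 X → (∃ p ∈ D,
          σ.arr .PL (ix2 1 (16 ^ p.1)) = S.handle rep rc 0 X ∧
          σ.arr .PL (ix2 16 (16 ^ p.2.1)) = S.handle rep rc 1 X) → υ.var .res = 1)
      (by simp [hρ]) ?_ ?_
  · obtain ⟨⟨k1, k2, k3⟩, k4⟩ := K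
    refine ⟨?_, ?_⟩
    · change ((loop .j1 .w1 (arr .PC (lit 1)) (loop .j2 .w2 (arr .PC (lit 16))
        (loop .j3 .w3 (lit 1) B))).run I ρ).var .res = _
      split_ifs with hPc
      · obtain ⟨X, hX, hsol⟩ := hPc
        refine k3 X hX (fun v hv => hsol v (S.side_lt _ _ hv)) (fun v hv => hsol v (S.side_lt _ _ hv)) ?_
        obtain ⟨t0, h0, e0⟩ := l0.complete X hX
        obtain ⟨t1, h1, e1⟩ := l1.complete X hX
        rw [pow_zero] at h0 e0
        rw [pow_one] at h1 e1
        exact ⟨(t0, t1, 0), ⟨h0, h1, by norm_num⟩, e0, e1⟩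
      · rcases k1 with h | h
        · exact h
        · exact absurd (k2 h) hPc
    · have ec : answerCmd.cost I σ = 3 + (loop .j1 .w1 (arr .PC (lit 1))
        (loop .j2 .w2 (arr .PC (lit 16)) (loop .j3 .w3 (lit 1) B))).cost I ρ := rfl
      rw [ec]
      simp only [cost_arr, cost_lit] at k4
      have e1 : 1 ≤ s * s := Nat.mul_pos hs1 hs1
      have e2 : s ≤ s * s := Nat.le_mul_of_pos_left _ hs1
      calc _ ≤ 3 + (1 + 9 + 3 + s * (1 + 9 + 3 + s * (1 + 3 + 1 * (120 + 12) + 12) + 12)) := by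
            refine Nat.add_le_add_left (k4.trans ?_) _
            gcongr
        _ = 16 + 25 * s + 148 * (s * s) := by ring
        _ ≤ _ := by omega
  · intro D υ x v hv hυ
    have : (υ.setVar v x).var .res = υ.var .res := by
      simp only [List.mem_cons, List.not_mem_nil, or_false] at hv
      rcases hv with rfl | rfl | rfl | rfl | rfl | rfl <;> simp
    rw [this]; exact hυ
  · rintro t1 ht1 t2 ht2 t3 - D υ ⟨j1, j2, j3⟩ hF hw1 hw2 -
    have υa : υ.arr = σ.arr := by funext k; rw [hF.2 k (by simp [hB, arrs]), ρa]
    obtain ⟨X₁, x1, e1⟩ := l0.sound t1 (by simpa using ht1)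
    obtain ⟨X₂, x2, e2⟩ := l1.sound t2 (by simpa using ht2)
    rw [pow_zero] at e1
    rw [pow_one] at e2
    have hcode := CutSystem.isCode_handle (S := S) (rep := rep) (rc := rc)
    have er : (B.run I υ).var .res =
        if σ.arr .TB (ix3 1 (S.handle rep rc 0 X₁) (S.handle rep rc 1 X₂)) ≠ 0 ∧
          σ.arr .TB (ix3 16 (S.handle rep rc 1 X₂) (S.handle rep rc 0 X₁)) ≠ 0 then 1
        else υ.var .res := by
      simp only [hB, run_seq, run_ite, run_skip, run_assign, eval_arr, eval_ix2, eval_ix3, eval_var,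
        eval_lit, Store.var_setVar, Store.arr_setVar, reduceCtorEq, if_true, if_false, υa, hw1, hw2,
        e1, e2]
      split_ifs with h1 h2 h3 h3 h3 <;> simp_all
    refine ⟨?_, ?_⟩
    swap
    · simp only [hB, cost_seq, cost_assign, cost_arr, cost_ix2, cost_ix3, cost_var, cost_ite,
        cost_skip, cost_lit]
      split_ifs <;> norm_num
    rw [er]
    split_ifs with hc
    · refine ⟨.inr rfl, fun _ => ?_, fun _ _ _ _ _ => rfl⟩
      obtain ⟨Y₁, y1, a1, a2, a3⟩ := T0.sound _ _ (hcode _ _) (hcode _ _)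
        (by rw [pow_zero]; exact hc.1)
      obtain ⟨Y₂, y2, b1, b2, b3⟩ := T1.sound _ _ (hcode _ _) (hcode _ _)
        (by rw [pow_one]; exact hc.2)
      rw [h01] at a2
      rw [h10] at b2
      -- The common labelling of `glue_opp` is taken to be the first partial solution.
      exact CutSystem.glue_opp hM y1 y2 (fun _ _ _ _ _ => rfl) (fun _ _ _ _ _ => rfl) a3
        ((R.handle_eq_iff hM).1 (b2.symm.trans a1))
        (by rw [h01]; exact (R.handle_eq_iff h1M).1 (b1.symm.trans a2)) (by rw [h01]; exact b3)
    · refine ⟨j1, j2, ?_⟩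
      rintro X hX s0 s1 ⟨p, hp, p1, p2⟩
      rcases Set.mem_insert_iff.1 hp with rfl | hp
      · exfalso
        apply hc
        have c0 := T0.complete X hX s0
        have c1 := T1.complete X hX s1
        rw [h01, pow_zero, ← p1, ← p2, e1, e2] at c0
        rw [h10, pow_one, ← p1, ← p2, e1, e2] at c1
        exact ⟨c0, c1⟩
      · exact j3 X hX s0 s1 ⟨p, hp, p1, p2⟩

end Imp

namespace Imp

open Imp.Cmd Imp.Expr

/-! ## The order of the sides -/

/-- The tail of the dart `p` of the tree. -/
def tail (m : ℕ) (I : ℕ → ℕ) (p : ℕ) : ℕ := I (3 + (m + m) + p)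

/-- The input lists the edges of a tree with `N` nodes, and its leaves; the darts are numbered such
that the darts `2 e` and `2 e + 1` belong to edge `e`; the sides of the system are those of the
darts, ranked by `rk`. -/
structure InputTree (S : CutSystem) (m N : ℕ) (rk : ℕ → ℕ) (I : ℕ → ℕ) : Prop where
  M_eq : S.M = (N - 1) + (N - 1)
  tail_lt : ∀ p < S.M, tail m I p < N
  leaf_inj : ∀ x < S.n, ∀ y < S.n, tail m I (S.M + x) = tail m I (S.M + y) → x = y
  opp_even : ∀ e < N - 1, S.opp (e + e) = e + e + 1 ∧ S.opp (e + e + 1) = e + e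
  node : ∀ p < S.M, (∃ x < S.n, tail m I (S.M + x) = tail m I p ∧ S.side p = {x} ∧
      ∀ p' < S.M, tail m I p' = tail m I p → p' = p) ∨
    ∃ p₁ < S.M, ∃ p₂ < S.M, p ≠ p₁ ∧ p ≠ p₂ ∧ p₁ ≠ p₂ ∧ tail m I p₁ = tail m I p ∧
      tail m I p₂ = tail m I p ∧ ∀ p' < S.M, tail m I p' = tail m I p → p' = p ∨ p' = p₁ ∨ p' = p₂
  join : ∀ p < S.M, ∀ p₁ < S.M, ∀ p₂ < S.M, p ≠ p₁ → p ≠ p₂ → p₁ ≠ p₂ → tail m I p₁ = tail m I p →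
    tail m I p₂ = tail m I p → S.Join p (S.opp p₁) (S.opp p₂)
  rank : ∀ p < S.M, ∀ p' < S.M, p' ≠ p → tail m I p' = tail m I p → rk (S.opp p') < rk p

variable {S : CutSystem} {m N : ℕ} {rk : ℕ → ℕ} {I : ℕ → ℕ}

/-- The array `OUT` lists the darts with a given tail. -/
structure OutTable (S : CutSystem) (m : ℕ) (I : ℕ → ℕ) (k : ℕ) (σ : Store) : Prop where
  sound : ∀ u, ∀ c < σ.arr .DEG u, σ.arr .OUT (ix2 (16 ^ u) (16 ^ c)) < k ∧
    tail m I (σ.arr .OUT (ix2 (16 ^ u) (16 ^ c))) = u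
  inj : ∀ u, ∀ c < σ.arr .DEG u, ∀ c' < σ.arr .DEG u,
    σ.arr .OUT (ix2 (16 ^ u) (16 ^ c)) = σ.arr .OUT (ix2 (16 ^ u) (16 ^ c')) → c = c'
  complete : ∀ p < k, ∃ c < σ.arr .DEG (tail m I p), σ.arr .OUT (ix2 (16 ^ tail m I p) (16 ^ c)) = p

/-- `p` is the only dart with its tail. -/
def LeafDart (S : CutSystem) (m : ℕ) (I : ℕ → ℕ) (p : ℕ) : Prop :=
  ∀ p' < S.M, tail m I p' = tail m I p → p' = p

theorem OutTable.deg_le {σ : Store} {k : ℕ} (h : OutTable S m I k σ) (u : ℕ) :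
    σ.arr .DEG u ≤ k := by
  have := Finset.card_le_card_of_injOn (s := Finset.range (σ.arr .DEG u)) (t := Finset.range k)
    (fun c => σ.arr .OUT (ix2 (16 ^ u) (16 ^ c)))
    (fun c hc => by simpa using (h.sound u c (by simpa using hc)).1)
    (fun c hc c' hc' he => h.inj u c (by simpa using hc) c' (by simpa using hc') he)
  simpa using this

/-- The dart itself is listed at its tail, so the degree is at least 1, and the truncated difference
vanishes exactly for degree 1. -/
theorem OutTable.deg_eq_one {σ : Store} (h : OutTable S m I S.M σ)
    {p : ℕ} (hp : p < S.M) : σ.arr .DEG (tail m I p) - 1 = 0 ↔ LeafDart S m I p := by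
  obtain ⟨c, hc, e⟩ := h.complete p hp
  constructor
  · intro h1 p' hp' ht
    obtain ⟨c', hc', e'⟩ := h.complete p' hp'
    rw [ht] at hc' e'
    rw [← e, ← e', show c' = c by omega]
  · intro hl
    by_contra h1
    have key : ∀ c < σ.arr .DEG (tail m I p), σ.arr .OUT (ix2 (16 ^ tail m I p) (16 ^ c)) = p :=
      fun c hc => hl _ (h.sound _ c hc).1 (h.sound _ c hc).2
    have := h.inj _ 0 (by omega) 1 (by omega) ((key 0 (by omega)).trans (key 1 (by omega)).symm)
    omega

/-- This makes the inner loop of the queue run in constant time. -/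
theorem OutTable.deg_le_three {σ : Store} (T : InputTree S m N rk I) (h : OutTable S m I S.M σ)
    {p : ℕ} (hp : p < S.M) : σ.arr .DEG (tail m I p) ≤ 3 := by
  obtain ⟨p₁, p₂, hall⟩ : ∃ p₁ p₂, ∀ p' < S.M, tail m I p' = tail m I p →
      p' = p ∨ p' = p₁ ∨ p' = p₂ := by
    rcases T.node p hp with ⟨x, -, -, -, hall⟩ | ⟨p₁, -, p₂, -, -, -, -, -, -, hall⟩
    · exact ⟨p, p, fun p' hp' e => .inl (hall p' hp' e)⟩
    · exact ⟨p₁, p₂, hall⟩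
  have := Finset.card_le_card_of_injOn (s := Finset.range (σ.arr .DEG (tail m I p)))
    (t := {p, p₁, p₂}) (fun c => σ.arr .OUT (ix2 (16 ^ tail m I p) (16 ^ c)))
    (fun c hc => by
      obtain ⟨h1, h2⟩ := h.sound _ c (by simpa using hc)
      simpa using hall _ h1 h2)
    (fun c hc c' hc' he => h.inj _ c (by simpa using hc) c' (by simpa using hc') he)
  rw [Finset.card_range] at this
  exact this.trans Finset.card_le_three

/-- Collects the darts with a given tail. -/
def outCmd : Cmd :=
  loop .p .wp Var.M
    (assign .u (inp (Var.t + Var.p)) ;;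
     write .OUT (Expr.ix2 (arr .PW Var.u) (arr .PW (arr .DEG Var.u))) Var.p ;;
     write .DEG Var.u (arr .DEG Var.u + lit 1))

theorem outCmd_spec (T : InputTree S m N rk I) {J : ℕ} {σ : Store} (hPW : PowTable J σ)
    (hN : N ≤ J) (hMJ : S.M < J) (hM : σ.var .M = S.M) (ht : σ.var .t = 3 + (m + m))
    (hD : ∀ i, σ.arr .DEG i = 0) :
    OutTable S m I S.M (outCmd.run I σ) ∧ outCmd.cost I σ ≤ 130 * (S.M + 1) := by
  unfold outCmd
  set B := (assign .u (inp (Var.t + Var.p)) ;;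
     write .OUT (Expr.ix2 (arr .PW Var.u) (arr .PW (arr .DEG Var.u))) Var.p ;;
     write .DEG Var.u (arr .DEG Var.u + lit 1)) with hB
  have L := loop_rule I .p .wp Var.M B σ S.M 118 (by simp [hM]) (fun k τ => OutTable S m I k τ)
    ⟨by simp [hD], by simp [hD], by simp⟩ ?_
  · refine ⟨L.1, ?_⟩
    have := L.2
    simp only [cost_var] at this
    omega
  intro k hk τ i1 fv fa
  have hP : τ.arr .PW = σ.arr .PW := fa _ (by simp [hB, arrs])
  have htt : τ.var .t = 3 + (m + m) := by rw [fv _ (by simp [hB, vars]), ht]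
  set u := tail m I k with hu
  have huN : u < N := T.tail_lt k hk
  set D := τ.arr .DEG u with hD
  have hDk : D ≤ k := i1.deg_le u
  refine ⟨?_, by simp [hB]⟩
  have e1 : (B.run I (enter .p .wp k τ)).arr .OUT =
      Function.update (τ.arr .OUT) (ix2 (16 ^ u) (16 ^ D)) k := by
    have : I (3 + (m + m) + k) = u := rfl
    simp [hB, enter, hP, htt, this, hPW u (by omega), ← hD, hPW D (by omega)]
  have e2 : (B.run I (enter .p .wp k τ)).arr .DEG = Function.update (τ.arr .DEG) u (D + 1) := by
    have : I (3 + (m + m) + k) = u := rfl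
    simp [hB, enter, htt, this, ← hD]
  have o : ∀ v c, (B.run I (enter .p .wp k τ)).arr .OUT (ix2 (16 ^ v) (16 ^ c)) =
      if v = u ∧ c = D then k else τ.arr .OUT (ix2 (16 ^ v) (16 ^ c)) := by
    intro v c; rw [e1, update_ix2_pow]
  have g : ∀ v, (B.run I (enter .p .wp k τ)).arr .DEG v = if v = u then D + 1 else τ.arr .DEG v := by
    intro v; rw [e2, Function.update_apply]
  refine ⟨?_, ?_, ?_⟩
  · intro v c hc
    rw [g] at hc
    rw [o]
    split_ifs with h
    · exact ⟨by omega, h.1 ▸ rfl⟩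
    · have : c < τ.arr .DEG v := by
        split_ifs at hc with h'
        · rw [h', ← hD]; have : c ≠ D := fun h'' => h ⟨h', h''⟩; omega
        · exact hc
      have := i1.sound v c this
      exact ⟨by omega, this.2⟩
  · intro v c hc c' hc'
    rw [g] at hc hc'
    rw [o, o]
    by_cases hv : v = u
    · subst hv
      simp only [if_true] at hc hc'
      by_cases h1 : c = D
      · by_cases h2 : c' = D
        · intro _; omega
        · rw [if_pos ⟨rfl, h1⟩, if_neg (fun h => h2 h.2)]
          have := (i1.sound u c' (by rw [← hD]; omega)).1
          omega
      · by_cases h2 : c' = D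
        · rw [if_neg (fun h => h1 h.2), if_pos ⟨rfl, h2⟩]
          have := (i1.sound u c (by rw [← hD]; omega)).1
          omega
        · rw [if_neg (fun h => h1 h.2), if_neg (fun h => h2 h.2)]
          exact i1.inj u c (by rw [← hD]; omega) c' (by rw [← hD]; omega)
    · rw [if_neg hv] at hc hc'
      rw [if_neg (fun h => hv h.1), if_neg (fun h => hv h.1)]
      exact i1.inj v c hc c' hc'
  · intro p hp
    rcases Nat.lt_succ_iff_lt_or_eq.1 hp with hp | rfl
    · obtain ⟨c, hc, e⟩ := i1.complete p hp
      refine ⟨c, ?_, ?_⟩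
      · rw [g]; split_ifs with h
        · rw [h, ← hD] at hc; omega
        · exact hc
      · rw [o, if_neg, e]
        rintro ⟨h1, h2⟩
        rw [h1, ← hD] at hc
        omega
    · refine ⟨D, ?_, ?_⟩
      · rw [g, if_pos rfl]; omega
      · rw [o, if_pos ⟨rfl, rfl⟩]

/-! ### The queue -/

/-- `a` is one of the sides of which side `p` is composed. -/
def Dep (S : CutSystem) (m : ℕ) (I : ℕ → ℕ) (a p : ℕ) : Prop :=
  a < S.M ∧ p < S.M ∧ p ≠ S.opp a ∧ tail m I (S.opp a) = tail m I p

/-- The state of the queue when the pairs in `R` have been treated. -/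
structure Queue (S : CutSystem) (m : ℕ) (I : ℕ → ℕ) (R : Set (ℕ × ℕ)) (σ : Store) : Prop where
  dep : ∀ a p, (a, p) ∈ R → Dep S m I a p
  cnt : ∀ p < S.M, (σ.arr .CNT p = 0 ∧ ∀ a, (a, p) ∉ R) ∨
    (σ.arr .CNT p = 1 ∧ ∀ a, (a, p) ∈ R ↔ a = σ.arr .D1 p) ∨
    (σ.arr .CNT p = 2 ∧ σ.arr .D1 p ≠ σ.arr .D2 p ∧
      ∀ a, (a, p) ∈ R ↔ a = σ.arr .D1 p ∨ a = σ.arr .D2 p)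
  mem : ∀ p < S.M, (∃ j < σ.var .ql, σ.arr .QUE j = p) ↔ LeafDart S m I p ∨ σ.arr .CNT p = 2
  lt : ∀ j < σ.var .ql, σ.arr .QUE j < S.M
  inj : ∀ j < σ.var .ql, ∀ j' < σ.var .ql, σ.arr .QUE j = σ.arr .QUE j' → j = j'
  ord : ∀ j < σ.var .ql, ¬ LeafDart S m I (σ.arr .QUE j) →
    (∃ j' < j, σ.arr .D1 (σ.arr .QUE j) = σ.arr .QUE j') ∧
    ∃ j' < j, σ.arr .D2 (σ.arr .QUE j) = σ.arr .QUE j'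
  leaf : ∀ p < S.M, LeafDart S m I p → ∃ x < S.n, tail m I (S.M + x) = tail m I p ∧
    σ.arr .D1 p = S.M + x ∧ σ.arr .D2 p = S.M + S.n

theorem Queue.congr {R : Set (ℕ × ℕ)} {σ τ : Store} (h : Queue S m I R σ)
    (h1 : τ.var .ql = σ.var .ql) (h2 : ∀ k ∈ [Arr.CNT, .D1, .D2, .QUE], τ.arr k = σ.arr k) :
    Queue S m I R τ := by
  have e1 := h2 .CNT (by simp)
  have e2 := h2 .D1 (by simp)
  have e3 := h2 .D2 (by simp)
  have e4 := h2 .QUE (by simp)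
  obtain ⟨i1, i2, i3, i4, i5, i6, i7⟩ := h
  constructor
  · exact i1
  · rw [e1, e2, e3]; exact i2
  · rw [e1, e4, h1]; exact i3
  · rw [e4, h1]; exact i4
  · rw [e4, h1]; exact i5
  · rw [e2, e3, e4, h1]; exact i6
  · rw [e2, e3]; exact i7

/-- A side depends on the reversals of the other darts with its tail, and the degree 3 of the node
leaves only two of these. -/
theorem Dep.two (T : InputTree S m N rk I) {p a b c : ℕ} (ha : Dep S m I a p) (hb : Dep S m I b p)
    (hc : Dep S m I c p) (hab : a ≠ b) : c = a ∨ c = b := by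
  have oi : ∀ {x y}, x < S.M → y < S.M → S.opp x = S.opp y → x = y := by
    intro x y hx hy h; rw [← S.opp_opp x hx, h, S.opp_opp y hy]
  have hp := ha.2.1
  rcases T.node p hp with ⟨x, -, -, -, hall⟩ | ⟨p₁, -, p₂, -, -, -, -, -, -, hall⟩
  · exact absurd (hall _ (S.opp_lt a ha.1) ha.2.2.2).symm ha.2.2.1
  · have h1 := (hall _ (S.opp_lt a ha.1) ha.2.2.2).resolve_left fun h => ha.2.2.1 h.symm
    have h2 := (hall _ (S.opp_lt b hb.1) hb.2.2.2).resolve_left fun h => hb.2.2.1 h.symm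
    have h3 := (hall _ (S.opp_lt c hc.1) hc.2.2.2).resolve_left fun h => hc.2.2.1 h.symm
    have hne : S.opp a ≠ S.opp b := fun h => hab (oi ha.1 hb.1 h)
    have : S.opp c = S.opp a ∨ S.opp c = S.opp b := by omega
    exact this.imp (oi hc.1 ha.1) (oi hc.1 hb.1)

theorem Dep.not_leaf {a p : ℕ} (h : Dep S m I a p) : ¬ LeafDart S m I p := fun hl =>
  h.2.2.1 (hl _ (S.opp_lt a h.1) h.2.2.2).symm

/-- Treats one pair of sides. -/
def pushCmd : Cmd :=
  ite (arr .CNT Var.p)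
    (write .D2 Var.p Var.a ;; write .CNT Var.p (lit 2) ;; write .QUE Var.ql Var.p ;;
     assign .ql (Var.ql + lit 1))
    (write .D1 Var.p Var.a ;; write .CNT Var.p (lit 1))

/-- A side enters the queue when its second part has been treated. At that moment both parts stand
at positions up to `i`, hence before the new entry, which is what the order property requires. -/
theorem pushCmd_spec (T : InputTree S m N rk I) {R : Set (ℕ × ℕ)} {σ : Store}
    (h : Queue S m I R σ) {a p i : ℕ} (hd : Dep S m I a p) (hR : (a, p) ∉ R)
    (hq : ∀ b, (b, p) ∈ insert (a, p) R → ∃ j ≤ i, σ.arr .QUE j = b) (hi : i < σ.var .ql)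
    (ha : σ.var .a = a) (hp : σ.var .p = p) :
    Queue S m I (insert (a, p) R) (pushCmd.run I σ) ∧
    σ.var .ql ≤ (pushCmd.run I σ).var .ql ∧
    (∀ j < σ.var .ql, (pushCmd.run I σ).arr .QUE j = σ.arr .QUE j) ∧
    pushCmd.cost I σ ≤ 70 := by
  have hpM : p < S.M := hd.2.1
  have hnl := hd.not_leaf
  have hcost : pushCmd.cost I σ ≤ 70 := by
    simp only [pushCmd, cost_ite, cost_seq, cost_write, cost_assign, cost_arr, cost_add, cost_var,
      cost_lit]
    split_ifs <;> norm_num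
  have hins : ∀ p' ≠ p, ∀ b, (b, p') ∈ insert (a, p) R ↔ (b, p') ∈ R := by
    intro p' hp' b
    rw [Set.mem_insert_iff]
    constructor
    · rintro (h1 | h1)
      · exact absurd (Prod.mk.inj h1).2 hp'
      · exact h1
    · exact .inr
  have hdep : ∀ b p', (b, p') ∈ insert (a, p) R → Dep S m I b p' := by
    intro b p' hb
    rcases Set.mem_insert_iff.1 hb with h1 | h1
    · obtain ⟨rfl, rfl⟩ := Prod.mk.inj h1; exact hd
    · exact h.dep _ _ h1
  rcases h.cnt p hpM with ⟨c0, c1⟩ | ⟨c0, c1⟩ | ⟨c0, c1, c2⟩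
  · have er : pushCmd.run I σ = (σ.setArr .D1 p a).setArr .CNT p 1 := by
      rw [pushCmd, run_ite, if_neg (by simp [hp, c0])]; simp [hp, ha]
    rw [er]
    refine ⟨⟨hdep, ?_, ?_, h.lt, h.inj, ?_, ?_⟩, le_rfl, fun _ _ => rfl, hcost⟩
    · intro p' hp'
      simp only [Store.arr_setArr, reduceCtorEq, if_true, if_false]
      by_cases hpp : p' = p
      · subst hpp
        refine .inr (.inl ⟨by simp, fun b => ?_⟩)
        rw [Function.update_self, Set.mem_insert_iff]
        constructor
        · rintro (h1 | h1)
          · exact (Prod.mk.inj h1).1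
          · exact absurd h1 (c1 b)
        · rintro rfl; exact .inl rfl
      · simp only [Function.update_of_ne hpp, hins p' hpp]
        exact h.cnt p' hp'
    · intro p' hp'
      simp only [Store.arr_setArr, Store.var_setArr, reduceCtorEq, if_true, if_false]
      by_cases hpp : p' = p
      · subst hpp
        have := h.mem p' hp'
        rw [c0] at this
        rw [Function.update_self, this]
        simp
      · rw [Function.update_of_ne hpp]; exact h.mem p' hp'
    · intro j hj hl
      simp only [Store.arr_setArr, Store.var_setArr, reduceCtorEq, if_true, if_false] at hj hl ⊢
      have hne : σ.arr .QUE j ≠ p := by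
        intro he
        rcases (h.mem p hpM).1 ⟨j, hj, he⟩ with h1 | h1
        · exact hnl h1
        · omega
      rw [Function.update_of_ne hne]
      exact h.ord j hj hl
    · intro p' hp' hl
      simp only [Store.arr_setArr, reduceCtorEq, if_true, if_false]
      have hne : p' ≠ p := by rintro rfl; exact hnl hl
      rw [Function.update_of_ne hne]
      exact h.leaf p' hp' hl
  · have er : pushCmd.run I σ = (((σ.setArr .D2 p a).setArr .CNT p 2).setArr .QUE (σ.var .ql) p).setVar
        .ql (σ.var .ql + 1) := by
      rw [pushCmd, run_ite, if_pos (by simp [hp, c0])]; simp [hp, ha]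
    have hnq : ∀ j < σ.var .ql, σ.arr .QUE j ≠ p := by
      intro j hj he
      rcases (h.mem p hpM).1 ⟨j, hj, he⟩ with h1 | h1
      · exact hnl h1
      · omega
    have hD1 : (σ.arr .D1 p, p) ∈ R := (c1 _).2 rfl
    have hne : σ.arr .D1 p ≠ a := fun he => hR (he ▸ hD1)
    rw [er]
    have qold : ∀ j < σ.var .ql, Function.update (σ.arr .QUE) (σ.var .ql) p j = σ.arr .QUE j :=
      fun j hj => Function.update_of_ne (by omega) _ _
    have cases : ∀ {t}, t < σ.var .ql + 1 → t < σ.var .ql ∨ t = σ.var .ql := by omega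
    refine ⟨⟨hdep, ?_, ?_, ?_, ?_, ?_, ?_⟩, by simp, by simpa using qold, hcost⟩
    · intro p' hp'
      simp only [Store.arr_setArr, Store.arr_setVar, reduceCtorEq, if_true, if_false]
      by_cases hpp : p' = p
      · subst hpp
        refine .inr (.inr ⟨by simp, by simpa using hne, fun b => ?_⟩)
        rw [Function.update_self, Set.mem_insert_iff, c1]
        constructor
        · rintro (h1 | h1)
          · exact .inr (Prod.mk.inj h1).1
          · exact .inl h1
        · rintro (h1 | rfl)
          · exact .inr h1
          · exact .inl rfl
      · simp only [Function.update_of_ne hpp, hins p' hpp]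
        exact h.cnt p' hp'
    · intro p' hp'
      simp only [Store.arr_setArr, Store.arr_setVar, Store.var_setVar, Store.var_setArr, reduceCtorEq,
        if_true, if_false]
      by_cases hpp : p' = p
      · subst hpp
        rw [Function.update_self]
        exact iff_of_true ⟨σ.var .ql, by omega, by simp⟩ (.inr rfl)
      · rw [Function.update_of_ne hpp, ← h.mem p' hp']
        constructor
        · rintro ⟨j, hj, e⟩
          rcases cases hj with hj | rfl
          · exact ⟨j, hj, by rw [← qold j hj, e]⟩
          · rw [Function.update_self] at e; exact absurd e.symm hpp
        · rintro ⟨j, hj, e⟩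
          exact ⟨j, by omega, by rw [qold j hj, e]⟩
    · intro j hj
      simp only [Store.arr_setArr, Store.arr_setVar, Store.var_setVar, Store.var_setArr, reduceCtorEq,
        if_true, if_false] at hj ⊢
      rcases cases hj with hj | rfl
      · rw [qold j hj]; exact h.lt j hj
      · rw [Function.update_self]; exact hpM
    · intro j hj j' hj'
      simp only [Store.arr_setArr, Store.arr_setVar, Store.var_setVar, Store.var_setArr, reduceCtorEq,
        if_true, if_false] at hj hj' ⊢
      rcases cases hj with hj | rfl <;> rcases cases hj' with hj' | rfl
      · rw [qold j hj, qold j' hj']; exact h.inj j hj j' hj'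
      · rw [qold j hj, Function.update_self]; exact fun he => absurd he (hnq j hj)
      · rw [qold j' hj', Function.update_self]; exact fun he => absurd he.symm (hnq j' hj')
      · exact fun _ => rfl
    · intro j hj hl
      simp only [Store.arr_setArr, Store.arr_setVar, Store.var_setVar, Store.var_setArr, reduceCtorEq,
        if_true, if_false] at hj hl ⊢
      rcases cases hj with hj | rfl
      · rw [qold j hj] at hl ⊢
        rw [Function.update_of_ne (hnq j hj)]
        obtain ⟨⟨j1, h1, e1⟩, ⟨j2, h2, e2⟩⟩ := h.ord j hj hl
        exact ⟨⟨j1, h1, by rw [qold j1 (by omega), e1]⟩, ⟨j2, h2, by rw [qold j2 (by omega), e2]⟩⟩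
      · simp only [Function.update_self]
        obtain ⟨j1, h1, e1⟩ := hq _ (.inr hD1)
        obtain ⟨j2, h2, e2⟩ := hq _ (.inl rfl)
        exact ⟨⟨j1, by omega, by rw [qold j1 (by omega), e1]⟩,
          ⟨j2, by omega, by rw [qold j2 (by omega), e2]⟩⟩
    · intro p' hp' hl
      simp only [Store.arr_setArr, Store.arr_setVar, reduceCtorEq, if_true, if_false]
      have hne : p' ≠ p := by rintro rfl; exact hnl hl
      rw [Function.update_of_ne hne]
      exact h.leaf p' hp' hl
  -- A side whose two parts were both treated cannot receive a third one.
  · exfalso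
    have h1 := (c2 (σ.arr .D1 p)).2 (.inl rfl)
    have h2 := (c2 (σ.arr .D2 p)).2 (.inr rfl)
    rcases Dep.two T (h.dep _ _ h1) (h.dep _ _ h2) hd c1 with rfl | rfl
    exacts [hR h1, hR h2]

end Imp

/-! ### Running the queue -/

namespace Imp

open Imp.Cmd Imp.Expr

variable {S : CutSystem} {m N : ℕ} {rk : ℕ → ℕ} {I : ℕ → ℕ}

/-- The number of the vertex at a leaf. -/
def leafCmd : Cmd := loop .x .px Var.n (write .LV (inp (Var.l + Var.x)) Var.x)

theorem leafCmd_spec (T : InputTree S m N rk I) {σ : Store} (hn : σ.var .n = S.n)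
    (hl : σ.var .l = 3 + (m + m) + S.M) :
    (∀ x < S.n, (leafCmd.run I σ).arr .LV (tail m I (S.M + x)) = x) ∧
    leafCmd.cost I σ ≤ 50 * (S.n + 1) := by
  unfold leafCmd
  have L := loop_rule I .x .px Var.n (write .LV (inp (Var.l + Var.x)) Var.x) σ S.n 30
    (by simp [hn]) (fun k τ => k ≤ S.n ∧ ∀ x < k, τ.arr .LV (tail m I (S.M + x)) = x) (by simp) ?_
  · refine ⟨L.1.2, ?_⟩
    have := L.2
    simp only [cost_var] at this
    omega
  rintro k hk τ ⟨-, i1⟩ fv fa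
  have hlt : τ.var .l = 3 + (m + m) + S.M := by rw [fv _ (by simp [vars]), hl]
  refine ⟨⟨hk, ?_⟩, by simp⟩
  intro x hx
  have e : I (3 + (m + m) + S.M + k) = tail m I (S.M + k) := by
    unfold tail; rw [add_assoc (3 + (m + m))]
  simp only [run_write, enter, eval_inp, eval_add, eval_var, Store.var_setVar, Store.arr_setArr,
    Store.arr_setVar, reduceCtorEq, if_true, if_false, hlt, e]
  by_cases h : x = k
  · subst h; exact Function.update_self _ _ _
  · rw [Function.update_of_ne (fun h' => h (T.leaf_inj x (by omega) k hk h'))]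
    exact i1 x (by omega)

/-- Puts the sides of the leaves into the queue. -/
def startCmd : Cmd :=
  loop .p .wp Var.M
    (assign .u (inp (Var.t + Var.p)) ;;
     ite (arr .DEG Var.u - lit 1) skip
       (write .D1 Var.p (Var.M + arr .LV Var.u) ;; write .D2 Var.p (Var.M + Var.n) ;;
        write .QUE Var.ql Var.p ;; assign .ql (Var.ql + lit 1)))

/-- A side of a leaf is the union of the appended singleton of its vertex and the empty side, both
available from the start. These sides need no predecessors in the queue. -/
theorem startCmd_spec (T : InputTree S m N rk I) {σ : Store} (hn : σ.var .n = S.n)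
    (hM : σ.var .M = S.M) (ht : σ.var .t = 3 + (m + m)) (hq : σ.var .ql = 0)
    (hO : OutTable S m I S.M σ) (hL : ∀ x < S.n, σ.arr .LV (tail m I (S.M + x)) = x)
    (hC : ∀ i, σ.arr .CNT i = 0) :
    Queue S m I ∅ (startCmd.run I σ) ∧ startCmd.cost I σ ≤ 130 * (S.M + 1) := by
  unfold startCmd
  set B := (assign .u (inp (Var.t + Var.p)) ;;
     ite (arr .DEG Var.u - lit 1) skip
       (write .D1 Var.p (Var.M + arr .LV Var.u) ;; write .D2 Var.p (Var.M + Var.n) ;;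
        write .QUE Var.ql Var.p ;; assign .ql (Var.ql + lit 1))) with hB
  have L := loop_rule I .p .wp Var.M B σ S.M 118 (by simp [hM])
    (fun k τ => (∀ p < S.M, (∃ j < τ.var .ql, τ.arr .QUE j = p) ↔ LeafDart S m I p ∧ p < k) ∧
      (∀ j < τ.var .ql, τ.arr .QUE j < S.M) ∧
      (∀ j < τ.var .ql, ∀ j' < τ.var .ql, τ.arr .QUE j = τ.arr .QUE j' → j = j') ∧
      ∀ p < k, LeafDart S m I p → ∃ x < S.n, tail m I (S.M + x) = tail m I p ∧
        τ.arr .D1 p = S.M + x ∧ τ.arr .D2 p = S.M + S.n) (by simp [hq]) ?_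
  · obtain ⟨⟨i1, i2, i3, i4⟩, i5⟩ := L
    have hCt : ((loop .p .wp Var.M B).run I σ).arr .CNT = σ.arr .CNT :=
      arr_run _ _ _ _ (by simp [hB, arrs])
    have i1' : ∀ p < S.M, (∃ j < ((loop .p .wp Var.M B).run I σ).var .ql,
        ((loop .p .wp Var.M B).run I σ).arr .QUE j = p) ↔ LeafDart S m I p := fun p hp => by
      rw [i1 p hp]; exact ⟨fun h => h.1, fun h => ⟨h, hp⟩⟩
    refine ⟨⟨by simp, fun p hp => .inl ⟨by rw [hCt, hC], by simp⟩, ?_, i2, i3, ?_, i4⟩, ?_⟩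
    · intro p hp
      rw [i1' p hp, hCt, hC]
      simp
    · intro j hj hl
      exact absurd ((i1' _ (i2 j hj)).1 ⟨j, hj, rfl⟩) hl
    · simp only [cost_var] at i5
      omega
  rintro k hk τ ⟨i1, i2, i3, i4⟩ fv fa
  have ftt : τ.var .t = 3 + (m + m) := by rw [fv _ (by simp [hB, vars]), ht]
  have fM : τ.var .M = S.M := by rw [fv _ (by simp [hB, vars]), hM]
  have fn : τ.var .n = S.n := by rw [fv _ (by simp [hB, vars]), hn]
  have fD : τ.arr .DEG = σ.arr .DEG := fa _ (by simp [hB, arrs])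
  have fL : τ.arr .LV = σ.arr .LV := fa _ (by simp [hB, arrs])
  have hu : I (3 + (m + m) + k) = tail m I k := rfl
  have hdeg := hO.deg_eq_one hk
  have hcost : B.cost I (enter .p .wp k τ) ≤ 118 := by
    simp only [hB, cost_seq, cost_assign, cost_inp, cost_add, cost_var, cost_ite, cost_sub, cost_arr,
      cost_lit, cost_skip, cost_write]
    split_ifs <;> norm_num
  refine ⟨?_, hcost⟩
  by_cases hlf : LeafDart S m I k
  · obtain ⟨x, hx, ex⟩ : ∃ x < S.n, tail m I (S.M + x) = tail m I k := by
      rcases T.node k hk with ⟨x, hx, e, -⟩ | ⟨p₁, h1, -, -, hne, -, -, e, -⟩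
      · exact ⟨x, hx, e⟩
      · exact absurd (hlf p₁ h1 e).symm hne
    have eL : σ.arr .LV (tail m I k) = x := by rw [← ex, hL x hx]
    have er : B.run I (enter .p .wp k τ) = (((((enter .p .wp k τ).setVar .u (tail m I k)).setArr .D1 k
        (S.M + x)).setArr .D2 k (S.M + S.n)).setArr .QUE (τ.var .ql) k).setVar .ql (τ.var .ql + 1) := by
      rw [hB, run_seq, run_ite, if_neg]
      · simp [enter, ftt, hu, fM, fn, fL, eL]
      · simp [enter, ftt, hu, fD, hdeg.2 hlf]
    have hnq : ∀ j < τ.var .ql, τ.arr .QUE j ≠ k := by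
      intro j hj he
      have := ((i1 k hk).1 ⟨j, hj, he⟩).2
      omega
    have qold : ∀ j < τ.var .ql, Function.update (τ.arr .QUE) (τ.var .ql) k j = τ.arr .QUE j :=
      fun j hj => Function.update_of_ne (by omega) _ _
    have cases : ∀ {t}, t < τ.var .ql + 1 → t < τ.var .ql ∨ t = τ.var .ql := by omega
    rw [er]
    simp only [enter, Store.arr_setArr, Store.arr_setVar, Store.var_setVar, Store.var_setArr,
      reduceCtorEq, if_true, if_false]
    refine ⟨?_, ?_, ?_, ?_⟩
    · intro p hp
      constructor
      · rintro ⟨j, hj, e⟩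
        rcases cases hj with hj | rfl
        · rw [qold j hj] at e
          have := (i1 p hp).1 ⟨j, hj, e⟩
          exact ⟨this.1, by omega⟩
        · rw [Function.update_self] at e
          subst e
          exact ⟨hlf, by omega⟩
      · rintro ⟨h1, h2⟩
        rcases Nat.lt_succ_iff_lt_or_eq.1 h2 with h2 | rfl
        · obtain ⟨j, hj, e⟩ := (i1 p hp).2 ⟨h1, h2⟩
          exact ⟨j, by omega, by rw [qold j hj, e]⟩
        · exact ⟨_, Nat.lt_succ_self _, Function.update_self _ _ _⟩
    · intro j hj
      rcases cases hj with hj | rfl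
      · rw [qold j hj]; exact i2 j hj
      · rw [Function.update_self]; exact hk
    · intro j hj j' hj'
      rcases cases hj with hj | rfl <;> rcases cases hj' with hj' | rfl
      · rw [qold j hj, qold j' hj']; exact i3 j hj j' hj'
      · rw [qold j hj, Function.update_self]; exact fun he => absurd he (hnq j hj)
      · rw [qold j' hj', Function.update_self]; exact fun he => absurd he.symm (hnq j' hj')
      · exact fun _ => rfl
    · intro p hp hl
      by_cases h : p = k
      · subst h
        rw [Function.update_self, Function.update_self]
        exact ⟨x, hx, ex, rfl, rfl⟩
      · rw [Function.update_of_ne h, Function.update_of_ne h]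
        exact i4 p (by omega) hl
  · have er : B.run I (enter .p .wp k τ) = (enter .p .wp k τ).setVar .u (tail m I k) := by
      rw [hB, run_seq, run_ite, if_pos]
      · simp [enter, ftt, hu]
      · simp [enter, ftt, hu, fD]
        exact fun h => hlf (hdeg.1 (by omega))
    rw [er]
    simp only [enter, Store.arr_setVar, Store.var_setVar, reduceCtorEq, if_false]
    refine ⟨?_, i2, i3, ?_⟩
    · intro p hp
      rw [i1 p hp]
      constructor
      · exact fun h => ⟨h.1, by omega⟩
      · rintro ⟨h1, h2⟩
        rcases Nat.lt_succ_iff_lt_or_eq.1 h2 with h2 | rfl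
        exacts [⟨h1, h2⟩, absurd h1 hlf]
    · intro p hp hl
      have : p ≠ k := by rintro rfl; exact hlf hl
      exact i4 p (by omega) hl

/-- Processes the queue. -/
def queueCmd : Cmd :=
  loop .i .wi Var.M
    (assign .a (arr .QUE Var.i) ;; assign .o (arr .OPP Var.a) ;; assign .u (inp (Var.t + Var.o)) ;;
     loop .e .we (arr .DEG Var.u)
       (assign .p (arr .OUT (Expr.ix2 (arr .PW Var.u) Var.we)) ;;
        ite (Var.p - Var.o + (Var.o - Var.p)) pushCmd skip))

/-- The pairs treated after `i` rounds. -/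
def treated (S : CutSystem) (m : ℕ) (I : ℕ → ℕ) (Q : ℕ → ℕ) (i : ℕ) : Set (ℕ × ℕ) :=
  {x | Dep S m I x.1 x.2 ∧ ∃ j < i, Q j = x.1}

/-- The queue never runs dry. If everything in it had been treated, then by induction on the rank
every side would be in it: the parts of a side have smaller rank, so they are queued and treated,
and hence the side has been pushed. Then all M sides would be among fewer than M entries. -/
theorem Queue.lt_of_lt (T : InputTree S m N rk I) {σ : Store} {i : ℕ} (hi : i < S.M)
    (hle : i ≤ σ.var .ql) (h : Queue S m I (treated S m I (σ.arr .QUE) i) σ) : i < σ.var .ql := by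
  by_contra hlt
  have hql : σ.var .ql = i := by omega
  -- A non-leaf side has two distinct parts, both treated by induction, which excludes a count of 0
  -- or 1.
  have all : ∀ r, ∀ p < S.M, rk p = r → ∃ j < σ.var .ql, σ.arr .QUE j = p := by
    intro r
    induction r using Nat.strong_induction_on with
    | _ r ih =>
      intro p hp hr
      rw [h.mem p hp]
      rcases T.node p hp with ⟨x, -, -, -, hall⟩ | ⟨p₁, h1, p₂, h2, n1, n2, n3, e1, e2, -⟩
      · exact .inl hall
      · right
        have mem : ∀ p' < S.M, p ≠ p' → tail m I p' = tail m I p →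
            (S.opp p', p) ∈ treated S m I (σ.arr .QUE) i := by
          intro p' hp' hne he
          have ho := S.opp_lt p' hp'
          obtain ⟨j, hj, e⟩ := ih _ (hr ▸ T.rank p hp p' hp' hne.symm he) _ ho rfl
          refine ⟨⟨ho, hp, ?_, ?_⟩, j, by omega, e⟩
          · rw [S.opp_opp p' hp']; exact hne
          · rw [S.opp_opp p' hp']; exact he
        have m1 := mem p₁ h1 n1 e1
        have m2 := mem p₂ h2 n2 e2
        rcases h.cnt p hp with ⟨-, c⟩ | ⟨-, c⟩ | ⟨c, -⟩
        · exact absurd m1 (c _)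
        · have := ((c _).1 m1).trans ((c _).1 m2).symm
          exact absurd (by rw [← S.opp_opp p₁ h1, this, S.opp_opp p₂ h2]) n3
        · exact c
  have := Finset.card_le_card (s := Finset.range S.M)
    (t := (Finset.range (σ.var .ql)).image (σ.arr .QUE)) (by
      intro p hp
      obtain ⟨j, hj, e⟩ := all _ p (Finset.mem_range.1 hp) rfl
      exact Finset.mem_image.2 ⟨j, Finset.mem_range.2 hj, e⟩)
  have h2 := Finset.card_image_le (s := Finset.range (σ.var .ql)) (f := σ.arr .QUE)
  rw [Finset.card_range] at this h2
  omega

-- Round i treats all dependencies on the i-th entry, which exists by `Queue.lt_of_lt`. Each dart at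
-- the node concerned, other than the reversed dart itself, is offered this entry as a part.
set_option maxHeartbeats 600000 in
theorem queueCmd_spec (T : InputTree S m N rk I) {J : ℕ} {σ : Store} (hPW : PowTable J σ)
    (hN : N ≤ J) (hM : σ.var .M = S.M) (ht : σ.var .t = 3 + (m + m))
    (hO : OutTable S m I S.M σ) (hop : OppTable S σ) (hq : Queue S m I ∅ σ) :
    (S.M ≤ (queueCmd.run I σ).var .ql ∧
      Queue S m I (treated S m I ((queueCmd.run I σ).arr .QUE) S.M) (queueCmd.run I σ)) ∧
    queueCmd.cost I σ ≤ 600 * (S.M + 1) := by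
  unfold queueCmd
  set B2 := (assign .p (arr .OUT (Expr.ix2 (arr .PW Var.u) Var.we)) ;;
        ite (Var.p - Var.o + (Var.o - Var.p)) pushCmd skip) with hB2
  set B1 := (assign .a (arr .QUE Var.i) ;; assign .o (arr .OPP Var.a) ;;
    assign .u (inp (Var.t + Var.o)) ;; loop .e .we (arr .DEG Var.u) B2) with hB1
  have B2a : B2.arrs = [.D2, .CNT, .QUE, .D1, .CNT] := rfl
  have B2v : B2.vars = [.p, .ql] := rfl
  have B1v : B1.vars = [.a, .o, .u, .e, .we, .p, .ql] := rfl
  have B1a : B1.arrs = [.D2, .CNT, .QUE, .D1, .CNT] := rfl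
  have L := loop_rule I .i .wi Var.M B1 σ S.M 480 (by simp [hM])
    (fun i τ => i ≤ τ.var .ql ∧ Queue S m I (treated S m I (τ.arr .QUE) i) τ)
    ⟨Nat.zero_le _, by convert hq using 1; ext; simp [treated]⟩ ?_
  · refine ⟨L.1, ?_⟩
    have := L.2
    simp only [cost_var] at this
    omega
  rintro i hi τ ⟨i1, i2⟩ fv fa
  have fv' : ∀ x, x ∉ (.i :: .wi :: B1.vars : List Var) → τ.var x = σ.var x := fv
  have hiq := i2.lt_of_lt T hi i1
  set a := τ.arr .QUE i with ha
  have haM : a < S.M := i2.lt i hiq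
  have ho := S.opp_lt a haM
  set u := tail m I (S.opp a) with hu
  have huN : u < N := T.tail_lt _ ho
  have fPW : τ.arr .PW = σ.arr .PW := fa _ (by simp [B1a])
  have fOUT : τ.arr .OUT = σ.arr .OUT := fa _ (by simp [B1a])
  have fDEG : τ.arr .DEG = σ.arr .DEG := fa _ (by simp [B1a])
  have fOPP : τ.arr .OPP = σ.arr .OPP := fa _ (by simp [B1a])
  have ft : τ.var .t = 3 + (m + m) := by rw [fv' _ (by simp [B1v]), ht]
  set ρ := (assign .a (arr .QUE Var.i) ;; assign .o (arr .OPP Var.a) ;;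
    assign .u (inp (Var.t + Var.o))).run I (enter .i .wi i τ) with hρ
  have ρar : ρ.arr = τ.arr := rfl
  have ρa : ρ.var .a = a := by simp [hρ, enter, ha]
  have ρo : ρ.var .o = S.opp a := by simp [hρ, enter, ← ha, fOPP, hop a haM]
  have ρu : ρ.var .u = u := by
    simp [hρ, enter, ← ha, fOPP, hop a haM, ft]; rfl
  have ρql : ρ.var .ql = τ.var .ql := by simp [hρ, enter]
  have K := loop_rule I .e .we (arr .DEG Var.u) B2 ρ (σ.arr .DEG u) 120
    (by simp [ρar, ρu, fDEG])
    (fun c υ => τ.var .ql ≤ υ.var .ql ∧ (∀ j < τ.var .ql, υ.arr .QUE j = τ.arr .QUE j) ∧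
      Queue S m I (treated S m I (τ.arr .QUE) i ∪
        {x | x.1 = a ∧ Dep S m I a x.2 ∧ ∃ c' < c, σ.arr .OUT (ix2 (16 ^ u) (16 ^ c')) = x.2}) υ)
    ⟨ρql.ge, by simp [ρar], by
      simpa using i2.congr ρql fun _ _ => by rw [ρar]⟩ ?_
  · obtain ⟨⟨k1, k2, k3⟩, k4⟩ := K
    have er : B1.run I (enter .i .wi i τ) = (loop .e .we (arr .DEG Var.u) B2).run I ρ := rfl
    have ec : B1.cost I (enter .i .wi i τ) = 13 + (13 + (10 +
      (loop .e .we (arr .DEG Var.u) B2).cost I ρ)) := rfl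
    rw [er, ec]
    refine ⟨⟨by omega, ?_⟩, ?_⟩
    · convert k3 using 1
      ext ⟨b, p⟩
      simp only [treated, Set.mem_ofPred_eq, Set.mem_union]
      constructor
      · rintro ⟨hd, j, hj, e⟩
        rcases Nat.lt_succ_iff_lt_or_eq.1 hj with hj | rfl
        · exact .inl ⟨hd, j, hj, by rw [← k2 j (by omega), e]⟩
        · have : b = a := by rw [← e, k2 j hiq]
          subst this
          right
          obtain ⟨c, hc, e'⟩ := hO.complete p hd.2.1
          rw [← hd.2.2.2] at hc e'
          exact ⟨rfl, hd, c, hc, e'⟩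
      · rintro (⟨hd, j, hj, e⟩ | ⟨rfl, hd, -⟩)
        · exact ⟨hd, j, by omega, by rw [k2 j (by omega), e]⟩
        · exact ⟨hd, i, by omega, by rw [k2 i hiq]⟩
    · have h3 : σ.arr .DEG u ≤ 3 := hO.deg_le_three T ho
      simp only [cost_arr, cost_var] at k4
      have : σ.arr .DEG u * (120 + 12) ≤ 3 * (120 + 12) := Nat.mul_le_mul_right _ h3
      omega
  rintro c hc υ ⟨j1, j2, j3⟩ gv ga
  have gu : υ.var .u = u := by rw [gv _ (by simp [vars, B2v]), ρu]
  have gO : υ.var .o = S.opp a := by rw [gv _ (by simp [vars, B2v]), ρo]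
  have gA : υ.var .a = a := by rw [gv _ (by simp [vars, B2v]), ρa]
  have gOUT : υ.arr .OUT = σ.arr .OUT := by rw [ga _ (by simp [B2a]), ρar, fOUT]
  have gPW : υ.arr .PW = σ.arr .PW := by rw [ga _ (by simp [B2a]), ρar, fPW]
  set p := σ.arr .OUT (ix2 (16 ^ u) (16 ^ c)) with hp
  obtain ⟨hpM, hpt⟩ := hO.sound u c hc
  rw [← hp] at hpM hpt
  set π := (assign .p (arr .OUT (Expr.ix2 (arr .PW Var.u) Var.we))).run I (enter .e .we c υ) with hπ
  have πa : π.arr = υ.arr := rfl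
  have πp : π.var .p = p := by
    simp [hπ, enter, gu, gPW, gOUT, hPW u (by omega), hp]
  have πo : π.var .o = S.opp a := by simp [hπ, enter, gO]
  have πA : π.var .a = a := by simp [hπ, enter, gA]
  have πq : π.var .ql = υ.var .ql := by simp [hπ, enter]
  have er : B2.run I (enter .e .we c υ) =
    (ite (Var.p - Var.o + (Var.o - Var.p)) pushCmd skip).run I π := rfl
  have ec : B2.cost I (enter .e .we c υ) = 28 +
    (ite (Var.p - Var.o + (Var.o - Var.p)) pushCmd skip).cost I π := by
    simp only [hB2, cost_seq, cost_assign, cost_arr, cost_ix2, cost_var]; rfl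
  have hQπ := j3.congr (τ := π) πq fun _ _ => by rw [πa]
  rw [er, ec, run_ite, cost_ite]
  simp only [eval_add, eval_sub, eval_var, πp, πo, cost_add, cost_sub, cost_var]
  by_cases hpo : p = S.opp a
  · rw [if_neg (by omega), if_neg (by omega), run_skip, cost_skip]
    refine ⟨⟨by rw [πq]; exact j1, by rw [πa]; exact j2, ?_⟩, by omega⟩
    convert hQπ using 2
    ext ⟨b, p'⟩
    simp only [Set.mem_ofPred_eq]
    constructor
    · rintro ⟨h1, h2, c', h3, h4⟩
      refine ⟨h1, h2, c', ?_, h4⟩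
      by_contra h5
      obtain rfl : c' = c := by omega
      exact h2.2.2.1 (h4.symm.trans (hp.symm.trans hpo))
    · rintro ⟨h1, h2, c', h3, h4⟩
      exact ⟨h1, h2, c', by omega, h4⟩
  · rw [if_pos (by omega), if_pos (by omega)]
    have hd : Dep S m I a p := ⟨haM, hpM, hpo, hpt.symm⟩
    have hnew : (a, p) ∉ treated S m I (τ.arr .QUE) i ∪
        {x | x.1 = a ∧ Dep S m I a x.2 ∧ ∃ c' < c, σ.arr .OUT (ix2 (16 ^ u) (16 ^ c')) = x.2} := by
      rintro (⟨-, j, hj, e⟩ | ⟨-, -, c', hc', e⟩)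
      · have := i2.inj j (by omega) i hiq e
        omega
      · have := hO.inj u c' (by omega) c hc e
        omega
    obtain ⟨u1, u2, u3, u4⟩ := pushCmd_spec T hQπ hd hnew (i := i) (by
      intro b hb
      rcases Set.mem_insert_iff.1 hb with hb | ⟨-, j, hj, e⟩ | ⟨e, -⟩
      · obtain ⟨rfl, -⟩ := Prod.mk.inj hb
        exact ⟨i, le_rfl, by rw [πa, j2 i hiq]⟩
      · exact ⟨j, by omega, by rw [πa, j2 j (by omega)]; exact e⟩
      · exact ⟨i, le_rfl, by rw [πa, j2 i hiq]; exact e.symm⟩) (by omega) πA πp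
    refine ⟨⟨by omega, ?_, ?_⟩, by omega⟩
    · intro j hj
      rw [u3 j (by omega), πa, j2 j hj]
    · convert u1 using 1
      ext ⟨b, p'⟩
      simp only [Set.mem_ofPred_eq, Set.mem_union, Set.mem_insert_iff, Prod.mk.injEq]
      constructor
      · rintro (h | ⟨h1, h2, c', h3, h4⟩)
        · exact .inr (.inl h)
        · rcases Nat.lt_succ_iff_lt_or_eq.1 h3 with h3 | rfl
          · exact .inr (.inr ⟨h1, h2, c', h3, h4⟩)
          · exact .inl ⟨h1, h4.symm.trans hp.symm⟩
      · rintro (⟨rfl, rfl⟩ | h | ⟨h1, h2, c', h3, h4⟩)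
        · exact .inr ⟨rfl, hd, c, by omega, hp.symm⟩
        · exact .inl h
        · exact .inr ⟨h1, h2, c', by omega, h4⟩

/-- At least M distinct entries below M exhaust all sides, so the queue itself is the schedule, and
the recorded parts are the two sides of which a side is composed. -/
theorem Queue.schedule (T : InputTree S m N rk I) {σ : Store} (hle : S.M ≤ σ.var .ql)
    (h : Queue S m I (treated S m I (σ.arr .QUE) S.M) σ) :
    Schedule S (σ.arr .QUE) (σ.arr .D1) (σ.arr .D2) ∧ Leafy S (σ.arr .D1) (σ.arr .D2) ∧
      SchedTable S (σ.arr .QUE) (σ.arr .D1) (σ.arr .D2) σ := by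
  have hinj : ∀ i < S.M, ∀ j < S.M, σ.arr .QUE i = σ.arr .QUE j → i = j :=
    fun i hi j hj => h.inj i (by omega) j (by omega)
  have hlt : ∀ i < S.M, σ.arr .QUE i < S.M := fun i hi => h.lt i (by omega)
  have hsurj : ∀ a < S.M, ∃ i < S.M, σ.arr .QUE i = a := by
    have := Finset.eq_of_subset_of_card_le (s := (Finset.range S.M).image (σ.arr .QUE))
      (t := Finset.range S.M) (by
        intro p hp
        obtain ⟨j, hj, rfl⟩ := Finset.mem_image.1 hp
        exact Finset.mem_range.2 (hlt j (Finset.mem_range.1 hj))) (by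
        rw [Finset.card_image_of_injOn]
        intro i hi j hj
        exact hinj i (by simpa using hi) j (by simpa using hj))
    intro a ha
    rw [← Finset.mem_range, ← this] at ha
    obtain ⟨j, hj, e⟩ := Finset.mem_image.1 ha
    exact ⟨j, Finset.mem_range.1 hj, e⟩
  have key : ∀ a < S.M, (LeafDart S m I a ∧ ∃ x < S.n, S.side a = {x} ∧ σ.arr .D1 a = S.M + x ∧
      σ.arr .D2 a = S.M + S.n) ∨ (¬ LeafDart S m I a ∧ σ.arr .D1 a ≠ σ.arr .D2 a ∧
      Dep S m I (σ.arr .D1 a) a ∧ Dep S m I (σ.arr .D2 a) a) := by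
    intro a ha
    by_cases hl : LeafDart S m I a
    · left
      obtain ⟨x, hx, e1, e2, e3⟩ := h.leaf a ha hl
      refine ⟨hl, x, hx, ?_, e2, e3⟩
      rcases T.node a ha with ⟨y, hy, e, hs, -⟩ | ⟨p₁, h1, -, -, hne, -, -, e, -⟩
      · rw [hs, T.leaf_inj x hx y hy (e1.trans e.symm)]
      · exact absurd (hl p₁ h1 e).symm hne
    · right
      obtain ⟨i, hi, e⟩ := hsurj a ha
      have hc := ((h.mem a ha).1 ⟨i, by omega, e⟩).resolve_left hl
      rcases h.cnt a ha with ⟨c, -⟩ | ⟨c, -⟩ | ⟨-, hne, c⟩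
      · omega
      · omega
      · exact ⟨hl, hne, h.dep _ _ ((c _).2 (.inl rfl)), h.dep _ _ ((c _).2 (.inr rfl))⟩
  have app : ∀ i b, S.M ≤ b → b ≤ S.M + S.n → Ready S (σ.arr .QUE) i b := fun i b h1 h2 => .inl ⟨h1, h2⟩
  refine ⟨⟨hlt, hinj, hsurj, ?_, ?_, ?_⟩, ?_, fun i _ => rfl, fun a _ => ⟨rfl, rfl⟩⟩
  · intro a ha
    rcases key a ha with ⟨-, x, hx, hs, e1, e2⟩ | ⟨-, hne, g1, g2⟩
    · rw [e1, e2]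
      exact ⟨by rw [hs, S.side_single x hx, S.side_empty, Finset.union_empty],
        by rw [S.side_empty]; exact Finset.disjoint_empty_right _⟩
    · have := T.join a ha _ (S.opp_lt _ g1.1) _ (S.opp_lt _ g2.1) g1.2.2.1 g2.2.2.1
        (fun he => hne (by rw [← S.opp_opp _ g1.1, he, S.opp_opp _ g2.1])) g1.2.2.2 g2.2.2.2
      rwa [S.opp_opp _ g1.1, S.opp_opp _ g2.1] at this
  · intro i hi
    rcases key _ (hlt i hi) with ⟨-, x, hx, hs, e1, e2⟩ | ⟨hl, -⟩
    · rw [e1]; exact app _ _ (by omega) (by omega)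
    · obtain ⟨⟨j, hj, e⟩, -⟩ := h.ord i (by omega) hl
      exact .inr ⟨j, hj, e⟩
  · intro i hi
    rcases key _ (hlt i hi) with ⟨-, x, hx, hs, e1, e2⟩ | ⟨hl, -⟩
    · rw [e2]; exact app _ _ (by omega) le_rfl
    · obtain ⟨-, ⟨j, hj, e⟩⟩ := h.ord i (by omega) hl
      exact .inr ⟨j, hj, e⟩
  · intro a ha
    rcases key a ha with ⟨-, x, hx, hs, e1, e2⟩ | ⟨-, -, g1, g2⟩
    · exact .inl ⟨x, hx, e1, e2⟩
    · exact .inr ⟨g1.1, g2.1⟩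

end Imp

namespace Imp

open Imp.Cmd Imp.Expr

variable {S : CutSystem} {m N : ℕ} {rk : ℕ → ℕ} {I : ℕ → ℕ}

/-! ## The whole program -/

/-- Marks the listed triples in the array `DT`. -/
def degCmd : List (ℕ × ℕ × ℕ) → Cmd
  | [] => skip
  | x :: L => write .DT (lit (ix3 (16 ^ x.1) (16 ^ x.2.1) (16 ^ x.2.2))) (lit 1) ;; degCmd L

/-- The constraints are not part of the input: the program text lists the feasible triples, one
write for each. -/
theorem degCmd_spec (L : List (ℕ × ℕ × ℕ)) (σ : Store) :
    (∀ i j v, ((degCmd L).run I σ).arr .DT (ix3 (16 ^ i) (16 ^ j) (16 ^ v)) ≠ 0 ↔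
      (i, j, v) ∈ L ∨ σ.arr .DT (ix3 (16 ^ i) (16 ^ j) (16 ^ v)) ≠ 0) ∧
    ((degCmd L).run I σ).var = σ.var ∧ (∀ k, k ≠ .DT → ((degCmd L).run I σ).arr k = σ.arr k) ∧
    (degCmd L).cost I σ = 11 * L.length + 1 := by
  induction L generalizing σ with
  | nil => simp [degCmd]
  | cons x L ih =>
    obtain ⟨h1, h2, h3, h4⟩ := ih ((write .DT (lit (ix3 (16 ^ x.1) (16 ^ x.2.1) (16 ^ x.2.2)))
      (lit 1)).run I σ)
    refine ⟨?_, h2, ?_, ?_⟩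
    · intro i j v
      rw [degCmd, run_seq, h1]
      simp only [run_write, eval_lit, Store.arr_setArr, if_true, List.mem_cons]
      rw [update_ix3 (isCode_pow _) (isCode_pow _) (isCode_pow _) (isCode_pow _) (isCode_pow _)
        (isCode_pow _)]
      simp only [pow_inj16]
      obtain ⟨a, b, c⟩ := x
      by_cases h : i = a ∧ j = b ∧ v = c
      · rw [if_pos h]
        obtain ⟨rfl, rfl, rfl⟩ := h
        simp
      · rw [if_neg h]
        simp only [Prod.mk.injEq, h, false_or]
    · intro k hk
      rw [degCmd, run_seq, h3 k hk]
      simp [hk]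
    · rw [degCmd, cost_seq, h4]
      simp
      ring

open Classical in
/-- The list of all feasible triples. -/
noncomputable def degList (q d : ℕ) (D : ℕ → ℕ → ℕ → Prop) : List (ℕ × ℕ × ℕ) :=
  ((Finset.range q ×ˢ Finset.range q ×ˢ Finset.range (d + 1)).filter
    fun x : ℕ × ℕ × ℕ => D x.1 x.2.1 x.2.2).toList

theorem mem_degList {q d : ℕ} {D : ℕ → ℕ → ℕ → Prop} {i j v : ℕ} (hi : i < q) (hj : j < q)
    (hv : v ≤ d) : (i, j, v) ∈ degList q d D ↔ D i j v := by
  simp only [degList, Finset.mem_toList, Finset.mem_filter, Finset.mem_product, Finset.mem_range]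
  constructor
  · exact fun h => h.2
  · exact fun h => ⟨⟨hi, hj, by omega⟩, h⟩

theorem length_degList (q d : ℕ) (D : ℕ → ℕ → ℕ → Prop) :
    (degList q d D).length ≤ q * (q * (d + 1)) := by
  classical
  rw [degList, Finset.length_toList]
  refine (Finset.card_filter_le _ _).trans ?_
  simp

/-- Reads the parameters and computes the table of powers and the complementary sides. -/
def paramCmd (q d : ℕ) : Cmd :=
  assign .n (inp (lit 0)) ;; assign .m (inp (lit 1)) ;; assign .nt (inp (lit 2)) ;;
  assign .M (Var.nt - lit 1 + (Var.nt - lit 1)) ;; assign .t (lit 3 + (Var.m + Var.m)) ;;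
  assign .l (Var.t + Var.M) ;;
  loop .x .px Var.n (assign .J (Var.J + lit (6 * q * (d + 1)))) ;;
  loop .j .wj Var.J (write .PW Var.j Var.wj) ;;
  loop .e .we (Var.nt - lit 1)
    (write .OPP (Var.e + Var.e) (Var.e + Var.e + lit 1) ;;
     write .OPP (Var.e + Var.e + lit 1) (Var.e + Var.e))

/-- The size 6 n q (d + 1) of the table of powers is a product, formed by n additions of a constant.
The powers themselves come from the loop counter and need no further arithmetic. -/
theorem paramCmd_spec (T : InputTree S m N rk I) (h0 : I 0 = S.n) (h1 : I 1 = m) (h2 : I 2 = N)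
    (q d : ℕ) :
    ((paramCmd q d).run I Store.zero).var .n = S.n ∧ ((paramCmd q d).run I Store.zero).var .m = m ∧
    ((paramCmd q d).run I Store.zero).var .M = S.M ∧
    ((paramCmd q d).run I Store.zero).var .t = 3 + (m + m) ∧
    ((paramCmd q d).run I Store.zero).var .l = 3 + (m + m) + S.M ∧
    PowTable (S.n * (6 * q * (d + 1))) ((paramCmd q d).run I Store.zero) ∧
    OppTable S ((paramCmd q d).run I Store.zero) ∧
    (paramCmd q d).cost I Store.zero ≤
      70 + 20 * S.n + 30 * (S.n * (6 * q * (d + 1))) + 70 * (N - 1) := by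
  set c := 6 * q * (d + 1) with hc
  set σ := (assign .n (inp (lit 0)) ;; assign .m (inp (lit 1)) ;; assign .nt (inp (lit 2)) ;;
    assign .M (Var.nt - lit 1 + (Var.nt - lit 1)) ;; assign .t (lit 3 + (Var.m + Var.m)) ;;
    assign .l (Var.t + Var.M)).run I Store.zero with hσ
  have σn : σ.var .n = S.n := by simp [hσ, h0]
  have σm : σ.var .m = m := by simp [hσ, h1]
  have σnt : σ.var .nt = N := by simp [hσ, h2]
  have σM : σ.var .M = S.M := by simp [hσ, h2, T.M_eq]
  have σt : σ.var .t = 3 + (m + m) := by simp [hσ, h1]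
  have σl : σ.var .l = 3 + (m + m) + S.M := by simp [hσ, h1, h2, T.M_eq]
  have σJ : σ.var .J = 0 := by simp [hσ, Store.zero]
  have L1 := loop_rule I .x .px Var.n (assign .J (Var.J + lit c)) σ S.n 8 (by simp [σn])
    (fun k τ => τ.var .J = k * c) (by simp [σJ]) (by
      intro k _ τ hτ _ _
      refine ⟨?_, by simp⟩
      simp only [run_assign, enter, eval_add, eval_var, eval_lit, Store.var_setVar, reduceCtorEq,
        if_true, if_false, hτ]
      ring)
  set σ1 := (loop .x .px Var.n (assign .J (Var.J + lit c))).run I σ with hσ1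
  have L2 := loop_rule I .j .wj Var.J (write .PW Var.j Var.wj) σ1 (S.n * c) 15
    (by rw [eval_var, L1.1]) (fun k τ => ∀ j < k, τ.arr .PW j = 16 ^ j) (by simp) (by
      intro k _ τ hτ _ _
      refine ⟨?_, by simp⟩
      intro j hj
      simp only [run_write, enter, eval_var, Store.var_setVar, Store.arr_setArr, Store.arr_setVar,
        reduceCtorEq, if_true, if_false]
      by_cases h : j = k
      · subst h; exact Function.update_self _ _ _
      · rw [Function.update_of_ne h]; exact hτ j (by omega))
  set σ2 := (loop .j .wj Var.J (write .PW Var.j Var.wj)).run I σ1 with hσ2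
  set B := (write .OPP (Var.e + Var.e) (Var.e + Var.e + lit 1) ;;
     write .OPP (Var.e + Var.e + lit 1) (Var.e + Var.e)) with hB
  have v1 : ∀ x ∈ [Var.n, .m, .nt, .M, .t, .l], σ2.var x = σ.var x := by
    intro x hx
    simp only [List.mem_cons, List.not_mem_nil, or_false] at hx
    rcases hx with rfl | rfl | rfl | rfl | rfl | rfl <;>
      rw [hσ2, var_run _ _ _ _ (by simp [vars]), hσ1, var_run _ _ _ _ (by simp [vars])]
  have L3 := loop_rule I .e .we (Var.nt - lit 1) B σ2 (N - 1) 50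
    (by simp [v1, σnt]) (fun k τ => ∀ e < k, τ.arr .OPP (e + e) = e + e + 1 ∧
      τ.arr .OPP (e + e + 1) = e + e) (by simp) (by
      intro k _ τ hτ _ _
      refine ⟨?_, by simp [hB]⟩
      intro e he
      simp only [hB, run_seq, run_write, enter, eval_add, eval_lit, eval_var, Store.var_setVar,
        Store.var_setArr, Store.arr_setArr, Store.arr_setVar, reduceCtorEq, if_true, if_false,
        Function.update_apply]
      by_cases h : e = k
      · subst h; simp
      · have := hτ e (by omega)
        rw [if_neg (by omega), if_neg (by omega), if_neg (by omega), if_neg (by omega)]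
        exact this)
  have er : (paramCmd q d).run I Store.zero = (loop .e .we (Var.nt - lit 1) B).run I σ2 := rfl
  have ec : (paramCmd q d).cost I Store.zero = 6 + (6 + (6 + (11 + (9 + (7 +
    ((loop .x .px Var.n (assign .J (Var.J + lit c))).cost I σ +
      ((loop .j .wj Var.J (write .PW Var.j Var.wj)).cost I σ1 +
        (loop .e .we (Var.nt - lit 1) B).cost I σ2))))))) := rfl
  set σ3 := (loop .e .we (Var.nt - lit 1) B).run I σ2 with hσ3
  have v3 : ∀ x ∈ [Var.n, .m, .nt, .M, .t, .l], σ3.var x = σ.var x := by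
    intro x hx
    rw [← v1 x hx]
    simp only [List.mem_cons, List.not_mem_nil, or_false] at hx
    rcases hx with rfl | rfl | rfl | rfl | rfl | rfl <;>
      rw [hσ3, var_run _ _ _ _ (by simp [vars, hB])]
  rw [er, ec]
  refine ⟨by simp [v3, σn], by simp [v3, σm], by simp [v3, σM], by simp [v3, σt],
    by simp [v3, σl], ?_, ?_, ?_⟩
  · intro j hj
    rw [hσ3, arr_run _ _ _ _ (by simp [arrs, hB])]
    exact L2.1 j hj
  · intro a ha
    have hM := T.M_eq
    rcases Nat.even_or_odd' a with ⟨e, rfl | rfl⟩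
    · rw [show 2 * e = e + e by ring, (T.opp_even e (by omega)).1]
      exact (L3.1 e (by omega)).1
    · rw [show 2 * e + 1 = e + e + 1 by ring, (T.opp_even e (by omega)).2]
      exact (L3.1 e (by omega)).2
  · have c1 := L1.2
    have c2 := L2.2
    have c3 := L3.2
    simp only [cost_var, cost_sub, cost_lit] at c1 c2 c3
    omega

/-- The program. -/
noncomputable def mainCmd (q d : ℕ) (D : ℕ → ℕ → ℕ → Prop) : Cmd :=
  paramCmd q d ;; degCmd (degList q d D) ;; outCmd ;; leafCmd ;; startCmd ;; queueCmd ;; colsCmd ;;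
    listsCmd q d ;; tabCmd q d ;; answerCmd

theorem _root_.CutSystem.Reps.rc_le {rep : ℕ → ℕ → ℕ} {rc : ℕ → ℕ} (R : S.Reps rep rc) {a : ℕ}
    (ha : a < S.M) : rc a ≤ S.n := by
  have := Finset.card_le_card_of_injOn (s := Finset.range (rc a)) (t := Finset.range S.n) (rep a)
    (fun t ht => by simpa using R.lt a ha t (by simpa using ht))
    (fun t ht t' ht' he => R.inj a ha t (by simpa using ht) t' (by simpa using ht')
      (by rw [he]))
  simpa using this

-- Here `s` and `c` occur only in the bound: the program knows neither the number of handles nor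
-- that of representatives. All stages before the handles cost O(n m) or are absorbed by n s³ c q d.
set_option maxHeartbeats 1600000 in
open Classical in
theorem mainCmd_spec (G : InputGraph S m I) (T : InputTree S m N rk I) (h0 : I 0 = S.n)
    (h1 : I 1 = m) (h2 : I 2 = N) (hN : 2 ≤ N) (hNn : N ≤ 2 * S.n) {s c : ℕ} (hc : 1 ≤ c)
    (hqs : S.q ≤ s)
    (hfew : ∀ rep rc, S.Reps rep rc → FewHandles S rep rc s ∧ ∀ a < S.M, rc a ≤ c) :
    ((mainCmd S.q S.d S.D).run I Store.zero).var .res =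
      (if ∃ X, S.IsLab X ∧ ∀ v < S.n, ∀ j < S.q, S.D (X v) j (S.cnt (Finset.range S.n) X v j)
        then 1 else 0) ∧
    (mainCmd S.q S.d S.D).cost I Store.zero ≤
      100000 * (S.n * (m + s * s * s * (c * S.q * S.d))) := by
  set q := S.q with hq
  set d := S.d with hd
  have hq1 : 1 ≤ q := S.q_pos
  have hd1 : 1 ≤ d := S.d_pos
  have hMN := T.M_eq
  set J := S.n * (6 * q * (d + 1)) with hJ
  -- The tree has at most 2n nodes, so all sides have numbers below 5n. The factor 6 in J is ample
  -- for these, for N ≤ 2n, and for the positions n q (d + 1) of a coded profile.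
  have hJ6 : 12 * S.n ≤ J := by
    calc 12 * S.n = S.n * (6 * 1 * (1 + 1)) := by ring
      _ ≤ J := by rw [hJ]; gcongr
  have hdJ : d < J := by
    calc d < 1 * (6 * 1 * (d + 1)) := by omega
      _ ≤ J := by rw [hJ]; gcongr; omega
  obtain ⟨p1, p2, p3, p4, p5, p6, p7, p8⟩ := paramCmd_spec T h0 h1 h2 q d
  set σ1 := (paramCmd q d).run I Store.zero with hσ1
  have σ1a : ∀ k, k ≠ .PW → k ≠ .OPP → σ1.arr k = fun _ => 0 := fun k hk hk' => by
    rw [hσ1, arr_run _ _ _ _ (by simp [paramCmd, arrs, hk, hk'])]; rfl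
  have σ1q : σ1.var .ql = 0 := by
    rw [hσ1, var_run _ _ _ _ (by simp [paramCmd, vars])]; rfl
  obtain ⟨d1, d2, d3, d4⟩ := degCmd_spec (I := I) (degList q d S.D) σ1
  set σ2 := (degCmd (degList q d S.D)).run I σ1 with hσ2
  obtain ⟨o1, o2⟩ := outCmd_spec T (J := J) (σ := σ2)
    (by intro j hj; rw [d3 _ (by simp)]; exact p6 j hj) (by omega) (by omega) (by rw [d2, p3])
    (by rw [d2, p4]) (fun i => by rw [d3 _ (by simp), σ1a _ (by simp) (by simp)])
  set σ3 := outCmd.run I σ2 with hσ3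
  have a3 : ∀ k, k ≠ .OUT → k ≠ .DEG → σ3.arr k = σ2.arr k := fun k h h' =>
    arr_run _ _ _ _ (by simp [outCmd, arrs, h, h'])
  have v3 : ∀ x, x ≠ .p → x ≠ .wp → x ≠ .u → σ3.var x = σ1.var x := fun x h h' h'' => by
    rw [← d2]; exact var_run _ _ _ _ (by simp [outCmd, vars, h, h', h''])
  obtain ⟨l1, l2⟩ := leafCmd_spec T (σ := σ3) (by rw [v3 _ (by simp) (by simp) (by simp), p1])
    (by rw [v3 _ (by simp) (by simp) (by simp), p5])
  set σ4 := leafCmd.run I σ3 with hσ4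
  have a4 : ∀ k, k ≠ .OUT → k ≠ .DEG → k ≠ .LV → σ4.arr k = σ2.arr k := fun k h h' h'' => by
    rw [← a3 k h h']; exact arr_run _ _ _ _ (by simp [leafCmd, arrs, h''])
  have a4' : ∀ k, k ≠ .LV → σ4.arr k = σ3.arr k := fun k h =>
    arr_run _ _ _ _ (by simp [leafCmd, arrs, h])
  have v4 : ∀ x, x ≠ .p → x ≠ .wp → x ≠ .u → x ≠ .x → x ≠ .px → σ4.var x = σ1.var x :=
    fun x h h' h'' g g' => by
      rw [← v3 x h h' h'']; exact var_run _ _ _ _ (by simp [leafCmd, vars, g, g'])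
  have O4 : OutTable S m I S.M σ4 := by
    have e1 := a4' .OUT (by simp)
    have e2 := a4' .DEG (by simp)
    obtain ⟨w1, w2, w3⟩ := o1
    exact ⟨by rw [e1, e2]; exact w1, by rw [e1, e2]; exact w2, by rw [e1, e2]; exact w3⟩
  obtain ⟨s1, s2⟩ := startCmd_spec T (σ := σ4) (by rw [v4 _ (by simp) (by simp) (by simp) (by simp) (by simp), p1])
    (by rw [v4 _ (by simp) (by simp) (by simp) (by simp) (by simp), p3])
    (by rw [v4 _ (by simp) (by simp) (by simp) (by simp) (by simp), p4])
    (by rw [v4 _ (by simp) (by simp) (by simp) (by simp) (by simp), σ1q]) O4 l1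
    (fun i => by rw [a4 _ (by simp) (by simp) (by simp), d3 _ (by simp), σ1a _ (by simp) (by simp)])
  set σ5 := startCmd.run I σ4 with hσ5
  have a5 : ∀ k, k ∉ [Arr.D1, .D2, .QUE] → σ5.arr k = σ4.arr k := fun k h =>
    arr_run _ _ _ _ h
  have v5 : ∀ x, x ∉ [Var.p, .wp, .u, .ql] → σ5.var x = σ4.var x := fun x h =>
    var_run _ _ _ _ (by simp only [List.mem_cons, List.not_mem_nil, or_false, not_or] at h
                        simp [startCmd, vars, h])
  have O5 : OutTable S m I S.M σ5 := by
    have e1 := a5 .OUT (by simp)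
    have e2 := a5 .DEG (by simp)
    obtain ⟨w1, w2, w3⟩ := O4
    exact ⟨by rw [e1, e2]; exact w1, by rw [e1, e2]; exact w2, by rw [e1, e2]; exact w3⟩
  have P5 : PowTable J σ5 := by
    intro j hj
    rw [a5 _ (by simp), a4 _ (by simp) (by simp) (by simp), d3 _ (by simp)]; exact p6 j hj
  have Op5 : OppTable S σ5 := by
    intro a ha
    rw [a5 _ (by simp), a4 _ (by simp) (by simp) (by simp), d3 _ (by simp)]; exact p7 a ha
  obtain ⟨⟨q1, q2⟩, q3⟩ := queueCmd_spec T P5 (by omega)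
    (by rw [v5 _ (by simp), v4 _ (by simp) (by simp) (by simp) (by simp) (by simp), p3])
    (by rw [v5 _ (by simp), v4 _ (by simp) (by simp) (by simp) (by simp) (by simp), p4]) O5 Op5 s1
  set σ6 := queueCmd.run I σ5 with hσ6
  have a6 : ∀ k, k ∉ [Arr.D1, .D2, .QUE, .CNT] → σ6.arr k = σ5.arr k := fun k h =>
    arr_run _ _ _ _ (by simp only [List.mem_cons, List.not_mem_nil, or_false, not_or] at h
                        simp [queueCmd, pushCmd, arrs, h])
  have v6 : ∀ x ∈ [Var.n, .m, .M], σ6.var x = σ1.var x := by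
    intro x hx
    simp only [List.mem_cons, List.not_mem_nil, or_false] at hx
    rcases hx with rfl | rfl | rfl <;>
      rw [hσ6, var_run _ _ _ _ (by simp [queueCmd, pushCmd, vars]), v5 _ (by simp),
        v4 _ (by simp) (by simp) (by simp) (by simp) (by simp)]
  have a6' : ∀ k, k ∉ [Arr.D1, .D2, .QUE, .CNT, .OUT, .DEG, .LV] → σ6.arr k = σ2.arr k := by
    intro k h
    simp only [List.mem_cons, List.not_mem_nil, or_false, not_or] at h
    rw [a6 k (by simp [h]), a5 k (by simp [h]), a4 k (by simp [h]) (by simp [h]) (by simp [h])]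
  have z6 : ∀ k ∈ [Arr.KEY, .INS, .SEEN, .PL, .VAL, .EX, .TB], ∀ i, σ6.arr k i = 0 := by
    intro k hk i
    simp only [List.mem_cons, List.not_mem_nil, or_false] at hk
    rcases hk with rfl | rfl | rfl | rfl | rfl | rfl | rfl <;>
      rw [a6' _ (by simp), d3 _ (by simp), σ1a _ (by simp) (by simp)]
  obtain ⟨sc, sl, st⟩ := Queue.schedule T q1 q2
  set Q := σ6.arr .QUE with hQ
  set d₁ := σ6.arr .D1 with hd₁
  set d₂ := σ6.arr .D2 with hd₂
  have P6 : PowTable J σ6 := by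
    intro j hj
    rw [a6 _ (by simp)]; exact P5 j hj
  have hMJ : S.M + S.n < J := by omega
  obtain ⟨c1, ⟨rep, rc, R, c2⟩, c3⟩ := colsCmd_spec I G sc P6 hMJ st (by rw [v6 _ (by simp), p2])
    (by rw [v6 _ (by simp), p1]) (by rw [v6 _ (by simp), p3]) (z6 _ (by simp)) (z6 _ (by simp))
    (z6 _ (by simp))
  set σ7 := colsCmd.run I σ6 with hσ7
  have a7 : ∀ k, k ∉ [Arr.KEY, .INS, .SEEN, .REP, .RC] → σ7.arr k = σ6.arr k := fun k h =>
    arr_run _ _ _ _ (by simp only [List.mem_cons, List.not_mem_nil, or_false, not_or] at h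
                        simp [colsCmd, atomCmd, fetchCmd, joinCmd, repCmd, arrs, h])
  have v7 : ∀ x ∈ [Var.n, .M], σ7.var x = σ1.var x := by
    intro x hx
    simp only [List.mem_cons, List.not_mem_nil, or_false] at hx
    rcases hx with rfl | rfl <;>
      rw [hσ7, var_run _ _ _ _ (by simp [colsCmd, atomCmd, fetchCmd, joinCmd, repCmd, vars]),
        v6 _ (by simp)]
  have T7 : Tables S rep rc J σ7 := ⟨by intro j hj; rw [a7 _ (by simp)]; exact P6 j hj, c1, c2⟩
  obtain ⟨few, hrc⟩ := hfew rep rc R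
  have F : Fits S rc J := ⟨hMJ, fun a ha => by
    have := R.rc_le ha
    calc rc a * S.q * (S.d + 1) ≤ S.n * S.q * (S.d + 1) := by gcongr
      _ ≤ 6 * (S.n * S.q * (S.d + 1)) := by omega
      _ = J := by rw [hJ, hq, hd]; ring⟩
  have S7 : SchedTable S Q d₁ d₂ σ7 := by
    unfold SchedTable; rw [a7 _ (by simp), a7 _ (by simp), a7 _ (by simp)]; exact st
  set W := 3 * (c * q) with hW
  have hcq : 1 ≤ c * q := Nat.mul_pos hc hq1
  have hWa : ∀ a < S.M, rc a * (S.q + 1) + 1 ≤ W := fun a ha => by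
    have := hrc a ha
    calc rc a * (S.q + 1) + 1 ≤ c * (q + 1) + 1 := by rw [← hq]; gcongr
      _ ≤ c * (q + q) + c * q := by gcongr
      _ = W := by rw [hW]; ring
  have hqW : S.q ≤ W := by
    have : 1 * q ≤ c * q := Nat.mul_le_mul_right _ hc
    omega
  have hs1 : 1 ≤ s := hq1.trans hqs
  obtain ⟨e1, e2⟩ := listsCmd_spec I R F sc T7 S7 (by rw [v7 _ (by simp), p1])
    (by rw [v7 _ (by simp), p3]) (by rw [a7 _ (by simp)]; exact z6 _ (by simp))
    (by rw [a7 _ (by simp)]; exact z6 _ (by simp)) (by rw [a7 _ (by simp)]; exact z6 _ (by simp))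
    few hs1 hWa
  set σ8 := (listsCmd S.q S.d).run I σ7 with hσ8
  have a8 : ∀ k, k ∉ [Arr.PC, .PL, .VAL, .EX] → σ8.arr k = σ7.arr k := fun k h =>
    arr_run _ _ _ _ (by simp only [List.mem_cons, List.not_mem_nil, or_false, not_or] at h
                        simp [listsCmd, atomListCmd, pairsCmd, fetchCmd, sumCmd_arrs, addCmd_arrs,
                          arrs, h])
  have v8 : σ8.var .M = S.M := by
    rw [hσ8, var_run _ _ _ _ (by simp [listsCmd, atomListCmd, pairsCmd, fetchCmd, sumCmd_vars,
      addCmd_vars, vars]), v7 _ (by simp), p3]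
  have T8 : AllTables S rep rc J σ8 := by
    refine ⟨T7.congr (a8 _ (by simp)) (a8 _ (by simp)) (a8 _ (by simp)) (a8 _ (by simp)), ?_, ?_,
      fun b hb => (e1 b hb).1, fun b hb => (e1 b hb).2⟩
    · intro i hi j hj v hv
      rw [a8 _ (by simp), a7 _ (by simp), a6' _ (by simp), d1, mem_degList hi hj hv,
        σ1a _ (by simp) (by simp)]
      simp
    · intro a ha
      rw [a8 _ (by simp), a7 _ (by simp), a6 _ (by simp)]
      exact Op5 a ha
  have S8 : SchedTable S Q d₁ d₂ σ8 := by
    unfold SchedTable; rw [a8 _ (by simp), a8 _ (by simp), a8 _ (by simp)]; exact S7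
  obtain ⟨t1, t2⟩ := tabCmd_spec I R F hdJ sc sl T8 S8 v8
    (by rw [a8 _ (by simp), a7 _ (by simp)]; exact z6 _ (by simp)) few hs1 hWa hqW
  set σ9 := (tabCmd S.q S.d).run I σ8 with hσ9
  have a9 : ∀ k, k ≠ .TB → σ9.arr k = σ8.arr k := fun k h =>
    arr_run _ _ _ _ (by simp [tabCmd, fetchCmd, tabBody_arrs, arrs, h])
  have T9 := T8.congr a9
  have h01 : S.opp 0 = 1 := (T.opp_even 0 (by omega)).1
  obtain ⟨f1, f2⟩ := answerCmd_spec I R (show 0 < S.M by omega) h01 T9.list t1 few hs1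
  have er : (mainCmd q d S.D).run I Store.zero = answerCmd.run I σ9 := rfl
  have ec : (mainCmd q d S.D).cost I Store.zero = (paramCmd q d).cost I Store.zero +
    ((degCmd (degList q d S.D)).cost I σ1 + (outCmd.cost I σ2 + (leafCmd.cost I σ3 +
    (startCmd.cost I σ4 + (queueCmd.cost I σ5 + (colsCmd.cost I σ6 + ((listsCmd S.q S.d).cost I σ7 +
    ((tabCmd S.q S.d).cost I σ8 + answerCmd.cost I σ9)))))))) := rfl
  rw [er, ec]
  refine ⟨f1, ?_⟩
  have hn1 : 1 ≤ S.n := by omega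
  set X := s * s * s * (c * q * d) with hX
  have sss : s ≤ s * s * s := (Nat.le_mul_of_pos_left _ hs1).trans (Nat.le_mul_of_pos_right _ hs1)
  have ss : s * s ≤ s * s * s := Nat.le_mul_of_pos_right _ hs1
  have hcqd : 1 ≤ c * q * d := Nat.mul_pos hcq hd1
  have hqd : q * d ≤ c * q * d := Nat.mul_le_mul_right _ (Nat.le_mul_of_pos_left _ hc)
  have hs3 : 1 ≤ s * s * s := hs1.trans sss
  have x1 : 1 ≤ X := Nat.mul_pos hs3 hcqd
  have x2 : q * d ≤ X := hqd.trans (Nat.le_mul_of_pos_left _ hs3)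
  have x3 : q ≤ q * d := Nat.le_mul_of_pos_right _ hd1
  -- The q² (d + 1) writes for the constraints are affordable because q ≤ s.
  have x4 : q * (q * d) ≤ X := Nat.mul_le_mul (hqs.trans sss) hqd
  have x5 : s * s * s * (c * q) ≤ X := Nat.mul_le_mul_left _ (Nat.le_mul_of_pos_right _ hd1)
  have x6 : s * s * (c * q) ≤ X := (Nat.mul_le_mul_right _ ss).trans x5
  have x7 : s * s ≤ X := ss.trans (Nat.le_mul_of_pos_right _ hcqd)
  have y0 : S.n ≤ S.n * X := Nat.le_mul_of_pos_right _ x1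
  have y1 : X ≤ S.n * X := Nat.le_mul_of_pos_left _ hn1
  have y2 : S.n * (q * d) ≤ S.n * X := Nat.mul_le_mul_left _ x2
  have b1 : J ≤ 12 * (S.n * (q * d)) := by
    calc J ≤ S.n * (6 * q * (d + d)) := by rw [hJ]; gcongr
      _ = 12 * (S.n * (q * d)) := by ring
  have b2 := length_degList q d S.D
  have b3 : q * (q * (d + 1)) ≤ 2 * (q * (q * d)) := by
    calc q * (q * (d + 1)) ≤ q * (q * (d + d)) := by gcongr
      _ = _ := by ring
  have hM4 : S.M + 1 ≤ 4 * S.n := by omega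
  have b4 : (S.M + 1) * (m + 1) ≤ 4 * (S.n * m) + 4 * S.n := by
    calc (S.M + 1) * (m + 1) ≤ 4 * S.n * (m + 1) := by gcongr
      _ = _ := by ring
  have b5 : S.n * (S.q + 1) ≤ 2 * (S.n * (q * d)) := by
    calc S.n * (S.q + 1) ≤ S.n * (q * d + q * d) := by
          gcongr
          exact hq1.trans x3
      _ = _ := by ring
  have b6 : S.M * (s * s * W) ≤ 12 * (S.n * X) := by
    calc S.M * (s * s * W) ≤ 4 * S.n * (s * s * W) := by gcongr; omega
      _ = 12 * (S.n * (s * s * (c * q))) := by rw [hW]; ring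
      _ ≤ _ := by gcongr
  have b7 : S.M * (s * s * s * W) ≤ 12 * (S.n * X) := by
    calc S.M * (s * s * s * W) ≤ 4 * S.n * (s * s * s * W) := by gcongr; omega
      _ = 12 * (S.n * (s * s * s * (c * q))) := by rw [hW]; ring
      _ ≤ _ := by gcongr
  have goal : S.n * (m + X) = S.n * m + S.n * X := by ring
  rw [goal]
  omega

end Imp

/-! ## Few handles from a bound on the cuts -/

namespace CutSystem

variable {S : CutSystem} {rep : ℕ → ℕ → ℕ} {rc : ℕ → ℕ}

/-- The neighbours of `x` on the other side of the cut `a`. -/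
noncomputable def row (S : CutSystem) (a x : ℕ) : Finset ℕ :=
  S.nbr (Finset.range S.n \ S.side a) x

theorem mem_row {a x y : ℕ} : y ∈ S.row a x ↔ (y < S.n ∧ y ∉ S.side a) ∧ S.adj x y := by
  simp [row, mem_nbr]

/-- The rows of the cut `a` take at most `K` values, the empty one included, and any set of rows
contains at most `r` rows with the same union. -/
def RowBound (S : CutSystem) (a K r : ℕ) : Prop :=
  (∃ F : Finset (Finset ℕ), F.card ≤ K ∧ ∅ ∈ F ∧ ∀ x ∈ S.side a, S.row a x ∈ F) ∧
    ∀ X ⊆ S.side a, ∃ R ⊆ X, R.card ≤ r ∧ ∀ x ∈ X, ∀ y ∈ S.row a x, ∃ z ∈ R, y ∈ S.row a z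

/-- Induction on t: from the members of X not yet chosen, choose r more whose rows have the same
union. Each vertex y that still has a neighbour among the rest gains at least one chosen neighbour,
so its count truncated one step higher becomes correct. -/
theorem RowBound.exists_sparse {a K r : ℕ} (h : S.RowBound a K r) {X : Finset ℕ}
    (hX : X ⊆ S.side a) (t : ℕ) : ∃ R ⊆ X, R.card ≤ t * r ∧ ∀ y < S.n, y ∉ S.side a →
      min t (X.filter fun x => y ∈ S.row a x).card = min t (R.filter fun x => y ∈ S.row a x).card := by
  classical
  induction t with
  | zero => exact ⟨∅, by simp, by simp, by simp⟩
  | succ t ih =>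
    obtain ⟨R, hR, hc, hm⟩ := ih
    obtain ⟨R', hR', hc', hm'⟩ := h.2 (X \ R) (Finset.sdiff_subset.trans hX)
    have hsub : R ∪ R' ⊆ X := Finset.union_subset hR (hR'.trans Finset.sdiff_subset)
    refine ⟨R ∪ R', hsub, ?_, ?_⟩
    · calc _ ≤ R.card + R'.card := Finset.card_union_le _ _
        _ ≤ _ := by rw [add_mul, one_mul]; omega
    · intro y hy hya
      have e := hm y hy hya
      have l1 : ((R ∪ R').filter fun x => y ∈ S.row a x).card ≤
          (X.filter fun x => y ∈ S.row a x).card :=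
        Finset.card_le_card (Finset.filter_subset_filter _ hsub)
      -- Either y has an unchosen neighbour in X and its chosen count grows strictly, or all its
      -- neighbours in X are chosen already and the counts agree without truncation.
      by_cases hx : ∃ x ∈ X \ R, y ∈ S.row a x
      · obtain ⟨x, hx, hyx⟩ := hx
        obtain ⟨z, hz, hyz⟩ := hm' x hx y hyx
        have hzR : z ∉ R := (Finset.mem_sdiff.1 (hR' hz)).2
        have l2 : (R.filter fun x => y ∈ S.row a x).card <
            ((R ∪ R').filter fun x => y ∈ S.row a x).card := by
          apply Finset.card_lt_card
          refine ⟨Finset.filter_subset_filter _ Finset.subset_union_left, fun hh => hzR ?_⟩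
          exact (Finset.mem_filter.1 (hh (Finset.mem_filter.2
            ⟨Finset.mem_union_right _ hz, hyz⟩))).1
        omega
      · have : (X.filter fun x => y ∈ S.row a x) = (R.filter fun x => y ∈ S.row a x) := by
          ext x
          simp only [Finset.mem_filter]
          refine ⟨fun ⟨h1, h2⟩ => ⟨?_, h2⟩, fun ⟨h1, h2⟩ => ⟨hR h1, h2⟩⟩
          by_contra h3
          exact hx ⟨x, Finset.mem_sdiff.2 ⟨h1, h3⟩, h2⟩
        have l2 : (R.filter fun x => y ∈ S.row a x).card ≤
            ((R ∪ R').filter fun x => y ∈ S.row a x).card :=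
          Finset.card_le_card (Finset.filter_subset_filter _ Finset.subset_union_left)
        rw [this] at l1 ⊢
        rw [le_antisymm l1 l2]

/-- The chosen vertices are replaced by their rows and padded with the empty row to a tuple of fixed
length. Empty rows count nowhere, and tuples of fixed length are easy to count. -/
theorem card_filter_padded {F : Finset (Finset ℕ)} (h0 : ∅ ∈ F) {R : Finset ℕ} {f : ℕ → Finset ℕ}
    (hf : ∀ x ∈ R, f x ∈ F) {m : ℕ} (hm : R.card ≤ m) :
    ∃ g : Fin m → F, ∀ y, (Finset.univ.filter fun t => y ∈ (g t).1).card =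
      (R.filter fun x => y ∈ f x).card := by
  classical
  let e := R.equivFin
  refine ⟨fun t => if h : t.1 < R.card then ⟨f (e.symm ⟨t, h⟩), hf _ (e.symm ⟨t, h⟩).2⟩ else ⟨∅, h0⟩,
    fun y => ?_⟩
  symm
  refine Finset.card_bij (fun x hx => ⟨(e ⟨x, (Finset.mem_filter.1 hx).1⟩).1,
    (e ⟨x, (Finset.mem_filter.1 hx).1⟩).2.trans_le hm⟩) ?_ ?_ ?_
  · intro x hx
    simpa using (Finset.mem_filter.1 hx).2
  · intro x hx x' hx' h
    have : e ⟨x, (Finset.mem_filter.1 hx).1⟩ = e ⟨x', (Finset.mem_filter.1 hx').1⟩ :=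
      Fin.ext (by simpa using h)
    simpa using this
  · intro t ht
    have ht' := (Finset.mem_filter.1 ht).2
    by_cases h : t.1 < R.card
    · simp only [dif_pos h] at ht'
      exact ⟨e.symm ⟨t, h⟩, Finset.mem_filter.2 ⟨(e.symm ⟨t, h⟩).2, ht'⟩, by simp⟩
    · simp only [dif_neg h] at ht'
      simp at ht'

theorem cnt_side_eq {a : ℕ} (Z : ℕ → ℕ) {y : ℕ} (hy : y < S.n) (hya : y ∉ S.side a) (i : ℕ) :
    S.cnt (S.side a) Z y i =
      (((S.side a).filter fun x => Z x = i).filter fun x => y ∈ S.row a x).card := by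
  unfold cnt
  congr 1
  ext x
  simp only [Finset.mem_filter, mem_nbr, mem_row]
  have := S.adj_symm x y
  have := S.adj_symm y x
  tauto

/-- Sparsify each label class separately. The truncated profile is then a function of q tuples of d
r rows. -/
theorem RowBound.exists_pick {a K r : ℕ} (h : S.RowBound a K r) {F : Finset (Finset ℕ)}
    (h0 : ∅ ∈ F) (hF : ∀ x ∈ S.side a, S.row a x ∈ F) (Z : ℕ → ℕ) :
    ∃ g : Fin S.q → Fin (S.d * r) → F, ∀ y < S.n, y ∉ S.side a → ∀ i : Fin S.q,
      min S.d (S.cnt (S.side a) Z y i) =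
        min S.d (Finset.univ.filter fun t => y ∈ (g i t).1).card := by
  choose R hR hc hm using fun i : Fin S.q =>
    h.exists_sparse (Finset.filter_subset (fun x => Z x = i) (S.side a)) S.d
  choose g hg using fun i : Fin S.q => card_filter_padded h0
    (f := S.row a) (fun x hx => hF x (Finset.filter_subset _ _ (hR i hx))) (hc i)
  refine ⟨g, fun y hy hya i => ?_⟩
  rw [hg, ← hm i y hy hya, cnt_side_eq Z hy hya]

/-- Sending a handle to such a choice of rows is injective, since the rows determine the profile.
The appended sides have at most q handles; q is below the bound because K ≥ 2 and the exponent is at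
least q. -/
theorem fewHandles {K r : ℕ} (hb : ∀ a < S.M, S.RowBound a K r) (hK : 2 ≤ K) (hr : 1 ≤ r)
    (R : S.Reps rep rc) : Imp.FewHandles S rep rc (K ^ (S.d * r * S.q)) := by
  classical
  have hexp : S.q ≤ S.d * r * S.q :=
    Nat.le_mul_of_pos_left _ (Nat.mul_pos S.d_pos (by omega))
  have hqK : S.q ≤ K ^ (S.d * r * S.q) := by
    calc S.q ≤ 2 ^ S.q := Nat.lt_two_pow_self.le
      _ ≤ K ^ S.q := Nat.pow_le_pow_left hK _
      _ ≤ _ := Nat.pow_le_pow_right (by omega) hexp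
  intro a ha H hH
  rcases lt_or_ge a S.M with haM | haM
  · obtain ⟨F, hFc, h0, hF⟩ := (hb a haM).1
    choose! Z hZ hxZ using hH
    choose g hg using fun x => (hb a haM).exists_pick h0 hF (Z x)
    -- Equal choices of rows give equal truncated counts at every outer vertex, hence equal profiles
    -- and equal handles.
    have hinj : Set.InjOn g (H : Set ℕ) := by
      intro x hx x' hx' he
      rw [hxZ x hx, hxZ x' hx', R.handle_eq_iff haM]
      intro y hy hya i hi
      rw [hg x y hy hya ⟨i, hi⟩, hg x' y hy hya ⟨i, hi⟩, he]
    calc H.card ≤ (Finset.univ : Finset (Fin S.q → Fin (S.d * r) → F)).card :=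
          Finset.card_le_card_of_injOn g (fun _ _ => Finset.mem_univ _) hinj
      _ = F.card ^ (S.d * r * S.q) := by simp [pow_mul]
      _ ≤ _ := Nat.pow_le_pow_left hFc _
  · rcases lt_or_ge a (S.M + S.n) with haN | haN
    · obtain ⟨x, rfl⟩ := Nat.exists_eq_add_of_le haM
      have hx : x < S.n := by omega
      have : H ⊆ (Finset.range S.q).image (16 ^ ·) := by
        intro h hh
        obtain ⟨Z, hZ, rfl⟩ := hH h hh
        rw [Imp.handle_single hx]
        exact Finset.mem_image_of_mem _ (Finset.mem_range.2 (hZ x))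
      calc H.card ≤ _ := Finset.card_le_card this
        _ ≤ S.q := Finset.card_image_le.trans (by simp)
        _ ≤ _ := hqK
    · have : a = S.M + S.n := by omega
      subst this
      have : H ⊆ {0} := by
        intro h hh
        obtain ⟨Z, hZ, rfl⟩ := hH h hh
        rw [Imp.handle_empty]; simp
      exact (Finset.card_le_card this).trans (by
        simpa using Nat.one_le_pow _ _ (by omega))

/-- The neighbourhoods in a side of vertices outside it are the rows of the opposite cut, so the
bound for that cut applies. -/
theorem Reps.count_le {K r : ℕ} (R : S.Reps rep rc) (hb : ∀ a < S.M, S.RowBound a K r) {a : ℕ}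
    (ha : a < S.M) : rc a ≤ K := by
  obtain ⟨F, hFc, h0, hF⟩ := (hb _ (S.opp_lt a ha)).1
  have e : ∀ y, S.row (S.opp a) y = S.nbr (S.side a) y := by
    intro y
    ext x
    rw [mem_row, mem_nbr]
    constructor
    · rintro ⟨⟨h1, h2⟩, h3⟩
      rw [S.side_opp a ha x h1, not_not] at h2
      exact ⟨h2, h3⟩
    · rintro ⟨h1, h3⟩
      refine ⟨⟨S.side_lt a x h1, ?_⟩, h3⟩
      rw [S.side_opp a ha x (S.side_lt a x h1), not_not]
      exact h1
  have := Finset.card_le_card_of_injOn (s := Finset.range (rc a)) (t := F)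
    (fun t => S.nbr (S.side a) (rep a t))
    (fun t ht => by
      have ht : t < rc a := by simpa using ht
      show S.nbr (S.side a) (rep a t) ∈ F
      rw [← e]
      exact hF _ ((S.side_opp a ha _ (R.lt a ha t ht)).2 (R.notMem a ha t ht)))
    (fun t ht t' ht' he => R.inj a ha t (by simpa using ht) t' (by simpa using ht') he)
  rw [Finset.card_range] at this
  exact this.trans hFc

end CutSystem

/-! ## Bounds on the rows of a cut -/

/-- The rows of the cut `A` take at most `K` values, the empty one included, and any set of rows
contains at most `log₂ K` rows with the same union. -/
def SimpleGraph.CutBound {V : Type*} (G : SimpleGraph V) (A : Set V) (K : ℕ) : Prop :=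
  (∃ F : Finset (Set V), F.card ≤ K ∧ ∅ ∈ F ∧ ∀ x ∈ A, {y | y ∉ A ∧ G.Adj x y} ∈ F) ∧
    ∀ X ⊆ A, ∃ R : Finset V, (R : Set V) ⊆ X ∧ 2 ^ R.card ≤ K ∧
      ∀ x ∈ X, ∀ y ∉ A, G.Adj x y → ∃ z ∈ R, G.Adj z y

-- A basis chosen among the rows of X has at most log₂ |W| members, where W is the whole row space.
-- If no basis row contains y, the coordinate y vanishes on their span and so on every row of X.
-- Hence the basis rows already have the full union.
open Classical in
theorem SimpleGraph.cutBound_of_span {V : Type*} [Finite V] (G : SimpleGraph V) {A : Set V} {K : ℕ}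
    (h : Nat.card (Submodule.span (ZMod 2)
      (Set.range fun a : A => fun b : (Aᶜ : Set V) => G.adjMatrix (ZMod 2) a.1 b.1)) ≤ K) :
    G.CutBound A K := by
  have := Fintype.ofFinite V
  set r : A → (Aᶜ : Set V) → ZMod 2 := fun a b => G.adjMatrix (ZMod 2) a.1 b.1 with hr
  set W := Submodule.span (ZMod 2) (Set.range r) with hW
  have hadj : ∀ (x : A) (y : (Aᶜ : Set V)), r x y ≠ 0 ↔ G.Adj x y := by
    intro x y
    simp [hr, SimpleGraph.adjMatrix_apply]
  constructor
  · haveI : Fintype W := Fintype.ofFinite W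
    refine ⟨(Finset.univ : Finset W).image fun w => {y | ∃ hy : y ∉ A, w.1 ⟨y, hy⟩ ≠ 0}, ?_, ?_, ?_⟩
    · refine Finset.card_image_le.trans ?_
      rwa [Finset.card_univ, ← Nat.card_eq_fintype_card]
    · refine Finset.mem_image.2 ⟨0, Finset.mem_univ _, ?_⟩
      ext y
      simp
    · intro x hx
      refine Finset.mem_image.2 ⟨⟨r ⟨x, hx⟩, Submodule.subset_span ⟨_, rfl⟩⟩, Finset.mem_univ _, ?_⟩
      ext y
      simp only [Set.mem_ofPred_eq, hadj]
      exact ⟨fun ⟨h1, h2⟩ => ⟨h1, h2⟩, fun ⟨h1, h2⟩ => ⟨h1, h2⟩⟩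
  · intro X hX
    obtain ⟨b, hb, hspan, hli⟩ := exists_linearIndependent (ZMod 2) (r '' {x | x.1 ∈ X})
    have hpre : ∀ v : b, ∃ x : A, x.1 ∈ X ∧ r x = v.1 := fun v => by
      obtain ⟨x, hx, e⟩ := hb v.2
      exact ⟨x, hx, e⟩
    choose p hpX hp using hpre
    have : Fintype b := Fintype.ofFinite b
    refine ⟨Finset.univ.image fun v : b => (p v).1, ?_, ?_, ?_⟩
    · intro x hx
      simp only [Finset.coe_image, Finset.coe_univ, Set.image_univ, Set.mem_range] at hx
      obtain ⟨v, rfl⟩ := hx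
      exact hpX v
    · have hle : Submodule.span (ZMod 2) b ≤ W := by
        rw [hspan]
        exact Submodule.span_mono (Set.image_subset_range _ _)
      -- Over the field with two elements, the size of the span gives the number of basis vectors.
      have h1 : Nat.card (Submodule.span (ZMod 2) b) = 2 ^ Fintype.card b := by
        rw [Module.natCard_eq_pow_finrank (K := ZMod 2), Nat.card_zmod]
        congr 1
        have := finrank_span_eq_card hli
        rwa [Subtype.range_coe] at this
      calc 2 ^ (Finset.univ.image fun v : b => (p v).1).card ≤ 2 ^ Fintype.card b :=
            Nat.pow_le_pow_right (by norm_num) Finset.card_image_le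
        _ = Nat.card (Submodule.span (ZMod 2) b) := h1.symm
        _ ≤ Nat.card W := Nat.card_le_card_of_injective (Submodule.inclusion hle)
            (Submodule.inclusion_injective hle)
        _ ≤ K := h
    · intro x hx y hy hxy
      by_contra hno
      push Not at hno
      -- The vectors with zero coordinate at y form a subspace, the kernel of a projection, which
      -- contains the basis.
      have hker : Submodule.span (ZMod 2) b ≤ LinearMap.ker
          (LinearMap.proj (R := ZMod 2) (φ := fun _ : (Aᶜ : Set V) => ZMod 2) ⟨y, hy⟩) := by
        rw [Submodule.span_le]
        intro v hv
        have h1 := hno _ (Finset.mem_image_of_mem (fun v : b => (p v).1) (Finset.mem_univ ⟨v, hv⟩))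
        rw [SetLike.mem_coe, LinearMap.mem_ker, LinearMap.proj_apply]
        by_contra h2
        have h3 := hp ⟨v, hv⟩
        simp only at h3
        rw [← h3] at h2
        exact h1 ((hadj _ _).1 h2)
      have hmem : r ⟨x, hX hx⟩ ∈ Submodule.span (ZMod 2) b := by
        rw [hspan]
        exact Submodule.subset_span ⟨⟨x, hX hx⟩, hx, rfl⟩
      exact (hadj ⟨x, hX hx⟩ ⟨y, hy⟩).2 hxy (hker hmem)

/-- Take R ⊆ X of minimum size with the same union of rows. Each member has a private neighbour,
since otherwise it could be dropped. Therefore the 2^|R| subsets of R have different unions, and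
there are at most K unions. The count is over Aᶜ because the rows of A are sets of vertices outside
A. -/
theorem SimpleGraph.cutBound_of_unions {V : Type*} [Finite V] (G : SimpleGraph V) {A : Set V}
    {K : ℕ} (h : {X : Set V | X ⊆ Aᶜ ∧
      ∃ Y ⊆ Aᶜᶜ, (⋃ y ∈ Y, G.neighborSet y) \ Aᶜᶜ = X}.ncard ≤ K) : G.CutBound A K := by
  classical
  set U : Set (Set V) := {X : Set V | X ⊆ Aᶜ ∧
      ∃ Y ⊆ Aᶜᶜ, (⋃ y ∈ Y, G.neighborSet y) \ Aᶜᶜ = X} with hU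
  have hfin : U.Finite := Set.toFinite _
  have hmem : ∀ Y ⊆ A, {y | y ∉ A ∧ ∃ x ∈ Y, G.Adj x y} ∈ U := by
    intro Y hY
    refine ⟨fun y hy => hy.1, Y, by rwa [compl_compl], ?_⟩
    ext y
    simp only [compl_compl, Set.mem_sdiff, Set.mem_iUnion, SimpleGraph.mem_neighborSet,
      exists_prop, Set.mem_ofPred_eq]
    tauto
  have hcard : hfin.toFinset.card ≤ K := by rwa [← Set.ncard_eq_toFinset_card U hfin]
  constructor
  · refine ⟨hfin.toFinset, hcard, ?_, ?_⟩
    · rw [Set.Finite.mem_toFinset]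
      simpa using hmem ∅ (by simp)
    · intro x hx
      rw [Set.Finite.mem_toFinset]
      simpa using hmem {x} (by simpa using hx)
  · intro X hX
    have hXf : X.Finite := Set.toFinite _
    obtain ⟨R, hR, hmin⟩ := Finset.exists_min_image
      ((Finset.powerset hXf.toFinset).filter fun R => ∀ x ∈ X, ∀ y ∉ A, G.Adj x y →
        ∃ z ∈ R, G.Adj z y) Finset.card
      ⟨hXf.toFinset, by
        simp only [Finset.mem_filter, Finset.mem_powerset, subset_refl, true_and]
        exact fun x hx y _ hxy => ⟨x, hXf.mem_toFinset.2 hx, hxy⟩⟩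
    simp only [Finset.mem_filter, Finset.mem_powerset] at hR hmin
    have hRX : (R : Set V) ⊆ X := fun x hx => hXf.mem_toFinset.1 (hR.1 hx)
    refine ⟨R, hRX, ?_, hR.2⟩
    -- Minimality: if every neighbour of z across the cut had another neighbour in R, then R without
    -- z would still cover.
    have hpriv : ∀ z ∈ R, ∃ y ∉ A, G.Adj z y ∧ ∀ z' ∈ R, G.Adj z' y → z' = z := by
      intro z hz
      by_contra hno
      push Not at hno
      have := hmin (R.erase z) ⟨(Finset.erase_subset _ _).trans hR.1, fun x hx y hy hxy => by
        obtain ⟨z', hz', hzy⟩ := hR.2 x hx y hy hxy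
        by_cases e : z' = z
        · subst e
          obtain ⟨z'', h1, h2, h3⟩ := hno y hy hzy
          · exact ⟨z'', Finset.mem_erase.2 ⟨h3, h1⟩, h2⟩
        · exact ⟨z', Finset.mem_erase.2 ⟨e, hz'⟩, hzy⟩⟩
      have := Finset.card_erase_lt_of_mem hz
      omega
    -- A subset of R is recovered from its union by looking at the private neighbours.
    have hle := Finset.card_le_card_of_injOn (s := R.powerset) (t := hfin.toFinset)
      (fun Y => {y | y ∉ A ∧ ∃ x ∈ (Y : Set V), G.Adj x y})
      (fun Y hY => by
        have hY : Y ⊆ R := by simpa using hY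
        rw [SetLike.mem_coe, Set.Finite.mem_toFinset]
        exact hmem Y (fun x hx => hX (hRX (hY hx))))
      (fun Y hY Y' hY' he => by
        have hY : Y ⊆ R := by simpa using hY
        have hY' : Y' ⊆ R := by simpa using hY'
        have key : ∀ Y ⊆ R, ∀ Y' ⊆ R, ({y | y ∉ A ∧ ∃ x ∈ (Y : Set V), G.Adj x y} : Set V) =
            {y | y ∉ A ∧ ∃ x ∈ (Y' : Set V), G.Adj x y} → Y ⊆ Y' := by
          intro Y hY Y' hY' he z hz
          obtain ⟨y, hy, hzy, hu⟩ := hpriv z (hY hz)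
          have : y ∈ ({y | y ∉ A ∧ ∃ x ∈ (Y : Set V), G.Adj x y} : Set V) := ⟨hy, z, hz, hzy⟩
          rw [he] at this
          obtain ⟨_, z', hz', h2⟩ := this
          rwa [← hu z' (hY' hz') h2]
        exact Finset.Subset.antisymm (key Y hY Y' hY' he) (key Y' hY' Y hY he.symm))
    rw [Finset.card_powerset] at hle
    exact hle.trans hcard

/-! ## Components of a tree minus an edge -/

namespace SimpleGraph

variable {V : Type*} {T : SimpleGraph V}

/-- The nodes on the side of `u` when the edge `uv` is removed. -/
def branch (T : SimpleGraph V) (u v : V) : Set V := {w | (T.deleteEdges {s(u, v)}).Reachable u w}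

/-- Let nxt w be the first node after u on the path from u to w. Removing an edge at u cuts off
exactly the nodes whose path starts with that edge, so all the branches at u are described by one
function. The node u itself has no first step and is treated separately. -/
theorem IsTree.exists_next (hT : T.IsTree) (u : V) : ∃ nxt : V → V,
    (∀ w, w ≠ u → T.Adj u (nxt w)) ∧ (∀ v, T.Adj u v → ∀ w,
      (w ∈ T.branch u v ↔ w = u ∨ nxt w ≠ v) ∧ (w ∈ T.branch v u ↔ w ≠ u ∧ nxt w = v)) := by
  choose p hp _ using hT.existsUnique_path u
  have hnil : ∀ w, w ≠ u → ¬ (p w).Nil := fun w hw => Walk.not_nil_of_ne (Ne.symm hw)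
  refine ⟨fun w => (p w).snd, fun w hw => (p w).adj_snd (hnil w hw), fun v huv w => ?_⟩
  have hbr : ¬ (T.deleteEdges {s(u, v)}).Reachable u v :=
    isBridge_iff.1 (isAcyclic_iff_forall_adj_isBridge.1 hT.isAcyclic huv)
  -- A path starting at u can use the edge uv only as its first edge.
  have h1 : w = u ∨ (p w).snd ≠ v → w ∈ T.branch u v := by
    intro h
    refine ⟨(p w).toDeleteEdges {s(u, v)} ?_⟩
    rintro e he rfl
    rcases h with rfl | h
    · have : p w = Walk.nil := (Walk.isPath_iff_nil.1 (hp w)).eq_nil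
      rw [this] at he
      simp at he
    · exact h ((hp w).eq_snd_of_mem_edges he).symm
  have h2 : w ≠ u ∧ (p w).snd = v → w ∈ T.branch v u := by
    rintro ⟨hw, rfl⟩
    refine ⟨(p w).tail.toDeleteEdges _ ?_⟩
    rintro e he rfl
    have hc := hp w
    rw [← Walk.cons_tail_eq _ (hnil w hw), Walk.cons_isPath_iff] at hc
    exact hc.2 (Walk.snd_mem_support_of_mem_edges _ he)
  -- In a tree the edge uv is a bridge, so the two branches are disjoint. With the two inclusions
  -- above this gives both equivalences.
  have h3 : w ∈ T.branch u v → w ∈ T.branch v u → False := by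
    intro h h'
    refine hbr (Reachable.trans h ?_)
    have h'' : (T.deleteEdges {s(v, u)}).Reachable v w := h'
    rw [Sym2.eq_swap] at h''
    exact h''.symm
  constructor
  · refine ⟨fun h => ?_, h1⟩
    by_contra hn
    push Not at hn
    exact h3 h (h2 hn)
  · refine ⟨fun h => ?_, h2⟩
    by_contra hn
    exact h3 (h1 (by tauto)) h

theorem IsTree.mem_branch_swap (hT : T.IsTree) {u v : V} (h : T.Adj u v) (w : V) :
    w ∈ T.branch v u ↔ w ∉ T.branch u v := by
  obtain ⟨nxt, -, h2⟩ := hT.exists_next u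
  rw [(h2 v h w).1, (h2 v h w).2]
  tauto

theorem mem_branch_self (u v : V) : u ∈ T.branch u v := Reachable.refl _

/-- Behind u, looking away from v, lie u and the branches of its other neighbours. This recursion
makes a side the union of two others. -/
theorem IsTree.mem_branch_iff (hT : T.IsTree) {u v : V} (h : T.Adj u v) (w : V) :
    w ∈ T.branch u v ↔ w = u ∨ ∃ v', T.Adj u v' ∧ v' ≠ v ∧ w ∈ T.branch v' u := by
  obtain ⟨nxt, h1, h2⟩ := hT.exists_next u
  rw [(h2 v h w).1]
  constructor
  · intro hw
    by_cases e : w = u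
    · exact .inl e
    · exact .inr ⟨nxt w, h1 w e, by tauto, ((h2 _ (h1 w e) w).2).2 ⟨e, rfl⟩⟩
  · rintro (e | ⟨v', ha, hv, hb⟩)
    · exact .inl e
    · rw [(h2 v' ha w).2] at hb
      exact .inr (hb.2 ▸ hv)

theorem IsTree.branch_disjoint (hT : T.IsTree) {u v v' : V} (h : T.Adj u v) (h' : T.Adj u v')
    (hne : v ≠ v') (w : V) (hw : w ∈ T.branch v u) : w ∉ T.branch v' u := by
  obtain ⟨nxt, h1, h2⟩ := hT.exists_next u
  rw [(h2 v h w).2] at hw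
  rw [(h2 v' h' w).2]
  rintro ⟨-, e⟩
  exact hne (hw.2.symm.trans e)

/-- The smaller branch is contained in the larger and misses u. This provides the rank that keeps
the queue going. -/
theorem IsTree.branch_ncard_lt [Finite V] (hT : T.IsTree) {u v v' : V} (h : T.Adj u v)
    (h' : T.Adj u v') (hne : v' ≠ v) : (T.branch v' u).ncard < (T.branch u v).ncard := by
  refine Set.ncard_lt_ncard ⟨fun w hw => (hT.mem_branch_iff h w).2 (.inr ⟨v', h', hne, hw⟩),
    fun hs => ?_⟩ (Set.toFinite _)
  have := hs (mem_branch_self u v)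
  rw [hT.mem_branch_swap h' u] at this
  exact this (mem_branch_self u v')

end SimpleGraph

/-! ### The size of a decomposition tree -/

namespace DecompositionTree

variable {V : Type*} (T : DecompositionTree V)

theorem neighbor_ncard_pos (h : 2 ≤ T.N) (t : Fin T.N) : 1 ≤ (T.tree.neighborSet t).ncard := by
  have : Nontrivial (Fin T.N) := Fin.nontrivial_iff_two_le.2 h
  have := T.isTree.connected.preconnected.exists_adj_of_nontrivial t
  obtain ⟨u, hu⟩ := this
  exact (Set.ncard_pos (Set.toFinite _)).2 ⟨u, hu⟩

/-- The degrees sum to 2(N - 1), and adding 2 for each leaf makes every summand at least 3. So 3N ≤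
2(N - 1) + 2|V|. -/
theorem N_le [Finite V] (h : 2 ≤ T.N) : T.N ≤ 2 * Nat.card V := by
  classical
  have hdeg : ∀ t, (T.tree.neighborSet t).ncard = T.tree.degree t := fun t => by
    rw [Set.ncard_eq_toFinset_card']; rfl
  have hN : Nat.card V = (Finset.univ.filter fun t => IsLeafNode T.tree t).card := by
    rw [Nat.card_congr T.leaf, Nat.card_eq_fintype_card, Fintype.card_subtype]
  have h1 := T.tree.sum_degrees_eq_twice_card_edges
  have h2 := T.isTree.card_edgeFinset
  rw [Fintype.card_fin] at h2
  -- A leaf has degree at least 1 since N ≥ 2, and an internal node has degree 3.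
  have h3 : ∑ t, (T.tree.degree t + if IsLeafNode T.tree t then 2 else 0) ≥ ∑ t : Fin T.N, 3 := by
    apply Finset.sum_le_sum
    intro t _
    have := T.neighbor_ncard_pos h t
    rw [hdeg] at this
    split_ifs with hl
    · omega
    · have := T.subcubic t hl
      rw [hdeg] at this
      omega
  rw [Finset.sum_add_distrib, ← Finset.sum_filter, Finset.sum_const, Finset.sum_const,
    Finset.card_univ, Fintype.card_fin, ← hN, smul_eq_mul, smul_eq_mul, h1] at h3
  omega

theorem card_le_N [Finite V] : Nat.card V ≤ T.N := by
  rw [Nat.card_congr T.leaf]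
  calc _ ≤ Nat.card (Fin T.N) := Finite.card_subtype_le _
    _ = _ := by simp

end DecompositionTree

/-! ## Decoding the input -/

theorem length_encodeEdges {n : ℕ} (L : List (Fin n × Fin n)) :
    (encodeEdges L).length = L.length + L.length := by
  induction L with
  | nil => rfl
  | cons p L ih =>
    have : encodeEdges (p :: L) = p.1.val :: p.2.val :: encodeEdges L := rfl
    rw [this]; simp only [List.length_cons, ih]; omega

theorem encodeEdges_getD {n : ℕ} (L : List (Fin n × Fin n)) (z : Fin n × Fin n) {e : ℕ}
    (he : e < L.length) : (encodeEdges L).getD (e + e) 0 = (L.getD e z).1.val ∧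
      (encodeEdges L).getD (e + e + 1) 0 = (L.getD e z).2.val := by
  induction L generalizing e with
  | nil => simp at he
  | cons p L ih =>
    have h : encodeEdges (p :: L) = p.1.val :: p.2.val :: encodeEdges L := rfl
    rw [h]
    cases e with
    | zero => simp
    | succ e =>
      have he : e < L.length := by simpa using he
      rw [show e + 1 + (e + 1) = e + e + 1 + 1 by omega]
      simpa only [List.getD_cons_succ] using ih he

section Input

variable {n : ℕ} (T : DecompositionTree (Fin n)) (L : List (Fin n × Fin n))
  (L' : List (Fin T.N × Fin T.N))

theorem encodeInput_graph {p : ℕ} (hp : p < L.length + L.length) :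
    (encodeInput T L L').getD (3 + p) 0 = (encodeEdges L).getD p 0 := by
  have h := length_encodeEdges L
  unfold encodeInput
  rw [List.getD_append _ _ _ _ (by simp; omega), List.getD_append _ _ _ _ (by simp; omega),
    List.getD_append_right _ _ _ _ (by simp)]
  simp

theorem encodeInput_tree {p : ℕ} (hp : p < L'.length + L'.length) :
    (encodeInput T L L').getD (3 + (L.length + L.length) + p) 0 = (encodeEdges L').getD p 0 := by
  have h := length_encodeEdges L
  have h' := length_encodeEdges L'
  unfold encodeInput
  rw [List.getD_append _ _ _ _ (by simp; omega), List.getD_append_right _ _ _ _ (by simp; omega)]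
  congr 1
  simp; omega

theorem encodeInput_leaf {x : ℕ} (hx : x < n) :
    (encodeInput T L L').getD (3 + (L.length + L.length) + (L'.length + L'.length + x)) 0 =
      (T.leaf ⟨x, hx⟩).1.val := by
  have h := length_encodeEdges L
  have h' := length_encodeEdges L'
  unfold encodeInput
  rw [List.getD_append_right _ _ _ _ (by simp; omega)]
  have : 3 + (L.length + L.length) + (L'.length + L'.length + x) -
    ([n, L.length, T.N] ++ encodeEdges L ++ encodeEdges L').length = x := by simp; omega
  rw [this, List.getD_eq_getElem _ _ (by simpa using hx)]
  simp

theorem length_encodeInput : (encodeInput T L L').length =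
    3 + (L.length + L.length) + (L'.length + L'.length) + n := by
  have h := length_encodeEdges L
  have h' := length_encodeEdges L'
  simp [encodeInput]; omega

end Input

/-! ## The darts of an edge list -/

section Darts

variable {α : Type*}

/-- Dart `2e` is the `e`-th edge of the list, dart `2e + 1` is its reversal. -/
def dartAt (z : α × α) (L : List (α × α)) (p : ℕ) : α × α :=
  if p % 2 = 0 then L.getD (p / 2) z else (L.getD (p / 2) z).swap

/-- The reversed dart. -/
def flipDart (p : ℕ) : ℕ := if p % 2 = 0 then p + 1 else p - 1

theorem flipDart_flipDart (p : ℕ) : flipDart (flipDart p) = p := by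
  unfold flipDart; split_ifs <;> omega

theorem flipDart_lt {p k : ℕ} (h : p < k + k) : flipDart p < k + k := by
  unfold flipDart; split_ifs <;> omega

theorem dartAt_flip (z : α × α) (L : List (α × α)) (p : ℕ) :
    dartAt z L (flipDart p) = (dartAt z L p).swap := by
  unfold dartAt flipDart
  split_ifs with h1 h2 h2
  · omega
  · rw [show (p + 1) / 2 = p / 2 by omega]
  · rw [show (p - 1) / 2 = p / 2 by omega, Prod.swap_swap]
  · omega

theorem mk_dartAt (z : α × α) (L : List (α × α)) (p : ℕ) :
    s((dartAt z L p).1, (dartAt z L p).2) = s((L.getD (p / 2) z).1, (L.getD (p / 2) z).2) := by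
  unfold dartAt
  split_ifs
  · rfl
  · rw [Sym2.eq_swap]; rfl

variable {N : ℕ} {T : SimpleGraph (Fin N)} {L : List (Fin N × Fin N)}

theorem IsEdgeList.adj (h : IsEdgeList T L) (z : Fin N × Fin N) {p : ℕ}
    (hp : p < L.length + L.length) : T.Adj (dartAt z L p).1 (dartAt z L p).2 := by
  rw [← SimpleGraph.mem_edgeSet, mk_dartAt, ← h.2, List.mem_map]
  have : p / 2 < L.length := by omega
  exact ⟨_, by rw [List.getD_eq_getElem _ _ this]; exact List.getElem_mem _, rfl⟩

theorem IsEdgeList.exists_dart (h : IsEdgeList T L) (z : Fin N × Fin N) {u v : Fin N}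
    (huv : T.Adj u v) : ∃ p < L.length + L.length, dartAt z L p = (u, v) := by
  rw [← SimpleGraph.mem_edgeSet, ← h.2, List.mem_map] at huv
  obtain ⟨x, hx, e⟩ := huv
  obtain ⟨i, hi, rfl⟩ := List.mem_iff_getElem.1 hx
  have hg : L.getD i z = L[i] := List.getD_eq_getElem _ _ hi
  rw [Sym2.eq_iff] at e
  rcases e with ⟨h1, h2⟩ | ⟨h1, h2⟩
  · refine ⟨i + i, by omega, ?_⟩
    unfold dartAt
    rw [if_pos (by omega), show (i + i) / 2 = i by omega, hg]
    exact Prod.ext h1 h2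
  · refine ⟨i + i + 1, by omega, ?_⟩
    unfold dartAt
    rw [if_neg (by omega), show (i + i + 1) / 2 = i by omega, hg]
    exact Prod.ext h2 h1

/-- Equal darts lie on the same edge, which is listed once. The two darts of one edge differ because
there are no loops. -/
theorem IsEdgeList.dart_inj (h : IsEdgeList T L) (z : Fin N × Fin N) {p p' : ℕ}
    (hp : p < L.length + L.length) (hp' : p' < L.length + L.length)
    (e : dartAt z L p = dartAt z L p') : p = p' := by
  have hne := (h.adj z hp).ne
  have h1 : p / 2 = p' / 2 := by
    have h2 : p / 2 < (L.map fun p => s(p.1, p.2)).length := by rw [List.length_map]; omega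
    have h3 : p' / 2 < (L.map fun p => s(p.1, p.2)).length := by rw [List.length_map]; omega
    refine (h.1.getElem_inj_iff (hi := h2) (hj := h3)).1 ?_
    have e' := congrArg (fun x : Fin N × Fin N => s(x.1, x.2)) e
    simp only [mk_dartAt] at e'
    rw [List.length_map] at h2 h3
    rw [List.getD_eq_getElem _ _ h2, List.getD_eq_getElem _ _ h3] at e'
    simpa using e'
  by_contra hpp
  have : p' = flipDart p := by unfold flipDart; split_ifs <;> omega
  rw [this, dartAt_flip] at e
  exact hne (congrArg Prod.fst e)

theorem IsEdgeList.length_eq (h : IsEdgeList T L) : L.length = T.edgeSet.ncard := by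
  classical
  have : T.edgeSet = ((L.map fun p => s(p.1, p.2)).toFinset : Set (Sym2 (Fin N))) := by
    ext e
    simp only [List.coe_toFinset, Set.mem_ofPred_eq, h.2]
  rw [this, Set.ncard_coe_finset, List.toFinset_card_of_nodup h.1, List.length_map]

theorem IsEdgeList.length_tree (h : IsEdgeList T L) (hT : T.IsTree) : L.length + 1 = N := by
  classical
  have := hT.card_edgeFinset
  rw [Fintype.card_fin] at this
  rw [h.length_eq, Set.ncard_eq_toFinset_card']
  exact this

end Darts

/-! ## Truncation -/

/-- If all elements of μ, or all elements of its complement, are below d, then every number from d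
on behaves like d itself. -/
theorem FiniteOrCofinite.mem_iff {μ : Set ℕ} (h : FiniteOrCofinite μ) {d : ℕ}
    (hd : degreeBound μ ≤ d) (a : ℕ) : a ∈ μ ↔ min d a ∈ μ := by
  have hfin : ∀ ν : Set ℕ, ν.Finite → (⨆ x ∈ ν, ((x : ℕ∞) + 1)) ≠ ⊤ := by
    intro ν hν
    obtain ⟨b, hb⟩ := hν.bddAbove
    have : (⨆ x ∈ ν, ((x : ℕ∞) + 1)) ≤ ((b + 1 : ℕ) : ℕ∞) :=
      iSup₂_le fun x hx => by exact_mod_cast Nat.succ_le_succ (hb hx)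
    exact ne_top_of_le_ne_top (ENat.natCast_ne_top _) this
  have hle : min (⨆ x ∈ μ, ((x : ℕ∞) + 1)) (⨆ x ∈ μᶜ, ((x : ℕ∞) + 1)) ≤ d := by
    -- `toNat` sends ⊤ to 0, so without finiteness of one of the two suprema the bound on
    -- `degreeBound` would say nothing.
    have hne : min (⨆ x ∈ μ, ((x : ℕ∞) + 1)) (⨆ x ∈ μᶜ, ((x : ℕ∞) + 1)) ≠ ⊤ := by
      rcases h with h | h
      · exact ne_top_of_le_ne_top (hfin _ h) (min_le_left _ _)
      · exact ne_top_of_le_ne_top (hfin _ h) (min_le_right _ _)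
    rw [← ENat.natCast_toNat hne]
    exact_mod_cast hd
  have key : ∀ ν : Set ℕ, (⨆ x ∈ ν, ((x : ℕ∞) + 1)) ≤ d → (a ∈ ν ↔ min d a ∈ ν) := by
    intro ν hν
    have hx : ∀ x ∈ ν, x + 1 ≤ d := fun x hx => by
      have := (le_iSup₂ (f := fun (x : ℕ) (_ : x ∈ ν) => ((x : ℕ∞) + 1)) x hx).trans hν
      exact_mod_cast this
    constructor
    · intro ha
      have := hx a ha
      rwa [min_eq_right (by omega)]
    · intro ha
      have := hx _ ha
      rwa [min_eq_right (by omega)] at ha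
  rcases min_le_iff.1 hle with h1 | h1
  · exact key _ h1
  · have := key _ h1
    simp only [Set.mem_compl_iff] at this
    tauto

theorem degreeBound_le_matrix {q : ℕ} (D : Fin q → Fin q → Set ℕ) (i j : Fin q) :
    degreeBound (D i j) ≤ matrixDegreeBound D :=
  (Finset.le_sup (f := fun j => degreeBound (D i j)) (Finset.mem_univ j)).trans
    (Finset.le_sup (f := fun i => Finset.univ.sup fun j => degreeBound (D i j)) (Finset.mem_univ i))

/-! ## The cuts of a decomposition tree -/

/-- The constraint matrix with natural numbers as indices. -/
def entryOf {q : ℕ} (D : Fin q → Fin q → Set ℕ) (i j c : ℕ) : Prop :=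
  ∃ (hi : i < q) (hj : j < q), c ∈ D ⟨i, hi⟩ ⟨j, hj⟩

namespace DecompositionTree

variable {n : ℕ} (T : DecompositionTree (Fin n)) {z : Fin T.N × Fin T.N}
  {L' : List (Fin T.N × Fin T.N)}

/-- The elements at the leaves of a branch. -/
def leavesAt (a : Fin T.N × Fin T.N) : Set (Fin n) := {x | (T.leaf x).1 ∈ T.tree.branch a.1 a.2}

theorem mem_leavesAt_swap {a : Fin T.N × Fin T.N} (h : T.tree.Adj a.1 a.2) :
    T.leavesAt a.swap = (T.leavesAt a)ᶜ := by
  ext x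
  exact T.isTree.mem_branch_swap h _

/-- There are finitely many darts, so the supremum is a true upper bound and not the default value
of an unbounded one. -/
theorem le_width (f : Set (Fin n) → ℝ) {a : Fin T.N × Fin T.N} (h : T.tree.Adj a.1 a.2) :
    f (T.leavesAt a) ≤ T.width f := by
  classical
  have : T.leavesAt a = T.side ⟨a, h⟩ := rfl
  rw [this]
  exact le_ciSup (f := fun a : T.tree.Dart => f (T.side a)) (Set.finite_range _).bddAbove _

/-- An optimal tree attains the infimum, and its width is the lower bound that makes the real
infimum meaningful. -/
theorem IsOptimal.width_eq {f : Set (Fin n) → ℝ} {T : DecompositionTree (Fin n)}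
    (h : T.IsOptimal f) : T.width f = minWidth f := by
  have : Nonempty (DecompositionTree (Fin n)) := ⟨T⟩
  exact le_antisymm (le_ciInf h) (ciInf_le ⟨T.width f, by rintro _ ⟨T', rfl⟩; exact h T'⟩ T)

open Classical in
/-- The cuts of a decomposition tree, given by a list of the tree edges. -/
noncomputable def cutSystem (G : SimpleGraph (Fin n)) (z : Fin T.N × Fin T.N)
    (hL' : IsEdgeList T.tree L') {q : ℕ} {D : Fin q → Fin q → Set ℕ}
    (hD : ∀ i j, FiniteOrCofinite (D i j)) (hd : 0 < matrixDegreeBound D) : CutSystem where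
  n := n
  q := q
  d := matrixDegreeBound D
  M := L'.length + L'.length
  adj x y := ∃ (hx : x < n) (hy : y < n), G.Adj ⟨x, hx⟩ ⟨y, hy⟩
  D := entryOf D
  side a := (Finset.range n).filter fun x => if a < L'.length + L'.length then
    ∃ hx : x < n, ⟨x, hx⟩ ∈ T.leavesAt (dartAt z L' a) else L'.length + L'.length + x = a
  opp := flipDart
  q_pos := by
    rcases Nat.eq_zero_or_pos q with rfl | h
    · simp [matrixDegreeBound] at hd
    · exact h
  d_pos := hd
  adj_symm := fun x y ⟨hx, hy, h⟩ => ⟨hy, hx, h.symm⟩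
  adj_irrefl := fun x ⟨hx, hy, h⟩ => h.ne rfl
  adj_lt := fun x y ⟨hx, hy, h⟩ => hx
  D_min := by
    intro i hi j hj c
    have := (hD ⟨i, hi⟩ ⟨j, hj⟩).mem_iff (degreeBound_le_matrix D ⟨i, hi⟩ ⟨j, hj⟩) c
    simp only [entryOf, hi, hj, exists_true_left]
    exact this
  side_lt := fun a x hx => by simpa using (Finset.mem_filter.1 hx).1
  side_single := by
    intro x hx
    ext y
    simp only [Finset.mem_filter, Finset.mem_range, Finset.mem_singleton]
    rw [if_neg (by omega)]
    omega
  side_empty := by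
    ext y
    simp only [Finset.mem_filter, Finset.mem_range, Finset.notMem_empty, iff_false]
    rw [if_neg (by omega)]
    omega
  opp_lt := fun a ha => flipDart_lt ha
  opp_opp := fun a _ => flipDart_flipDart a
  side_opp := by
    intro a ha x hx
    simp only [Finset.mem_filter, Finset.mem_range, hx, true_and, ha, flipDart_lt ha, if_true,
      exists_true_left, dartAt_flip, T.mem_leavesAt_swap (hL'.adj z ha), Set.mem_compl_iff]

variable {G : SimpleGraph (Fin n)} {hL' : IsEdgeList T.tree L'} {q : ℕ}
  {D : Fin q → Fin q → Set ℕ} {hD : ∀ i j, FiniteOrCofinite (D i j)}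
  {hd : 0 < matrixDegreeBound D}

theorem mem_cutSystem_side {a : ℕ} (ha : a < L'.length + L'.length) {x : ℕ} :
    x ∈ (T.cutSystem G z hL' hD hd).side a ↔
      ∃ hx : x < n, ⟨x, hx⟩ ∈ T.leavesAt (dartAt z L' a) := by
  simp only [cutSystem, Finset.mem_filter, Finset.mem_range, ha, if_true]
  exact ⟨fun h => h.2, fun h => ⟨h.1, h⟩⟩

/-- Transport from `Fin n` to natural numbers. A set R with 2^|R| ≤ K has at most log₂ K elements,
rounded down. -/
theorem cutSystem_rowBound {a K : ℕ} (ha : a < L'.length + L'.length)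
    (h : G.CutBound (T.leavesAt (dartAt z L' a)) K) :
    (T.cutSystem G z hL' hD hd).RowBound a K (Nat.log 2 K) := by
  classical
  set S := T.cutSystem G z hL' hD hd with hS
  have hrow : ∀ (x : Fin n) (y : ℕ), y ∈ S.row a x.1 ↔
      ∃ hy : y < n, (⟨y, hy⟩ : Fin n) ∉ T.leavesAt (dartAt z L' a) ∧ G.Adj x ⟨y, hy⟩ := by
    intro x y
    rw [CutSystem.mem_row, T.mem_cutSystem_side ha]
    constructor
    · rintro ⟨⟨h1, h2⟩, ⟨_, h3, h4⟩⟩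
      exact ⟨h3, fun hh => h2 ⟨h3, hh⟩, h4⟩
    · rintro ⟨h1, h2, h3⟩
      exact ⟨⟨h1, fun ⟨_, hh⟩ => h2 hh⟩, x.2, h1, h3⟩
  constructor
  · obtain ⟨F, hF, h0, hm⟩ := h.1
    refine ⟨F.image fun U => (Finset.univ.filter fun x : Fin n => x ∈ U).image Fin.val,
      Finset.card_image_le.trans hF, ?_, ?_⟩
    · refine Finset.mem_image.2 ⟨∅, h0, ?_⟩
      simp
    · intro x hx
      obtain ⟨hxn, hx⟩ := (T.mem_cutSystem_side ha).1 hx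
      refine Finset.mem_image.2 ⟨_, hm _ hx, ?_⟩
      ext y
      rw [hrow ⟨x, hxn⟩ y]
      simp only [Finset.mem_image, Finset.mem_filter, Finset.mem_univ, true_and, Set.mem_ofPred_eq]
      constructor
      · rintro ⟨w, hw, rfl⟩
        exact ⟨w.2, hw⟩
      · rintro ⟨hy, hw⟩
        exact ⟨⟨y, hy⟩, hw, rfl⟩
  · intro X hX
    obtain ⟨R, hR, hc, hm⟩ := h.2 {x | x.1 ∈ X} (fun x hx => by
      obtain ⟨_, h⟩ := (T.mem_cutSystem_side ha).1 (hX hx)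
      exact h)
    refine ⟨R.image Fin.val, ?_, ?_, ?_⟩
    · intro x hx
      obtain ⟨w, hw, rfl⟩ := Finset.mem_image.1 hx
      exact hR hw
    · exact Finset.card_image_le.trans (Nat.le_log_of_pow_le (by norm_num) hc)
    · intro x hx y hy
      obtain ⟨hxn, hxa⟩ := (T.mem_cutSystem_side ha).1 (hX hx)
      obtain ⟨hyn, hya, hxy⟩ := (hrow ⟨x, hxn⟩ y).1 hy
      obtain ⟨w, hw, hwy⟩ := hm ⟨x, hxn⟩ hx ⟨y, hyn⟩ hya hxy
      exact ⟨w.1, Finset.mem_image_of_mem _ hw, (hrow w y).2 ⟨hyn, hya, hwy⟩⟩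

theorem leavesAt_of_leaf {u v : Fin T.N} (huv : T.tree.Adj u v) (hu : IsLeafNode T.tree u) :
    T.leavesAt (u, v) = {T.leaf.symm ⟨u, hu⟩} := by
  ext x
  have hone : ∀ v', T.tree.Adj u v' → v' = v := fun v' hv' =>
    (Set.ncard_le_one (Set.toFinite _)).1 hu v' hv' v huv
  simp only [leavesAt, Set.mem_ofPred_eq, T.isTree.mem_branch_iff huv, Set.mem_singleton_iff]
  constructor
  · rintro (h | ⟨v', h1, h2, -⟩)
    · rw [← T.leaf.apply_eq_iff_eq_symm_apply]
      exact Subtype.ext h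
    · exact absurd (hone v' h1) h2
  · rintro rfl
    left
    simp

/-- Three different neighbours show that u is not a leaf, so u has degree 3 and these are all its
neighbours. As no vertex sits at u itself, the recursion for branches leaves just two of them. -/
theorem leavesAt_of_inner {u v v₁ v₂ : Fin T.N} (huv : T.tree.Adj u v) (h₁ : T.tree.Adj u v₁)
    (h₂ : T.tree.Adj u v₂) (hv₁ : v ≠ v₁) (hv₂ : v ≠ v₂) (h₁₂ : v₁ ≠ v₂) :
    T.leavesAt (u, v) = T.leavesAt (v₁, u) ∪ T.leavesAt (v₂, u) := by
  have hsub : ({v, v₁, v₂} : Set (Fin T.N)) ⊆ T.tree.neighborSet u := by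
    rintro w (rfl | rfl | rfl) <;> assumption
  have hc : ({v, v₁, v₂} : Set (Fin T.N)).ncard = 3 :=
    Set.ncard_eq_three.2 ⟨v, v₁, v₂, hv₁, hv₂, h₁₂, rfl⟩
  have hnl : ¬ IsLeafNode T.tree u := by
    intro h
    have := Set.ncard_le_ncard hsub (Set.toFinite _)
    unfold IsLeafNode at h
    omega
  have heq : ({v, v₁, v₂} : Set (Fin T.N)) = T.tree.neighborSet u :=
    Set.eq_of_subset_of_ncard_le hsub (by rw [hc, T.subcubic u hnl]) (Set.toFinite _)
  ext x
  simp only [leavesAt, Set.mem_ofPred_eq, T.isTree.mem_branch_iff huv, Set.mem_union]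
  constructor
  · rintro (h | ⟨w, hw, hne, hb⟩)
    · exact absurd (h ▸ (T.leaf x).2) hnl
    · have : w ∈ ({v, v₁, v₂} : Set (Fin T.N)) := by rw [heq]; exact hw
      rcases this with rfl | rfl | rfl
      · exact absurd rfl hne
      · exact .inl hb
      · exact .inr hb
  · rintro (h | h)
    · exact .inr ⟨_, h₁, hv₁.symm, h⟩
    · exact .inr ⟨_, h₂, hv₂.symm, h⟩

/-- The tail of a dart is an end of a tree edge, so the listed edges are literally the table of
tails, followed in memory by the leaves of the vertices. The rank of a dart is the number of nodes
of its branch. -/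
theorem inputTree (L : List (Fin n × Fin n)) (hN : 2 ≤ T.N) :
    Imp.InputTree (T.cutSystem G z hL' hD hd) L.length T.N
      (fun p => (T.tree.branch (dartAt z L' p).1 (dartAt z L' p).2).ncard)
      (fun i => (encodeInput T L L').getD i 0) := by
  have hlen := hL'.length_tree T.isTree
  have htail : ∀ p < L'.length + L'.length,
      Imp.tail L.length (fun i => (encodeInput T L L').getD i 0) p = (dartAt z L' p).1.val := by
    intro p hp
    have hz := encodeEdges_getD L' z (e := p / 2) (by omega)
    unfold Imp.tail
    simp only
    rw [encodeInput_tree T L L' hp]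
    unfold dartAt
    split_ifs with h
    · rw [← hz.1]; congr 1; omega
    · rw [Prod.fst_swap, ← hz.2]; congr 1; omega
  have hleaf : ∀ x (hx : x < n), Imp.tail L.length (fun i => (encodeInput T L L').getD i 0)
      (L'.length + L'.length + x) = (T.leaf ⟨x, hx⟩).1.val := fun x hx =>
    encodeInput_leaf T L L' hx
  have hsame : ∀ p < L'.length + L'.length, ∀ p' < L'.length + L'.length,
      Imp.tail L.length (fun i => (encodeInput T L L').getD i 0) p' =
        Imp.tail L.length (fun i => (encodeInput T L L').getD i 0) p →
      (dartAt z L' p').1 = (dartAt z L' p).1 := by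
    intro p hp p' hp' h
    rw [htail p hp, htail p' hp'] at h
    exact Fin.ext h
  have hsnd : ∀ p < L'.length + L'.length, ∀ p' < L'.length + L'.length,
      (dartAt z L' p').1 = (dartAt z L' p).1 → p ≠ p' →
        (dartAt z L' p).2 ≠ (dartAt z L' p').2 := fun p hp p' hp' h hne he =>
    hne (hL'.dart_inj z hp hp' (Prod.ext h.symm he))
  refine ⟨?_, ?_, ?_, ?_, ?_, ?_, ?_⟩
  · show L'.length + L'.length = _
    omega
  · intro p hp
    rw [htail p hp]
    exact Fin.is_lt _
  · intro x hx y hy h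
    have h1 := (hleaf x hx).symm.trans (h.trans (hleaf y hy))
    have h2 := T.leaf.injective (Subtype.ext (Fin.ext h1))
    exact congrArg Fin.val h2
  · intro e he
    show flipDart _ = _ ∧ flipDart _ = _
    unfold flipDart
    constructor <;> split_ifs <;> omega
  · intro p hp
    have hp : p < L'.length + L'.length := hp
    have hadj := hL'.adj z hp
    by_cases hl : IsLeafNode T.tree (dartAt z L' p).1
    · left
      have hside : T.leavesAt (dartAt z L' p) = {T.leaf.symm ⟨_, hl⟩} :=
        T.leavesAt_of_leaf hadj hl
      refine ⟨(T.leaf.symm ⟨_, hl⟩).1, (T.leaf.symm ⟨_, hl⟩).2, ?_, ?_, ?_⟩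
      · rw [htail p hp]
        refine (hleaf _ (T.leaf.symm ⟨_, hl⟩).2).trans ?_
        simp
      · ext x
        rw [T.mem_cutSystem_side hp, Finset.mem_singleton]
        rw [hside]
        constructor
        · rintro ⟨hx, h⟩
          exact congrArg Fin.val h
        · rintro rfl
          exact ⟨Fin.is_lt _, rfl⟩
      · intro p' hp' h
        have h1 := hsame p hp p' hp' h
        have h2 := hL'.adj z (show p' < L'.length + L'.length from hp')
        rw [h1] at h2
        exact hL'.dart_inj z hp' hp (Prod.ext h1
          ((Set.ncard_le_one (Set.toFinite _)).1 hl _ h2 _ hadj))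
    · right
      have h3 := T.subcubic _ hl
      obtain ⟨a, b, c, hab, hac, hbc, hs⟩ := Set.ncard_eq_three.1 h3
      -- The head of the given dart is singled out among the three neighbours of its tail.
      have key : ∃ b c, (dartAt z L' p).2 ≠ b ∧ (dartAt z L' p).2 ≠ c ∧ b ≠ c ∧
          T.tree.neighborSet (dartAt z L' p).1 = {(dartAt z L' p).2, b, c} := by
        have : (dartAt z L' p).2 ∈ T.tree.neighborSet (dartAt z L' p).1 := hadj
        rw [hs] at this
        rcases this with h | h | h
        · exact ⟨b, c, h ▸ hab, h ▸ hac, hbc, by rw [hs, h]⟩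
        · exact ⟨a, c, h ▸ hab.symm, h ▸ hbc, hac, by rw [hs, h, Set.insert_comm]⟩
        · have h : (dartAt z L' p).2 = c := h
          refine ⟨a, b, h ▸ hac.symm, h ▸ hbc.symm, hab, ?_⟩
          rw [hs, h]
          ext w; simp; tauto
      obtain ⟨b, c, hb, hc, hbc, hs⟩ := key
      have mb : T.tree.Adj (dartAt z L' p).1 b := by
        have : b ∈ T.tree.neighborSet (dartAt z L' p).1 := by rw [hs]; simp
        exact this
      have mc : T.tree.Adj (dartAt z L' p).1 c := by
        have : c ∈ T.tree.neighborSet (dartAt z L' p).1 := by rw [hs]; simp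
        exact this
      obtain ⟨p₁, hp₁, e₁⟩ := hL'.exists_dart z mb
      obtain ⟨p₂, hp₂, e₂⟩ := hL'.exists_dart z mc
      refine ⟨p₁, hp₁, p₂, hp₂, ?_, ?_, ?_, ?_, ?_, ?_⟩
      · rintro rfl
        exact hb (by rw [e₁])
      · rintro rfl
        exact hc (by rw [e₂])
      · rintro rfl
        rw [e₁] at e₂
        exact hbc (congrArg Prod.snd e₂)
      · rw [htail _ hp₁, htail _ hp, e₁]
      · rw [htail _ hp₂, htail _ hp, e₂]
      · intro p' hp' h
        have hp' : p' < L'.length + L'.length := hp'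
        have h1 := hsame p hp p' hp' h
        have h2 := hL'.adj z hp'
        rw [h1] at h2
        have h4 : (dartAt z L' p').2 ∈ T.tree.neighborSet (dartAt z L' p).1 := h2
        rw [hs] at h4
        rcases h4 with h4 | h4 | h4
        · exact .inl (hL'.dart_inj z hp' hp (Prod.ext h1 h4))
        · exact .inr (.inl (hL'.dart_inj z hp' hp₁ (by rw [e₁]; exact Prod.ext h1 h4)))
        · exact .inr (.inr (hL'.dart_inj z hp' hp₂ (by rw [e₂]; exact Prod.ext h1 h4)))
  · intro p hp p₁ hp₁ p₂ hp₂ h1 h2 h12 ht1 ht2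
    have hp : p < L'.length + L'.length := hp
    have hp₁ : p₁ < L'.length + L'.length := hp₁
    have hp₂ : p₂ < L'.length + L'.length := hp₂
    have hu1 := hsame p hp p₁ hp₁ ht1
    have hu2 := hsame p hp p₂ hp₂ ht2
    have a0 := hL'.adj z hp
    have a1 := hL'.adj z hp₁
    have a2 := hL'.adj z hp₂
    have n12 := hsnd p₁ hp₁ p₂ hp₂ (hu2.trans hu1.symm) h12
    have d1 : dartAt z L' (flipDart p₁) = ((dartAt z L' p₁).2, (dartAt z L' p).1) := by
      rw [dartAt_flip, ← hu1]; rfl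
    have d2 : dartAt z L' (flipDart p₂) = ((dartAt z L' p₂).2, (dartAt z L' p).1) := by
      rw [dartAt_flip, ← hu2]; rfl
    rw [hu1] at a1
    rw [hu2] at a2
    have e := T.leavesAt_of_inner a0 a1 a2 (hsnd p hp p₁ hp₁ hu1 h1) (hsnd p hp p₂ hp₂ hu2 h2) n12
    constructor
    · show _ = (T.cutSystem G z hL' hD hd).side (flipDart p₁) ∪
        (T.cutSystem G z hL' hD hd).side (flipDart p₂)
      ext x
      rw [Finset.mem_union, T.mem_cutSystem_side hp, T.mem_cutSystem_side (flipDart_lt hp₁),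
        T.mem_cutSystem_side (flipDart_lt hp₂), d1, d2]
      have : dartAt z L' p = ((dartAt z L' p).1, (dartAt z L' p).2) := rfl
      rw [this, e]
      constructor
      · rintro ⟨hx, h | h⟩
        · exact .inl ⟨hx, h⟩
        · exact .inr ⟨hx, h⟩
      · rintro (⟨hx, h⟩ | ⟨hx, h⟩)
        · exact ⟨hx, .inl h⟩
        · exact ⟨hx, .inr h⟩
    · show Disjoint ((T.cutSystem G z hL' hD hd).side (flipDart p₁))
        ((T.cutSystem G z hL' hD hd).side (flipDart p₂))
      rw [Finset.disjoint_left]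
      intro x hx hx'
      rw [T.mem_cutSystem_side (flipDart_lt hp₁), d1] at hx
      rw [T.mem_cutSystem_side (flipDart_lt hp₂), d2] at hx'
      obtain ⟨_, hx⟩ := hx
      obtain ⟨_, hx'⟩ := hx'
      exact T.isTree.branch_disjoint a1 a2 n12 _ hx hx'
  · intro p hp p' hp' hne ht
    have hp : p < L'.length + L'.length := hp
    have hp' : p' < L'.length + L'.length := hp'
    have hu := hsame p hp p' hp' ht
    have a0 := hL'.adj z hp
    have a1 := hL'.adj z hp'
    have n1 := hsnd p hp p' hp' hu hne.symm
    show (T.tree.branch (dartAt z L' (flipDart p')).1 (dartAt z L' (flipDart p')).2).ncard < _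
    rw [dartAt_flip, Prod.fst_swap, Prod.snd_swap, hu]
    rw [hu] at a1
    exact T.isTree.branch_ncard_lt a0 a1 n1.symm

theorem inputGraph {L : List (Fin n × Fin n)} (hL : IsEdgeList G L) :
    Imp.InputGraph (T.cutSystem G z hL' hD hd) L.length
      (fun i => (encodeInput T L L').getD i 0) := by
  have hcell : ∀ e (he : e < L.length),
      (encodeInput T L L').getD (3 + (e + e)) 0 = (L[e]).1.val ∧
      (encodeInput T L L').getD (4 + (e + e)) 0 = (L[e]).2.val := by
    intro e he
    have hz := encodeEdges_getD L L[e] he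
    rw [List.getD_eq_getElem _ _ he] at hz
    rw [encodeInput_graph T L L' (by omega), hz.1,
      show 4 + (e + e) = 3 + (e + e + 1) by omega, encodeInput_graph T L L' (by omega), hz.2]
    exact ⟨rfl, rfl⟩
  constructor
  · intro p hp
    show _ < n
    obtain ⟨e, rfl | rfl⟩ := Nat.even_or_odd' p
    · rw [show 3 + 2 * e = 3 + (e + e) by omega]
      simp only [(hcell e (by omega)).1]
      exact Fin.is_lt _
    · rw [show 3 + (2 * e + 1) = 4 + (e + e) by omega]
      simp only [(hcell e (by omega)).2]
      exact Fin.is_lt _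
  · intro x y
    constructor
    · rintro ⟨hx, hy, h⟩
      rw [← SimpleGraph.mem_edgeSet, ← hL.2, List.mem_map] at h
      obtain ⟨w, hw, e⟩ := h
      obtain ⟨i, hi, rfl⟩ := List.mem_iff_getElem.1 hw
      refine ⟨i, hi, ?_⟩
      simp only [(hcell i hi).1, (hcell i hi).2]
      rw [Sym2.eq_iff] at e
      rcases e with ⟨h1, h2⟩ | ⟨h1, h2⟩
      · exact .inl ⟨congrArg Fin.val h1, congrArg Fin.val h2⟩
      · exact .inr ⟨congrArg Fin.val h1, congrArg Fin.val h2⟩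
    · rintro ⟨e, he, h⟩
      simp only [(hcell e he).1, (hcell e he).2] at h
      have hadj : G.Adj (L[e]).1 (L[e]).2 := by
        rw [← SimpleGraph.mem_edgeSet, ← hL.2, List.mem_map]
        exact ⟨_, List.getElem_mem he, rfl⟩
      rcases h with ⟨rfl, rfl⟩ | ⟨rfl, rfl⟩
      · exact ⟨Fin.is_lt _, Fin.is_lt _, hadj⟩
      · exact ⟨Fin.is_lt _, Fin.is_lt _, hadj.symm⟩

end DecompositionTree

/-! ## Partitions as labellings -/

section Labelling

variable {n q : ℕ} {G : SimpleGraph (Fin n)} {D : Fin q → Fin q → Set ℕ}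

/-- The classes are the fibres of a labelling, empty fibres being allowed. -/
theorem hasDegreePartition_iff : HasDegreePartition G D ↔ ∃ X : Fin n → Fin q,
    ∀ v j, {w | G.Adj v w ∧ X w = j}.ncard ∈ D (X v) j := by
  constructor
  · rintro ⟨W, hdis, hun, hW⟩
    have hex : ∀ v, ∃ i, v ∈ W i := fun v => by
      have : v ∈ ⋃ i, W i := by rw [hun]; trivial
      exact Set.mem_iUnion.1 this
    choose X hX using hex
    refine ⟨X, fun v j => ?_⟩
    have : {w | G.Adj v w ∧ X w = j} = G.neighborSet v ∩ W j := by
      ext w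
      refine and_congr Iff.rfl ⟨?_, fun h => ?_⟩
      · rintro rfl
        exact hX w
      · by_contra hne
        exact Set.disjoint_left.1 (hdis _ _ hne) (hX w) h
    rw [this]
    exact hW _ j v (hX v)
  · rintro ⟨X, hX⟩
    refine ⟨fun i => {v | X v = i}, ?_, ?_, ?_⟩
    · intro i j hij
      rw [Set.disjoint_left]
      rintro v rfl h
      exact hij h
    · ext v
      simp
    · rintro i j v rfl
      exact hX v j

/-- If the counts do not matter, each vertex can be judged alone, and one good label serves them
all. A vertex must exist, for otherwise the empty partition would always do. -/
theorem hasDegreePartition_iff_of_trivial [Nonempty (Fin n)]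
    (h : ∀ (X : Fin n → Fin q) v j,
      {w | G.Adj v w ∧ X w = j}.ncard ∈ D (X v) j ↔ 0 ∈ D (X v) j) :
    HasDegreePartition G D ↔ ∃ i, ∀ j, 0 ∈ D i j := by
  rw [hasDegreePartition_iff]
  constructor
  · rintro ⟨X, hX⟩
    exact ⟨X (Classical.arbitrary _), fun j => (h X _ j).1 (hX _ j)⟩
  · rintro ⟨i, hi⟩
    exact ⟨fun _ => i, fun v j => (h (fun _ => i) v j).2 (hi j)⟩

variable (T : DecompositionTree (Fin n)) {z : Fin T.N × Fin T.N} {L' : List (Fin T.N × Fin T.N)}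
  {hL' : IsEdgeList T.tree L'} {hD : ∀ i j, FiniteOrCofinite (D i j)}
  {hd : 0 < matrixDegreeBound D}

theorem DecompositionTree.cutSystem_cnt (X : ℕ → ℕ) (v : Fin n) (j : ℕ) :
    (T.cutSystem G z hL' hD hd).cnt (Finset.range n) X v.1 j =
      {w : Fin n | G.Adj v w ∧ X w.1 = j}.ncard := by
  classical
  rw [Set.ncard_eq_toFinset_card', ← Finset.card_image_of_injective _ Fin.val_injective]
  unfold CutSystem.cnt
  congr 1
  ext x
  simp only [Finset.mem_filter, CutSystem.mem_nbr, Finset.mem_range, Finset.mem_image,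
    Set.mem_toFinset, Set.mem_ofPred_eq]
  constructor
  · rintro ⟨⟨h1, _, h2, h3⟩, h4⟩
    exact ⟨⟨x, h1⟩, ⟨h3, h4⟩, rfl⟩
  · rintro ⟨w, ⟨h1, h2⟩, rfl⟩
    exact ⟨⟨w.2, v.2, w.2, h1⟩, h2⟩

theorem DecompositionTree.exists_labelling_iff :
    (∃ X, (T.cutSystem G z hL' hD hd).IsLab X ∧ ∀ v < n, ∀ j < q,
      entryOf D (X v) j ((T.cutSystem G z hL' hD hd).cnt (Finset.range n) X v j)) ↔
      HasDegreePartition G D := by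
  rw [hasDegreePartition_iff]
  constructor
  · rintro ⟨X, hX, h⟩
    refine ⟨fun v => ⟨X v.1, hX v.1⟩, fun v j => ?_⟩
    obtain ⟨_, _, hm⟩ := h v.1 v.2 j.1 j.2
    rw [T.cutSystem_cnt] at hm
    simpa [Fin.ext_iff] using hm
  · rintro ⟨X, hX⟩
    have hq : 0 < q := (T.cutSystem G z hL' hD hd).q_pos
    refine ⟨fun x => if hx : x < n then (X ⟨x, hx⟩).1 else 0, fun x => ?_, fun v hv j hj => ?_⟩
    · dsimp only
      split_ifs
      · exact Fin.is_lt _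
      · exact hq
    · have hm := hX ⟨v, hv⟩ ⟨j, hj⟩
      refine ⟨by simp [hv], hj, ?_⟩
      rw [T.cutSystem_cnt _ ⟨v, hv⟩]
      simpa [hv, Fin.ext_iff] using hm

end Labelling

/-! ## Cut functions -/

/-- What the algorithm needs to know about a cut function. -/
structure SimpleGraph.IsCutMeasure {V : Type*} (G : SimpleGraph V) (f : Set V → ℝ) : Prop where
  nonneg : ∀ A, 0 ≤ f A
  one_le : ∀ u v, G.Adj u v → 1 ≤ f {u}
  cutBound : ∀ A (k : ℝ), f A ≤ k → f Aᶜ ≤ k → G.CutBound A ⌊(2 : ℝ) ^ k⌋₊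

theorem one_le_logb_two {a : ℕ} (h : 2 ≤ a) : 1 ≤ Real.logb 2 a := by
  rw [Real.le_logb_iff_rpow_le (by norm_num) (by exact_mod_cast (by omega : 0 < a)), Real.rpow_one]
  exact_mod_cast h

theorem logb_two_nonneg (a : ℕ) : 0 ≤ Real.logb 2 a := by
  rcases Nat.eq_zero_or_pos a with rfl | h
  · simp
  · exact Real.logb_nonneg (by norm_num) (by exact_mod_cast h)

theorem le_floor_of_logb_le {a : ℕ} {k : ℝ} (h : Real.logb 2 a ≤ k) : a ≤ ⌊(2 : ℝ) ^ k⌋₊ := by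
  rcases Nat.eq_zero_or_pos a with rfl | ha
  · exact Nat.zero_le _
  · exact Nat.le_floor ((Real.logb_le_iff_le_rpow (by norm_num) (by exact_mod_cast ha)).1 h)

/-- The row of u has the entry 1 at v, so the span contains a nonzero vector besides 0. -/
theorem SimpleGraph.isCutMeasure_cutRank {V : Type*} [Finite V] (G : SimpleGraph V) :
    G.IsCutMeasure G.cutRank where
  nonneg A := logb_two_nonneg _
  one_le u v h := by
    classical
    have : Fintype V := Fintype.ofFinite V
    refine one_le_logb_two (Nat.succ_le_of_lt (Finite.one_lt_card_iff_nontrivial.2 ?_))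
    refine ⟨⟨⟨_, Submodule.subset_span ⟨⟨u, rfl⟩, rfl⟩⟩, 0, fun e => ?_⟩⟩
    have hv : v ∈ ({u}ᶜ : Set V) := h.ne'
    have := congrFun (congrArg Subtype.val e) ⟨v, hv⟩
    simp [SimpleGraph.adjMatrix_apply, h] at this
  cutBound A k h _ := G.cutBound_of_span (by
    classical
    convert le_floor_of_logb_le h)

/-- For the cut {u} the sets ∅ and {u} both occur, from Y = ∅ and Y = {v}. -/
theorem SimpleGraph.isCutMeasure_booleanCut {V : Type*} [Finite V] (G : SimpleGraph V) :
    G.IsCutMeasure G.booleanCut where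
  nonneg A := logb_two_nonneg _
  one_le u v h := by
    refine one_le_logb_two ((Set.one_lt_ncard (Set.toFinite _)).2 ⟨∅, ?_, {u}, ?_, ?_⟩)
    · exact ⟨Set.empty_subset _, ∅, Set.empty_subset _, by simp⟩
    · refine ⟨subset_rfl, {v}, by simpa using h.ne, ?_⟩
      ext w
      simp only [Set.mem_singleton_iff, Set.iUnion_iUnion_eq_left, Set.mem_sdiff,
        SimpleGraph.mem_neighborSet, Set.mem_compl_iff, not_not]
      constructor
      · exact fun hw => hw.2
      · rintro rfl
        exact ⟨h.symm, rfl⟩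
    · exact (Set.singleton_ne_empty u).symm
  -- The boolean cut function at A counts unions inside A, so the bound at Aᶜ is the one that
  -- concerns the rows of A. Since a tree edge has two orientations, both bounds are available and
  -- symmetry of the function is not needed.
  cutBound A k _ h := G.cutBound_of_unions (le_floor_of_logb_le h)

/-! ## The machine program -/

open Classical in
/-- The constant answer for constraints that do not depend on the neighbourhoods. -/
noncomputable def constantAnswer {q : ℕ} (D : Fin q → Fin q → Set ℕ) : RamProg :=
  .const 0 (if ∃ i, ∀ j, 0 ∈ D i j then 1 else 0)

/-- Computes an upper bound for the length of the input and runs the main program. -/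
noncomputable def mainProg {q : ℕ} (D : Fin q → Fin q → Set ℕ) : RamProg :=
  .seq (.const 11 2) (.seq (.load 7 9) (.seq (.load 13 11) (.seq (.add 1 5 5) (.seq (.add 1 1 13)
    (.seq (.add 1 1 13) (.seq (.add 1 1 7) (.seq (.add 1 1 11) (.seq (.add 1 1 3)
      ((Imp.mainCmd q (matrixDegreeBound D) (entryOf D)).compile 1)))))))))

/-- The program for the partitioning problem. -/
noncomputable def partitionProg {q : ℕ} (D : Fin q → Fin q → Set ℕ) : RamProg :=
  if matrixDegreeBound D = 0 then constantAnswer D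
  else .seq (.const 3 1) (.seq (.load 5 3) (.ite 5 (mainProg D) (constantAnswer D)))

theorem constantAnswer_exec {q : ℕ} (D : Fin q → Fin q → Set ℕ) (s : RamState) :
    ∃ s', (constantAnswer D).Exec s 1 s' ∧
      ((∃ i, ∀ j, 0 ∈ D i j) → s'.reg 0 = 1) ∧ (¬ (∃ i, ∀ j, 0 ∈ D i j) → s'.reg 0 = 0) := by
  refine ⟨_, .const _ _ _, ?_, ?_⟩ <;> intro h <;> simp [RamState.setReg, h]

/-- The preamble uses odd registers only, so every variable of the main program still has the value
0, and leaves the base address in register 1, which is `tmp 0`. -/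
theorem mainProg_exec {q : ℕ} (D : Fin q → Fin q → Set ℕ) (input : List ℕ) (s : RamState)
    (hreg : ∀ r, r ≠ 3 → r ≠ 5 → s.reg r = 0) (h3 : s.reg 3 = 1) (h5 : s.reg 5 = input.getD 1 0)
    (hmem : s.mem = fun i => input.getD i 0)
    (hlen : input.length ≤ 2 * input.getD 1 0 + 2 * input.getD 2 0 + input.getD 0 0 + 3) :
    ∃ s', (mainProg D).Exec s
      (9 + (Imp.mainCmd q (matrixDegreeBound D) (entryOf D)).cost (fun i => input.getD i 0)
        Imp.Store.zero) s' ∧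
      s'.reg 0 = ((Imp.mainCmd q (matrixDegreeBound D) (entryOf D)).run (fun i => input.getD i 0)
        Imp.Store.zero).var .res := by
  set I : ℕ → ℕ := fun i => input.getD i 0 with hI
  -- With N in place of N - 1 tree edges this is slightly more than the length of the input. Only an
  -- upper bound is needed, beyond which the memory is zero.
  set base := I 1 + I 1 + I 2 + I 2 + I 0 + 2 + 1 with hbase
  have hIz : ∀ i, base ≤ i → I i = 0 := fun i hi => List.getD_eq_default _ _ (by
    have : 2 * I 1 + 2 * I 2 + I 0 + 3 = base := by omega
    change input.length ≤ 2 * I 1 + 2 * I 2 + I 0 + 3 at hlen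
    omega)
  have h9 : s.reg 9 = 0 := hreg 9 (by norm_num) (by norm_num)
  let s1 := s.setReg 11 2
  let s2 := s1.setReg 7 (s1.mem (s1.reg 9))
  let s3 := s2.setReg 13 (s2.mem (s2.reg 11))
  let s4 := s3.setReg 1 (s3.reg 5 + s3.reg 5)
  let s5 := s4.setReg 1 (s4.reg 1 + s4.reg 13)
  let s6 := s5.setReg 1 (s5.reg 1 + s5.reg 13)
  let s7 := s6.setReg 1 (s6.reg 1 + s6.reg 7)
  let s8 := s7.setReg 1 (s7.reg 1 + s7.reg 11)
  let s9 := s8.setReg 1 (s8.reg 1 + s8.reg 3)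
  have hm9 : s9.mem = I := hmem
  have hrep : Imp.Represents I base Imp.Store.zero s9 := by
    refine ⟨fun v => ?_, ?_, fun i _ => by rw [hm9], hIz, fun k i => ?_⟩
    · have hv : ∀ t, v.reg ≠ 2 * t + 1 := fun t => Imp.reg_ne_tmp t v
      have e : s9.reg v.reg = s.reg v.reg := by
        simp [s9, s8, s7, s6, s5, s4, s3, s2, s1, RamState.setReg, Function.update_apply,
          hv 0, hv 6, hv 3, hv 5]
      rw [e, hreg _ (hv 1) (hv 2)]
      rfl
    · show s9.reg 1 = base
      simp [s9, s8, s7, s6, s5, s4, s3, s2, s1, RamState.setReg, Function.update_apply, h3, h5, h9,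
        hmem, hbase, hI]
    · rw [hm9, hIz _ (by omega)]
      rfl
  obtain ⟨s', he, hr, -⟩ := Imp.exec_cmd I base
    (Imp.mainCmd q (matrixDegreeBound D) (entryOf D)) 1 one_pos Imp.Store.zero s9 hrep
  -- `res` is the first variable, so its register is number 0, where the answer is expected.
  refine ⟨s', ?_, hr.var .res⟩
  have := RamProg.Exec.seq (.const s 11 2) (.seq (.load s1 7 9) (.seq (.load s2 13 11)
    (.seq (.add s3 1 5 5) (.seq (.add s4 1 1 13) (.seq (.add s5 1 1 13) (.seq (.add s6 1 1 7)
      (.seq (.add s7 1 1 11) (.seq (.add s8 1 1 3) he))))))))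
  unfold mainProg
  convert this using 1
  omega

/-! ### The time bound and the conclusion -/

/-- With K ≤ 2^k and r ≤ k, each of the three factors s = K^(d r q) is at most 2^(q d k²), and the
number of representatives contributes 2^k. -/
theorem time_le {n m q d K r c s : ℕ} {k : ℝ} (hk : 1 ≤ k) (hK : (K : ℝ) ≤ 2 ^ k)
    (hr : (r : ℝ) ≤ k) (hc : c = K) (hs : s = K ^ (d * r * q)) :
    ((n * (m + s * s * s * (c * q * d)) : ℕ) : ℝ) ≤ partitionTime n m q d k := by
  have hs' : (s : ℝ) ≤ (2 : ℝ) ^ (q * d * k ^ 2) := by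
    rw [hs]
    push_cast
    calc (K : ℝ) ^ (d * r * q) ≤ ((2 : ℝ) ^ k) ^ (d * r * q) := by gcongr
      _ = (2 : ℝ) ^ (k * (d * r * q : ℕ)) := by rw [Real.rpow_mul (by norm_num), Real.rpow_natCast]
      _ ≤ _ := by
          apply Real.rpow_le_rpow_of_exponent_le (by norm_num)
          push_cast
          have hk0 : 0 ≤ k := by linarith
          calc k * (d * r * q) = (q * d * k) * r := by ring
            _ ≤ (q * d * k) * k := by gcongr
            _ = _ := by ring
  have e : (2 : ℝ) ^ (3 * q * d * k ^ 2 + k) = (2 : ℝ) ^ (q * d * k ^ 2) *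
      (2 : ℝ) ^ (q * d * k ^ 2) * (2 : ℝ) ^ (q * d * k ^ 2) * (2 : ℝ) ^ k := by
    rw [← Real.rpow_add (by norm_num), ← Real.rpow_add (by norm_num),
      ← Real.rpow_add (by norm_num)]
    congr 1
    ring
  unfold partitionTime
  rw [e, hc]
  set E := (2 : ℝ) ^ (q * d * k ^ 2)
  have hE : 0 ≤ E := by positivity
  have hP : 0 ≤ (2 : ℝ) ^ k := by positivity
  push_cast
  refine mul_le_mul_of_nonneg_left (add_le_add_right ?_ _) (Nat.cast_nonneg n)
  calc (s : ℝ) * s * s * (K * q * d) ≤ E * E * E * (2 ^ k * q * d) := by gcongr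
    _ = q * d * 1 * (E * E * E * 2 ^ k) := by ring
    -- The factor k of the bound is only given away here; it needs k ≥ 1.
    _ ≤ q * d * k * (E * E * E * 2 ^ k) := by gcongr

theorem partitionTime_nonneg (n m q d : ℕ) {k : ℝ} (hk : 0 ≤ k) : 0 ≤ partitionTime n m q d k := by
  unfold partitionTime; positivity

/-- Nothing but `IsCutMeasure` is used of the cut function, so rank-width and boolean-width are
handled alike, and by the same program. The 20 in the constant covers the few steps of the preamble.
-/
theorem partitionProg_decides {q : ℕ} {D : Fin q → Fin q → Set ℕ}
    (hD : ∀ i j, FiniteOrCofinite (D i j)) {n : ℕ} {G : SimpleGraph (Fin n)}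
    {T : DecompositionTree (Fin n)} {f : Set (Fin n) → ℝ} (hf : G.IsCutMeasure f)
    (hT : T.IsOptimal f) {L : List (Fin n × Fin n)} {L' : List (Fin T.N × Fin T.N)}
    (hL : IsEdgeList G L) (hL' : IsEdgeList T.tree L') :
    (partitionProg D).DecidesWithin (encodeInput T L L') (HasDegreePartition G D)
      (100020 * (1 + partitionTime n G.edgeSet.ncard q (matrixDegreeBound D) (minWidth f))) := by
  classical
  have hk0 : 0 ≤ minWidth f := by
    rw [← hT.width_eq]
    exact Real.iSup_nonneg fun a => hf.nonneg _
  have hPT := partitionTime_nonneg n G.edgeSet.ncard q (matrixDegreeBound D) hk0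
  -- The tree has a node. A single node is a leaf and carries a vertex; for a larger tree N ≤ 2n
  -- forces n > 0.
  have hne : Nonempty (Fin n) := by
    have := T.isTree.connected.nonempty
    by_contra hn
    rw [not_nonempty_iff] at hn
    rcases Nat.lt_or_ge T.N 2 with h | h
    · obtain ⟨t⟩ := T.isTree.connected.nonempty
      have : Subsingleton (Fin T.N) := Fin.subsingleton_iff_le_one.2 (by omega)
      have hl : IsLeafNode T.tree t := by
        unfold IsLeafNode
        exact (Set.ncard_le_one (Set.toFinite _)).2 fun a _ b _ => Subsingleton.elim _ _
      exact hn.false (T.leaf.symm ⟨t, hl⟩)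
    · have := T.N_le h
      rw [Nat.card_of_isEmpty] at this
      omega
  have hlenT := hL'.length_tree T.isTree
  unfold partitionProg
  split_ifs with hd0
  · obtain ⟨s', he, h1, h2⟩ := constantAnswer_exec D (RamState.init (encodeInput T L L'))
    -- Truncation at d = 0 turns every count into 0, so the neighbourhoods are irrelevant. This
    -- includes the case q = 0, where no label exists and the answer is negative.
    have hiff : HasDegreePartition G D ↔ ∃ i, ∀ j, 0 ∈ D i j := by
      refine hasDegreePartition_iff_of_trivial fun X v j => ?_
      have := (hD (X v) j).mem_iff (degreeBound_le_matrix D (X v) j)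
        ({w | G.Adj v w ∧ X w = j}.ncard)
      rwa [hd0, Nat.zero_min] at this
    refine ⟨1, s', he, ?_, ?_, ?_⟩
    · push_cast; linarith
    · rwa [hiff]
    · rwa [hiff]
  set input := encodeInput T L L' with hinput
  have i0 : input.getD 0 0 = n := rfl
  have i1 : input.getD 1 0 = L.length := rfl
  have i2 : input.getD 2 0 = T.N := rfl
  let s1 := (RamState.init input).setReg 3 1
  let s2 := s1.setReg 5 (s1.mem (s1.reg 3))
  have hs5 : s2.reg 5 = input.getD 1 0 := by
    simp [s2, s1, RamState.setReg, RamState.init]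
  -- Without edges all counts are 0. This case is separated because k may be 0 there, while the main
  -- program may take more than constant time.
  rcases Nat.eq_zero_or_pos L.length with hm | hm
  · obtain ⟨s', he, h1, h2⟩ := constantAnswer_exec D s2
    have hemp : ∀ v w, ¬ G.Adj v w := by
      intro v w h
      rw [← SimpleGraph.mem_edgeSet, ← hL.2, List.length_eq_zero_iff.1 hm] at h
      simp at h
    have hiff : HasDegreePartition G D ↔ ∃ i, ∀ j, 0 ∈ D i j := by
      refine hasDegreePartition_iff_of_trivial fun X v j => ?_
      simp [hemp]
    refine ⟨_, s', .seq (.const _ 3 1) (.seq (.load s1 5 3) (.iteFalse ?_ he)), ?_, ?_, ?_⟩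
    · rw [hs5, i1, hm]
    · push_cast; linarith
    · rwa [hiff]
    · rwa [hiff]
  have hN : 2 ≤ T.N := by
    have h1 : 2 ≤ n := by
      have hx : ∃ x : Fin n × Fin n, x ∈ L := List.exists_mem_of_length_pos hm
      obtain ⟨x, hx⟩ := hx
      have : G.Adj x.1 x.2 := by
        rw [← SimpleGraph.mem_edgeSet, ← hL.2, List.mem_map]
        exact ⟨x, hx, rfl⟩
      have h1 : x.1.val ≠ x.2.val := fun h => this.ne (Fin.ext h)
      omega
    have h2 := T.card_le_N
    rw [Nat.card_eq_fintype_card, Fintype.card_fin] at h2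
    omega
  have hNn : T.N ≤ 2 * n := by
    have := T.N_le hN
    rwa [Nat.card_eq_fintype_card, Fintype.card_fin] at this
  -- The tree edge at the leaf of a non-isolated vertex separates that vertex from the others, and
  -- this cut has value at least 1.
  have hk : 1 ≤ minWidth f := by
    obtain ⟨x, hx⟩ := List.exists_mem_of_length_pos hm
    have hadj : G.Adj x.1 x.2 := by
      rw [← SimpleGraph.mem_edgeSet, ← hL.2, List.mem_map]
      exact ⟨x, hx, rfl⟩
    have hpos := T.neighbor_ncard_pos hN (T.leaf x.1).1
    obtain ⟨v, hv⟩ := (Set.ncard_pos (Set.toFinite _)).1 hpos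
    have h1 := T.le_width f (a := ((T.leaf x.1).1, v)) hv
    rw [T.leavesAt_of_leaf hv (T.leaf x.1).2] at h1
    rw [← hT.width_eq]
    refine (hf.one_le _ _ hadj).trans ?_
    simpa using h1
  set K := ⌊(2 : ℝ) ^ (minWidth f)⌋₊ with hK
  have hKle : (K : ℝ) ≤ 2 ^ (minWidth f) := Nat.floor_le (by positivity)
  have hK2 : 2 ≤ K := Nat.le_floor (by
    calc ((2 : ℕ) : ℝ) = (2 : ℝ) ^ (1 : ℝ) := by norm_num
      _ ≤ _ := Real.rpow_le_rpow_of_exponent_le (by norm_num) hk)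
  have hr1 : 1 ≤ Nat.log 2 K := Nat.le_log_of_pow_le (by norm_num) (by simpa using hK2)
  have hrk : ((Nat.log 2 K : ℕ) : ℝ) ≤ minWidth f := by
    have h1 : ((2 ^ Nat.log 2 K : ℕ) : ℝ) ≤ 2 ^ (minWidth f) :=
      le_trans (by exact_mod_cast Nat.pow_log_le_self 2 (by omega)) hKle
    rw [Nat.cast_pow, ← Real.rpow_natCast] at h1
    exact (Real.rpow_le_rpow_left_iff (by norm_num)).1 h1
  let z : Fin T.N × Fin T.N := (⟨0, by omega⟩, ⟨0, by omega⟩)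
  have hd : 0 < matrixDegreeBound D := Nat.pos_of_ne_zero hd0
  set S := T.cutSystem G z hL' hD hd with hS
  -- Both orientations of a tree edge count for the width, so the side and its complement are
  -- bounded by k.
  have hbound : ∀ a < S.M, S.RowBound a K (Nat.log 2 K) := by
    intro a ha
    have ha : a < L'.length + L'.length := ha
    have hadj := hL'.adj z ha
    refine T.cutSystem_rowBound ha (hf.cutBound _ _ ?_ ?_)
    · exact (T.le_width f hadj).trans hT.width_eq.le
    · rw [← T.mem_leavesAt_swap hadj]
      exact (T.le_width f (a := (dartAt z L' a).swap) hadj.symm).trans hT.width_eq.le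
  have hqs : S.q ≤ K ^ (S.d * Nat.log 2 K * S.q) := by
    calc S.q ≤ 2 ^ S.q := Nat.lt_two_pow_self.le
      _ ≤ K ^ S.q := Nat.pow_le_pow_left hK2 _
      _ ≤ _ := Nat.pow_le_pow_right (by omega)
        (Nat.le_mul_of_pos_left _ (Nat.mul_pos S.d_pos (by omega)))
  obtain ⟨hres, hcost⟩ := Imp.mainCmd_spec (S := S) (T.inputGraph hL) (T.inputTree L hN) i0 i1 i2
    hN hNn (c := K) (by omega) hqs
    (fun rep rc R => ⟨CutSystem.fewHandles hbound hK2 hr1 R, fun a ha => R.count_le hbound ha⟩)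
  obtain ⟨s', he, hr⟩ := mainProg_exec D input s2 (fun r h3 h5 => by
      simp [s2, s1, RamState.setReg, RamState.init, h3, h5]) (by simp [s2, s1, RamState.setReg]) hs5
    rfl (by
      rw [i0, i1, i2, hinput, length_encodeInput]
      omega)
  rw [show (Imp.mainCmd q (matrixDegreeBound D) (entryOf D)) = Imp.mainCmd S.q S.d S.D from rfl,
    hres] at hr
  have hiff := T.exists_labelling_iff (G := G) (z := z) (hL' := hL') (hD := hD) (hd := hd)
  refine ⟨_, s', .seq (.const _ 3 1) (.seq (.load s1 5 3) (.iteTrue ?_ he)), ?_, ?_, ?_⟩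
  · rw [hs5, i1]
    omega
  · have ht := time_le (n := n) (m := L.length) (q := q) (d := matrixDegreeBound D) hk hKle hrk
      rfl rfl
    rw [hL.length_eq] at ht
    have hcost' : (((Imp.mainCmd q (matrixDegreeBound D) (entryOf D)).cost
        (fun i => input.getD i 0) Imp.Store.zero : ℕ) : ℝ) ≤
        100000 * partitionTime n G.edgeSet.ncard q (matrixDegreeBound D) (minWidth f) := by
      refine le_trans (Nat.cast_le.2 hcost) ?_
      rw [Nat.cast_mul, hL.length_eq]
      exact mul_le_mul_of_nonneg_left ht (by norm_num)
    push_cast at hcost' ⊢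
    linarith
  · intro h
    rw [hr]
    exact if_pos (hiff.2 h)
  · intro h
    rw [hr]
    exact if_neg fun h' => h (hiff.1 h')

/-- The constant and the program are the same for both widths; only the verification of
`IsCutMeasure` differs. -/
theorem theorem5 :
    ∃ C : ℝ, ∀ (q : ℕ) (D : Fin q → Fin q → Set ℕ), (∀ i j, FiniteOrCofinite (D i j)) →
      (∃ P : RamProg,
        ∀ (n : ℕ) (G : SimpleGraph (Fin n)) (T : DecompositionTree (Fin n)),
          T.IsOptimal G.cutRank →
          ∀ (L : List (Fin n × Fin n)) (L' : List (Fin T.N × Fin T.N)),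
            IsEdgeList G L → IsEdgeList T.tree L' →
            P.DecidesWithin (encodeInput T L L') (HasDegreePartition G D)
              (C * (1 + partitionTime n G.edgeSet.ncard q (matrixDegreeBound D) G.rankWidth))) ∧
      (∃ P : RamProg,
        ∀ (n : ℕ) (G : SimpleGraph (Fin n)) (T : DecompositionTree (Fin n)),
          T.IsOptimal G.booleanCut →
          ∀ (L : List (Fin n × Fin n)) (L' : List (Fin T.N × Fin T.N)),
            IsEdgeList G L → IsEdgeList T.tree L' →
            P.DecidesWithin (encodeInput T L L') (HasDegreePartition G D)
              (C * (1 + partitionTime n G.edgeSet.ncard q (matrixDegreeBound D) G.booleanWidth))) :=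
  ⟨100020, fun _ D hD =>
    ⟨⟨partitionProg D, fun _ G _ hT _ _ hL hL' =>
      partitionProg_decides hD G.isCutMeasure_cutRank hT hL hL'⟩,
    ⟨partitionProg D, fun _ G _ hT _ _ hL hL' =>
      partitionProg_decides hD G.isCutMeasure_booleanCut hT hL hL'⟩⟩⟩
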